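/- Notation. Let $q$ be a prime power, $D\ge 2$ an integer, $H$ a hyperplane of $\mathbb F_q^{2D+1}$, $X'$ the set of $(D+1)$-dimensional subspaces of $\mathbb F_q^{2D+1}$ not contained in $H$, $X''$ the set of $(D-1)$-dimensional subspaces of $H$, and $X=X'\sqcup X''$. The twisted Grassmann graph $\tilde J_q(2D+1,D)$ has vertex set $X$, with $y,z$ adjacent if and only if $\dim y+\dim z-2\dim(y\cap z)=2$; let $A$ be its adjacency matrix. Fix $x\in X''$. Let $E_i^*$ be the diagonal $0$-$1$ matrix of the set of vertices at distance $i$ from $x$, and let $T=T(x)$ be the $\mathbb C$-algebra of matrices generated by $A$ and the $E_i^*$, acting on $\mathbb CX$. Write $(q)_n=\prod_{l=1}^{n}(1-q^l)$, $[m]=(1-q^m)/(1-q)$, $\theta_i=q[D][D+1]-[i][2D-i+2]$ $(0\le i\le D)$, and let $E_i$ be the orthogonal projection onto the eigenspace of $A$ for $\theta_i$. For an irreducible $T$-module $W$ put $\epsilon=\min\{i:E_i^*W\neq0\}$ (endpoint), $\epsilon^*=\min\{i:E_iW\ne0\}$ (dual endpoint), $d=|\{i:E_i^*W\ne0\}|-1$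 (diameter); $W$ is thin if $\dim E_i^*W\le1$ for all $i$. The algebra $\tilde{\mathcal H}$. Let $\tilde P$ be the set of all subspaces of $\mathbb F_q^{2D+1}$, and put $a=D-1$, $b=D+1$. For $0\le i\le a$, $0\le j\le b$, $0\le k\le 1$ let $\tilde P_{i,j,k}=\{y\in\tilde P:\dim x\cap y=i,\ \dim H\cap y=i+j,\ \dim y=i+j+k\}$ (and $\tilde P_{i,j,k}=\emptyset$ for other $i,j,k$), and let $\tilde{\mathcal E}^*_{i,j,k}$ be the diagonal $0$-$1$ matrix of $\tilde P_{i,j,k}$. Let $\tilde{\mathcal L}_1,\tilde{\mathcal L}_2,\tilde{\mathcal L}_3$ be the $0$-$1$ matrices indexed by $\tilde P$ whose $(y,z)$-entry, for $z\in\tilde P_{i,j,k}$, is $1$ exactly when $y\subset z$ and $y$ lies in $\tilde P_{i-1,j,k}$, $\tilde P_{i,j-1,k}$, $\tilde P_{i,j,k-1}$, respectively, and let $\tilde{\mathcal R}_l=\tilde{\mathcal L}_l^{\mathsf T}$. Let $\tilde{\mathcal H}$ be the $\mathbb C$-algebra generated by all these matrices, acting on $\mathbb C\tilde P$. For an irreducible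 $\tilde{\mathcal H}$-submodule $\tilde{\mathcal W}$ of $\mathbb C\tilde P$ let $\nu$ and $\nu'$ (resp. $\mu$; $\tau$) be the minimum and maximum of those $i$ (resp. the minimum of those $j$; the minimum of those $k$) for which $\sum_{j,k}\tilde{\mathcal E}^*_{i,j,k}\tilde{\mathcal W}\ne0$ (resp. $\sum_{i,k}\tilde{\mathcal E}^*_{i,j,k}\tilde{\mathcal W}\ne0$; $\sum_{i,j}\tilde{\mathcal E}^*_{i,j,k}\tilde{\mathcal W}\ne 0$), the sums being sums of matrices, and let $\rho=a-\nu-\nu'$. A standard basis of such a $\tilde{\mathcal W}$ with $\tau=0$ is a basis $w_{i,j,k}\in\tilde{\mathcal E}^*_{i,j,k}\tilde{\mathcal W}$ $(\nu\le i\le a-\nu-\rho,\ \mu\le j\le b-\mu+\rho,\ 0\le k\le1)$ such that $$\tilde{\mathcal L}_1w_{i,j,k}=q^{\nu+j}[a-\nu-\rho-i+1][i-\nu]\,w_{i-1,j,k},\qquad \tilde{\mathcal R}_1w_{i,j,k}=q^kw_{i+1,j,k},$$ $$\tilde{\mathcal L}_2w_{i,j,k}=q^{a-\nu+\mu-\rho}[b-\mu+\rho-j+1][j-\mu]\,w_{i,j-1,k},\qquad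 \tilde{\mathcal R}_2w_{i,j,k}=q^{\nu-i+k}w_{i,j+1,k},$$ $$\tilde{\mathcal L}_3w_{i,j,k}=q^{a+b-i-j}w_{i,j,k-1},\qquad \tilde{\mathcal R}_3w_{i,j,k}=w_{i,j,k+1},$$ where $w_{i,j,k}:=0$ outside the range. The subspace $W_1\subseteq\mathbb CX$ obtained from $\tilde{\mathcal W}$ is the span of the vectors $$w_i=w_{D-i,i,1}+q^{\nu+i}[D-\nu-i]\,w_{D-i-1,i,0}\qquad(\max\{\nu+\rho,\mu\}\le i\le\min\{D-\nu,D-\mu+\rho+1\}).$$ The tridiagonal matrix. For $d\ge0$ let $\mathsf A(q,d;h,r,s,\lambda_0)$ be the $(d+1)\times(d+1)$ tridiagonal matrix with rows and columns indexed by $0,\dots,d$, with $(i,i-1)$, $(i,i)$, $(i,i+1)$ entries $\mathsf c_i,\mathsf a_i,\mathsf b_i$, where $\mathsf a_i+\mathsf b_i+\mathsf c_i=\lambda_0$, $\mathsf b_i=h(1-q^{i-d})(1-rq^{i+1})$, $\mathsf c_i=hsq(1-q^i)(1-rq^{i-d-1}/s)$; the parameters are required to satisfy $h,r,s\ne0$,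 $rq^i\neq 1$ and $sq^i/r\ne1$ $(1\le i\le d)$, and $sq^i\ne1$ $(2\le i\le 2d)$. Let $\Omega$ be the set of $(\epsilon,\epsilon^*,d)\in\mathbb Z^3$ with $\epsilon,\epsilon^*,d\ge0$, $\epsilon+d\le D$, $\epsilon^*+d\le D$, $2\epsilon+d\ge D$, $2\epsilon^*+d\ge D$. Theorem. Every irreducible $\tilde{\mathcal H}$-submodule $\tilde{\mathcal W}$ of $\mathbb C\tilde P$ with $\tau=0$ has a standard basis, the subspace $W_1$ does not depend on its choice, and $W_1$ is a thin irreducible $T$-module. Let $V_1$ be the sum of all the $W_1$, over all the irreducible $\tilde{\mathcal H}$-submodules of $\mathbb C\tilde P$ with $\tau=0$, and let $V_{1,0}$ (resp. $V_{1,1}$) be the sum of those $W_1$ with $\nu+\rho\ge\mu$ (resp. $\nu+\rho<\mu$). Then $V_{1,0}$ and $V_{1,1}$ are $T$-modules, $V_1=V_{1,0}\oplus V_{1,1}$, and the following hold. (i) As $W$ ranges over the irreducible $T$-submodules of $V_{1,0}$, the triple $(\epsilon,\epsilon^*,d)$ ranges over exactly the set $$\Omega_{1,0}=\{(\epsilon,\epsilon^*,d)\in\Omega:\epsilon^*\ge\epsilon,\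 d>0\}.$$ Every such $W$ is thin and has a basis $v_i$ $(0\le i\le d)$ with $v_i\in E^*_{\epsilon+i}W$ for all $i$, with respect to which the matrix representing $A|_W$ is $\mathsf A(q,d;h,r,s,\lambda_0)$ with $$h=\frac{q^{2D+2-\epsilon^*}}{(1-q)^2},\quad r=q^{\epsilon^*-D-2},\quad s=q^{2\epsilon^*-2D-3},\quad\lambda_0=\theta_{\epsilon^*}$$ (and these parameters satisfy the requirements above). Two irreducible $T$-submodules of $V_{1,0}$ are isomorphic if and only if they have the same $(\epsilon,\epsilon^*,d)$, and the multiplicity $m^{1,0}_{\epsilon,\epsilon^*,d}$ in $V_{1,0}$ of those with given $(\epsilon,\epsilon^*,d)$ satisfies $$\frac{m^{1,0}_{\epsilon,\epsilon^*,d}}{(q)_{D-1}(q)_{D+1}}=\frac{(-1)^{D-d}(1-q^{2D-2\epsilon^*-d+2})(1-q^d)\,q^{D-2\epsilon+\epsilon^*-d+\binom{2\epsilon-D+d}{2}}}{(q)_{D-\epsilon}(q)_{2D-\epsilon-\epsilon^*-d+2}(q)_{D-\epsilon-d}(q)_{2\epsilon-D+d}(q)_{\epsilon^*-\epsilon}}.$$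 (ii) The same statements hold for $V_{1,1}$, with the same $h,s,\lambda_0$, with $r=q^{\epsilon^*-D-1}$, and with $\Omega_{1,0}$ and $m^{1,0}_{\epsilon,\epsilon^*,d}$ replaced by $$\Omega_{1,1}=\{(\epsilon,\epsilon^*,d)\in\Omega:\epsilon^*\ge\epsilon,\ 2\epsilon+d>D\},$$ $$\frac{m^{1,1}_{\epsilon,\epsilon^*,d}}{(q)_{D-1}(q)_{D+1}}=\frac{(-1)^{D-d+1}(1-q^{2D-2\epsilon^*-d+1})(1-q^{d+1})\,q^{D-2\epsilon+\epsilon^*-d+1+\binom{2\epsilon-D+d-1}{2}}}{(q)_{D-\epsilon+2}(q)_{2D-\epsilon-\epsilon^*-d+1}(q)_{D-\epsilon-d+1}(q)_{2\epsilon-D+d-1}(q)_{\epsilon^*-\epsilon}}.$$ -/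

import Mathlib

namespace TwistedGrassmann

noncomputable section

/-! ### q-symbols -/

/-- The shifted factorial `(α; q)_n = ∏_{l < n} (1 - α q^l)`. -/
def qPoch (q α : ℂ) (n : ℕ) : ℂ := ∏ l ∈ Finset.range n, (1 - α * q ^ l)

/-- `(q)_n = (q; q)_n`, only used for `n ≥ 0`. -/
def qq (q : ℂ) (n : ℤ) : ℂ := qPoch q q n.toNat

/-- The Gaussian number `[m] = (1 - q^m) / (1 - q)`, that is, the `q`-binomial coefficient
"`m` choose `1`"; in particular `[0] = 0`. -/
def gauss1 (q : ℂ) (m : ℤ) : ℂ := (1 - q ^ m) / (1 - q)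

/-- The binomial coefficient "`n` choose `2`", only used for `n ≥ 0`. -/
def choose2 (n : ℤ) : ℤ := (n.toNat.choose 2 : ℤ)

/-- The order of the finite field `F`, as a complex number. -/
def order (F : Type*) [Fintype F] : ℂ := (Fintype.card F : ℂ)

/-! ### Cutting down a subspace by a matrix -/

/-- The subspace `M U` for a square matrix `M` and a subspace `U`. -/
def cut {n : Type*} [Fintype n] (M : Matrix n n ℂ) (U : Submodule ℂ (n → ℂ)) :
    Submodule ℂ (n → ℂ) :=
  U.map M.mulVecLin

/-! ### The set `P̃` of all subspaces of `F^(2D+1)` and the algebra `H̃` -/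

/-- The set `P̃` of all subspaces of `F^(2D+1)`. -/
abbrev Pt (F : Type*) [Field F] (D : ℕ) : Type _ := Submodule F (Fin (2 * D + 1) → F)

instance instFintypePt (F : Type*) [Field F] [Fintype F] (D : ℕ) : Fintype (Pt F D) :=
  Fintype.ofFinite _

instance instDecidableEqPt (F : Type*) [Field F] (D : ℕ) : DecidableEq (Pt F D) :=
  Classical.decEq _

section Subspaces

variable {F : Type*} [Field F] [Fintype F] {D : ℕ} (x H : Pt F D)

/-- The set `P̃_{i,j,k}`. When `x` lies in the hyperplane `H`, it is automatically empty
unless `0 ≤ i ≤ dim x`, `0 ≤ j ≤ dim H - dim x` and `0 ≤ k ≤ 1`. -/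
def cell (i j k : ℤ) : Set (Pt F D) :=
  {y | (Module.finrank F ↥(x ⊓ y) : ℤ) = i ∧ (Module.finrank F ↥(H ⊓ y) : ℤ) = i + j ∧
    (Module.finrank F ↥y : ℤ) = i + j + k}

open Classical in
/-- The diagonal `0`-`1` matrix of the cell `P̃_{i,j,k}`. -/
def cellE (i j k : ℤ) : Matrix (Pt F D) (Pt F D) ℂ :=
  Matrix.diagonal fun y => if y ∈ cell x H i j k then 1 else 0

open Classical in
/-- The matrix with `(y,z)`-entry `1` if `z ∈ P̃_{i,j,k}`, `y ∈ P̃_{i-α,j-β,k-γ}` for some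
`i,j,k` and `y ⊆ z`, and `0` otherwise. -/
def lower (α β γ : ℤ) : Matrix (Pt F D) (Pt F D) ℂ := Matrix.of fun y z =>
  if y ≤ z ∧ ∃ i j k : ℤ, z ∈ cell x H i j k ∧ y ∈ cell x H (i - α) (j - β) (k - γ)
  then 1 else 0

open Classical in
/-- The matrix with `(y,z)`-entry `1` if `z ∈ P̃_{i,j,k}`, `y ∈ P̃_{i+α,j+β,k+γ}` for some
`i,j,k` and `y ⊇ z`, and `0` otherwise. -/
def raise (α β γ : ℤ) : Matrix (Pt F D) (Pt F D) ℂ := Matrix.of fun y z =>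
  if z ≤ y ∧ ∃ i j k : ℤ, z ∈ cell x H i j k ∧ y ∈ cell x H (i + α) (j + β) (k + γ)
  then 1 else 0

def L1 : Matrix (Pt F D) (Pt F D) ℂ := lower x H 1 0 0
def L2 : Matrix (Pt F D) (Pt F D) ℂ := lower x H 0 1 0
def L3 : Matrix (Pt F D) (Pt F D) ℂ := lower x H 0 0 1
def R1 : Matrix (Pt F D) (Pt F D) ℂ := raise x H 1 0 0
def R2 : Matrix (Pt F D) (Pt F D) ℂ := raise x H 0 1 0
def R3 : Matrix (Pt F D) (Pt F D) ℂ := raise x H 0 0 1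

/-- The algebra `H̃` generated by the lowering and raising matrices and the diagonal matrices
of the cells (those of empty cells are zero). It acts on `ℂP̃ = (P̃ → ℂ)` by matrix-vector
multiplication. -/
def Halg : Subalgebra ℂ (Matrix (Pt F D) (Pt F D) ℂ) :=
  Algebra.adjoin ℂ ({L1 x H, L2 x H, L3 x H, R1 x H, R2 x H, R3 x H} ∪
    {M | ∃ i j k : ℤ, M = cellE x H i j k})

variable {x H} (𝒲 : Submodule (Halg x H) (Pt F D → ℂ))

/-- The first coordinate `ν` of the lower endpoint (for `dim x = D - 1`, `dim H = 2D`). -/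
def nu : ℕ := sInf {i : ℕ | cut (∑ j ∈ Finset.range (D + 2), ∑ k ∈ Finset.range 2,
  cellE x H i j k) (𝒲.restrictScalars ℂ) ≠ ⊥}

/-- The first coordinate `ν'` of the upper endpoint. -/
def nu' : ℕ := sSup {i : ℕ | cut (∑ j ∈ Finset.range (D + 2), ∑ k ∈ Finset.range 2,
  cellE x H i j k) (𝒲.restrictScalars ℂ) ≠ ⊥}

/-- The second coordinate `μ` of the lower endpoint. -/
def mu : ℕ := sInf {j : ℕ | cut (∑ i ∈ Finset.range D, ∑ k ∈ Finset.range 2,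
  cellE x H i j k) (𝒲.restrictScalars ℂ) ≠ ⊥}

/-- The third coordinate `τ` of the lower endpoint. -/
def tau : ℕ := sInf {k : ℕ | cut (∑ i ∈ Finset.range D, ∑ j ∈ Finset.range (D + 2),
  cellE x H i j k) (𝒲.restrictScalars ℂ) ≠ ⊥}

/-- The index `ρ = a - ν - ν'`, where `a = D - 1`. -/
def rho : ℤ := (D : ℤ) - 1 - nu 𝒲 - nu' 𝒲

/-- The index range `ν ≤ i ≤ a - ν - ρ`, `μ ≤ j ≤ b - μ + ρ`, `0 ≤ k ≤ 1` of the standard basis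
of an `H̃`-module with `τ = 0`, where `a = D - 1` and `b = D + 1`. -/
def stdIndex : Set (ℤ × ℤ × ℤ) :=
  {t | (nu 𝒲 : ℤ) ≤ t.1 ∧ t.1 ≤ (D : ℤ) - 1 - nu 𝒲 - rho 𝒲 ∧
    (mu 𝒲 : ℤ) ≤ t.2.1 ∧ t.2.1 ≤ (D : ℤ) + 1 - mu 𝒲 + rho 𝒲 ∧ 0 ≤ t.2.2 ∧ t.2.2 ≤ 1}

open Matrix in
/-- `w` is a standard basis of the `H̃`-module `𝒲` (with `τ = 0`), extended by zero outside
the index range. -/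
structure IsStandardBasis (w : ℤ → ℤ → ℤ → Pt F D → ℂ) : Prop where
  zero : ∀ i j k, (i, j, k) ∉ stdIndex 𝒲 → w i j k = 0
  mem : ∀ i j k, (i, j, k) ∈ stdIndex 𝒲 →
    w i j k ∈ cut (cellE x H i j k) (𝒲.restrictScalars ℂ)
  linearIndependent :
    LinearIndependent ℂ fun t : stdIndex 𝒲 => w t.1.1 t.1.2.1 t.1.2.2
  span : Submodule.span ℂ (Set.range fun t : stdIndex 𝒲 => w t.1.1 t.1.2.1 t.1.2.2) =
    𝒲.restrictScalars ℂ
  lower1 : ∀ i j k, (i, j, k) ∈ stdIndex 𝒲 → L1 x H *ᵥ w i j k =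
    (order F ^ (nu 𝒲 + j) * gauss1 (order F) ((D : ℤ) - 1 - nu 𝒲 - rho 𝒲 - i + 1) *
      gauss1 (order F) (i - nu 𝒲)) • w (i - 1) j k
  raise1 : ∀ i j k, (i, j, k) ∈ stdIndex 𝒲 → R1 x H *ᵥ w i j k =
    order F ^ k • w (i + 1) j k
  lower2 : ∀ i j k, (i, j, k) ∈ stdIndex 𝒲 → L2 x H *ᵥ w i j k =
    (order F ^ ((D : ℤ) - 1 - nu 𝒲 + mu 𝒲 - rho 𝒲) *
      gauss1 (order F) ((D : ℤ) + 1 - mu 𝒲 + rho 𝒲 - j + 1) *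
      gauss1 (order F) (j - mu 𝒲)) • w i (j - 1) k
  raise2 : ∀ i j k, (i, j, k) ∈ stdIndex 𝒲 → R2 x H *ᵥ w i j k =
    order F ^ ((nu 𝒲 : ℤ) - i + k) • w i (j + 1) k
  lower3 : ∀ i j k, (i, j, k) ∈ stdIndex 𝒲 → L3 x H *ᵥ w i j k =
    order F ^ (2 * (D : ℤ) - i - j) • w i j (k - 1)
  raise3 : ∀ i j k, (i, j, k) ∈ stdIndex 𝒲 → R3 x H *ᵥ w i j k = w i j (k + 1)

end Subspaces

/-! ### The twisted Grassmann graph and its Terwilliger algebra -/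

section Graph

variable {F : Type*} [Field F] {D : ℕ} (H : Pt F D)

/-- `X'`: the `(D+1)`-dimensional subspaces of `F^(2D+1)` not contained in `H`. -/
def X1 : Set (Pt F D) := {y | Module.finrank F ↥y = D + 1 ∧ ¬ y ≤ H}

/-- `X''`: the `(D-1)`-dimensional subspaces of `H` (with `D ≥ 2`). -/
def X2 : Set (Pt F D) := {y | Module.finrank F ↥y = D - 1 ∧ y ≤ H}

/-- The vertex set `X = X' ⊔ X''`. -/
def Vertex : Type _ := {y : Pt F D // y ∈ X1 H ∪ X2 H}

instance instFintypeVertex [Fintype F] : Fintype (Vertex H) :=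
  @Fintype.ofFinite _ (inferInstanceAs (Finite {y : Pt F D // y ∈ X1 H ∪ X2 H}))

instance instDecidableEqVertex : DecidableEq (Vertex H) := Classical.decEq _

/-- The twisted Grassmann graph: `y` and `z` are adjacent when
`dim y + dim z - 2 dim (y ∩ z) = 2`. -/
def graph : SimpleGraph (Vertex H) where
  Adj y z := (Module.finrank F ↥y.1 : ℤ) + Module.finrank F ↥z.1
    - 2 * Module.finrank F ↥(y.1 ⊓ z.1) = 2
  symm := ⟨fun y z h => by rw [inf_comm]; linarith⟩
  loopless := ⟨fun y h => by rw [inf_idem] at h; linarith⟩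

variable [Fintype F]

open Classical in
/-- The adjacency matrix `A`. -/
def adj : Matrix (Vertex H) (Vertex H) ℂ := (graph H).adjMatrix ℂ

variable {H} (x : Vertex H)

/-- The diagonal matrix `E_i^*(x)` of the set of vertices at distance `i` from `x`. -/
def dualE (i : ℕ) : Matrix (Vertex H) (Vertex H) ℂ :=
  Matrix.diagonal fun y => if (graph H).dist x y = i then 1 else 0

/-- The Terwilliger algebra `T(x)`. It acts on `ℂX = (X → ℂ)` by matrix-vector
multiplication. -/
def Talg : Subalgebra ℂ (Matrix (Vertex H) (Vertex H) ℂ) :=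
  Algebra.adjoin ℂ ({adj H} ∪ Set.range (dualE x))

/-- The eigenvalue `θ_i = q [D] [D+1] - [i] [2D-i+2]`. -/
def theta (q : ℂ) (D : ℕ) (i : ℤ) : ℂ :=
  q * gauss1 q D * gauss1 q (D + 1) - gauss1 q i * gauss1 q (2 * D - i + 2)

variable (H) in
/-- The orthogonal projection `E_i` onto the eigenspace of `A` with eigenvalue `θ_i`. -/
def eigE (i : ℕ) : Matrix (Vertex H) (Vertex H) ℂ :=
  (Matrix.toEuclideanCLM (n := Vertex H) (𝕜 := ℂ)).symm
    (Submodule.starProjection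
      (Module.End.eigenspace (Matrix.toEuclideanLin (adj H)) (theta (order F) D i)))

variable {x} (W : Submodule (Talg x) (Vertex H → ℂ))

def supp : Set ℕ := {i | i ≤ D ∧ cut (dualE x i) (W.restrictScalars ℂ) ≠ ⊥}

def dualSupp : Set ℕ := {i | i ≤ D ∧ cut (eigE H i) (W.restrictScalars ℂ) ≠ ⊥}

/-- The endpoint `ε`. -/
def endpoint : ℕ := sInf (supp W)

/-- The dual endpoint `ε^*`. -/
def dualEndpoint : ℕ := sInf (dualSupp W)

/-- The diameter `d`. -/
def diam : ℕ := (supp W).ncard - 1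

/-- The triple `(ε, ε^*, d)`. -/
def triple : ℤ × ℤ × ℤ := (endpoint W, dualEndpoint W, diam W)

/-- `W` is thin: `dim E_i^* W ≤ 1` for all `i`. -/
def IsThin : Prop := ∀ i, Module.finrank ℂ (cut (dualE x i) (W.restrictScalars ℂ)) ≤ 1

end Graph

/-! ### The tridiagonal matrix of dual `q`-Hahn type -/

/-- The entries `b_i` of the tridiagonal matrix. -/
def entryB (q : ℂ) (d : ℕ) (h r : ℂ) (i : ℕ) : ℂ :=
  h * (1 - q ^ ((i : ℤ) - d)) * (1 - r * q ^ (i + 1))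

/-- The entries `c_i` of the tridiagonal matrix. -/
def entryC (q : ℂ) (d : ℕ) (h r s : ℂ) (i : ℕ) : ℂ :=
  h * s * q * (1 - q ^ i) * (1 - r * q ^ ((i : ℤ) - d - 1) / s)

/-- The tridiagonal matrix `A(q, d; h, r, s, λ₀)`, with rows `(…, c_i, a_i, b_i, …)`, where
`a_i + b_i + c_i = λ₀`. -/
def hahn (q : ℂ) (d : ℕ) (h r s l0 : ℂ) : Matrix (Fin (d + 1)) (Fin (d + 1)) ℂ :=
  Matrix.of fun i j =>
    if i = j then l0 - entryB q d h r i - entryC q d h r s i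
    else if (j : ℕ) = i + 1 then entryB q d h r i
    else if (i : ℕ) = j + 1 then entryC q d h r s i
    else 0

/-- The standing assumptions on the parameters of the tridiagonal matrix. -/
def Admissible (q : ℂ) (d : ℕ) (h r s : ℂ) : Prop :=
  h ≠ 0 ∧ r ≠ 0 ∧ s ≠ 0 ∧ (∀ i ∈ Finset.Icc 1 d, r * q ^ i ≠ 1 ∧ s * q ^ i / r ≠ 1) ∧
    ∀ i ∈ Finset.Icc 2 (2 * d), s * q ^ i ≠ 1

/-! ### Parameter sets and multiplicities -/

/-- The set `Ω = Ω_D`. -/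
def Omega (D : ℕ) : Set (ℤ × ℤ × ℤ) :=
  {t | 0 ≤ t.1 ∧ 0 ≤ t.2.1 ∧ 0 ≤ t.2.2 ∧ t.1 + t.2.2 ≤ D ∧ t.2.1 + t.2.2 ≤ D ∧
    (D : ℤ) ≤ 2 * t.1 + t.2.2 ∧ (D : ℤ) ≤ 2 * t.2.1 + t.2.2}

/-- `Ω_{1,0}`: those `(ε, ε^*, d)` in `Ω` with `ε^* ≥ ε` and `d > 0`. -/
def Omega10 (D : ℕ) : Set (ℤ × ℤ × ℤ) := {t ∈ Omega D | t.1 ≤ t.2.1 ∧ 0 < t.2.2}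

/-- `Ω_{1,1}`: those `(ε, ε^*, d)` in `Ω` with `ε^* ≥ ε` and `2ε + d > D`. -/
def Omega11 (D : ℕ) : Set (ℤ × ℤ × ℤ) :=
  {t ∈ Omega D | t.1 ≤ t.2.1 ∧ (D : ℤ) < 2 * t.1 + t.2.2}

/-- The value of `m^{1,0}_{ε,ε^*,d} / ((q)_{D-1} (q)_{D+1})`; here `e = ε` and `f = ε^*`. -/
def mult10 (q : ℂ) (D : ℕ) (e f d : ℤ) : ℂ :=
  ((-1) ^ ((D : ℤ) - d) * (1 - q ^ (2 * (D : ℤ) - 2 * f - d + 2)) * (1 - q ^ d) *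
      q ^ ((D : ℤ) - 2 * e + f - d + choose2 (2 * e - D + d))) /
    (qq q (D - e) * qq q (2 * D - e - f - d + 2) * qq q (D - e - d) *
      qq q (2 * e - D + d) * qq q (f - e))

/-- The value of `m^{1,1}_{ε,ε^*,d} / ((q)_{D-1} (q)_{D+1})`; here `e = ε` and `f = ε^*`. -/
def mult11 (q : ℂ) (D : ℕ) (e f d : ℤ) : ℂ :=
  ((-1) ^ ((D : ℤ) - d + 1) * (1 - q ^ (2 * (D : ℤ) - 2 * f - d + 1)) * (1 - q ^ (d + 1)) *
      q ^ ((D : ℤ) - 2 * e + f - d + 1 + choose2 (2 * e - D + d - 1))) /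
    (qq q (D - e + 2) * qq q (2 * D - e - f - d + 1) * qq q (D - e - d + 1) *
      qq q (2 * e - D + d - 1) * qq q (f - e))

/-! ### The `T`-modules `W₁`, their sums, and the description of the irreducible submodules -/

section Main

variable {F : Type*} [Field F] [Fintype F] {D : ℕ} {H : Pt F D}

section TypeOne

variable {x : Pt F D}

/-- The vector `w_i = w_{D-i,i,1} + q^{ν+i} [D-ν-i] w_{D-i-1,i,0}`, which is supported on `X`,
viewed as a vector of `ℂX`. -/
def wVec (𝒲 : Submodule (Halg x H) (Pt F D → ℂ)) (w : ℤ → ℤ → ℤ → Pt F D → ℂ) (i : ℤ) :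
    Vertex H → ℂ :=
  fun y => (w (D - i) i 1 + (order F ^ (nu 𝒲 + i) * gauss1 (order F) (D - nu 𝒲 - i)) •
    w (D - i - 1) i 0) y.1

/-- `U` is the subspace `W₁` of `ℂX` obtained from the `H̃`-module `𝒲` with `τ = 0`. -/
def IsTypeOne (𝒲 : Submodule (Halg x H) (Pt F D → ℂ)) (U : Submodule ℂ (Vertex H → ℂ)) :
    Prop :=
  ∃ w, IsStandardBasis 𝒲 w ∧ U = Submodule.span ℂ (wVec 𝒲 w ''
    Set.Icc (max (nu 𝒲 + rho 𝒲) (mu 𝒲)) (min ((D : ℤ) - nu 𝒲) (D - mu 𝒲 + rho 𝒲 + 1)))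

variable (H x) in
/-- `V₁`, the sum of all the `W₁`, over all the irreducible `H̃`-modules in `ℂP̃` with
`τ = 0`. -/
def V1 : Submodule ℂ (Vertex H → ℂ) :=
  sSup {U | ∃ 𝒲 : Submodule (Halg x H) (Pt F D → ℂ),
    IsSimpleModule (Halg x H) 𝒲 ∧ tau 𝒲 = 0 ∧ IsTypeOne 𝒲 U}

variable (H x) in
/-- The sum of those `W₁` for which `ν + ρ ≥ μ`. -/
def V1ge : Submodule ℂ (Vertex H → ℂ) :=
  sSup {U | ∃ 𝒲 : Submodule (Halg x H) (Pt F D → ℂ),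
    IsSimpleModule (Halg x H) 𝒲 ∧ tau 𝒲 = 0 ∧ (mu 𝒲 : ℤ) ≤ nu 𝒲 + rho 𝒲 ∧ IsTypeOne 𝒲 U}

variable (H x) in
/-- The sum of those `W₁` for which `ν + ρ < μ`. -/
def V1lt : Submodule ℂ (Vertex H → ℂ) :=
  sSup {U | ∃ 𝒲 : Submodule (Halg x H) (Pt F D → ℂ),
    IsSimpleModule (Halg x H) 𝒲 ∧ tau 𝒲 = 0 ∧ nu 𝒲 + rho 𝒲 < (mu 𝒲 : ℤ) ∧ IsTypeOne 𝒲 U}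

end TypeOne

variable {x : Vertex H}

/-- The irreducible module `W` occurs with multiplicity `m` in `V`: the sum of all submodules
of `V` isomorphic to `W` is isomorphic to a direct sum of `m` copies of `W`. -/
def HasMultiplicity (V W : Submodule (Talg x) (Vertex H → ℂ)) (m : ℕ) : Prop :=
  Nonempty (isotypicComponent (Talg x) V W ≃ₗ[Talg x] (Fin m → W))

open Matrix in
/-- `W` has a basis `v_0, …, v_d` with `v_i ∈ E_{ε+i}^* W` for all `i`, with respect to which
`A` acts on `W` as the matrix `M`. -/
def ActsAs (W : Submodule (Talg x) (Vertex H → ℂ))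
    (M : Matrix (Fin (diam W + 1)) (Fin (diam W + 1)) ℂ) : Prop :=
  ∃ v : Fin (diam W + 1) → Vertex H → ℂ,
    LinearIndependent ℂ v ∧ Submodule.span ℂ (Set.range v) = W.restrictScalars ℂ ∧
    (∀ i : Fin (diam W + 1), v i ∈ cut (dualE x (endpoint W + (i : ℕ))) (W.restrictScalars ℂ)) ∧
    ∀ j, adj H *ᵥ v j = ∑ i, M i j • v i

/-- The description of the irreducible submodules of a `T`-module `V ⊆ ℂX` in terms of the set
`Ω'` over which `(ε, ε^*, d)` ranges, the parameter `r` (a function of `ε^*`), and the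
multiplicities divided by `(q)_{D-1} (q)_{D+1}` (a function `m'` of `ε, ε^*, d`). -/
structure Described (V : Submodule (Talg x) (Vertex H → ℂ)) (Ω' : Set (ℤ × ℤ × ℤ))
    (r : ℤ → ℂ) (m' : ℤ → ℤ → ℤ → ℂ) : Prop where
  range : {t | ∃ W : Submodule (Talg x) (Vertex H → ℂ),
    W ≤ V ∧ IsSimpleModule (Talg x) W ∧ triple W = t} = Ω'
  thin : ∀ W : Submodule (Talg x) (Vertex H → ℂ), W ≤ V → IsSimpleModule (Talg x) W → IsThin W
  admissible : ∀ W : Submodule (Talg x) (Vertex H → ℂ), W ≤ V → IsSimpleModule (Talg x) W →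
    Admissible (order F) (diam W)
      (order F ^ (2 * (D : ℤ) + 2 - dualEndpoint W) / (1 - order F) ^ 2)
      (r (dualEndpoint W))
      (order F ^ (2 * (dualEndpoint W : ℤ) - 2 * D - 3))
  acts : ∀ W : Submodule (Talg x) (Vertex H → ℂ), W ≤ V → IsSimpleModule (Talg x) W →
    ActsAs W (hahn (order F) (diam W)
      (order F ^ (2 * (D : ℤ) + 2 - dualEndpoint W) / (1 - order F) ^ 2)
      (r (dualEndpoint W))
      (order F ^ (2 * (dualEndpoint W : ℤ) - 2 * D - 3))
      (theta (order F) D (dualEndpoint W)))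
  iso : ∀ W W' : Submodule (Talg x) (Vertex H → ℂ), W ≤ V → W' ≤ V →
    IsSimpleModule (Talg x) W → IsSimpleModule (Talg x) W' →
    (Nonempty (W ≃ₗ[Talg x] W') ↔ triple W = triple W')
  multiplicity : ∀ W : Submodule (Talg x) (Vertex H → ℂ), W ≤ V → IsSimpleModule (Talg x) W →
    ∃ m : ℕ, HasMultiplicity V W m ∧
      (m : ℂ) / (qq (order F) ((D : ℤ) - 1) * qq (order F) ((D : ℤ) + 1)) =
        m' (endpoint W) (dualEndpoint W) (diam W)

end Main

end

end TwistedGrassmann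

namespace TwistedGrassmann

noncomputable section

set_option linter.unusedSectionVars false

open Module

/-! ### Covers in the lattice of subspaces -/

section Covers

variable {F : Type*} [Field F] [Fintype F] {E : Type*} [AddCommGroup E] [Module F E] [Finite E]

/-! The distance of a vertex from `x` depends only on its cell (`dist_of_mem_cell`), and on each
half of the vertex set `A` is, up to a scalar, quadratic in the lowering and raising matrices
(`Splitting.adj_mulVec_of_mem_X1`, `Splitting.adj_mulVec_of_mem_X2`). An explicit knowledge of the
`Halg`-modules with `τ = 0` therefore yields `T`-modules together with the action of `A` on them.

To obtain it, split `H` as a product `X × C` with first factor `x`. A subspace `u` of `X × C`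
amounts to its intersection `A` with `X`, its projection `B` to `C`, and a homomorphism `B → X/A`.
For fixed `A` and `B` these homomorphisms form a finite group, and the trace pairing labels its
characters by the maps `φ : X → C` with `A ≤ ker φ` and `range φ ≤ B`. After this Fourier transform
`φ` is conserved. The first lowering and raising matrices become, up to powers of `q`, the covering
operators of the interval `[0, ker φ]`, and the second ones those of `[range φ, C]`. Each pair
satisfies a relation of `sl₂` type (`dn_up_sub_up_dn`), and the two pairs commute up to powers of
`q`. The third pair only moves between subspaces inside and outside `H` with the same trace. An
irreducible module with `τ = 0` is hence generated by a single vector killed by `l1` and `l2`, of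
one rank `ρ` and one bidegree `(ν, μ)` (`Splitting.exists_generates`), and its standard basis is
obtained by raising this vector; it is unique up to a scalar.

On the vectors `w_i` the matrix `A` is tridiagonal (`Splitting.adj_omv`), and a rescaling brings it
to the form `hahn`. The two families arise because the first nonzero `w_i` has index `max (ν + ρ)
μ`. Irreducibility follows from the nonvanishing of the off-diagonal entries. The dual endpoint is
read off by triangularizing `A` with eigenvalues `θ_f, …, θ_{f+d}` (`hahnPoly_step`,
`IsHahnBasis.eigE_eq_zero`).

Within a family the triple `(ε, ε^*, d)` determines both the isomorphism class and `(ν, μ, ρ)`. The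
isotypic component is an injective image of `d + 1` copies of the space `Low` of lowest weight
vectors, so the multiplicity is `dim Low`. This dimension comes from counting the triples `(φ, A,
B)` and from two applications of the surjectivity of lowering below the middle (`finrank_ladder`,
`finrank_Low_eq`). A simple module common to both families would have two different values of `r`,
although for `d > 0` the action of `A` determines `r` (`IsHahnBasis.param_eq`); hence the sum is
direct. -/

instance fintypeSubmodule : Fintype (Submodule F E) := Fintype.ofFinite _

/-- The subspace `B` covers the subspace `A`. -/
def Cov (A B : Submodule F E) : Prop := A ≤ B ∧ finrank F B = finrank F A + 1

theorem finite_dimensional_of_finite : FiniteDimensional F E := Module.Finite.of_finite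

theorem one_lt_card : 1 < Fintype.card F := Fintype.one_lt_card

theorem order_ne_zero : order F ≠ 0 := by
  unfold order; exact_mod_cast (Fintype.card_pos).ne'

theorem order_zpow_eq_one_iff {m : ℤ} : order F ^ m = 1 ↔ m = 0 := by
  have h1 : (1 : ℝ) < Fintype.card F := by exact_mod_cast one_lt_card
  constructor
  · intro h
    have h2 : ((Fintype.card F : ℝ)) ^ m = 1 := by
      apply Complex.ofReal_injective
      rw [Complex.ofReal_zpow, Complex.ofReal_natCast, Complex.ofReal_one]
      exact h
    by_contra hm
    exact (zpow_right_injective₀ (by linarith) h1.ne').ne hm (by simpa using h2)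
  · rintro rfl; simp

theorem order_zpow_inj {m n : ℤ} : order F ^ m = order F ^ n ↔ m = n := by
  rw [← sub_eq_zero (a := m), ← order_zpow_eq_one_iff (F := F), zpow_sub₀ order_ne_zero,
    div_eq_one_iff_eq (zpow_ne_zero _ order_ne_zero)]

theorem order_pow_eq_one_iff {m : ℕ} : order F ^ m = 1 ↔ m = 0 := by
  have := order_zpow_eq_one_iff (F := F) (m := m)
  simpa using this

theorem one_sub_order_ne_zero : 1 - order F ≠ 0 := by
  have := order_pow_eq_one_iff (F := F) (m := 1)
  intro h
  rw [pow_one] at this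
  exact one_ne_zero (this.1 (by linear_combination -h))

theorem gauss1_inj {m n : ℤ} : gauss1 (order F) m = gauss1 (order F) n ↔ m = n := by
  unfold gauss1
  rw [div_left_inj' one_sub_order_ne_zero, sub_right_inj, order_zpow_inj]

theorem gauss1_zero {q : ℂ} : gauss1 q 0 = 0 := by simp [gauss1]

theorem gauss1_eq_zero_iff {m : ℤ} : gauss1 (order F) m = 0 ↔ m = 0 := by
  rw [← gauss1_inj (F := F) (m := m), gauss1_zero]

open Classical in
theorem card_filter_mem_sdiff {A B : Submodule F E} [Fintype E] (h : A ≤ B) :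
    (Finset.univ.filter fun v : E => v ∈ B ∧ v ∉ A).card + Fintype.card F ^ finrank F A
      = Fintype.card F ^ finrank F B := by
  have hA : (Finset.univ.filter fun v : E => v ∈ A).card = Fintype.card F ^ finrank F A := by
    rw [← Module.card_eq_pow_finrank (K := F) (V := A), Fintype.card_subtype]
  have hB : (Finset.univ.filter fun v : E => v ∈ B).card = Fintype.card F ^ finrank F B := by
    rw [← Module.card_eq_pow_finrank (K := F) (V := B), Fintype.card_subtype]
  rw [← hA, ← hB, ← Finset.card_union_of_disjoint]
  · congr 1; ext v; simp only [Finset.mem_union, Finset.mem_filter, Finset.mem_univ, true_and]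
    constructor
    · rintro (h1 | h1)
      exacts [h1.1, h h1]
    · intro h1; by_cases h2 : v ∈ A
      exacts [Or.inr h2, Or.inl ⟨h1, h2⟩]
  · rw [Finset.disjoint_filter]; tauto

theorem finrank_sup_span_singleton {A : Submodule F E} {v : E} (h : v ∉ A) :
    finrank F ↥(A ⊔ Submodule.span F {v}) = finrank F A + 1 := by
  have := finite_dimensional_of_finite (F := F) (E := E)
  have h0 : v ≠ 0 := fun h0 => h (h0 ▸ A.zero_mem)
  have hinf : A ⊓ Submodule.span F {v} = ⊥ := by
    rw [← disjoint_iff, Submodule.disjoint_span_singleton' h0]; exact h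
  have h2 := Submodule.finrank_sup_add_finrank_inf_eq A (Submodule.span F {v})
  rw [hinf, finrank_bot, finrank_span_singleton h0] at h2
  simpa using h2

theorem Cov.eq_sup_span {A B : Submodule F E} (h : Cov A B) {v : E} (hv : v ∈ B) (hA : v ∉ A) :
    A ⊔ Submodule.span F {v} = B := by
  have := finite_dimensional_of_finite (F := F) (E := E)
  apply Submodule.eq_of_le_of_finrank_eq
  · exact sup_le h.1 (by simpa using hv)
  · rw [finrank_sup_span_singleton hA, h.2]

theorem eq_of_le_of_finrank_le' {A B : Submodule F E} (h : A ≤ B)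
    (h2 : finrank F B ≤ finrank F A) : A = B := by
  have := finite_dimensional_of_finite (F := F) (E := E)
  exact Submodule.eq_of_le_of_finrank_le h h2

theorem finrank_mono' {A B : Submodule F E} (h : A ≤ B) : finrank F A ≤ finrank F B := by
  have := finite_dimensional_of_finite (F := F) (E := E)
  exact Submodule.finrank_mono h

theorem finrank_sup_inf (A B : Submodule F E) :
    finrank F ↥(A ⊔ B) + finrank F ↥(A ⊓ B) = finrank F A + finrank F B := by
  have := finite_dimensional_of_finite (F := F) (E := E)
  exact Submodule.finrank_sup_add_finrank_inf_eq A B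

open Classical in
-- The vectors of `Q` outside `A` are counted along the map `v ↦ A + ⟨v⟩` to the covers of `A` in
-- `Q`; the fibre over `B` is the complement of `A` in `B`.
theorem card_covers_mul {A Q : Submodule F E} (h : A ≤ Q) :
    (Finset.univ.filter fun B : Submodule F E => Cov A B ∧ B ≤ Q).card *
      (Fintype.card F ^ (finrank F A + 1) - Fintype.card F ^ finrank F A) =
      Fintype.card F ^ finrank F Q - Fintype.card F ^ finrank F A := by
  have := Fintype.ofFinite E
  have key := Finset.card_eq_sum_card_fiberwise
    (f := fun v : E => A ⊔ Submodule.span F {v})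
    (s := Finset.univ.filter fun v : E => v ∈ Q ∧ v ∉ A)
    (t := Finset.univ.filter fun B : Submodule F E => Cov A B ∧ B ≤ Q) (by
      intro v hv
      simp only [Finset.coe_filter, Finset.mem_univ, true_and, Set.mem_ofPred_eq] at hv ⊢
      exact ⟨⟨le_sup_left, finrank_sup_span_singleton hv.2⟩, sup_le h (by simpa using hv.1)⟩)
  have h1 := card_filter_mem_sdiff h
  rw [← h1, Nat.add_sub_cancel, key, Finset.sum_const_nat]
  intro B hB
  simp only [Finset.mem_filter, Finset.mem_univ, true_and] at hB
  have h2 := card_filter_mem_sdiff hB.1.1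
  rw [← hB.1.2, ← h2, Nat.add_sub_cancel]
  congr 1
  ext v
  simp only [Finset.mem_filter, Finset.mem_univ, true_and]
  constructor
  · rintro ⟨⟨_, h3⟩, rfl⟩
    exact ⟨le_sup_right (a := A) (Submodule.mem_span_singleton_self v), h3⟩
  · rintro ⟨h3, h4⟩
    exact ⟨⟨hB.2 h3, h4⟩, hB.1.eq_sup_span h3 h4⟩

open Classical in
theorem card_covers {A Q : Submodule F E} (h : A ≤ Q) :
    ((Finset.univ.filter fun B : Submodule F E => Cov A B ∧ B ≤ Q).card : ℂ) =
      gauss1 (order F) ((finrank F Q : ℤ) - finrank F A) := by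
  have h1 := card_covers_mul h
  have hq : 1 ≤ Fintype.card F := Fintype.card_pos
  have h2 : finrank F A ≤ finrank F Q := finrank_mono' h
  have h3 := congrArg (Nat.cast (R := ℂ)) h1
  rw [Nat.cast_mul, Nat.cast_sub (Nat.pow_le_pow_right hq (by omega)),
    Nat.cast_sub (Nat.pow_le_pow_right hq h2)] at h3
  push_cast at h3
  have h4 : (order F) ^ (finrank F A) ≠ 0 := pow_ne_zero _ order_ne_zero
  have h5 := one_sub_order_ne_zero (F := F)
  unfold gauss1
  rw [zpow_sub₀ order_ne_zero, zpow_natCast, zpow_natCast]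
  simp only [order] at *
  field_simp
  linear_combination -h3

open Classical in
-- By duality: annihilators reverse inclusion and turn the cocovers of `A` above `P` into the covers
-- of the annihilator of `A` below that of `P`.
theorem card_cocovers {A P : Submodule F E} (h : P ≤ A) :
    ((Finset.univ.filter fun B : Submodule F E => Cov B A ∧ P ≤ B).card : ℂ) =
      gauss1 (order F) ((finrank F A : ℤ) - finrank F P) := by
  have := finite_dimensional_of_finite (F := F) (E := E)
  have : Finite (Dual F E) := Module.finite_of_finite F
  have hfr : ∀ B : Submodule F E, finrank F B + finrank F B.dualAnnihilator = finrank F E :=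
    fun B => Subspace.finrank_add_finrank_dualAnnihilator_eq B
  have hle : A.dualAnnihilator ≤ P.dualAnnihilator := Submodule.dualAnnihilator_anti h
  have h1 := card_covers hle
  have e := Subspace.orderIsoFiniteDimensional (K := F) (V := E)
  rw [show ((finrank F A : ℤ) - finrank F P) =
    (finrank F P.dualAnnihilator : ℤ) - finrank F A.dualAnnihilator by
      have := hfr A; have := hfr P; omega, ← h1]
  congr 1
  apply Finset.card_nbij' (i := Submodule.dualAnnihilator) (j := Submodule.dualCoannihilator)
  · intro B hB
    simp only [Finset.coe_filter, Finset.mem_univ, true_and, Set.mem_ofPred_eq] at hB ⊢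
    refine ⟨⟨Submodule.dualAnnihilator_anti hB.1.1, ?_⟩, Submodule.dualAnnihilator_anti hB.2⟩
    have := hfr A; have := hfr B; have := hB.1.2; omega
  · intro B hB
    simp only [Finset.coe_filter, Finset.mem_univ, true_and, Set.mem_ofPred_eq] at hB ⊢
    have hB' : B.dualCoannihilator.dualAnnihilator = B :=
      Subspace.dualCoannihilator_dualAnnihilator_eq
    have hA' : A.dualAnnihilator.dualCoannihilator = A :=
      Subspace.dualAnnihilator_dualCoannihilator_eq
    have hP' : P.dualAnnihilator.dualCoannihilator = P :=
      Subspace.dualAnnihilator_dualCoannihilator_eq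
    refine ⟨⟨?_, ?_⟩, ?_⟩
    · rw [← hA']; exact Submodule.dualCoannihilator_anti hB.1.1
    · have := hfr A; have := hfr B.dualCoannihilator; have := hB.1.2; rw [hB'] at *; omega
    · rw [← hP']; exact Submodule.dualCoannihilator_anti hB.2
  · intro B _; exact Subspace.dualAnnihilator_dualCoannihilator_eq
  · intro B _; exact Subspace.dualCoannihilator_dualAnnihilator_eq

/-- Two distinct subspaces have at most one common cover, their sum, and dually at most one common
cocover, their intersection. Both exist under the same condition on dimensions, which is what makes
the commutator in `sum_covInd_sub` diagonal. -/
theorem cov_cov_iff {A Z B : Submodule F E} (hAZ : A ≠ Z) :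
    Cov A B ∧ Cov Z B ↔ B = A ⊔ Z ∧ finrank F A = finrank F Z ∧
      finrank F ↥(A ⊓ Z) + 1 = finrank F A := by
  have hs := finrank_sup_inf A Z
  constructor
  · rintro ⟨⟨h1, h2⟩, h3, h4⟩
    have hle : A ⊔ Z ≤ B := sup_le h1 h3
    have h5 := finrank_mono' hle
    have h6 : finrank F ↥(A ⊔ Z) ≠ finrank F A := by
      intro h
      have e1 := eq_of_le_of_finrank_le' (le_sup_left : A ≤ A ⊔ Z) h.le
      have e2 := eq_of_le_of_finrank_le' (le_sup_right : Z ≤ A ⊔ Z) (by omega)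
      exact hAZ (e1.trans e2.symm)
    have h7 := finrank_mono' (le_sup_left : A ≤ A ⊔ Z)
    refine ⟨(eq_of_le_of_finrank_le' hle (by omega)).symm, by omega, by omega⟩
  · rintro ⟨rfl, h1, h2⟩
    exact ⟨⟨le_sup_left, by omega⟩, le_sup_right, by omega⟩

theorem cocov_cocov_iff {A Z B : Submodule F E} (hAZ : A ≠ Z) :
    Cov B A ∧ Cov B Z ↔ B = A ⊓ Z ∧ finrank F A = finrank F Z ∧
      finrank F ↥(A ⊓ Z) + 1 = finrank F A := by
  constructor
  · rintro ⟨⟨h1, h2⟩, h3, h4⟩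
    have hle : B ≤ A ⊓ Z := le_inf h1 h3
    have h5 := finrank_mono' hle
    have h6 : finrank F ↥(A ⊓ Z) ≠ finrank F A := by
      intro h
      have e1 := eq_of_le_of_finrank_le' (inf_le_left : A ⊓ Z ≤ A) h.ge
      have e2 := eq_of_le_of_finrank_le' (inf_le_right : A ⊓ Z ≤ Z) (by omega)
      exact hAZ (e1.symm.trans e2)
    have h7 := finrank_mono' (inf_le_left : A ⊓ Z ≤ A)
    refine ⟨eq_of_le_of_finrank_le' hle (by omega), by omega, by omega⟩
  · rintro ⟨rfl, h1, h2⟩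
    exact ⟨⟨inf_le_left, by omega⟩, inf_le_right, by omega⟩

/-! ### Raising and lowering operators in an interval of subspaces -/

open Classical in
/-- The `0`-`1` matrix of the covering relation in the interval `[P, Q]`. -/
def covInd (P Q A B : Submodule F E) : ℂ := if Cov A B ∧ P ≤ A ∧ B ≤ Q then 1 else 0

/-- Summation over the subspaces covered by a given one, in the interval `[P, Q]`. -/
def up (P Q : Submodule F E) (f : Submodule F E → ℂ) (B : Submodule F E) : ℂ :=
  ∑ A, covInd P Q A B * f A

/-- Summation over the subspaces covering a given one, in the interval `[P, Q]`. -/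
def dn (P Q : Submodule F E) (f : Submodule F E → ℂ) (A : Submodule F E) : ℂ :=
  ∑ B, covInd P Q A B * f B

open Classical in
-- Off the diagonal the two sums cancel, since a common cover exists exactly when a common cocover
-- does and both then lie in the interval. On the diagonal they count covers and cocovers.
theorem sum_covInd_sub {P Q A Z : Submodule F E} (hA : P ≤ A ∧ A ≤ Q) (hZ : P ≤ Z ∧ Z ≤ Q) :
    ∑ B, covInd P Q A B * covInd P Q Z B - ∑ B, covInd P Q B A * covInd P Q B Z =
      if A = Z then gauss1 (order F) ((finrank F Q : ℤ) - finrank F A) -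
        gauss1 (order F) ((finrank F A : ℤ) - finrank F P) else 0 := by
  split_ifs with h
  · subst h
    rw [← card_covers hA.2, ← card_cocovers hA.1]
    congr 1 <;>
    · rw [Finset.card_filter, Nat.cast_sum]
      refine Finset.sum_congr rfl fun B _ => ?_
      unfold covInd
      split_ifs <;> simp_all
  · have e : ∀ B, covInd P Q A B * covInd P Q Z B = if B = A ⊔ Z then
        (if finrank F A = finrank F Z ∧ finrank F ↥(A ⊓ Z) + 1 = finrank F A then 1 else 0)
        else 0 := by
      intro B
      have := cov_cov_iff (B := B) h
      have h2 : A ⊔ Z ≤ Q := sup_le hA.2 hZ.2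
      unfold covInd
      split_ifs <;> simp_all
    have e' : ∀ B, covInd P Q B A * covInd P Q B Z = if B = A ⊓ Z then
        (if finrank F A = finrank F Z ∧ finrank F ↥(A ⊓ Z) + 1 = finrank F A then 1 else 0)
        else 0 := by
      intro B
      have := cocov_cocov_iff (B := B) h
      have h2 : P ≤ A ⊓ Z := le_inf hA.1 hZ.1
      unfold covInd
      split_ifs <;> simp_all
    simp only [e, e', Finset.sum_ite_eq', Finset.mem_univ, if_true, sub_self]

/-- The `sl₂`-type relation behind all later computations with strings. The hypothesis on the
support of `f` makes both sides vanish when `A` lies outside the interval. -/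
theorem dn_up_sub_up_dn {P Q : Submodule F E} {f : Submodule F E → ℂ}
    (hf : ∀ A, f A ≠ 0 → P ≤ A ∧ A ≤ Q) {A : Submodule F E} :
    dn P Q (up P Q f) A - up P Q (dn P Q f) A =
      (gauss1 (order F) ((finrank F Q : ℤ) - finrank F A) -
        gauss1 (order F) ((finrank F A : ℤ) - finrank F P)) * f A := by
  classical
  have e1 : dn P Q (up P Q f) A = ∑ Z, (∑ B, covInd P Q A B * covInd P Q Z B) * f Z := by
    simp only [dn, up, Finset.mul_sum, Finset.sum_mul]
    rw [Finset.sum_comm]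
    simp only [mul_assoc]
  have e2 : up P Q (dn P Q f) A = ∑ Z, (∑ B, covInd P Q B A * covInd P Q B Z) * f Z := by
    simp only [dn, up, Finset.mul_sum, Finset.sum_mul]
    rw [Finset.sum_comm]
    simp only [mul_assoc]
  rw [e1, e2, ← Finset.sum_sub_distrib]
  by_cases hA : P ≤ A ∧ A ≤ Q
  · rw [Finset.sum_eq_single A]
    · rw [← sub_mul, sum_covInd_sub hA hA, if_pos rfl]
    · intro Z _ hZ
      by_cases h0 : f Z = 0
      · simp [h0]
      · rw [← sub_mul, sum_covInd_sub hA (hf Z h0), if_neg (Ne.symm hZ), zero_mul]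
    · simp
  · have hf0 : f A = 0 := by by_contra h; exact hA (hf A h)
    rw [hf0, mul_zero]
    refine Finset.sum_eq_zero fun Z _ => ?_
    have z1 : ∀ B, covInd P Q A B = 0 := by
      intro B; unfold covInd; rw [if_neg]; rintro ⟨h1, h2, h3⟩; exact hA ⟨h2, h1.1.trans h3⟩
    have z2 : ∀ B, covInd P Q B A = 0 := by
      intro B; unfold covInd; rw [if_neg]; rintro ⟨h1, h2, h3⟩; exact hA ⟨h2.trans h1.1, h3⟩
    simp [z1, z2]

/-! ### Counting subspaces of given dimension -/

/-- The Gaussian binomial coefficient, zero unless `0 ≤ i ≤ n`. -/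
def gbin (q : ℂ) (n i : ℤ) : ℂ :=
  if 0 ≤ i ∧ i ≤ n then qq q n / (qq q i * qq q (n - i)) else 0

theorem qq_succ (q : ℂ) {n : ℤ} (hn : 0 ≤ n) : qq q (n + 1) = qq q n * (1 - q ^ (n + 1)) := by
  obtain ⟨n, rfl⟩ := Int.eq_ofNat_of_zero_le hn
  have : ((n : ℤ) + 1).toNat = n + 1 := by omega
  simp only [qq, this, Int.toNat_natCast, qPoch, Finset.prod_range_succ]
  congr 2
  rw [← pow_succ']; norm_cast

theorem qq_zero (q : ℂ) : qq q 0 = 1 := by simp [qq, qPoch]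

theorem qq_ne_zero (n : ℤ) : qq (order F) n ≠ 0 := by
  unfold qq qPoch
  rw [Finset.prod_ne_zero_iff]
  intro l _ h
  rw [← pow_succ', sub_eq_zero, eq_comm, order_pow_eq_one_iff] at h
  omega

open Classical in
-- The covering pairs in dimensions `i` and `i + 1` are counted from below and from above. The
-- subtracted term is always zero, because `A = P` forces the factor `[0]`.
theorem sum_card_covers (P Q : Submodule F E) (i : ℕ) :
    ((Finset.univ.filter fun A : Submodule F E => P ≤ A ∧ A ≤ Q ∧ finrank F A = i).card : ℂ) *
      gauss1 (order F) ((finrank F Q : ℤ) - i) =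
    ((Finset.univ.filter fun A : Submodule F E => P ≤ A ∧ A ≤ Q ∧ finrank F A = i + 1).card : ℂ) *
      gauss1 (order F) ((i : ℤ) + 1 - finrank F P) -
    ((Finset.univ.filter fun A : Submodule F E => A = P ∧ A ≤ Q ∧ finrank F A = i + 1).card : ℂ) *
      gauss1 (order F) ((i : ℤ) + 1 - finrank F P) := by
  have e1 : ((Finset.univ.filter fun A : Submodule F E =>
        P ≤ A ∧ A ≤ Q ∧ finrank F A = i).card : ℂ) *
      gauss1 (order F) ((finrank F Q : ℤ) - i) =
      ∑ A ∈ Finset.univ.filter (fun A : Submodule F E => finrank F A = i),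
        ∑ B ∈ Finset.univ.filter (fun B : Submodule F E => finrank F B = i + 1),
          covInd P Q A B := by
    rw [Finset.card_filter, Nat.cast_sum, Finset.sum_mul, Finset.sum_filter]
    refine Finset.sum_congr rfl fun A _ => ?_
    by_cases hA : P ≤ A ∧ A ≤ Q ∧ finrank F A = i
    · rw [if_pos hA, if_pos hA.2.2, ← hA.2.2, ← card_covers hA.2.1, Nat.cast_one, one_mul,
        Finset.card_filter, Nat.cast_sum, Finset.sum_filter]
      refine Finset.sum_congr rfl fun B _ => ?_
      unfold covInd Cov
      split_ifs <;> simp_all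
    · rw [if_neg hA, Nat.cast_zero, zero_mul]
      split_ifs with h
      · symm
        refine Finset.sum_eq_zero fun B _ => ?_
        unfold covInd
        rw [if_neg]
        rintro ⟨h1, h2, h3⟩
        exact hA ⟨h2, h1.1.trans h3, h⟩
      · rfl
  rw [e1, Finset.sum_comm]
  rw [Finset.card_filter, Finset.card_filter, Nat.cast_sum, Nat.cast_sum, Finset.sum_mul,
    Finset.sum_mul, Finset.sum_filter, ← Finset.sum_sub_distrib]
  refine Finset.sum_congr rfl fun A _ => ?_
  by_cases hi : finrank F A = i + 1
  swap
  · simp [hi]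
  by_cases hQ : A ≤ Q
  swap
  · rw [if_pos hi, if_neg (by tauto), if_neg (by tauto), Nat.cast_zero, zero_mul, sub_zero]
    refine Finset.sum_eq_zero fun B _ => ?_
    unfold covInd; rw [if_neg]; tauto
  by_cases hP : P ≤ A
  swap
  · rw [if_pos hi, if_neg (by tauto), if_neg (by rintro ⟨rfl, _⟩; exact hP le_rfl),
      Nat.cast_zero, zero_mul, sub_zero]
    refine Finset.sum_eq_zero fun B _ => ?_
    unfold covInd; rw [if_neg]; rintro ⟨h1, h2, _⟩; exact hP (h2.trans h1.1)
  have e2 : ∑ B ∈ Finset.univ.filter (fun B : Submodule F E => finrank F B = i), covInd P Q B A =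
      gauss1 (order F) ((i : ℤ) + 1 - finrank F P) := by
    rw [show (i : ℤ) + 1 = finrank F A by rw [hi]; simp, ← card_cocovers hP, Finset.card_filter,
      Nat.cast_sum, Finset.sum_filter]
    refine Finset.sum_congr rfl fun B _ => ?_
    unfold covInd Cov
    split_ifs <;> simp_all
  rw [if_pos hi, if_pos ⟨hP, hQ, hi⟩, e2]
  by_cases hPA : A = P
  · rw [if_pos ⟨hPA, hQ, hi⟩]
    have : (i : ℤ) + 1 - finrank F P = 0 := by rw [← hPA, hi]; simp
    rw [this, gauss1_zero]; ring
  · rw [if_neg (by tauto)]; ring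

open Classical in
/-- The number of subspaces of given dimension in an interval. -/
theorem card_interval {P Q : Submodule F E} (hPQ : P ≤ Q) (i : ℕ) :
    ((Finset.univ.filter fun A : Submodule F E => P ≤ A ∧ A ≤ Q ∧ finrank F A = i).card : ℂ) =
      gbin (order F) ((finrank F Q : ℤ) - finrank F P) ((i : ℤ) - finrank F P) := by
  have hd := finrank_mono' hPQ
  by_cases hi : finrank F P ≤ i
  swap
  · rw [gbin, if_neg (by omega), Finset.filter_eq_empty_iff.2, Finset.card_empty, Nat.cast_zero]
    rintro A - ⟨h1, h2, h3⟩
    have := finrank_mono' h1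
    omega
  induction i, hi using Nat.le_induction with
  | base =>
    rw [gbin, sub_self, if_pos (by omega), qq_zero, one_mul, sub_zero, div_self (qq_ne_zero _),
      Nat.cast_eq_one, Finset.card_eq_one]
    refine ⟨P, ?_⟩
    ext A
    simp only [Finset.mem_filter, Finset.mem_univ, true_and, Finset.mem_singleton]
    constructor
    · rintro ⟨h1, h2, h3⟩; exact (eq_of_le_of_finrank_le' h1 h3.le).symm
    · rintro rfl; exact ⟨le_rfl, hPQ, rfl⟩
  | succ i hi ih =>
    have h1 := sum_card_covers P Q i
    rw [ih] at h1
    have h2 : (Finset.univ.filter fun A : Submodule F E =>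
        A = P ∧ A ≤ Q ∧ finrank F A = i + 1).card = 0 := by
      rw [Finset.card_eq_zero, Finset.filter_eq_empty_iff]
      rintro A - ⟨rfl, h2, h3⟩; omega
    rw [h2, Nat.cast_zero, zero_mul, sub_zero] at h1
    have h3 : gauss1 (order F) ((i : ℤ) + 1 - finrank F P) ≠ 0 := by
      rw [Ne, gauss1_eq_zero_iff]; omega
    rw [← mul_right_inj' h3, mul_comm, ← h1]
    by_cases hlt : i + 1 ≤ finrank F Q
    · rw [gbin, gbin, if_pos (by omega), if_pos (by omega)]
      have e1 := qq_succ (order F) (n := (i : ℤ) - finrank F P) (by omega)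
      have e2 := qq_succ (order F) (n := (finrank F Q : ℤ) - (i + 1)) (by omega)
      rw [show (i : ℤ) - finrank F P + 1 = (i : ℤ) + 1 - finrank F P by ring] at e1
      rw [show (finrank F Q : ℤ) - (i + 1) + 1 = finrank F Q - i by ring] at e2
      push_cast
      rw [show (finrank F Q : ℤ) - finrank F P - (i - finrank F P) = finrank F Q - i by ring,
        show (finrank F Q : ℤ) - finrank F P - (i + 1 - finrank F P) = finrank F Q - (i + 1) by
          ring, e1, e2]
      have n1 := qq_ne_zero (F := F) ((i : ℤ) - finrank F P)
      have n2 := qq_ne_zero (F := F) ((finrank F Q : ℤ) - (i + 1))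
      have n3 := one_sub_order_ne_zero (F := F)
      have n4 : 1 - order F ^ ((i : ℤ) + 1 - finrank F P) ≠ 0 := by
        intro h; apply h3; simp [gauss1, h]
      have n5 : 1 - order F ^ ((finrank F Q : ℤ) - i) ≠ 0 := by
        intro h
        have := order_zpow_eq_one_iff (F := F) (m := (finrank F Q : ℤ) - i)
        rw [sub_eq_zero] at h
        have := this.1 h.symm; omega
      unfold gauss1
      field_simp
    -- Beyond the top dimension the recursion still holds: at `i = dim Q` the factor is `[0]`, and
    -- above it the previous coefficient is already zero.
    · rw [gbin, gbin, if_neg (c := _ ∧ ((i + 1 : ℕ) : ℤ) - _ ≤ _) (by omega), mul_zero]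
      split_ifs with h
      · rw [show (finrank F Q : ℤ) - i = 0 by omega, gauss1_zero, mul_zero]
      · rw [zero_mul]

end Covers

end

end TwistedGrassmann

namespace TwistedGrassmann

noncomputable section

set_option linter.unusedSectionVars false

open Module

/-! ### Subspaces of a product -/

section Product

variable {F : Type*} [Field F] [Fintype F] {X : Type*} [AddCommGroup X] [Module F X] [Finite X]
  {C : Type*} [AddCommGroup C] [Module F C] [Finite C]

instance fintypeLinearMap : Fintype (X →ₗ[F] C) :=
  @Fintype.ofFinite _ (DFunLike.finite _)

/-- The intersection of a subspace of `X × C` with `X`. -/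
def lo (u : Submodule F (X × C)) : Submodule F X := u.comap (LinearMap.inl F X C)

/-- The projection of a subspace of `X × C` to `C`. -/
def hi (u : Submodule F (X × C)) : Submodule F C := u.map (LinearMap.snd F X C)

/-- The subspace of `X × C` with given intersection with `X`, given projection to `C`, and
given linear section modulo the intersection. -/
def mkSub (A : Submodule F X) (B : Submodule F C) (ψ : C →ₗ[F] X) : Submodule F (X × C) :=
  B.comap (LinearMap.snd F X C) ⊓ A.comap (LinearMap.fst F X C - ψ ∘ₗ LinearMap.snd F X C)

theorem mem_mkSub {A : Submodule F X} {B : Submodule F C} {ψ : C →ₗ[F] X} {p : X × C} :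
    p ∈ mkSub A B ψ ↔ p.2 ∈ B ∧ p.1 - ψ p.2 ∈ A := Iff.rfl

theorem mem_lo {u : Submodule F (X × C)} {a : X} : a ∈ lo u ↔ (a, (0 : C)) ∈ u := Iff.rfl

theorem mem_hi {u : Submodule F (X × C)} {c : C} : c ∈ hi u ↔ ∃ a, (a, c) ∈ u := by
  simp [hi]

theorem lo_mono {u v : Submodule F (X × C)} (h : u ≤ v) : lo u ≤ lo v := fun _ ha => h ha

theorem hi_mono {u v : Submodule F (X × C)} (h : u ≤ v) : hi u ≤ hi v := Submodule.map_mono h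

theorem lo_mkSub (A : Submodule F X) (B : Submodule F C) (ψ : C →ₗ[F] X) :
    lo (mkSub A B ψ) = A := by
  ext a; simp [mem_lo, mem_mkSub]

theorem hi_mkSub (A : Submodule F X) (B : Submodule F C) (ψ : C →ₗ[F] X) :
    hi (mkSub A B ψ) = B := by
  ext c; rw [mem_hi]
  constructor
  · rintro ⟨a, h⟩; exact h.1
  · intro h; exact ⟨ψ c, h, by simp⟩

/-- The projection `u → hi u` has a linear section; its `X`-coordinate, extended from `hi u` to all
of `C`, serves as `ψ`. -/
theorem exists_eq_mkSub (u : Submodule F (X × C)) : ∃ ψ, u = mkSub (lo u) (hi u) ψ := by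
  let f : u →ₗ[F] hi u := ((LinearMap.snd F X C).comp u.subtype).codRestrict (hi u)
    fun p => mem_hi.2 ⟨p.1.1, p.2⟩
  have hf : LinearMap.range f = ⊤ := by
    rw [LinearMap.range_eq_top]
    rintro ⟨c, hc⟩
    obtain ⟨a, ha⟩ := mem_hi.1 hc
    exact ⟨⟨(a, c), ha⟩, rfl⟩
  obtain ⟨g, hg⟩ := f.exists_rightInverse_of_surjective hf
  obtain ⟨ψ, hψ⟩ := LinearMap.exists_extend (((LinearMap.fst F X C).comp u.subtype).comp g)
  have key : ∀ c : hi u, (ψ c, (c : C)) ∈ u := by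
    intro c
    have h1 : ψ c = (g c).1.1 := by
      have := LinearMap.congr_fun hψ c
      simpa using this
    have h2 : (g c).1.2 = c := by
      have := LinearMap.congr_fun hg c
      exact congrArg Subtype.val this
    have : (ψ c, (c : C)) = (g c).1 := Prod.ext h1 h2.symm
    rw [this]; exact (g c).2
  refine ⟨ψ, ?_⟩
  ext ⟨a, c⟩
  rw [mem_mkSub, mem_lo]
  constructor
  · intro h
    have hc : c ∈ hi u := mem_hi.2 ⟨a, h⟩
    refine ⟨hc, ?_⟩
    have := u.sub_mem h (key ⟨c, hc⟩)
    simpa using this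
  · rintro ⟨hc, h⟩
    have := u.add_mem h (key ⟨c, hc⟩)
    simpa using this

/-- A linear section of a subspace of `X × C`. -/
def psi (u : Submodule F (X × C)) : C →ₗ[F] X := (exists_eq_mkSub u).choose

theorem eq_mkSub_psi (u : Submodule F (X × C)) : u = mkSub (lo u) (hi u) (psi u) :=
  (exists_eq_mkSub u).choose_spec

theorem mkSub_le_iff {A A' : Submodule F X} {B B' : Submodule F C} {ψ ψ' : C →ₗ[F] X} :
    mkSub A B ψ ≤ mkSub A' B' ψ' ↔ A ≤ A' ∧ B ≤ B' ∧ ∀ c ∈ B, (ψ - ψ') c ∈ A' := by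
  constructor
  · intro h
    refine ⟨?_, ?_, ?_⟩
    · have := lo_mono h; rwa [lo_mkSub, lo_mkSub] at this
    · have := hi_mono h; rwa [hi_mkSub, hi_mkSub] at this
    · intro c hc
      have : (ψ c, c) ∈ mkSub A B ψ := ⟨hc, by simp⟩
      exact (h this).2
  · rintro ⟨h1, h2, h3⟩ ⟨a, c⟩ ⟨hc, ha⟩
    refine ⟨h2 hc, ?_⟩
    have := A'.add_mem (h1 ha) (h3 c hc)
    simpa using this

/-- The subspaces over `(A, B)` thus correspond to the elements of `Hom(B, X/A)`, the finite group
on which the Fourier analysis takes place. -/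
theorem mkSub_eq_iff {A : Submodule F X} {B : Submodule F C} {ψ ψ' : C →ₗ[F] X} :
    mkSub A B ψ = mkSub A B ψ' ↔ ∀ c ∈ B, (ψ - ψ') c ∈ A := by
  constructor
  · intro h; exact (mkSub_le_iff.1 h.le).2.2
  · intro h
    refine le_antisymm (mkSub_le_iff.2 ⟨le_rfl, le_rfl, h⟩) (mkSub_le_iff.2 ⟨le_rfl, le_rfl, ?_⟩)
    intro c hc
    have := A.neg_mem (h c hc)
    simpa using this

theorem finrank_eq_lo_add_hi (u : Submodule F (X × C)) :
    finrank F u = finrank F (lo u) + finrank F (hi u) := by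
  have : FiniteDimensional F X := finite_dimensional_of_finite
  have : FiniteDimensional F C := finite_dimensional_of_finite
  have h := ((LinearMap.snd F X C).domRestrict u).finrank_range_add_finrank_ker
  have h1 : LinearMap.range ((LinearMap.snd F X C).domRestrict u) = hi u := by
    ext c; simp [hi]
  have e : lo u ≃ₗ[F] LinearMap.ker ((LinearMap.snd F X C).domRestrict u) :=
    { toFun := fun a => ⟨⟨(a.1, 0), a.2⟩, rfl⟩
      invFun := fun p => ⟨p.1.1.1, by
        have h1 : p.1.1.2 = 0 := p.2
        have h2 := p.1.2
        rw [mem_lo]; rw [← h1]; exact h2⟩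
      map_add' := fun a b => by ext <;> simp
      map_smul' := fun a b => by ext <;> simp
      left_inv := fun a => rfl
      right_inv := fun p => by
        have h1 : p.1.1.2 = 0 := p.2
        ext
        · rfl
        · exact h1.symm }
  rw [h1, ← e.finrank_eq] at h
  omega

/-! ### Characters -/

variable (F) in
theorem exists_addChar_ne_one : ∃ η : AddChar F ℂ, ∃ a, η a ≠ 1 := by
  obtain ⟨η, h⟩ := AddChar.exists_apply_ne_zero.2 (one_ne_zero (α := F))
  exact ⟨η, 1, h⟩

variable (F) in
/-- A nontrivial additive character of the finite field. -/
def eta : AddChar F ℂ := (exists_addChar_ne_one F).choose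

/-- The pairing of `Hom(X, C)` and `Hom(C, X)` given by the trace. -/
def chi (φ : X →ₗ[F] C) (ψ : C →ₗ[F] X) : ℂ := eta F (LinearMap.trace F C (φ ∘ₗ ψ))

theorem chi_add_left (φ φ' : X →ₗ[F] C) (ψ : C →ₗ[F] X) :
    chi (φ + φ') ψ = chi φ ψ * chi φ' ψ := by
  simp [chi, LinearMap.add_comp, AddChar.map_add_eq_mul]

theorem chi_add_right (φ : X →ₗ[F] C) (ψ ψ' : C →ₗ[F] X) :
    chi φ (ψ + ψ') = chi φ ψ * chi φ ψ' := by
  simp [chi, LinearMap.comp_add, AddChar.map_add_eq_mul]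

theorem chi_zero_left (ψ : C →ₗ[F] X) : chi (0 : X →ₗ[F] C) ψ = 1 := by
  simp [chi]

theorem chi_zero_right (φ : X →ₗ[F] C) : chi φ (0 : C →ₗ[F] X) = 1 := by
  simp [chi]

theorem exists_chi_smul_ne_one {φ : X →ₗ[F] C} {ψ : C →ₗ[F] X}
    (h : LinearMap.trace F C (φ ∘ₗ ψ) ≠ 0) : ∃ s : F, chi φ (s • ψ) ≠ 1 ∧ chi (s • φ) ψ ≠ 1 := by
  obtain ⟨a, ha⟩ : ∃ a, eta F a ≠ 1 := (exists_addChar_ne_one F).choose_spec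
  -- This scalar moves the trace to the element `a`, on which the character `eta` is nontrivial.
  refine ⟨a * (LinearMap.trace F C (φ ∘ₗ ψ))⁻¹, ?_, ?_⟩ <;>
  · simpa [chi, LinearMap.comp_smul, LinearMap.smul_comp, h] using ha

theorem trace_smulRight' (f : C →ₗ[F] F) (c : C) : LinearMap.trace F C (f.smulRight c) = f c := by
  have : FiniteDimensional F C := finite_dimensional_of_finite
  have := LinearMap.trace_eq_contract_apply F C (f ⊗ₜ c)
  rw [contractLeft_apply] at this
  rw [← this]
  congr 1

/-- Nondegeneracy of the trace pairing. A map of rank one with image `⟨a⟩`, where `φ a ≠ 0`, already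
has nonzero trace against `φ`. -/
theorem exists_chi_ne_one_of_ne_zero {φ : X →ₗ[F] C} (h : φ ≠ 0) : ∃ ψ, chi φ ψ ≠ 1 := by
  obtain ⟨a, ha⟩ : ∃ a, φ a ≠ 0 := by
    by_contra hcon; push Not at hcon; exact h (LinearMap.ext hcon)
  obtain ⟨f, hf, -⟩ := Submodule.exists_le_ker_of_notMem (p := (⊥ : Submodule F C)) (v := φ a)
    (by simpa using ha)
  have h2 : LinearMap.trace F C (φ ∘ₗ f.smulRight a) ≠ 0 := by
    have : φ ∘ₗ f.smulRight a = f.smulRight (φ a) := by ext; simp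
    rw [this, trace_smulRight']; exact hf
  obtain ⟨s, hs, -⟩ := exists_chi_smul_ne_one h2
  exact ⟨_, hs⟩

/-- The condition on `φ : X → C` that it vanishes on `A` and has image in `B`. -/
def Xi (φ : X →ₗ[F] C) (A : Submodule F X) (B : Submodule F C) : Prop :=
  A ≤ LinearMap.ker φ ∧ LinearMap.range φ ≤ B

theorem Xi.add {φ φ' : X →ₗ[F] C} {A : Submodule F X} {B : Submodule F C} (h : Xi φ A B)
    (h' : Xi φ' A B) : Xi (φ + φ') A B := by
  constructor
  · intro a ha
    have h1 : φ a = 0 := h.1 ha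
    have h2 : φ' a = 0 := h'.1 ha
    simp [h1, h2]
  · rintro _ ⟨a, rfl⟩
    exact B.add_mem (h.2 ⟨a, rfl⟩) (h'.2 ⟨a, rfl⟩)

theorem Xi.smul {φ : X →ₗ[F] C} {A : Submodule F X} {B : Submodule F C} (s : F) (h : Xi φ A B) :
    Xi (s • φ) A B := by
  constructor
  · intro a ha
    have h1 : φ a = 0 := h.1 ha
    simp [h1]
  · rintro _ ⟨a, rfl⟩
    exact B.smul_mem _ (h.2 ⟨a, rfl⟩)

theorem Xi.neg {φ : X →ₗ[F] C} {A : Submodule F X} {B : Submodule F C} (h : Xi φ A B) :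
    Xi (-φ) A B := by
  have := h.smul (-1); rwa [neg_one_smul] at this

theorem Xi.zero (A : Submodule F X) (B : Submodule F C) : Xi (0 : X →ₗ[F] C) A B := by
  constructor
  · simp
  · simp

/-- The endomorphism `φ ∘ δ` has square zero: its image lies in `B`, which `δ` sends into `A ≤ ker
φ`. Its trace therefore vanishes, so that `chi φ` is well defined on the fibre over `(A, B)`. -/
theorem Xi.chi_eq_one {φ : X →ₗ[F] C} {A : Submodule F X} {B : Submodule F C} (h : Xi φ A B)
    {δ : C →ₗ[F] X} (hδ : ∀ c ∈ B, δ c ∈ A) : chi φ δ = 1 := by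
  have : FiniteDimensional F C := finite_dimensional_of_finite
  have hn : IsNilpotent (φ ∘ₗ δ) := by
    refine ⟨2, ?_⟩
    ext c
    rw [pow_two]
    exact h.1 (hδ _ (h.2 ⟨δ c, rfl⟩))
  rw [chi, (LinearMap.isNilpotent_trace_of_isNilpotent hn).eq_zero, AddChar.map_zero_eq_one]

theorem Xi.chi_eq_of_mkSub_eq {φ : X →ₗ[F] C} {A : Submodule F X} {B : Submodule F C}
    (h : Xi φ A B) {ψ ψ' : C →ₗ[F] X} (hδ : mkSub A B ψ = mkSub A B ψ') : chi φ ψ = chi φ ψ' := by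
  have := chi_add_right φ (ψ - ψ') ψ'
  rw [sub_add_cancel, h.chi_eq_one (mkSub_eq_iff.1 hδ), one_mul] at this
  exact this

/-- The maps satisfying `Xi` separate the points of `Hom(B, X/A)`, so no further characters are
needed. The witness has rank one, with image `⟨c⟩` and given by a functional that kills `A` but not
`δ c`. -/
theorem exists_xi_chi_ne_one {A : Submodule F X} {B : Submodule F C} {δ : C →ₗ[F] X}
    (h : ¬ ∀ c ∈ B, δ c ∈ A) : ∃ φ, Xi φ A B ∧ chi φ δ ≠ 1 := by
  push Not at h
  obtain ⟨c, hc, ha⟩ := h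
  obtain ⟨f, hf, hA⟩ := Submodule.exists_le_ker_of_notMem ha
  have hxi : Xi (f.smulRight c) A B := by
    constructor
    · intro a h1
      have : f a = 0 := hA h1
      simp [this]
    · rintro _ ⟨a, rfl⟩
      exact B.smul_mem _ hc
  have h2 : LinearMap.trace F C (f.smulRight c ∘ₗ δ) ≠ 0 := by
    have : f.smulRight c ∘ₗ δ = (f ∘ₗ δ).smulRight c := by ext; simp
    rw [this, trace_smulRight']; exact hf
  obtain ⟨s, -, hs⟩ := exists_chi_smul_ne_one h2
  exact ⟨_, hxi.smul s, hs⟩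

/-! ### The model and the Fourier transform -/

variable (F X C) in
/-- The functions of a linear map `X → C`, a subspace of `X` and a subspace of `C`. -/
abbrev Model : Type _ := (X →ₗ[F] C) → Submodule F X → Submodule F C → ℂ

open Classical in
/-- The indicator function of `Xi`. -/
def xiInd (φ : X →ₗ[F] C) (A : Submodule F X) (B : Submodule F C) : ℂ := if Xi φ A B then 1 else 0

/-- The Fourier transform. -/
def fourier : Model F X C →ₗ[ℂ] (Submodule F (X × C) → ℂ) where
  toFun f u := ∑ φ, xiInd φ (lo u) (hi u) * chi φ (psi u) * f φ (lo u) (hi u)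
  map_add' f g := by
    ext u; simp only [Pi.add_apply, mul_add, Finset.sum_add_distrib]
  map_smul' c f := by
    ext u; simp only [Pi.smul_apply, smul_eq_mul, Finset.mul_sum, RingHom.id_apply]
    exact Finset.sum_congr rfl fun _ _ => by ring

theorem fourier_apply (f : Model F X C) (u : Submodule F (X × C)) : fourier f u =
    ∑ φ, xiInd φ (lo u) (hi u) * chi φ (psi u) * f φ (lo u) (hi u) := rfl

/-- The chosen section `psi` may be replaced by any other, since the characters in the sum see it
only on `B` and modulo `A`. -/
theorem fourier_mkSub (f : Model F X C) (A : Submodule F X) (B : Submodule F C)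
    (ψ : C →ₗ[F] X) : fourier f (mkSub A B ψ) = ∑ φ, xiInd φ A B * chi φ ψ * f φ A B := by
  rw [fourier_apply]
  refine Finset.sum_congr rfl fun φ _ => ?_
  have h := eq_mkSub_psi (mkSub A B ψ)
  rw [lo_mkSub, hi_mkSub] at h ⊢
  unfold xiInd
  split_ifs with hx
  · rw [hx.chi_eq_of_mkSub_eq h]
  · simp

open Classical in
-- Orthogonality of characters: translation of the fibre by some `δ` with `chi θ δ ≠ 1` permutes it
-- and multiplies the sum by a factor other than one.
theorem sum_chi_fiber_eq_zero {θ : X →ₗ[F] C} {A : Submodule F X} {B : Submodule F C}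
    (hθ : Xi θ A B) (h0 : θ ≠ 0) :
    ∑ u ∈ Finset.univ.filter (fun u : Submodule F (X × C) => lo u = A ∧ hi u = B),
      chi θ (psi u) = 0 := by
  obtain ⟨δ, hδ⟩ := exists_chi_ne_one_of_ne_zero h0
  set S := Finset.univ.filter (fun u : Submodule F (X × C) => lo u = A ∧ hi u = B)
  have hS : ∀ u ∈ S, u = mkSub A B (psi u) := by
    intro u hu
    obtain ⟨-, h1, h2⟩ := Finset.mem_filter.1 hu
    rw [← h1, ← h2]; exact eq_mkSub_psi u
  have hmk : ∀ ψ, mkSub A B ψ ∈ S := fun ψ =>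
    Finset.mem_filter.2 ⟨Finset.mem_univ _, lo_mkSub _ _ _, hi_mkSub _ _ _⟩
  have hpsi : ∀ ψ, chi θ (psi (mkSub A B ψ)) = chi θ ψ := fun ψ =>
    (hθ.chi_eq_of_mkSub_eq (hS _ (hmk ψ))).symm
  have key : ∑ u ∈ S, chi θ (psi u) = ∑ u ∈ S, chi θ (psi u) * chi θ δ := by
    refine Finset.sum_nbij' (fun u => mkSub A B (psi u - δ)) (fun u => mkSub A B (psi u + δ))
      (fun u _ => hmk _) (fun u _ => hmk _) ?_ ?_ ?_
    · intro u hu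
      conv_rhs => rw [hS u hu]
      have h1 := mkSub_eq_iff.1 (hS _ (hmk (psi u - δ)))
      rw [mkSub_eq_iff]
      intro c hc
      have := A.neg_mem (h1 c hc)
      simp only [LinearMap.sub_apply, LinearMap.add_apply, neg_sub] at this ⊢
      convert this using 1; abel
    · intro u hu
      conv_rhs => rw [hS u hu]
      have h1 := mkSub_eq_iff.1 (hS _ (hmk (psi u + δ)))
      rw [mkSub_eq_iff]
      intro c hc
      have := A.neg_mem (h1 c hc)
      simp only [LinearMap.sub_apply, LinearMap.add_apply, neg_sub] at this ⊢
      convert this using 1; abel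
    · intro u hu
      rw [hpsi, ← chi_add_right, sub_add_cancel]
  rw [← Finset.sum_mul] at key
  have : (∑ u ∈ S, chi θ (psi u)) * (1 - chi θ δ) = 0 := by linear_combination key
  rcases mul_eq_zero.1 this with h | h
  · exact h
  · exact absurd (by linear_combination -h) hδ

open Classical in
-- The fibre is in bijection with `Hom(B, X/A)`; surjectivity comes from lifting through `X → X/A`
-- and extending from `B` to `C`.
theorem card_fiber (A : Submodule F X) (B : Submodule F C) :
    (Finset.univ.filter fun u : Submodule F (X × C) => lo u = A ∧ hi u = B).card =
      Fintype.card F ^ ((finrank F X - finrank F A) * finrank F B) := by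
  have : FiniteDimensional F X := finite_dimensional_of_finite
  have : FiniteDimensional F C := finite_dimensional_of_finite
  have hfin : Finite (X ⧸ A) := Finite.of_surjective _ A.mkQ_surjective
  let κ : (C →ₗ[F] X) → (B →ₗ[F] X ⧸ A) := fun ψ => (A.mkQ ∘ₗ ψ) ∘ₗ B.subtype
  have hκ : ∀ ψ ψ', κ ψ = κ ψ' ↔ mkSub A B ψ = mkSub A B ψ' := by
    intro ψ ψ'
    rw [mkSub_eq_iff]
    constructor
    · intro h c hc
      have := LinearMap.congr_fun h ⟨c, hc⟩
      exact (Submodule.Quotient.eq A).1 this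
    · intro h
      ext c
      exact (Submodule.Quotient.eq A).2 (h c.1 c.2)
  have hsurj : Function.Surjective κ := by
    intro g
    obtain ⟨s, hs⟩ := A.mkQ.exists_rightInverse_of_surjective (Submodule.range_mkQ A)
    obtain ⟨ψ, hψ⟩ := LinearMap.exists_extend (s ∘ₗ g)
    refine ⟨ψ, ?_⟩
    change (A.mkQ ∘ₗ ψ) ∘ₗ B.subtype = g
    rw [LinearMap.comp_assoc, hψ, ← LinearMap.comp_assoc, hs, LinearMap.id_comp]
  have : Finite (B →ₗ[F] X ⧸ A) := DFunLike.finite _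
  have := Fintype.ofFinite (B →ₗ[F] X ⧸ A)
  have hcard : Fintype.card (B →ₗ[F] X ⧸ A) =
      Fintype.card F ^ ((finrank F X - finrank F A) * finrank F B) := by
    rw [Module.card_eq_pow_finrank (K := F), Module.finrank_linearMap, ← A.finrank_quotient,
      mul_comm]
  rw [← hcard, ← Finset.card_univ]
  refine Finset.card_bij (fun u _ => κ (psi u)) (fun _ _ => Finset.mem_univ _) ?_ ?_
  · intro u hu v hv h
    obtain ⟨-, h1, h2⟩ := Finset.mem_filter.1 hu
    obtain ⟨-, h3, h4⟩ := Finset.mem_filter.1 hv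
    rw [hκ] at h
    rw [eq_mkSub_psi u, eq_mkSub_psi v, h1, h2, h3, h4, h]
  · intro g _
    obtain ⟨ψ, rfl⟩ := hsurj g
    refine ⟨mkSub A B ψ, Finset.mem_filter.2 ⟨Finset.mem_univ _, lo_mkSub _ _ _,
      hi_mkSub _ _ _⟩, ?_⟩
    rw [hκ]
    have h := eq_mkSub_psi (mkSub A B ψ)
    rw [lo_mkSub, hi_mkSub] at h
    exact h.symm

/-- The weight of a pair of subspaces: the number of subspaces of `X × C` lying over it. -/
def wt (A : Submodule F X) (B : Submodule F C) : ℂ :=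
  order F ^ ((finrank F X - finrank F A) * finrank F B)

theorem wt_ne_zero (A : Submodule F X) (B : Submodule F C) : wt A B ≠ 0 :=
  pow_ne_zero _ order_ne_zero

/-- The bilinear form on the model that corresponds to the dot product. -/
def pairing (f g : Model F X C) : ℂ :=
  ∑ A, ∑ B, ∑ φ, wt A B * xiInd φ A B * f φ A B * g (-φ) A B

/-- Plancherel. On each fibre the product of the characters of `φ` and `φ'` sums to zero unless `φ'
= -φ`. The form is bilinear, without conjugation, which is why `pairing` contains `-φ`. -/
theorem sum_fourier_mul_fourier (f g : Model F X C) :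
    ∑ u, fourier f u * fourier g u = pairing f g := by
  classical
  have h1 : ∑ u, fourier f u * fourier g u = ∑ A, ∑ B,
      ∑ u ∈ Finset.univ.filter (fun u : Submodule F (X × C) => lo u = A ∧ hi u = B),
        fourier f u * fourier g u := by
    rw [← Finset.sum_fiberwise_of_maps_to (s := Finset.univ) (t := Finset.univ)
      (g := fun u => lo u) (fun _ _ => Finset.mem_univ _)]
    refine Finset.sum_congr rfl fun A _ => ?_
    rw [← Finset.sum_fiberwise_of_maps_to (s := Finset.univ.filter fun u => lo u = A)
      (t := Finset.univ) (g := fun u => hi u) (fun _ _ => Finset.mem_univ _)]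
    refine Finset.sum_congr rfl fun B _ => ?_
    rw [Finset.filter_filter]
  rw [h1, pairing]
  refine Finset.sum_congr rfl fun A _ => Finset.sum_congr rfl fun B _ => ?_
  have h2 : ∀ u ∈ Finset.univ.filter (fun u : Submodule F (X × C) => lo u = A ∧ hi u = B),
      fourier f u * fourier g u = ∑ φ, ∑ φ', xiInd φ A B * xiInd φ' A B * f φ A B * g φ' A B *
        chi (φ + φ') (psi u) := by
    intro u hu
    obtain ⟨-, h1, h2⟩ := Finset.mem_filter.1 hu
    rw [fourier_apply, fourier_apply, h1, h2, Finset.sum_mul_sum]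
    refine Finset.sum_congr rfl fun φ _ => Finset.sum_congr rfl fun φ' _ => ?_
    rw [chi_add_left]; ring
  rw [Finset.sum_congr rfl h2, Finset.sum_comm]
  refine Finset.sum_congr rfl fun φ _ => ?_
  rw [Finset.sum_comm, Finset.sum_eq_single (-φ)]
  · simp only [add_neg_cancel, chi_zero_left, mul_one, Finset.sum_const, card_fiber, nsmul_eq_mul]
    have : xiInd φ A B * xiInd (-φ) A B = xiInd φ A B := by
      unfold xiInd
      split_ifs with h h'
      · simp
      · exact absurd h.neg h'
      · simp
      · simp
    rw [this, wt, order]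
    push_cast; ring
  · intro φ' _ hne
    rw [← Finset.mul_sum]
    by_cases hx : Xi φ A B ∧ Xi φ' A B
    · rw [sum_chi_fiber_eq_zero (hx.1.add hx.2), mul_zero]
      intro h; apply hne; rw [eq_neg_iff_add_eq_zero, add_comm]; exact h
    · have : xiInd φ A B * xiInd φ' A B = 0 := by
        unfold xiInd; split_ifs <;> simp_all
      rw [this]; ring
  · simp

/-- The functions of the model supported on `Xi`. -/
def Supported (f : Model F X C) : Prop := ∀ φ A B, f φ A B ≠ 0 → Xi φ A B

/-- Pairing with the indicator function of the point `(-φ, A, B)` returns a nonzero multiple of `f φ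
A B`. -/
theorem Supported.eq_zero_of_fourier {f : Model F X C} (hf : Supported f) (h : fourier f = 0) :
    f = 0 := by
  classical
  ext φ A B
  by_contra hne
  let g : Model F X C := fun φ' A' B' => if φ' = -φ ∧ A' = A ∧ B' = B then 1 else 0
  have h1 := sum_fourier_mul_fourier f g
  rw [h] at h1
  simp only [Pi.zero_apply, zero_mul, Finset.sum_const_zero] at h1
  rw [pairing, Finset.sum_eq_single A, Finset.sum_eq_single B, Finset.sum_eq_single φ] at h1
  · have hx : xiInd φ A B = 1 := if_pos (hf _ _ _ hne)
    simp only [g, hx, and_self, if_true, mul_one] at h1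
    exact mul_ne_zero (wt_ne_zero A B) hne h1.symm
  · intro φ' _ h'; simp [g, h']
  · simp
  · intro B' _ h'; simp [g, h']
  · simp
  · intro A' _ h'; simp [g, h']
  · simp

/-- Fourier inversion. By linearity it is enough to reach the indicator function of one subspace,
which is the average over its fibre's characters; at any other point of the fibre this average
vanishes by `exists_xi_chi_ne_one`. -/
theorem exists_fourier_eq (h : Submodule F (X × C) → ℂ) :
    ∃ f : Model F X C, Supported f ∧ fourier f = h := by
  classical
  have hdelta : ∀ u₀ : Submodule F (X × C), ∃ f : Model F X C, Supported f ∧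
      fourier f = Pi.single u₀ 1 := by
    intro u₀
    set A := lo u₀
    set B := hi u₀
    set N := (Finset.univ.filter fun φ : X →ₗ[F] C => Xi φ A B).card
    have hN : (N : ℂ) ≠ 0 := by
      rw [Nat.cast_ne_zero, ← Nat.pos_iff_ne_zero, Finset.card_pos]
      exact ⟨0, by simp [Xi.zero]⟩
    refine ⟨fun φ A' B' => if A' = A ∧ B' = B then (N : ℂ)⁻¹ * xiInd φ A B * chi φ (-psi u₀)
      else 0, ?_, ?_⟩
    · intro φ A' B' h1
      by_cases h2 : A' = A ∧ B' = B
      · obtain ⟨rfl, rfl⟩ := h2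
        by_contra h3
        apply h1
        simp [xiInd, h3]
      · simp [h2] at h1
    · ext u
      rw [fourier_apply]
      by_cases hu : lo u = A ∧ hi u = B
      swap
      · rw [Pi.single_eq_of_ne]
        · simp [hu]
        · rintro rfl; exact hu ⟨rfl, rfl⟩
      rw [hu.1, hu.2]
      have e : ∀ φ, xiInd φ A B * chi φ (psi u) * (if A = A ∧ B = B then
          (N : ℂ)⁻¹ * xiInd φ A B * chi φ (-psi u₀) else 0) =
          (N : ℂ)⁻¹ * (if Xi φ A B then chi φ (psi u - psi u₀) else 0) := by
        intro φ
        rw [sub_eq_add_neg, chi_add_right]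
        unfold xiInd
        split_ifs <;> simp_all
        ring
      rw [Finset.sum_congr rfl fun φ _ => e φ, ← Finset.mul_sum, ← Finset.sum_filter]
      have hmk : u = u₀ ↔ ∀ c ∈ B, (psi u - psi u₀) c ∈ A := by
        rw [← mkSub_eq_iff, ← eq_mkSub_psi u₀]
        conv_lhs => rw [eq_mkSub_psi u, hu.1, hu.2]
      by_cases huu : u = u₀
      · rw [huu, Pi.single_eq_same, sub_self]
        simp only [chi_zero_right, Finset.sum_const, nsmul_eq_mul, mul_one]
        exact inv_mul_cancel₀ hN
      · rw [Pi.single_eq_of_ne huu]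
        obtain ⟨φ₀, hφ₀, hne⟩ := exists_xi_chi_ne_one (fun h => huu (hmk.2 h))
        set S := Finset.univ.filter fun φ : X →ₗ[F] C => Xi φ A B
        have key : ∑ φ ∈ S, chi φ (psi u - psi u₀) =
            ∑ φ ∈ S, chi φ (psi u - psi u₀) * chi φ₀ (psi u - psi u₀) := by
          refine Finset.sum_nbij' (fun φ => φ - φ₀) (fun φ => φ + φ₀) ?_ ?_ ?_ ?_ ?_
          · intro φ hφ
            simp only [S, Finset.mem_filter, Finset.mem_univ, true_and] at hφ ⊢
            rw [sub_eq_add_neg]; exact hφ.add hφ₀.neg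
          · intro φ hφ
            simp only [S, Finset.mem_filter, Finset.mem_univ, true_and] at hφ ⊢
            exact hφ.add hφ₀
          · intro φ _; simp
          · intro φ _; simp
          · intro φ _; rw [← chi_add_left, sub_add_cancel]
        rw [← Finset.sum_mul] at key
        have h0 : (∑ φ ∈ S, chi φ (psi u - psi u₀)) * (1 - chi φ₀ (psi u - psi u₀)) = 0 := by
          linear_combination key
        rcases mul_eq_zero.1 h0 with h | h
        · rw [h, mul_zero]
        · exact absurd (by linear_combination -h) hne
  choose f hf hf' using hdelta
  refine ⟨∑ u, h u • f u, ?_, ?_⟩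
  · intro φ A B hne
    by_contra hx
    apply hne
    rw [Finset.sum_apply, Finset.sum_apply, Finset.sum_apply]
    refine Finset.sum_eq_zero fun u _ => ?_
    have : f u φ A B = 0 := by by_contra h1; exact hx (hf u φ A B h1)
    simp [this]
  · rw [map_sum]
    ext v
    rw [Finset.sum_apply, Finset.sum_eq_single v]
    · rw [map_smul, hf']; simp
    · intro u _ hne
      rw [map_smul, hf']; simp [Pi.single_eq_of_ne hne.symm]
    · simp

end Product

end

end TwistedGrassmann

namespace TwistedGrassmann

noncomputable section

set_option linter.unusedSectionVars false

open Module

section ModelOperators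

variable {F : Type*} [Field F] [Fintype F] {X : Type*} [AddCommGroup X] [Module F X] [Finite X]
  {C : Type*} [AddCommGroup C] [Module F C] [Finite C]

/-! ### Operators on the model -/

/-- The first lowering operator on the model. -/
def l1 : Model F X C →ₗ[ℂ] Model F X C where
  toFun f φ A B := ∑ A', covInd ⊥ (LinearMap.ker φ) A A' * f φ A' B
  map_add' f g := by
    ext φ A B; simp only [Pi.add_apply, mul_add, Finset.sum_add_distrib]
  map_smul' c f := by
    ext φ A B; simp only [Pi.smul_apply, smul_eq_mul, Finset.mul_sum, RingHom.id_apply]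
    exact Finset.sum_congr rfl fun _ _ => by ring

/-- The first raising operator on the model. -/
def r1 : Model F X C →ₗ[ℂ] Model F X C where
  toFun f φ A B := order F ^ finrank F B * ∑ A', covInd ⊥ (LinearMap.ker φ) A' A * f φ A' B
  map_add' f g := by
    ext φ A B; simp only [Pi.add_apply, mul_add, Finset.sum_add_distrib]
  map_smul' c f := by
    ext φ A B; simp only [Pi.smul_apply, smul_eq_mul, Finset.mul_sum, RingHom.id_apply]
    exact Finset.sum_congr rfl fun _ _ => by ring

/-- The second lowering operator on the model. -/
def l2 : Model F X C →ₗ[ℂ] Model F X C where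
  toFun f φ A B := order F ^ (finrank F X - finrank F A) *
    ∑ B', covInd (LinearMap.range φ) ⊤ B B' * f φ A B'
  map_add' f g := by
    ext φ A B; simp only [Pi.add_apply, mul_add, Finset.sum_add_distrib]
  map_smul' c f := by
    ext φ A B; simp only [Pi.smul_apply, smul_eq_mul, Finset.mul_sum, RingHom.id_apply]
    exact Finset.sum_congr rfl fun _ _ => by ring

/-- The second raising operator on the model. -/
def r2 : Model F X C →ₗ[ℂ] Model F X C where
  toFun f φ A B := ∑ B', covInd (LinearMap.range φ) ⊤ B' B * f φ A B'
  map_add' f g := by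
    ext φ A B; simp only [Pi.add_apply, mul_add, Finset.sum_add_distrib]
  map_smul' c f := by
    ext φ A B; simp only [Pi.smul_apply, smul_eq_mul, Finset.mul_sum, RingHom.id_apply]
    exact Finset.sum_congr rfl fun _ _ => by ring

theorem l1_apply (f : Model F X C) (φ A B) :
    l1 f φ A B = ∑ A', covInd ⊥ (LinearMap.ker φ) A A' * f φ A' B := rfl

theorem r1_apply (f : Model F X C) (φ A B) :
    r1 f φ A B = order F ^ finrank F B * ∑ A', covInd ⊥ (LinearMap.ker φ) A' A * f φ A' B := rfl

theorem l2_apply (f : Model F X C) (φ A B) : l2 f φ A B =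
    order F ^ (finrank F X - finrank F A) *
      ∑ B', covInd (LinearMap.range φ) ⊤ B B' * f φ A B' := rfl

theorem r2_apply (f : Model F X C) (φ A B) :
    r2 f φ A B = ∑ B', covInd (LinearMap.range φ) ⊤ B' B * f φ A B' := rfl

theorem covInd_ne_zero {E : Type*} [AddCommGroup E] [Module F E] [Finite E]
    {P Q A B : Submodule F E} (h : covInd P Q A B ≠ 0) : Cov A B ∧ P ≤ A ∧ B ≤ Q := by
  unfold covInd at h; by_contra h'; rw [if_neg h'] at h; exact h rfl

theorem finrank_le_whole {E : Type*} [AddCommGroup E] [Module F E] [Finite E]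
    (A : Submodule F E) : finrank F A ≤ finrank F E := by
  have : FiniteDimensional F E := finite_dimensional_of_finite
  exact Submodule.finrank_le A

/-- The first pair of operators moves only `A`, the second only `B`. All mixed relations are thus
commutations up to a power of `q`, caused by the weights `q^{dim B}` in `r1` and `q^{dim X - dim A}`
in `l2`. -/
theorem r1_r2 (f : Model F X C) : r1 (r2 f) = order F • r2 (r1 f) := by
  ext φ A B
  simp only [Pi.smul_apply, smul_eq_mul, r1_apply, r2_apply, Finset.mul_sum]
  rw [Finset.sum_comm]
  refine Finset.sum_congr rfl fun B' _ => Finset.sum_congr rfl fun A' _ => ?_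
  by_cases h : covInd (LinearMap.range φ) ⊤ B' B = 0
  · simp [h]
  · rw [(covInd_ne_zero h).1.2, pow_succ]; ring

theorem l1_r2 (f : Model F X C) : l1 (r2 f) = r2 (l1 f) := by
  ext φ A B
  simp only [l1_apply, r2_apply, Finset.mul_sum]
  rw [Finset.sum_comm]
  exact Finset.sum_congr rfl fun B' _ => Finset.sum_congr rfl fun A' _ => by ring

/-- Each operator shifts the weight of the other by one factor `q`, and these two shifts balance. -/
theorem l2_r1 (f : Model F X C) : l2 (r1 f) = r1 (l2 f) := by
  ext φ A B
  simp only [l2_apply, r1_apply, Finset.mul_sum]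
  rw [Finset.sum_comm]
  refine Finset.sum_congr rfl fun A' _ => Finset.sum_congr rfl fun B' _ => ?_
  by_cases h : covInd (LinearMap.range φ) ⊤ B B' = 0
  · simp [h]
  by_cases h' : covInd ⊥ (LinearMap.ker φ) A' A = 0
  · simp [h']
  have h1 := (covInd_ne_zero h).1.2
  have h2 := (covInd_ne_zero h').1.2
  have h3 := finrank_le_whole A
  rw [h1, show finrank F X - finrank F A' = finrank F X - finrank F A + 1 by omega,
    pow_succ, pow_succ]
  ring

theorem l2_l1 (f : Model F X C) : l2 (l1 f) = order F • l1 (l2 f) := by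
  ext φ A B
  simp only [Pi.smul_apply, smul_eq_mul, l2_apply, l1_apply, Finset.mul_sum]
  rw [Finset.sum_comm]
  refine Finset.sum_congr rfl fun A' _ => Finset.sum_congr rfl fun B' _ => ?_
  by_cases h : covInd ⊥ (LinearMap.ker φ) A A' = 0
  · simp [h]
  have h2 := (covInd_ne_zero h).1.2
  have h3 := finrank_le_whole A'
  rw [show finrank F X - finrank F A = finrank F X - finrank F A' + 1 by omega, pow_succ]
  ring

/-- For fixed `φ` and `B` this is `dn_up_sub_up_dn` in the interval `[⊥, ker φ]`, whose top
dimension is given by rank-nullity. The companion `l2_r2_sub` uses `[range φ, ⊤]` instead. -/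
theorem l1_r1_sub (f : Model F X C) (hf : Supported f) (φ A B) :
    l1 (r1 f) φ A B - r1 (l1 f) φ A B = order F ^ finrank F B *
      (gauss1 (order F) ((finrank F X : ℤ) - finrank F (LinearMap.range φ) - finrank F A) -
        gauss1 (order F) (finrank F A)) * f φ A B := by
  have : FiniteDimensional F X := finite_dimensional_of_finite
  have h := dn_up_sub_up_dn (P := ⊥) (Q := LinearMap.ker φ) (f := fun A' => f φ A' B) (A := A)
    (fun A' h => ⟨bot_le, (hf _ _ _ h).1⟩)
  have h2 := φ.finrank_range_add_finrank_ker
  rw [show ((finrank F X : ℤ) - finrank F (LinearMap.range φ) - finrank F A) =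
    (finrank F (LinearMap.ker φ) : ℤ) - finrank F A by omega]
  simp only [finrank_bot, Nat.cast_zero, sub_zero, dn, up] at h
  rw [mul_assoc, ← h]
  simp only [l1_apply, r1_apply, Finset.mul_sum, mul_sub]
  congr 1
  exact Finset.sum_congr rfl fun _ _ => Finset.sum_congr rfl fun _ _ => by ring

theorem l2_r2_sub (f : Model F X C) (hf : Supported f) (φ A B) :
    l2 (r2 f) φ A B - r2 (l2 f) φ A B = order F ^ (finrank F X - finrank F A) *
      (gauss1 (order F) ((finrank F C : ℤ) - finrank F B) -
        gauss1 (order F) ((finrank F B : ℤ) - finrank F (LinearMap.range φ))) * f φ A B := by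
  have h := dn_up_sub_up_dn (P := LinearMap.range φ) (Q := ⊤) (f := f φ A) (A := B)
    (fun B' h => ⟨(hf _ _ _ h).2, le_top⟩)
  simp only [finrank_top, dn, up] at h
  rw [mul_assoc, ← h]
  simp only [l2_apply, r2_apply, Finset.mul_sum, mul_sub]
  congr 1
  exact Finset.sum_congr rfl fun _ _ => Finset.sum_congr rfl fun _ _ => by ring

variable (F X C) in
/-- The functions of the model supported on `Xi` and on given dimensions. -/
def lev (i j : ℤ) : Submodule ℂ (Model F X C) where
  carrier := {f | ∀ φ A B, f φ A B ≠ 0 → Xi φ A B ∧ (finrank F A : ℤ) = i ∧ (finrank F B : ℤ) = j}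
  add_mem' := by
    intro f g hf hg φ A B h
    by_cases h1 : f φ A B = 0
    · exact hg φ A B (by simpa [h1] using h)
    · exact hf φ A B h1
  zero_mem' := by intro φ A B h; simp at h
  smul_mem' := by
    intro c f hf φ A B h
    exact hf φ A B (by intro h1; simp [h1] at h)

variable (F X C) in
/-- The functions of the model supported on the linear maps of given rank. -/
def rk (ρ : ℤ) : Submodule ℂ (Model F X C) where
  carrier := {f | ∀ φ A B, f φ A B ≠ 0 → (finrank F (LinearMap.range φ) : ℤ) = ρ}
  add_mem' := by
    intro f g hf hg φ A B h
    by_cases h1 : f φ A B = 0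
    · exact hg φ A B (by simpa [h1] using h)
    · exact hf φ A B h1
  zero_mem' := by intro φ A B h; simp at h
  smul_mem' := by
    intro c f hf φ A B h
    exact hf φ A B (by intro h1; simp [h1] at h)

theorem supported_of_mem_lev {i j : ℤ} {f : Model F X C} (h : f ∈ lev F X C i j) :
    Supported f := fun φ A B hne => (h φ A B hne).1

theorem l1_mem_lev {i j : ℤ} {f : Model F X C} (hf : f ∈ lev F X C i j) :
    l1 f ∈ lev F X C (i - 1) j := by
  intro φ A B h
  rw [l1_apply] at h
  obtain ⟨A', -, h'⟩ := Finset.exists_ne_zero_of_sum_ne_zero h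
  have h1 := covInd_ne_zero (left_ne_zero_of_mul h')
  obtain ⟨h2, h3, h4⟩ := hf _ _ _ (right_ne_zero_of_mul h')
  have := h1.1.2
  exact ⟨⟨h1.1.1.trans h2.1, h2.2⟩, by omega, h4⟩

theorem r1_mem_lev {i j : ℤ} {f : Model F X C} (hf : f ∈ lev F X C i j) :
    r1 f ∈ lev F X C (i + 1) j := by
  intro φ A B h
  rw [r1_apply] at h
  obtain ⟨A', -, h'⟩ := Finset.exists_ne_zero_of_sum_ne_zero (right_ne_zero_of_mul h)
  have h1 := covInd_ne_zero (left_ne_zero_of_mul h')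
  obtain ⟨h2, h3, h4⟩ := hf _ _ _ (right_ne_zero_of_mul h')
  have := h1.1.2
  exact ⟨⟨h1.2.2, h2.2⟩, by omega, h4⟩

theorem l2_mem_lev {i j : ℤ} {f : Model F X C} (hf : f ∈ lev F X C i j) :
    l2 f ∈ lev F X C i (j - 1) := by
  intro φ A B h
  rw [l2_apply] at h
  obtain ⟨A', -, h'⟩ := Finset.exists_ne_zero_of_sum_ne_zero (right_ne_zero_of_mul h)
  have h1 := covInd_ne_zero (left_ne_zero_of_mul h')
  obtain ⟨h2, h3, h4⟩ := hf _ _ _ (right_ne_zero_of_mul h')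
  have := h1.1.2
  exact ⟨⟨h2.1, h1.2.1⟩, h3, by omega⟩

theorem r2_mem_lev {i j : ℤ} {f : Model F X C} (hf : f ∈ lev F X C i j) :
    r2 f ∈ lev F X C i (j + 1) := by
  intro φ A B h
  rw [r2_apply] at h
  obtain ⟨A', -, h'⟩ := Finset.exists_ne_zero_of_sum_ne_zero h
  have h1 := covInd_ne_zero (left_ne_zero_of_mul h')
  obtain ⟨h2, h3, h4⟩ := hf _ _ _ (right_ne_zero_of_mul h')
  have := h1.1.2
  exact ⟨⟨h2.1, h2.2.trans h1.1.1⟩, h3, by omega⟩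

theorem l1_mem_rk {ρ : ℤ} {f : Model F X C} (hf : f ∈ rk F X C ρ) : l1 f ∈ rk F X C ρ := by
  intro φ A B h
  rw [l1_apply] at h
  obtain ⟨A', -, h'⟩ := Finset.exists_ne_zero_of_sum_ne_zero h
  exact hf _ _ _ (right_ne_zero_of_mul h')

theorem r1_mem_rk {ρ : ℤ} {f : Model F X C} (hf : f ∈ rk F X C ρ) : r1 f ∈ rk F X C ρ := by
  intro φ A B h
  rw [r1_apply] at h
  obtain ⟨A', -, h'⟩ := Finset.exists_ne_zero_of_sum_ne_zero (right_ne_zero_of_mul h)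
  exact hf _ _ _ (right_ne_zero_of_mul h')

theorem l2_mem_rk {ρ : ℤ} {f : Model F X C} (hf : f ∈ rk F X C ρ) : l2 f ∈ rk F X C ρ := by
  intro φ A B h
  rw [l2_apply] at h
  obtain ⟨A', -, h'⟩ := Finset.exists_ne_zero_of_sum_ne_zero (right_ne_zero_of_mul h)
  exact hf _ _ _ (right_ne_zero_of_mul h')

theorem r2_mem_rk {ρ : ℤ} {f : Model F X C} (hf : f ∈ rk F X C ρ) : r2 f ∈ rk F X C ρ := by
  intro φ A B h
  rw [r2_apply] at h
  obtain ⟨A', -, h'⟩ := Finset.exists_ne_zero_of_sum_ne_zero h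
  exact hf _ _ _ (right_ne_zero_of_mul h')

theorem eq_zero_of_mem_lev {i j : ℤ} {f : Model F X C} (hf : f ∈ lev F X C i j)
    (h : i < 0 ∨ j < 0 ∨ finrank F X < i ∨ finrank F C < j) : f = 0 := by
  ext φ A B
  by_contra hne
  obtain ⟨-, h1, h2⟩ := hf φ A B hne
  have := finrank_le_whole A
  have := finrank_le_whole B
  omega

theorem l1_r1_of_mem {i j ρ : ℤ} {f : Model F X C} (hf : f ∈ lev F X C i j)
    (hr : f ∈ rk F X C ρ) : l1 (r1 f) = r1 (l1 f) + (order F ^ j *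
      (gauss1 (order F) ((finrank F X : ℤ) - ρ - i) - gauss1 (order F) i)) • f := by
  ext φ A B
  have h := l1_r1_sub f (supported_of_mem_lev hf) φ A B
  rw [sub_eq_iff_eq_add'] at h
  rw [h]
  simp only [Pi.add_apply, Pi.smul_apply, smul_eq_mul]
  congr 1
  by_cases h0 : f φ A B = 0
  · simp [h0]
  obtain ⟨-, h1, h2⟩ := hf φ A B h0
  have h3 := hr φ A B h0
  rw [← zpow_natCast, h1, h2, h3]

theorem l2_r2_of_mem {i j ρ : ℤ} {f : Model F X C} (hf : f ∈ lev F X C i j)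
    (hr : f ∈ rk F X C ρ) : l2 (r2 f) = r2 (l2 f) + (order F ^ ((finrank F X : ℤ) - i) *
      (gauss1 (order F) ((finrank F C : ℤ) - j) - gauss1 (order F) (j - ρ))) • f := by
  ext φ A B
  have h := l2_r2_sub f (supported_of_mem_lev hf) φ A B
  rw [sub_eq_iff_eq_add'] at h
  rw [h]
  simp only [Pi.add_apply, Pi.smul_apply, smul_eq_mul]
  congr 1
  by_cases h0 : f φ A B = 0
  · simp [h0]
  obtain ⟨-, h1, h2⟩ := hf φ A B h0
  have h3 := hr φ A B h0
  rw [← zpow_natCast, Nat.cast_sub (finrank_le_whole A), h1, h2, h3]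

/-! ### Intertwining properties of the Fourier transform -/

/-- Summation over the predecessors of an element in a relation. -/
def sumPred {S : Type*} [Fintype S] (c : S → S → Prop) (f : S → ℂ) (v : S) : ℂ := by
  classical exact ∑ u, if c u v then f u else 0

/-- Summation over the successors of an element in a relation. -/
def sumSucc {S : Type*} [Fintype S] (c : S → S → Prop) (f : S → ℂ) (u : S) : ℂ := by
  classical exact ∑ v, if c u v then f v else 0

/-- The two summations are transposes of each other for the dot product, so that an intertwining
property of one can be transferred to the other. -/
theorem sumPred_dot {S : Type*} [Fintype S] (c : S → S → Prop) (f g : S → ℂ) :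
    ∑ v, sumPred c f v * g v = ∑ u, f u * sumSucc c g u := by
  classical
  simp only [sumPred, sumSucc, Finset.sum_mul, Finset.mul_sum]
  rw [Finset.sum_comm]
  refine Finset.sum_congr rfl fun _ _ => Finset.sum_congr rfl fun _ _ => ?_
  split_ifs <;> simp

/-- Inclusion of codimension one with the same projection to `C`. -/
def step1 (u v : Submodule F (X × C)) : Prop :=
  u ≤ v ∧ finrank F (lo v) = finrank F (lo u) + 1 ∧ finrank F (hi v) = finrank F (hi u)

/-- Inclusion of codimension one with the same intersection with `X`. -/
def step2 (u v : Submodule F (X × C)) : Prop :=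
  u ≤ v ∧ finrank F (lo v) = finrank F (lo u) ∧ finrank F (hi v) = finrank F (hi u) + 1

/-- Enlarging `A` with `B` fixed leaves no choice for the section, which now matters only modulo a
larger space. Downwards the section can be lifted in several ways, and that sum is obtained by
transposition instead. For `step2` the easy direction is downwards, by restriction to a smaller `B`.
-/
theorem step1_mkSub_iff {A : Submodule F X} {B : Submodule F C} {ψ : C →ₗ[F] X}
    {v : Submodule F (X × C)} :
    step1 (mkSub A B ψ) v ↔ ∃ A', Cov A A' ∧ v = mkSub A' B ψ := by
  constructor
  · rintro ⟨h1, h2, h3⟩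
    rw [lo_mkSub] at h2
    rw [hi_mkSub] at h3
    have hv := eq_mkSub_psi v
    rw [hv, mkSub_le_iff] at h1
    have hB : B = hi v := eq_of_le_of_finrank_le' h1.2.1 h3.le
    refine ⟨lo v, ⟨h1.1, h2⟩, ?_⟩
    rw [hv, lo_mkSub, ← hB, eq_comm, mkSub_eq_iff]
    exact h1.2.2
  · rintro ⟨A', hA, rfl⟩
    refine ⟨mkSub_le_iff.2 ⟨hA.1, le_rfl, by simp⟩, ?_, ?_⟩
    · rw [lo_mkSub, lo_mkSub, hA.2]
    · rw [hi_mkSub, hi_mkSub]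

theorem step2_mkSub_iff {A : Submodule F X} {B : Submodule F C} {ψ : C →ₗ[F] X}
    {u : Submodule F (X × C)} :
    step2 u (mkSub A B ψ) ↔ ∃ B', Cov B' B ∧ u = mkSub A B' ψ := by
  constructor
  · rintro ⟨h1, h2, h3⟩
    rw [lo_mkSub] at h2
    rw [hi_mkSub] at h3
    have hv := eq_mkSub_psi u
    rw [hv, mkSub_le_iff] at h1
    have hA : lo u = A := eq_of_le_of_finrank_le' h1.1 h2.le
    refine ⟨hi u, ⟨h1.2.1, h3⟩, ?_⟩
    rw [hv, hi_mkSub, hA, mkSub_eq_iff]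
    exact h1.2.2
  · rintro ⟨A', hA, rfl⟩
    refine ⟨mkSub_le_iff.2 ⟨le_rfl, hA.1, by simp⟩, ?_, ?_⟩
    · rw [lo_mkSub, lo_mkSub]
    · rw [hi_mkSub, hi_mkSub, hA.2]

/-- The characters are untouched and only the constraint changes: for `A ≤ A'`, `Xi φ A' B` is `Xi φ
A B` together with `A' ≤ ker φ`, the upper bound of the interval used by `l1`. -/
theorem sumSucc_step1_fourier (f : Model F X C) : sumSucc step1 (fourier f) = fourier (l1 f) := by
  classical
  ext u
  rw [eq_mkSub_psi u]
  generalize lo u = A, hi u = B, psi u = ψ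
  have h : sumSucc step1 (fourier f) (mkSub A B ψ) =
      ∑ A', if Cov A A' then fourier f (mkSub A' B ψ) else 0 := by
    unfold sumSucc
    rw [← Finset.sum_filter, ← Finset.sum_filter]
    symm
    refine Finset.sum_nbij' (fun A' => mkSub A' B ψ) (fun v => lo v) ?_ ?_ ?_ ?_ ?_
    · intro A' hA'
      simp only [Finset.mem_filter, Finset.mem_univ, true_and] at hA' ⊢
      exact step1_mkSub_iff.2 ⟨A', hA', rfl⟩
    · intro v hv
      simp only [Finset.mem_filter, Finset.mem_univ, true_and] at hv ⊢
      obtain ⟨A', hA', rfl⟩ := step1_mkSub_iff.1 hv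
      rwa [lo_mkSub]
    · intro A' _; exact lo_mkSub _ _ _
    · intro v hv
      simp only [Finset.mem_filter, Finset.mem_univ, true_and] at hv ⊢
      obtain ⟨A', hA', rfl⟩ := step1_mkSub_iff.1 hv
      rw [lo_mkSub]
    · intro _ _; rfl
  rw [h, fourier_mkSub]
  simp only [fourier_mkSub, l1_apply, Finset.mul_sum]
  rw [Finset.sum_comm]
  refine Finset.sum_congr rfl fun A' _ => ?_
  split_ifs with hc
  · refine Finset.sum_congr rfl fun φ _ => ?_
    have : xiInd φ A' B = xiInd φ A B * covInd ⊥ (LinearMap.ker φ) A A' := by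
      have := hc.1
      unfold xiInd covInd Xi
      by_cases h1 : A' ≤ LinearMap.ker φ
      · simp [h1, hc, hc.1.trans h1]
      · simp [h1]
    rw [this]; ring
  · symm
    refine Finset.sum_eq_zero fun φ _ => ?_
    simp [covInd, hc]

theorem sumPred_step2_fourier (f : Model F X C) : sumPred step2 (fourier f) = fourier (r2 f) := by
  classical
  ext u
  rw [eq_mkSub_psi u]
  generalize lo u = A, hi u = B, psi u = ψ
  have h : sumPred step2 (fourier f) (mkSub A B ψ) =
      ∑ B', if Cov B' B then fourier f (mkSub A B' ψ) else 0 := by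
    unfold sumPred
    rw [← Finset.sum_filter, ← Finset.sum_filter]
    symm
    refine Finset.sum_nbij' (fun B' => mkSub A B' ψ) (fun v => hi v) ?_ ?_ ?_ ?_ ?_
    · intro A' hA'
      simp only [Finset.mem_filter, Finset.mem_univ, true_and] at hA' ⊢
      exact step2_mkSub_iff.2 ⟨A', hA', rfl⟩
    · intro v hv
      simp only [Finset.mem_filter, Finset.mem_univ, true_and] at hv ⊢
      obtain ⟨A', hA', rfl⟩ := step2_mkSub_iff.1 hv
      rwa [hi_mkSub]
    · intro A' _; exact hi_mkSub _ _ _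
    · intro v hv
      simp only [Finset.mem_filter, Finset.mem_univ, true_and] at hv ⊢
      obtain ⟨A', hA', rfl⟩ := step2_mkSub_iff.1 hv
      rw [hi_mkSub]
    · intro _ _; rfl
  rw [h, fourier_mkSub]
  simp only [fourier_mkSub, r2_apply, Finset.mul_sum]
  rw [Finset.sum_comm]
  refine Finset.sum_congr rfl fun B' _ => ?_
  split_ifs with hc
  · refine Finset.sum_congr rfl fun φ _ => ?_
    have : xiInd φ A B' = xiInd φ A B * covInd (LinearMap.range φ) ⊤ B' B := by
      unfold xiInd covInd Xi
      by_cases h1 : LinearMap.range φ ≤ B'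
      · simp [h1, hc, h1.trans hc.1]
      · simp [h1]
    rw [this]; ring
  · symm
    refine Finset.sum_eq_zero fun φ _ => ?_
    simp [covInd, hc]

/-- The fibre sizes over `A'` and over a cover `A` of it differ by the factor `q^{dim B}`, which is
exactly the weight built into `r1`. The weight of `l2` has the same origin. -/
theorem pairing_r1 (f g : Model F X C) : pairing (r1 f) g = pairing f (l1 g) := by
  have e1 : pairing (r1 f) g = ∑ B, ∑ φ, ∑ A, ∑ A', wt A B * xiInd φ A B *
      (order F ^ finrank F B * (covInd ⊥ (LinearMap.ker φ) A' A * f φ A' B)) * g (-φ) A B := by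
    unfold pairing
    rw [Finset.sum_comm]
    refine Finset.sum_congr rfl fun B _ => ?_
    rw [Finset.sum_comm]
    refine Finset.sum_congr rfl fun φ _ => Finset.sum_congr rfl fun A _ => ?_
    rw [r1_apply]; simp only [Finset.mul_sum, Finset.sum_mul]
  have e2 : pairing f (l1 g) = ∑ B, ∑ φ, ∑ A', ∑ A, wt A' B * xiInd φ A' B * f φ A' B *
      (covInd ⊥ (LinearMap.ker (-φ)) A' A * g (-φ) A B) := by
    unfold pairing
    rw [Finset.sum_comm]
    refine Finset.sum_congr rfl fun B _ => ?_
    rw [Finset.sum_comm]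
    refine Finset.sum_congr rfl fun φ _ => Finset.sum_congr rfl fun A _ => ?_
    rw [l1_apply]; simp only [Finset.mul_sum]
  rw [e1, e2]
  refine Finset.sum_congr rfl fun B _ => Finset.sum_congr rfl fun φ _ => ?_
  rw [Finset.sum_comm]
  refine Finset.sum_congr rfl fun A' _ => Finset.sum_congr rfl fun A _ => ?_
  have hk : LinearMap.ker (-φ) = LinearMap.ker φ := by ext; simp
  rw [hk]
  by_cases h : covInd ⊥ (LinearMap.ker φ) A' A = 0
  · simp [h]
  obtain ⟨⟨h1, h2⟩, -, h3⟩ := covInd_ne_zero h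
  have hx : xiInd φ A B = xiInd φ A' B := by
    have : Xi φ A B ↔ Xi φ A' B :=
      ⟨fun h => ⟨h1.trans h.1, h.2⟩, fun h => ⟨h3, h.2⟩⟩
    classical exact if_congr this rfl rfl
  have h4 := finrank_le_whole A
  have hw : wt A' B = wt A B * order F ^ finrank F B := by
    rw [wt, wt, ← pow_add, show finrank F X - finrank F A' = finrank F X - finrank F A + 1 by omega,
      add_one_mul]
  rw [hx, hw]; ring

theorem pairing_l2 (f g : Model F X C) : pairing (l2 f) g = pairing f (r2 g) := by
  have e1 : pairing (l2 f) g = ∑ A, ∑ φ, ∑ B, ∑ B', wt A B * xiInd φ A B *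
      (order F ^ (finrank F X - finrank F A) * (covInd (LinearMap.range φ) ⊤ B B' * f φ A B')) *
        g (-φ) A B := by
    unfold pairing
    refine Finset.sum_congr rfl fun A _ => ?_
    rw [Finset.sum_comm]
    refine Finset.sum_congr rfl fun φ _ => Finset.sum_congr rfl fun B _ => ?_
    rw [l2_apply]; simp only [Finset.mul_sum, Finset.sum_mul]
  have e2 : pairing f (r2 g) = ∑ A, ∑ φ, ∑ B', ∑ B, wt A B' * xiInd φ A B' * f φ A B' *
      (covInd (LinearMap.range (-φ)) ⊤ B B' * g (-φ) A B) := by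
    unfold pairing
    refine Finset.sum_congr rfl fun A _ => ?_
    rw [Finset.sum_comm]
    refine Finset.sum_congr rfl fun φ _ => Finset.sum_congr rfl fun B _ => ?_
    rw [r2_apply]; simp only [Finset.mul_sum]
  rw [e1, e2]
  refine Finset.sum_congr rfl fun A _ => Finset.sum_congr rfl fun φ _ => ?_
  rw [Finset.sum_comm]
  refine Finset.sum_congr rfl fun B' _ => Finset.sum_congr rfl fun B _ => ?_
  have hk : LinearMap.range (-φ) = LinearMap.range φ := LinearMap.range_neg φ
  rw [hk]
  by_cases h : covInd (LinearMap.range φ) ⊤ B B' = 0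
  · simp [h]
  obtain ⟨⟨h1, h2⟩, h3, -⟩ := covInd_ne_zero h
  have hx : xiInd φ A B = xiInd φ A B' := by
    have : Xi φ A B ↔ Xi φ A B' :=
      ⟨fun h => ⟨h.1, h.2.trans h1⟩, fun h => ⟨h.1, h3⟩⟩
    classical exact if_congr this rfl rfl
  have hw : wt A B' = wt A B * order F ^ (finrank F X - finrank F A) := by
    rw [wt, wt, ← pow_add, h2, mul_add_one]
  rw [hx, hw]; ring

theorem eq_of_forall_dot {S : Type*} [Fintype S] {f g : S → ℂ}
    (h : ∀ k : S → ℂ, ∑ u, f u * k u = ∑ u, g u * k u) : f = g := by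
  classical
  ext u
  have := h (Pi.single u 1)
  simpa [Pi.single_apply] using this

/-- By transposition: every test function is a Fourier transform, and Plancherel moves the operator
across the pairing. -/
theorem sumPred_step1_fourier (f : Model F X C) : sumPred step1 (fourier f) = fourier (r1 f) := by
  apply eq_of_forall_dot
  intro k
  obtain ⟨g, -, rfl⟩ := exists_fourier_eq k
  rw [sumPred_dot, sumSucc_step1_fourier, sum_fourier_mul_fourier, sum_fourier_mul_fourier,
    pairing_r1]

theorem sumSucc_step2_fourier (f : Model F X C) : sumSucc step2 (fourier f) = fourier (l2 f) := by
  apply eq_of_forall_dot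
  intro k
  obtain ⟨g, -, rfl⟩ := exists_fourier_eq k
  have h := sumPred_dot step2 (fourier g) (fourier f)
  simp only [mul_comm (sumSucc step2 (fourier f) _)]
  rw [← h, sumPred_step2_fourier, sum_fourier_mul_fourier]
  simp only [mul_comm (fourier (l2 f) _)]
  rw [sum_fourier_mul_fourier]
  have hsymm : ∀ f g : Model F X C, pairing f g = pairing g f := by
    intro f g
    rw [← sum_fourier_mul_fourier, ← sum_fourier_mul_fourier]
    exact Finset.sum_congr rfl fun _ _ => mul_comm _ _
  rw [hsymm, ← pairing_l2, hsymm]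

theorem fourier_apply_ne_zero {i j : ℤ} {f : Model F X C} (hf : f ∈ lev F X C i j)
    {u : Submodule F (X × C)} (hu : fourier f u ≠ 0) :
    (finrank F (lo u) : ℤ) = i ∧ (finrank F (hi u) : ℤ) = j := by
  rw [fourier_apply] at hu
  obtain ⟨φ, -, h⟩ := Finset.exists_ne_zero_of_sum_ne_zero hu
  exact (hf _ _ _ (right_ne_zero_of_mul h)).2

theorem exists_fourier_eq_of_lev {i j : ℤ} {h : Submodule F (X × C) → ℂ}
    (hh : ∀ u, h u ≠ 0 → (finrank F (lo u) : ℤ) = i ∧ (finrank F (hi u) : ℤ) = j) :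
    ∃ f ∈ lev F X C i j, fourier f = h := by
  classical
  obtain ⟨f, hf, rfl⟩ := exists_fourier_eq h
  -- Truncation does not change the transform, since the value of `fourier f` at `u` only involves
  -- the pair `(lo u, hi u)`, and the given function vanishes at all other dimensions.
  refine ⟨fun φ A B => if (finrank F A : ℤ) = i ∧ (finrank F B : ℤ) = j then f φ A B else 0,
    ?_, ?_⟩
  · intro φ A B hne
    beta_reduce at hne
    split_ifs at hne with h1
    · exact ⟨hf _ _ _ hne, h1⟩
    · exact absurd rfl hne
  · ext u
    by_cases hu : fourier f u = 0
    · by_cases h1 : (finrank F (lo u) : ℤ) = i ∧ (finrank F (hi u) : ℤ) = j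
      · rw [fourier_apply]; simp only [h1, and_self, if_true]; rfl
      · rw [hu, fourier_apply]; simp [h1]
    · have h1 := hh u hu
      rw [fourier_apply]; simp only [h1, and_self, if_true]; rfl

end ModelOperators

end

end TwistedGrassmann

namespace TwistedGrassmann

noncomputable section

set_option linter.unusedSectionVars false

open Module Matrix

/-! ### Functions of the trace of a subspace on the hyperplane -/

/-- A decomposition of the hyperplane `H` as a product, whose first factor is `x`. -/
structure Splitting {F : Type*} [Field F] {D : ℕ} (x H : Pt F D) (X C : Type*)
    [AddCommGroup X] [Module F X] [AddCommGroup C] [Module F C] where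
  ι : X × C →ₗ[F] (Fin (2 * D + 1) → F)
  inj : Function.Injective ι
  range_eq : LinearMap.range ι = H
  map_inl : LinearMap.range (ι ∘ₗ LinearMap.inl F X C) = x
  finrank_H : finrank F H = 2 * D

section Pull

variable {F : Type*} [Field F] [Fintype F] {D : ℕ} {x H : Pt F D}
  {X : Type*} [AddCommGroup X] [Module F X] [Finite X]
  {C : Type*} [AddCommGroup C] [Module F C] [Finite C]

/-- A complement of `x` in the whole space, cut with `H`, is a complement of `x` in `H` by the
modular law. -/
theorem exists_splitting (hxH : x ≤ H) (hH : finrank F H = 2 * D) :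
    ∃ c : Pt F D, finrank F x + finrank F c = 2 * D ∧ Nonempty (Splitting x H x c) := by
  obtain ⟨c', hc'⟩ := Submodule.exists_isCompl x
  have hsup : x ⊔ (c' ⊓ H) = H := by
    rw [← sup_inf_assoc_of_le _ hxH, hc'.sup_eq_top, top_inf_eq]
  have hinf : x ⊓ (c' ⊓ H) = ⊥ := by
    rw [← inf_assoc, hc'.inf_eq_bot, bot_inf_eq]
  refine ⟨c' ⊓ H, ?_, ⟨⟨x.subtype.coprod (c' ⊓ H).subtype, ?_, ?_, ?_, hH⟩⟩⟩
  · have := finrank_sup_inf x (c' ⊓ H)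
    rw [hsup, hinf, finrank_bot] at this
    omega
  · rw [← LinearMap.ker_eq_bot, LinearMap.ker_coprod_of_disjoint_range]
    · simp
    · rw [Submodule.range_subtype, Submodule.range_subtype, disjoint_iff, hinf]
  · rw [LinearMap.range_coprod, Submodule.range_subtype, Submodule.range_subtype, hsup]
  · rw [LinearMap.coprod_inl, Submodule.range_subtype]

variable (H) in
/-- The codimension of the trace on `H`. -/
def kk (y : Pt F D) : ℤ := (finrank F y : ℤ) - finrank F ↥(H ⊓ y)

theorem kk_nonneg (y : Pt F D) : 0 ≤ kk H y := by
  have := finrank_mono' (inf_le_right : H ⊓ y ≤ y)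
  unfold kk; omega

theorem kk_eq_zero_iff {y : Pt F D} : kk H y = 0 ↔ y ≤ H := by
  unfold kk
  constructor
  · intro h
    have := eq_of_le_of_finrank_le' (inf_le_right : H ⊓ y ≤ y) (by omega)
    rw [← this]; exact inf_le_left
  · intro h; rw [inf_eq_right.2 h]; simp

namespace Splitting

variable (s : Splitting x H X C)

theorem kk_le_one (s : Splitting x H X C) (y : Pt F D) : kk H y ≤ 1 := by
  have h1 := finrank_sup_inf H y
  have h2 := finrank_le_whole (H ⊔ y)
  have h3 := s.finrank_H
  rw [Module.finrank_fin_fun] at h2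
  unfold kk; omega

/-- The trace on `H` of a subspace, as a subspace of `X × C`. -/
def pull (y : Pt F D) : Submodule F (X × C) := y.comap s.ι

/-- A subspace of `X × C`, as a subspace of `H`. -/
def push (u : Submodule F (X × C)) : Pt F D := u.map s.ι

theorem pull_mono {y z : Pt F D} (h : y ≤ z) : s.pull y ≤ s.pull z := Submodule.comap_mono h

theorem push_mono {u v : Submodule F (X × C)} (h : u ≤ v) : s.push u ≤ s.push v :=
  Submodule.map_mono h

theorem push_le (u : Submodule F (X × C)) : s.push u ≤ H := by
  exact LinearMap.map_le_range.trans s.range_eq.le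

theorem push_pull (y : Pt F D) : s.push (s.pull y) = H ⊓ y := by
  rw [push, pull, Submodule.map_comap_eq, s.range_eq]

theorem pull_push (u : Submodule F (X × C)) : s.pull (s.push u) = u :=
  Submodule.comap_map_eq_of_injective s.inj u

theorem pull_eq_of_inf_eq {y : Pt F D} {u : Submodule F (X × C)} (h : H ⊓ y = s.push u) :
    s.pull y = u := by
  rw [← s.pull_push u, ← h, ← s.push_pull, s.pull_push]

theorem finrank_push (u : Submodule F (X × C)) : finrank F (s.push u) = finrank F u :=
  (Submodule.equivMapOfInjective s.ι s.inj u).finrank_eq.symm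

theorem finrank_pull (y : Pt F D) : finrank F (s.pull y) = finrank F ↥(H ⊓ y) := by
  rw [← s.push_pull, s.finrank_push]

theorem finrank_eq (y : Pt F D) : (finrank F y : ℤ) = finrank F (s.pull y) + kk H y := by
  rw [finrank_pull, kk]; ring

theorem finrank_lo_pull (y : Pt F D) : finrank F (lo (s.pull y)) = finrank F ↥(x ⊓ y) := by
  have : x ⊓ y = (lo (s.pull y)).map (s.ι ∘ₗ LinearMap.inl F X C) := by
    rw [lo, pull, ← Submodule.comap_comp, Submodule.map_comap_eq, s.map_inl]
  rw [this]
  exact (Submodule.equivMapOfInjective (s.ι ∘ₗ LinearMap.inl F X C)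
    (s.inj.comp LinearMap.inl_injective) _).finrank_eq

theorem mem_cell_iff {y : Pt F D} {i j k : ℤ} : y ∈ cell x H i j k ↔
    (finrank F (lo (s.pull y)) : ℤ) = i ∧ (finrank F (hi (s.pull y)) : ℤ) = j ∧ kk H y = k := by
  have h1 := finrank_eq_lo_add_hi (s.pull y)
  have h2 := s.finrank_lo_pull y
  have h3 := s.finrank_pull y
  have h4 := s.finrank_eq y
  simp only [cell, Set.mem_ofPred_eq]
  omega

open Classical in
/-- The function on the set of subspaces that depends only on the trace on `H` and is supported
on the subspaces whose trace has codimension `k`. -/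
def emb (k : ℤ) : (Submodule F (X × C) → ℂ) →ₗ[ℂ] (Pt F D → ℂ) where
  toFun g y := if kk H y = k then g (s.pull y) else 0
  map_add' f g := by ext y; simp only [Pi.add_apply]; split_ifs <;> simp
  map_smul' c f := by ext y; simp only [Pi.smul_apply, RingHom.id_apply]; split_ifs <;> simp

open Classical in
theorem emb_apply (k : ℤ) (g : Submodule F (X × C) → ℂ) (y : Pt F D) :
    s.emb k g y = if kk H y = k then g (s.pull y) else 0 := rfl

theorem kk_push (u : Submodule F (X × C)) : kk H (s.push u) = 0 :=
  kk_eq_zero_iff.2 (s.push_le u)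

/-- Any vector outside `H` may be adjoined to the image of `u`; the modular law keeps the trace on
`H` unchanged. -/
theorem exists_kk_one (u : Submodule F (X × C)) : ∃ y, kk H y = 1 ∧ s.pull y = u := by
  obtain ⟨e, he⟩ : ∃ e, e ∉ H := by
    by_contra! h
    have h1 : H = ⊤ := by ext v; simp [h v]
    have h2 := s.finrank_H
    rw [h1, finrank_top, Module.finrank_fin_fun] at h2
    omega
  have hdis : Submodule.span F {e} ⊓ H = ⊥ := by
    have h0 : e ≠ 0 := fun h0 => he (h0 ▸ H.zero_mem)
    rw [inf_comm, ← disjoint_iff, Submodule.disjoint_span_singleton' h0]; exact he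
  have hinf : H ⊓ (s.push u ⊔ Submodule.span F {e}) = s.push u := by
    rw [inf_comm, sup_inf_assoc_of_le _ (s.push_le u), hdis, sup_bot_eq]
  refine ⟨s.push u ⊔ Submodule.span F {e}, ?_, s.pull_eq_of_inf_eq hinf⟩
  unfold kk
  rw [hinf, finrank_sup_span_singleton (fun h => he (s.push_le u h))]
  push_cast; ring

theorem emb_injective {k : ℤ} (hk : k = 0 ∨ k = 1) : Function.Injective (s.emb k) := by
  rw [injective_iff_map_eq_zero]
  intro g hg
  ext u
  obtain ⟨y, hy, rfl⟩ : ∃ y, kk H y = k ∧ s.pull y = u := by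
    rcases hk with rfl | rfl
    · exact ⟨s.push u, s.kk_push u, s.pull_push u⟩
    · exact s.exists_kk_one u
  have := congrFun hg y
  rwa [emb_apply, if_pos hy] at this

/-! ### Lowering and raising of such functions -/

/-- The subspace with given trace that contains a given subspace. -/
theorem sup_push {y : Pt F D} {v : Submodule F (X × C)} (h : s.pull y ≤ v) :
    s.pull (y ⊔ s.push v) = v ∧ kk H (y ⊔ s.push v) = kk H y := by
  have h1 : s.push (s.pull y) ≤ s.push v := s.push_mono h
  have h2 : H ⊓ (y ⊔ s.push v) = s.push v := by
    rw [inf_comm, sup_comm, sup_inf_assoc_of_le _ (s.push_le v), inf_comm, ← s.push_pull,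
      sup_eq_left.2 h1]
  have h3 : y ⊓ s.push v = s.push (s.pull y) := by
    apply le_antisymm
    · rw [s.push_pull]; exact le_inf (inf_le_right.trans (s.push_le v)) inf_le_left
    · exact le_inf (by rw [s.push_pull]; exact inf_le_right) h1
  refine ⟨s.pull_eq_of_inf_eq h2, ?_⟩
  have h4 := finrank_sup_inf y (s.push v)
  rw [h3, s.push_pull] at h4
  unfold kk
  rw [h2]
  omega

/-- Upwards, a subspace with the same codimension over `H` is determined by its trace, so sums over
larger subspaces carry no multiplicity. Downwards there is one, computed in `card_le_pull_eq`. -/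
theorem eq_sup_push {y z : Pt F D} (h : y ≤ z) (hk : kk H y = kk H z) :
    z = y ⊔ s.push (s.pull z) := by
  have h1 := s.sup_push (s.pull_mono h)
  symm
  apply eq_of_le_of_finrank_le'
  · exact sup_le h (by rw [s.push_pull]; exact inf_le_right)
  · have h2 := s.finrank_eq (y ⊔ s.push (s.pull z))
    have h3 := s.finrank_eq z
    rw [h1.1, h1.2] at h2
    omega

open Classical in
theorem sum_ge_emb (c : Submodule F (X × C) → Submodule F (X × C) → Prop)
    (hc : ∀ u v, c u v → u ≤ v) (k : ℤ) (g : Submodule F (X × C) → ℂ) (y : Pt F D) :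
    ∑ z, (if y ≤ z ∧ c (s.pull y) (s.pull z) ∧ kk H y = kk H z then s.emb k g z else 0) =
      s.emb k (sumSucc c g) y := by
  rw [emb_apply, sumSucc, ← Finset.sum_filter]
  by_cases hk : kk H y = k
  · rw [if_pos hk, ← Finset.sum_filter]
    refine Finset.sum_nbij' (fun z => s.pull z) (fun v => y ⊔ s.push v) ?_ ?_ ?_ ?_ ?_
    · intro z hz
      simp only [Finset.mem_filter, Finset.mem_univ, true_and] at hz ⊢
      exact hz.2.1
    · intro v hv
      simp only [Finset.mem_filter, Finset.mem_univ, true_and] at hv ⊢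
      have := s.sup_push (hc _ _ hv)
      rw [this.1, this.2]
      exact ⟨le_sup_left, hv, rfl⟩
    · intro z hz
      simp only [Finset.mem_filter, Finset.mem_univ, true_and] at hz
      exact (s.eq_sup_push hz.1 hz.2.2).symm
    · intro v hv
      simp only [Finset.mem_filter, Finset.mem_univ, true_and] at hv
      exact (s.sup_push (hc _ _ hv)).1
    · intro z hz
      simp only [Finset.mem_filter, Finset.mem_univ, true_and] at hz
      rw [emb_apply, if_pos (by rw [← hz.2.2, hk])]
  · rw [if_neg hk]
    refine Finset.sum_eq_zero fun z hz => ?_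
    simp only [Finset.mem_filter, Finset.mem_univ, true_and] at hz
    rw [emb_apply, if_neg]
    rw [← hz.2.2]; exact hk

open Classical in
-- If `y` is not inside `H`, then `[2] = q + 1` covers of the image of `u` lie below `y`. One of
-- them is `H ⊓ y`, and the other `q` have trace `u`. This is the source of the factor `q^k` in the
-- raising relations.
theorem card_le_pull_eq {y : Pt F D} {u : Submodule F (X × C)} (hu : u ≤ s.pull y)
    (hd : finrank F (s.pull y) = finrank F u + 1) :
    ((Finset.univ.filter fun z : Pt F D => z ≤ y ∧ s.pull z = u ∧ kk H z = kk H y).card : ℂ) =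
      order F ^ kk H y := by
  have h0 := kk_nonneg (H := H) y
  have h1 := s.kk_le_one y
  have hle : s.push u ≤ y := (s.push_mono hu).trans (by rw [s.push_pull]; exact inf_le_right)
  obtain hk | hk : kk H y = 0 ∨ kk H y = 1 := by omega
  · rw [hk, zpow_zero, Nat.cast_eq_one, Finset.card_eq_one]
    refine ⟨s.push u, ?_⟩
    ext z
    simp only [Finset.mem_filter, Finset.mem_univ, true_and, Finset.mem_singleton]
    constructor
    · rintro ⟨-, h3, h4⟩
      rw [← h3, s.push_pull, inf_eq_right.2 (kk_eq_zero_iff.1 h4)]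
    · rintro rfl
      exact ⟨hle, s.pull_push u, s.kk_push u⟩
  · have hc := card_covers hle
    have hfy := s.finrank_eq y
    rw [s.finrank_push, show ((finrank F y : ℤ) - finrank F u) = 2 by omega] at hc
    have hset : (Finset.univ.filter fun z : Pt F D => Cov (s.push u) z ∧ z ≤ y) =
        insert (H ⊓ y) (Finset.univ.filter fun z : Pt F D =>
          z ≤ y ∧ s.pull z = u ∧ kk H z = kk H y) := by
      ext z
      simp only [Finset.mem_filter, Finset.mem_univ, true_and, Finset.mem_insert]
      have hfz := s.finrank_eq z
      constructor
      · rintro ⟨⟨h2, h3⟩, h4⟩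
        rw [s.finrank_push] at h3
        have h5 := s.pull_mono h2
        rw [s.pull_push] at h5
        have h6 := kk_nonneg (H := H) z
        have h7 := s.kk_le_one z
        obtain h8 | h8 : kk H z = 0 ∨ kk H z = 1 := by omega
        · left
          apply eq_of_le_of_finrank_le' (le_inf (kk_eq_zero_iff.1 h8) h4)
          rw [← s.finrank_pull y]; omega
        · right
          refine ⟨h4, (eq_of_le_of_finrank_le' h5 ?_).symm, by omega⟩
          omega
      · rintro (rfl | ⟨h2, h3, h4⟩)
        · refine ⟨⟨le_inf (s.push_le u) hle, ?_⟩, inf_le_right⟩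
          rw [s.finrank_push, ← s.finrank_pull, hd]
        · refine ⟨⟨?_, ?_⟩, h2⟩
          · rw [← h3, s.push_pull]; exact inf_le_right
          · rw [s.finrank_push]; rw [h3] at hfz; omega
    have hnot : (H ⊓ y) ∉ (Finset.univ.filter fun z : Pt F D =>
        z ≤ y ∧ s.pull z = u ∧ kk H z = kk H y) := by
      simp only [Finset.mem_filter, Finset.mem_univ, true_and]
      rintro ⟨-, -, h⟩
      have := (kk_eq_zero_iff (H := H) (y := H ⊓ y)).2 inf_le_left
      omega
    rw [hset, Finset.card_insert_of_notMem hnot] at hc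
    push_cast at hc
    rw [hk] at hc
    rw [hk, zpow_one, ← add_left_inj 1, hc, gauss1]
    have := one_sub_order_ne_zero (F := F)
    rw [div_eq_iff this]
    rw [zpow_ofNat]
    ring

open Classical in
theorem sum_le_emb (c : Submodule F (X × C) → Submodule F (X × C) → Prop)
    (hc : ∀ u v, c u v → u ≤ v ∧ finrank F v = finrank F u + 1) (k : ℤ)
    (g : Submodule F (X × C) → ℂ) (y : Pt F D) :
    ∑ z, (if z ≤ y ∧ c (s.pull z) (s.pull y) ∧ kk H z = kk H y then s.emb k g z else 0) =
      s.emb k (order F ^ k • sumPred c g) y := by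
  rw [emb_apply]
  by_cases hk : kk H y = k
  · rw [if_pos hk, Pi.smul_apply, sumPred, smul_eq_mul, Finset.mul_sum,
      ← Finset.sum_fiberwise_of_maps_to (s := Finset.univ) (t := Finset.univ)
      (g := fun z => s.pull z) (fun _ _ => Finset.mem_univ _)]
    refine Finset.sum_congr rfl fun u _ => ?_
    split_ifs with hcu
    · rw [← hk, ← s.card_le_pull_eq (hc _ _ hcu).1 (hc _ _ hcu).2, ← nsmul_eq_mul,
        ← Finset.sum_const, Finset.sum_filter, Finset.sum_filter]
      refine Finset.sum_congr rfl fun z _ => ?_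
      by_cases h1 : s.pull z = u
      · subst h1
        by_cases h2 : z ≤ y ∧ kk H z = kk H y
        · rw [if_pos rfl, if_pos ⟨h2.1, hcu, h2.2⟩, if_pos ⟨h2.1, rfl, h2.2⟩, emb_apply,
            if_pos h2.2]
        · rw [if_pos rfl, if_neg (by tauto), if_neg (by tauto)]
      · rw [if_neg h1, if_neg (by tauto)]
    · rw [mul_zero]
      refine Finset.sum_eq_zero fun z hz => ?_
      simp only [Finset.mem_filter, Finset.mem_univ, true_and] at hz
      subst hz
      rw [if_neg (by tauto)]
  · rw [if_neg hk]
    refine Finset.sum_eq_zero fun z _ => ?_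
    rw [emb_apply, ← ite_and, if_neg]
    rintro ⟨⟨-, -, h⟩, h'⟩
    exact hk (h ▸ h')

theorem lower_apply (α β γ : ℤ) (y z : Pt F D) [Decidable (y ≤ z ∧
      (finrank F (lo (s.pull z)) : ℤ) = finrank F (lo (s.pull y)) + α ∧
      (finrank F (hi (s.pull z)) : ℤ) = finrank F (hi (s.pull y)) + β ∧
      kk H z = kk H y + γ)] :
    lower x H α β γ y z = if y ≤ z ∧
      (finrank F (lo (s.pull z)) : ℤ) = finrank F (lo (s.pull y)) + α ∧
      (finrank F (hi (s.pull z)) : ℤ) = finrank F (hi (s.pull y)) + β ∧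
      kk H z = kk H y + γ then 1 else 0 := by
  rw [lower, Matrix.of_apply]
  classical
  refine if_congr (and_congr Iff.rfl ?_) rfl rfl
  constructor
  · rintro ⟨i, j, k, h1, h2⟩
    rw [s.mem_cell_iff] at h1 h2
    omega
  · rintro ⟨h1, h2, h3⟩
    exact ⟨_, _, _, s.mem_cell_iff.2 ⟨rfl, rfl, rfl⟩, s.mem_cell_iff.2 (by omega)⟩

theorem raise_apply (α β γ : ℤ) (y z : Pt F D) [Decidable (z ≤ y ∧
      (finrank F (lo (s.pull y)) : ℤ) = finrank F (lo (s.pull z)) + α ∧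
      (finrank F (hi (s.pull y)) : ℤ) = finrank F (hi (s.pull z)) + β ∧
      kk H y = kk H z + γ)] :
    raise x H α β γ y z = if z ≤ y ∧
      (finrank F (lo (s.pull y)) : ℤ) = finrank F (lo (s.pull z)) + α ∧
      (finrank F (hi (s.pull y)) : ℤ) = finrank F (hi (s.pull z)) + β ∧
      kk H y = kk H z + γ then 1 else 0 := by
  rw [raise, Matrix.of_apply]
  classical
  refine if_congr (and_congr Iff.rfl ?_) rfl rfl
  constructor
  · rintro ⟨i, j, k, h1, h2⟩
    rw [s.mem_cell_iff] at h1 h2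
    omega
  · rintro ⟨h1, h2, h3⟩
    exact ⟨_, _, _, s.mem_cell_iff.2 ⟨rfl, rfl, rfl⟩, s.mem_cell_iff.2 (by omega)⟩

theorem L1_emb (k : ℤ) (g : Submodule F (X × C) → ℂ) :
    L1 x H *ᵥ s.emb k g = s.emb k (sumSucc step1 g) := by
  classical
  ext y
  rw [← s.sum_ge_emb step1 (fun u v h => h.1), Matrix.mulVec, dotProduct]
  refine Finset.sum_congr rfl fun z _ => ?_
  rw [L1, s.lower_apply, ite_mul, one_mul, zero_mul]
  refine if_congr ?_ rfl rfl
  have := s.pull_mono (y := y) (z := z)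
  unfold step1
  constructor
  · rintro ⟨h1, h2, h3, h4⟩; exact ⟨h1, ⟨this h1, by omega, by omega⟩, by omega⟩
  · rintro ⟨h1, ⟨h2, h3, h4⟩, h5⟩; exact ⟨h1, by omega, by omega, by omega⟩

theorem L2_emb (k : ℤ) (g : Submodule F (X × C) → ℂ) :
    L2 x H *ᵥ s.emb k g = s.emb k (sumSucc step2 g) := by
  classical
  ext y
  rw [← s.sum_ge_emb step2 (fun u v h => h.1), Matrix.mulVec, dotProduct]
  refine Finset.sum_congr rfl fun z _ => ?_
  rw [L2, s.lower_apply, ite_mul, one_mul, zero_mul]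
  refine if_congr ?_ rfl rfl
  have := s.pull_mono (y := y) (z := z)
  unfold step2
  constructor
  · rintro ⟨h1, h2, h3, h4⟩; exact ⟨h1, ⟨this h1, by omega, by omega⟩, by omega⟩
  · rintro ⟨h1, ⟨h2, h3, h4⟩, h5⟩; exact ⟨h1, by omega, by omega, by omega⟩

theorem R1_emb (k : ℤ) (g : Submodule F (X × C) → ℂ) :
    R1 x H *ᵥ s.emb k g = order F ^ k • s.emb k (sumPred step1 g) := by
  classical
  rw [← map_smul]
  ext y
  rw [← s.sum_le_emb step1 (fun u v h => ⟨h.1, by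
    have := h.2; rw [finrank_eq_lo_add_hi u, finrank_eq_lo_add_hi v]; omega⟩), Matrix.mulVec,
    dotProduct]
  refine Finset.sum_congr rfl fun z _ => ?_
  rw [R1, s.raise_apply, ite_mul, one_mul, zero_mul]
  refine if_congr ?_ rfl rfl
  have := s.pull_mono (y := z) (z := y)
  unfold step1
  constructor
  · rintro ⟨h1, h2, h3, h4⟩; exact ⟨h1, ⟨this h1, by omega, by omega⟩, by omega⟩
  · rintro ⟨h1, ⟨h2, h3, h4⟩, h5⟩; exact ⟨h1, by omega, by omega, by omega⟩

theorem R2_emb (k : ℤ) (g : Submodule F (X × C) → ℂ) :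
    R2 x H *ᵥ s.emb k g = order F ^ k • s.emb k (sumPred step2 g) := by
  classical
  rw [← map_smul]
  ext y
  rw [← s.sum_le_emb step2 (fun u v h => ⟨h.1, by
    have := h.2; rw [finrank_eq_lo_add_hi u, finrank_eq_lo_add_hi v]; omega⟩), Matrix.mulVec,
    dotProduct]
  refine Finset.sum_congr rfl fun z _ => ?_
  rw [R2, s.raise_apply, ite_mul, one_mul, zero_mul]
  refine if_congr ?_ rfl rfl
  have := s.pull_mono (y := z) (z := y)
  unfold step2
  constructor
  · rintro ⟨h1, h2, h3, h4⟩; exact ⟨h1, ⟨this h1, by omega, by omega⟩, by omega⟩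
  · rintro ⟨h1, ⟨h2, h3, h4⟩, h5⟩; exact ⟨h1, by omega, by omega, by omega⟩

theorem pull_eq_of_finrank {y z : Pt F D} (h : y ≤ z)
    (h1 : (finrank F (lo (s.pull z)) : ℤ) = finrank F (lo (s.pull y)) + 0)
    (h2 : (finrank F (hi (s.pull z)) : ℤ) = finrank F (hi (s.pull y)) + 0) :
    s.pull y = s.pull z := by
  apply eq_of_le_of_finrank_le' (s.pull_mono h)
  rw [finrank_eq_lo_add_hi, finrank_eq_lo_add_hi]; omega

theorem R3_emb_zero (g : Submodule F (X × C) → ℂ) : R3 x H *ᵥ s.emb 0 g = s.emb 1 g := by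
  classical
  ext y
  rw [Matrix.mulVec, dotProduct, Finset.sum_eq_single (s.push (s.pull y))]
  · have h2 := s.kk_push (s.pull y)
    have hle : s.push (s.pull y) ≤ y := by rw [s.push_pull]; exact inf_le_right
    rw [R3, s.raise_apply, emb_apply, emb_apply, if_pos h2, s.pull_push, ite_mul, one_mul, zero_mul]
    refine if_congr ?_ rfl rfl
    rw [h2]
    simp [hle]
  · intro z _ hz
    rw [R3, s.raise_apply, emb_apply]
    split_ifs with h1 h2
    · exfalso
      apply hz
      rw [← s.pull_eq_of_finrank h1.1 h1.2.1 h1.2.2.1, s.push_pull,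
        inf_eq_right.2 (kk_eq_zero_iff.1 h2)]
    all_goals simp
  · simp

theorem R3_emb_one (g : Submodule F (X × C) → ℂ) : R3 x H *ᵥ s.emb 1 g = 0 := by
  classical
  ext y
  rw [Matrix.mulVec, dotProduct]
  refine Finset.sum_eq_zero fun z _ => ?_
  rw [R3, s.raise_apply, emb_apply]
  have := s.kk_le_one y
  split_ifs with h1 h2
  · have := h1.2.2.2; omega
  all_goals simp

theorem L3_emb_zero (g : Submodule F (X × C) → ℂ) : L3 x H *ᵥ s.emb 0 g = 0 := by
  classical
  ext y
  rw [Matrix.mulVec, dotProduct]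
  refine Finset.sum_eq_zero fun z _ => ?_
  rw [L3, s.lower_apply, emb_apply]
  have := kk_nonneg (H := H) y
  split_ifs with h1 h2
  · have := h1.2.2.2; omega
  all_goals simp

/-- A subspace `y ≤ H` has `[2D + 1 - dim y] - [2D - dim y] = q^{2D - dim y}` covers outside `H`,
and all of them have the trace of `y`. -/
theorem L3_emb_one (g : Submodule F (X × C) → ℂ) : L3 x H *ᵥ s.emb 1 g =
    s.emb 0 (fun u => order F ^ (2 * (D : ℤ) - finrank F u) * g u) := by
  classical
  ext y
  rw [Matrix.mulVec, dotProduct, emb_apply]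
  have hterm : ∀ z, L3 x H y z * s.emb 1 g z =
      if (Cov y z ∧ z ≤ ⊤ ∧ ¬ z ≤ H) ∧ kk H y = 0 then g (s.pull y) else 0 := by
    intro z
    rw [L3, s.lower_apply, emb_apply]
    have hz1 := s.kk_le_one z
    have hz0 := kk_nonneg (H := H) z
    have hy0 := kk_nonneg (H := H) y
    have hzH := kk_eq_zero_iff (H := H) (y := z)
    have hfy := s.finrank_eq y
    have hfz := s.finrank_eq z
    by_cases h1 : y ≤ z ∧ (finrank F (lo (s.pull z)) : ℤ) = finrank F (lo (s.pull y)) + 0 ∧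
      (finrank F (hi (s.pull z)) : ℤ) = finrank F (hi (s.pull y)) + 0 ∧ kk H z = kk H y + 1
    · have hp := s.pull_eq_of_finrank h1.1 h1.2.1 h1.2.2.1
      have h2 : kk H z = 1 := by omega
      rw [hp] at hfy
      rw [if_pos h1, if_pos h2, one_mul, hp, if_pos]
      refine ⟨⟨⟨h1.1, by omega⟩, le_top, ?_⟩, by omega⟩
      rw [← hzH]; omega
    · rw [if_neg h1, zero_mul, if_neg]
      rintro ⟨⟨⟨h2, h3⟩, -, h4⟩, h5⟩
      rw [← hzH] at h4
      have h6 := s.pull_mono h2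
      have hp : s.pull y = s.pull z := eq_of_le_of_finrank_le' h6 (by omega)
      apply h1
      rw [hp]
      exact ⟨h2, by omega, by omega, by omega⟩
  rw [Finset.sum_congr rfl fun z _ => hterm z]
  by_cases hk : kk H y = 0
  · have hyH := kk_eq_zero_iff.1 hk
    simp only [hk, and_true, if_true]
    rw [← Finset.sum_filter, Finset.sum_const, nsmul_eq_mul]
    congr 1
    have h1 := card_covers hyH
    have h2 := card_covers (le_top : y ≤ ⊤)
    have h3 : (Finset.univ.filter fun B : Pt F D => Cov y B ∧ B ≤ ⊤) =
        (Finset.univ.filter fun B : Pt F D => Cov y B ∧ B ≤ H) ∪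
        (Finset.univ.filter fun B : Pt F D => Cov y B ∧ B ≤ ⊤ ∧ ¬ B ≤ H) := by
      ext B; simp only [Finset.mem_union, Finset.mem_filter, Finset.mem_univ, true_and, le_top]
      tauto
    rw [h3, Finset.card_union_of_disjoint, Nat.cast_add, h1, finrank_top, Module.finrank_fin_fun,
      s.finrank_H] at h2
    · rw [← add_right_inj, h2]
      have hfy := s.finrank_eq y
      rw [hk, add_zero] at hfy
      rw [hfy]
      have := one_sub_order_ne_zero (F := F)
      unfold gauss1
      push_cast
      rw [show (2 * (D : ℤ) + 1 - finrank F (s.pull y)) = (2 * (D : ℤ) - finrank F (s.pull y)) + 1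
        by ring, zpow_add_one₀ order_ne_zero]
      field_simp
      ring
    · rw [Finset.disjoint_filter]; tauto
  · simp [hk]

/-! ### The embedding of the model -/

/-- The embedding of the model into the functions on the set of all subspaces. -/
def Phi (k : ℤ) : Model F X C →ₗ[ℂ] (Pt F D → ℂ) := s.emb k ∘ₗ fourier

theorem L1_Phi (k : ℤ) (f : Model F X C) : L1 x H *ᵥ s.Phi k f = s.Phi k (l1 f) := by
  rw [Phi, LinearMap.comp_apply, L1_emb, sumSucc_step1_fourier]; rfl

theorem L2_Phi (k : ℤ) (f : Model F X C) : L2 x H *ᵥ s.Phi k f = s.Phi k (l2 f) := by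
  rw [Phi, LinearMap.comp_apply, L2_emb, sumSucc_step2_fourier]; rfl

theorem R1_Phi (k : ℤ) (f : Model F X C) :
    R1 x H *ᵥ s.Phi k f = order F ^ k • s.Phi k (r1 f) := by
  rw [Phi, LinearMap.comp_apply, R1_emb, sumPred_step1_fourier]; rfl

theorem R2_Phi (k : ℤ) (f : Model F X C) :
    R2 x H *ᵥ s.Phi k f = order F ^ k • s.Phi k (r2 f) := by
  rw [Phi, LinearMap.comp_apply, R2_emb, sumPred_step2_fourier]; rfl

theorem R3_Phi_zero (f : Model F X C) : R3 x H *ᵥ s.Phi 0 f = s.Phi 1 f := s.R3_emb_zero _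

theorem R3_Phi_one (f : Model F X C) : R3 x H *ᵥ s.Phi 1 f = 0 := s.R3_emb_one _

theorem L3_Phi_zero (f : Model F X C) : L3 x H *ᵥ s.Phi 0 f = 0 := s.L3_emb_zero _

theorem L3_Phi_one {i j : ℤ} {f : Model F X C} (hf : f ∈ lev F X C i j) :
    L3 x H *ᵥ s.Phi 1 f = order F ^ (2 * (D : ℤ) - i - j) • s.Phi 0 f := by
  rw [Phi, LinearMap.comp_apply, L3_emb_one, Phi, LinearMap.comp_apply, ← map_smul]
  congr 1
  ext u
  rw [Pi.smul_apply, smul_eq_mul]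
  by_cases h : fourier f u = 0
  · simp [h]
  · obtain ⟨h1, h2⟩ := fourier_apply_ne_zero hf h
    rw [finrank_eq_lo_add_hi, Nat.cast_add, h1, h2, sub_sub]

theorem Phi_apply_ne_zero {i j k : ℤ} {f : Model F X C} (hf : f ∈ lev F X C i j) {y : Pt F D}
    (hy : s.Phi k f y ≠ 0) : y ∈ cell x H i j k := by
  rw [Phi, LinearMap.comp_apply, emb_apply] at hy
  split_ifs at hy with h
  · obtain ⟨h1, h2⟩ := fourier_apply_ne_zero hf hy
    exact s.mem_cell_iff.2 ⟨h1, h2, h⟩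
  · exact absurd rfl hy

theorem Phi_eq_zero {i j k : ℤ} {f : Model F X C} (hf : f ∈ lev F X C i j) (hk : k = 0 ∨ k = 1)
    (h : s.Phi k f = 0) : f = 0 := by
  apply (supported_of_mem_lev hf).eq_zero_of_fourier
  exact s.emb_injective hk (by rw [map_zero]; exact h)

/-- A subspace inside `H` is its own trace, so at `k = 0` the embedding reaches every function. At
`k = 1` it reaches only those constant on subspaces with equal trace; this is where the condition `τ
= 0` becomes essential. -/
theorem exists_Phi_zero_eq {i j : ℤ} {w : Pt F D → ℂ} (hw : ∀ y, w y ≠ 0 → y ∈ cell x H i j 0) :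
    ∃ f ∈ lev F X C i j, s.Phi 0 f = w := by
  obtain ⟨f, hf, h⟩ := exists_fourier_eq_of_lev (i := i) (j := j) (h := fun u => w (s.push u)) (by
    intro u hu
    have := s.mem_cell_iff.1 (hw _ hu)
    rw [s.pull_push] at this
    exact ⟨this.1, this.2.1⟩)
  refine ⟨f, hf, ?_⟩
  ext y
  rw [Phi, LinearMap.comp_apply, h, emb_apply]
  split_ifs with hk
  · rw [s.push_pull, inf_eq_right.2 (kk_eq_zero_iff.1 hk)]
  · by_contra hne
    exact hk (s.mem_cell_iff.1 (hw y (Ne.symm hne))).2.2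

end Splitting

/-! ### The diagonal matrices of the cells -/

theorem cell_unique {i j k i' j' k' : ℤ} {y : Pt F D} (h : y ∈ cell x H i j k)
    (h' : y ∈ cell x H i' j' k') : i = i' ∧ j = j' ∧ k = k' := by
  simp only [cell, Set.mem_ofPred_eq] at h h'
  omega

open Classical in
theorem cellE_mulVec_apply (i j k : ℤ) (w : Pt F D → ℂ) (y : Pt F D) :
    (cellE x H i j k *ᵥ w) y = if y ∈ cell x H i j k then w y else 0 := by
  rw [cellE, Matrix.mulVec_diagonal]; split_ifs <;> simp

theorem cellE_mulVec_of_supported {i j k : ℤ} {w : Pt F D → ℂ}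
    (hw : ∀ y, w y ≠ 0 → y ∈ cell x H i j k) : cellE x H i j k *ᵥ w = w := by
  ext y
  rw [cellE_mulVec_apply]
  split_ifs with h
  · rfl
  · by_contra h'; exact h (hw y (Ne.symm h'))

theorem cellE_mulVec_of_ne {i j k i' j' k' : ℤ} {w : Pt F D → ℂ}
    (hw : ∀ y, w y ≠ 0 → y ∈ cell x H i j k) (hne : (i', j', k') ≠ (i, j, k)) :
    cellE x H i' j' k' *ᵥ w = 0 := by
  ext y
  rw [cellE_mulVec_apply]
  split_ifs with h
  · by_contra h'
    obtain ⟨rfl, rfl, rfl⟩ := cell_unique h (hw y h')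
    exact hne rfl
  · rfl

end Pull

end

end TwistedGrassmann

namespace TwistedGrassmann

noncomputable section

set_option linter.unusedSectionVars false

open Module Matrix

section LowestWeight

variable {F : Type*} [Field F] [Fintype F] {X : Type*} [AddCommGroup X] [Module F X] [Finite X]
  {C : Type*} [AddCommGroup C] [Module F C] [Finite C]

/-! ### Lowest weight vectors in the model -/

/-- The inductive step of the string formulas: the commutator at weight `i + n`, added to the `n`-th
coefficient, gives the next one. -/
theorem gauss1_recursion {q : ℂ} (hq : q ≠ 0) (h1 : 1 - q ≠ 0) (i n t : ℤ) :
    q ^ i * gauss1 q (t - 2 * i - n + 1) * gauss1 q n + (gauss1 q (t - (i + n)) - gauss1 q (i + n))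
      = q ^ i * gauss1 q (t - 2 * i - (n + 1) + 1) * gauss1 q (n + 1) := by
  unfold gauss1
  rw [show t - 2 * i - n + 1 = t - i - i - n + 1 by ring,
    show t - 2 * i - (n + 1) + 1 = t - i - i - n by ring, show t - (i + n) = t - i - n by ring]
  simp only [zpow_sub₀ hq, zpow_add₀ hq, zpow_one]
  have := zpow_ne_zero i hq
  have := zpow_ne_zero n hq
  field_simp
  ring

theorem pow_succ_apply' {V : Type*} [AddCommGroup V] [Module ℂ V] (f : V →ₗ[ℂ] V) (n : ℕ) (v : V) :
    (f ^ (n + 1)) v = f ((f ^ n) v) := by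
  rw [pow_succ', Module.End.mul_apply]

theorem r1_pow_mem {i j ρ : ℤ} {f : Model F X C} (hf : f ∈ lev F X C i j)
    (hr : f ∈ rk F X C ρ) (n : ℕ) :
    (r1 ^ n) f ∈ lev F X C (i + n) j ∧ (r1 ^ n) f ∈ rk F X C ρ := by
  induction n with
  | zero => simpa using ⟨hf, hr⟩
  | succ n ih =>
    rw [pow_succ_apply']
    have := r1_mem_lev ih.1
    rw [add_assoc] at this
    exact ⟨by exact_mod_cast this, r1_mem_rk ih.2⟩

theorem r2_pow_mem {i j ρ : ℤ} {f : Model F X C} (hf : f ∈ lev F X C i j)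
    (hr : f ∈ rk F X C ρ) (n : ℕ) :
    (r2 ^ n) f ∈ lev F X C i (j + n) ∧ (r2 ^ n) f ∈ rk F X C ρ := by
  induction n with
  | zero => simpa using ⟨hf, hr⟩
  | succ n ih =>
    rw [pow_succ_apply']
    have := r2_mem_lev ih.1
    rw [add_assoc] at this
    exact ⟨by exact_mod_cast this, r2_mem_rk ih.2⟩

theorem l2_r1_pow (f : Model F X C) (n : ℕ) : l2 ((r1 ^ n) f) = (r1 ^ n) (l2 f) := by
  induction n with
  | zero => simp
  | succ n ih => rw [pow_succ_apply', pow_succ_apply', l2_r1, ih]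

theorem l1_r2_pow (f : Model F X C) (n : ℕ) : l1 ((r2 ^ n) f) = (r2 ^ n) (l1 f) := by
  induction n with
  | zero => simp
  | succ n ih => rw [pow_succ_apply', pow_succ_apply', l1_r2, ih]

theorem r2_r1_pow (f : Model F X C) (n : ℕ) :
    r2 ((r1 ^ n) f) = order F ^ (-(n : ℤ)) • (r1 ^ n) (r2 f) := by
  induction n with
  | zero => simp
  | succ n ih =>
    have h : r2 (r1 ((r1 ^ n) f)) = (order F)⁻¹ • r1 (r2 ((r1 ^ n) f)) := by
      rw [r1_r2, smul_smul, inv_mul_cancel₀ order_ne_zero, one_smul]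
    rw [pow_succ_apply', pow_succ_apply', h, ih, map_smul, smul_smul]
    congr 1
    rw [Nat.cast_succ, neg_add, zpow_add₀ order_ne_zero, _root_.zpow_neg_one, mul_comm]

/-- As for `sl₂`, the commutation relation is summed along the string. The coefficient vanishes only
at `n = 0` and at `n = dim X - ρ - 2i + 1`, and the latter determines the length of the string. -/
theorem l1_r1_pow {i j ρ : ℤ} {f : Model F X C} (hf : f ∈ lev F X C i j)
    (hr : f ∈ rk F X C ρ) (h0 : l1 f = 0) (n : ℕ) :
    l1 ((r1 ^ n) f) = (order F ^ j * (order F ^ i *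
      gauss1 (order F) ((finrank F X : ℤ) - ρ - 2 * i - n + 1) * gauss1 (order F) n)) •
        (r1 ^ (n - 1)) f := by
  induction n with
  | zero => simp [h0, gauss1_zero]
  | succ n ih =>
    obtain ⟨h1, h2⟩ := r1_pow_mem hf hr n
    have h3 : r1 (l1 ((r1 ^ n) f)) = (order F ^ j * (order F ^ i *
      gauss1 (order F) ((finrank F X : ℤ) - ρ - 2 * i - n + 1) * gauss1 (order F) n)) •
        (r1 ^ n) f := by
      rw [ih, map_smul]
      cases n with
      | zero => simp [gauss1_zero]
      | succ n => rw [Nat.add_sub_cancel, ← pow_succ_apply']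
    rw [pow_succ_apply', l1_r1_of_mem h1 h2, h3, ← add_smul, Nat.add_sub_cancel, ← mul_add,
      gauss1_recursion order_ne_zero one_sub_order_ne_zero]
    push_cast
    rfl

theorem l2_r2_pow {i j ρ : ℤ} {f : Model F X C} (hf : f ∈ lev F X C i j)
    (hr : f ∈ rk F X C ρ) (h0 : l2 f = 0) (n : ℕ) :
    l2 ((r2 ^ n) f) = (order F ^ ((finrank F X : ℤ) - i) * (order F ^ (j - ρ) *
      gauss1 (order F) ((finrank F C : ℤ) - ρ - 2 * (j - ρ) - n + 1) * gauss1 (order F) n)) •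
        (r2 ^ (n - 1)) f := by
  induction n with
  | zero => simp [h0, gauss1_zero]
  | succ n ih =>
    obtain ⟨h1, h2⟩ := r2_pow_mem hf hr n
    have h3 : r2 (l2 ((r2 ^ n) f)) = (order F ^ ((finrank F X : ℤ) - i) * (order F ^ (j - ρ) *
      gauss1 (order F) ((finrank F C : ℤ) - ρ - 2 * (j - ρ) - n + 1) * gauss1 (order F) n)) •
        (r2 ^ n) f := by
      rw [ih, map_smul]
      cases n with
      | zero => simp [gauss1_zero]
      | succ n => rw [Nat.add_sub_cancel, ← pow_succ_apply']
    rw [pow_succ_apply', l2_r2_of_mem h1 h2, h3, ← add_smul, Nat.add_sub_cancel, ← mul_add,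
      show (finrank F C : ℤ) - (j + n) = (finrank F C : ℤ) - ρ - ((j - ρ) + n) by ring,
      show j + (n : ℤ) - ρ = (j - ρ) + n by ring,
      gauss1_recursion order_ne_zero one_sub_order_ne_zero]
    push_cast
    rfl

/-- Applying `L` to the first vanishing power forces its coefficient to be zero, hence that power is
the `(N + 1)`-st. -/
theorem exists_vanishing {V : Type*} [AddCommGroup V] [Module ℂ V] {R : V →ₗ[ℂ] V} {v : V}
    {L : V →ₗ[ℂ] V} {N : ℤ} {c : ℂ} (hc : c ≠ 0) (hv : v ≠ 0) (hvan : ∃ n : ℕ, (R ^ n) v = 0)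
    (hL : ∀ n : ℕ, L ((R ^ n) v) = (c * gauss1 (order F) (N - n + 1) * gauss1 (order F) n) •
      (R ^ (n - 1)) v) : 0 ≤ N ∧ ∀ n : ℕ, (R ^ n) v = 0 ↔ N < n := by
  classical
  set n := Nat.find hvan
  have hn : (R ^ n) v = 0 := Nat.find_spec hvan
  have hn0 : n ≠ 0 := by intro h; rw [h] at hn; exact hv (by simpa using hn)
  have h1 : (R ^ (n - 1)) v ≠ 0 := Nat.find_min hvan (by omega)
  have h2 := hL n
  rw [hn, map_zero] at h2
  have h3 : gauss1 (order F) (N - n + 1) = 0 := by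
    rcases smul_eq_zero.1 h2.symm with h | h
    · rcases mul_eq_zero.1 h with h | h
      · rcases mul_eq_zero.1 h with h | h
        · exact absurd h hc
        · exact h
      · rw [gauss1_eq_zero_iff] at h; omega
    · exact absurd h h1
  rw [gauss1_eq_zero_iff] at h3
  refine ⟨by omega, fun m => ⟨fun hm => ?_, fun hm => ?_⟩⟩
  · have := Nat.find_min' hvan hm; omega
  · obtain ⟨k, rfl⟩ : ∃ k, m = k + n := ⟨m - n, by omega⟩
    rw [pow_add, Module.End.mul_apply, hn, map_zero]

theorem r1_pow_eq_zero_iff {i j ρ : ℤ} {f : Model F X C} (hf : f ∈ lev F X C i j)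
    (hr : f ∈ rk F X C ρ) (h0 : l1 f = 0) (hne : f ≠ 0) :
    0 ≤ (finrank F X : ℤ) - ρ - 2 * i ∧
      ∀ n : ℕ, (r1 ^ n) f = 0 ↔ (finrank F X : ℤ) - ρ - 2 * i < n := by
  refine exists_vanishing (F := F) (L := l1) (c := order F ^ j * order F ^ i)
    (mul_ne_zero (zpow_ne_zero _ order_ne_zero) (zpow_ne_zero _ order_ne_zero)) hne ?_ ?_
  · refine ⟨((finrank F X : ℤ) + 1 - i).toNat, eq_zero_of_mem_lev (r1_pow_mem hf hr _).1 ?_⟩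
    omega
  · intro n; rw [l1_r1_pow hf hr h0]; congr 1; ring

theorem r2_pow_eq_zero_iff {i j ρ : ℤ} {f : Model F X C} (hf : f ∈ lev F X C i j)
    (hr : f ∈ rk F X C ρ) (h0 : l2 f = 0) (hne : f ≠ 0) :
    0 ≤ (finrank F C : ℤ) - ρ - 2 * (j - ρ) ∧
      ∀ n : ℕ, (r2 ^ n) f = 0 ↔ (finrank F C : ℤ) - ρ - 2 * (j - ρ) < n := by
  refine exists_vanishing (F := F) (L := l2)
    (c := order F ^ ((finrank F X : ℤ) - i) * order F ^ (j - ρ))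
    (mul_ne_zero (zpow_ne_zero _ order_ne_zero) (zpow_ne_zero _ order_ne_zero)) hne ?_ ?_
  · refine ⟨((finrank F C : ℤ) + 1 - j).toNat, eq_zero_of_mem_lev (r2_pow_mem hf hr _).1 ?_⟩
    omega
  · intro n; rw [l2_r2_pow hf hr h0]; congr 1; ring

variable (F X C) in
/-- The lowest weight vectors of given weight and rank. -/
def Low (ν μ ρ : ℤ) : Submodule ℂ (Model F X C) :=
  lev F X C ν μ ⊓ rk F X C ρ ⊓ LinearMap.ker l1 ⊓ LinearMap.ker l2

variable {ν μ ρ : ℤ} {g : Model F X C}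

theorem mem_Low : g ∈ Low F X C ν μ ρ ↔
    g ∈ lev F X C ν μ ∧ g ∈ rk F X C ρ ∧ l1 g = 0 ∧ l2 g = 0 := by
  simp only [Low, Submodule.mem_inf, LinearMap.mem_ker, and_assoc]

/-- The two upper bounds express that the strings have nonnegative length; `ρ ≤ μ` holds because
`range φ ≤ B` on the support. -/
theorem Low_bounds (hg : g ∈ Low F X C ν μ ρ) (hne : g ≠ 0) : 0 ≤ ν ∧ 0 ≤ ρ ∧ ρ ≤ μ ∧
    2 * ν ≤ (finrank F X : ℤ) - ρ ∧ 2 * μ ≤ (finrank F C : ℤ) + ρ := by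
  obtain ⟨h1, h2, h3, h4⟩ := mem_Low.1 hg
  have h5 := (r1_pow_eq_zero_iff h1 h2 h3 hne).1
  have h6 := (r2_pow_eq_zero_iff h1 h2 h4 hne).1
  obtain ⟨φ, A, B, h⟩ : ∃ φ A B, g φ A B ≠ 0 := by
    by_contra! hcon
    exact hne (by ext φ A B; exact hcon φ A B)
  obtain ⟨h7, h8, h9⟩ := h1 φ A B h
  have h10 := h2 φ A B h
  have h11 := finrank_mono' h7.2
  refine ⟨by omega, by omega, by omega, by omega, by omega⟩

/-- The vectors obtained from a lowest weight vector by the raising operators. -/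
def std (ν μ i j : ℤ) : Model F X C →ₗ[ℂ] Model F X C :=
  if ν ≤ i ∧ μ ≤ j then (r1 ^ (i - ν).toNat) ∘ₗ (r2 ^ (j - μ).toNat) else 0

theorem std_apply {i j : ℤ} (hi : ν ≤ i) (hj : μ ≤ j) (g : Model F X C) :
    std ν μ i j g = (r1 ^ (i - ν).toNat) ((r2 ^ (j - μ).toNat) g) := by
  rw [std, if_pos ⟨hi, hj⟩]; rfl

theorem std_apply_of_not {i j : ℤ} (h : ¬ (ν ≤ i ∧ μ ≤ j)) (g : Model F X C) :
    std ν μ i j g = 0 := by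
  rw [std, if_neg h]; rfl

theorem std_self (g : Model F X C) : std ν μ ν μ g = g := by
  rw [std_apply le_rfl le_rfl]; simp

theorem std_mem (hg : g ∈ Low F X C ν μ ρ) (i j : ℤ) :
    std ν μ i j g ∈ lev F X C i j ∧ std ν μ i j g ∈ rk F X C ρ := by
  by_cases h : ν ≤ i ∧ μ ≤ j
  · rw [std_apply h.1 h.2]
    obtain ⟨h1, h2, -, -⟩ := mem_Low.1 hg
    obtain ⟨h3, h4⟩ := r2_pow_mem h1 h2 (j - μ).toNat
    have h5 := r1_pow_mem h3 h4 (i - ν).toNat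
    rwa [show ν + ((i - ν).toNat : ℤ) = i by omega, show μ + ((j - μ).toNat : ℤ) = j by omega] at h5
  · rw [std_apply_of_not h]; exact ⟨zero_mem _, zero_mem _⟩

theorem std_eq_zero_iff (hg : g ∈ Low F X C ν μ ρ) (hne : g ≠ 0) (i j : ℤ) :
    std ν μ i j g = 0 ↔ ¬ (ν ≤ i ∧ i ≤ finrank F X - ν - ρ ∧ μ ≤ j ∧ j ≤ finrank F C - μ + ρ) := by
  by_cases h : ν ≤ i ∧ μ ≤ j
  · rw [std_apply h.1 h.2]
    obtain ⟨h1, h2, h3, h4⟩ := mem_Low.1 hg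
    obtain ⟨h5, h6⟩ := r2_pow_mem h1 h2 (j - μ).toNat
    have h7 : l1 ((r2 ^ (j - μ).toNat) g) = 0 := by rw [l1_r2_pow, h3, map_zero]
    have h8 := (r2_pow_eq_zero_iff h1 h2 h4 hne).2 (j - μ).toNat
    by_cases h0 : (r2 ^ (j - μ).toNat) g = 0
    · rw [h0, map_zero]
      have := h8.1 h0
      simp only [true_iff]; omega
    · rw [(r1_pow_eq_zero_iff h5 h6 h7 h0).2]
      have := mt h8.2 h0
      omega
  · rw [std_apply_of_not h]; simp only [true_iff]; tauto

theorem r1_std {i j : ℤ} (hi : ν ≤ i) (g : Model F X C) :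
    r1 (std ν μ i j g) = std ν μ (i + 1) j g := by
  by_cases hj : μ ≤ j
  · rw [std_apply hi hj, std_apply (by omega) hj, ← pow_succ_apply']
    congr 2; omega
  · rw [std_apply_of_not (by omega), std_apply_of_not (by omega), map_zero]

theorem r2_std {i j : ℤ} (hj : μ ≤ j) (g : Model F X C) :
    r2 (std ν μ i j g) = order F ^ (ν - i) • std ν μ i (j + 1) g := by
  by_cases hi : ν ≤ i
  · rw [std_apply hi hj, std_apply hi (by omega), r2_r1_pow, ← pow_succ_apply']
    congr 3
    · omega
    · congr 1; omega
  · rw [std_apply_of_not (by omega), std_apply_of_not (by omega), map_zero, smul_zero]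

theorem l1_std (hg : g ∈ Low F X C ν μ ρ) (i j : ℤ) :
    l1 (std ν μ i j g) = (order F ^ (ν + j) * gauss1 (order F) (finrank F X - ν - ρ - i + 1) *
      gauss1 (order F) (i - ν)) • std ν μ (i - 1) j g := by
  by_cases h : ν ≤ i ∧ μ ≤ j
  · rw [std_apply h.1 h.2]
    obtain ⟨h1, h2, h3, h4⟩ := mem_Low.1 hg
    obtain ⟨h5, h6⟩ := r2_pow_mem h1 h2 (j - μ).toNat
    have h7 : l1 ((r2 ^ (j - μ).toNat) g) = 0 := by rw [l1_r2_pow, h3, map_zero]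
    rw [l1_r1_pow h5 h6 h7, show μ + ((j - μ).toNat : ℤ) = j by omega,
      show ((i - ν).toNat : ℤ) = i - ν by omega]
    by_cases hi : i = ν
    · subst hi; simp [gauss1_zero]
    · rw [std_apply (by omega) h.2, show (i - 1 - ν).toNat = (i - ν).toNat - 1 by omega,
        zpow_add₀ order_ne_zero]
      congr 1
      rw [show (finrank F X : ℤ) - ρ - 2 * ν - (i - ν) + 1 = finrank F X - ν - ρ - i + 1 by ring]
      ring
  · rw [std_apply_of_not h, std_apply_of_not (by omega), map_zero, smul_zero]

theorem l2_std (hg : g ∈ Low F X C ν μ ρ) (i j : ℤ) :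
    l2 (std ν μ i j g) = (order F ^ (finrank F X - ν + μ - ρ) *
      gauss1 (order F) (finrank F C - μ + ρ - j + 1) *
      gauss1 (order F) (j - μ)) • std ν μ i (j - 1) g := by
  by_cases h : ν ≤ i ∧ μ ≤ j
  · rw [std_apply h.1 h.2]
    obtain ⟨h1, h2, h3, h4⟩ := mem_Low.1 hg
    rw [l2_r1_pow, l2_r2_pow h1 h2 h4, map_smul, show ((j - μ).toNat : ℤ) = j - μ by omega]
    by_cases hi : j = μ
    · subst hi; simp [gauss1_zero]
    · rw [std_apply h.1 (by omega), show (j - 1 - μ).toNat = (j - μ).toNat - 1 by omega,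
        show (finrank F X : ℤ) - ν + μ - ρ = (finrank F X - ν) + (μ - ρ) by ring,
        zpow_add₀ order_ne_zero]
      congr 1
      rw [show (finrank F C : ℤ) - ρ - 2 * (μ - ρ) - (j - μ) + 1 = finrank F C - μ + ρ - j + 1
        by ring]
      ring
  · rw [std_apply_of_not h, std_apply_of_not (by omega), map_zero, smul_zero]

end LowestWeight

end

end TwistedGrassmann

namespace TwistedGrassmann

noncomputable section

set_option linter.unusedSectionVars false

open Module Matrix

/-! ### Subspaces stable under an algebra of matrices -/

section Stable

variable {n : Type*} [Fintype n] [DecidableEq n]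

theorem mulVec_mem_of_mem_adjoin {S : Set (Matrix n n ℂ)} {U : Submodule ℂ (n → ℂ)}
    (h : ∀ M ∈ S, ∀ u ∈ U, M *ᵥ u ∈ U) {M : Matrix n n ℂ} (hM : M ∈ Algebra.adjoin ℂ S) :
    ∀ u ∈ U, M *ᵥ u ∈ U := by
  induction hM using Algebra.adjoin_induction with
  | mem M hM => exact h M hM
  | algebraMap c =>
    intro u hu
    rw [Algebra.algebraMap_eq_smul_one, smul_mulVec, one_mulVec]
    exact U.smul_mem c hu
  | add M N _ _ hM hN => intro u hu; rw [add_mulVec]; exact U.add_mem (hM u hu) (hN u hu)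
  | mul M N _ _ hM hN => intro u hu; rw [← mulVec_mulVec]; exact hM _ (hN u hu)

theorem exists_submodule_adjoin {S : Set (Matrix n n ℂ)} (U : Submodule ℂ (n → ℂ))
    (h : ∀ M ∈ S, ∀ u ∈ U, M *ᵥ u ∈ U) :
    ∃ W : Submodule (Algebra.adjoin ℂ S) (n → ℂ), W.restrictScalars ℂ = U :=
  ⟨{ carrier := U
     add_mem' := fun ha hb => U.add_mem ha hb
     zero_mem' := U.zero_mem
     smul_mem' := fun M u hu => mulVec_mem_of_mem_adjoin h M.2 u hu }, rfl⟩

theorem mulVec_mem_submodule {A : Subalgebra ℂ (Matrix n n ℂ)} (W : Submodule A (n → ℂ))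
    {M : Matrix n n ℂ} (hM : M ∈ A) {u : n → ℂ} (hu : u ∈ W) : M *ᵥ u ∈ W :=
  W.smul_mem (⟨M, hM⟩ : A) hu

theorem smul_mem_submodule {A : Subalgebra ℂ (Matrix n n ℂ)} (W : Submodule A (n → ℂ))
    (c : ℂ) {u : n → ℂ} (hu : u ∈ W) : c • u ∈ W :=
  (W.restrictScalars ℂ).smul_mem c hu

theorem cut_eq_bot_iff {M : Matrix n n ℂ} {U : Submodule ℂ (n → ℂ)} :
    cut M U = ⊥ ↔ ∀ u ∈ U, M *ᵥ u = 0 := by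
  rw [cut, ← le_bot_iff, Submodule.map_le_iff_le_comap]
  rfl

theorem cut_ne_bot_iff {M : Matrix n n ℂ} {U : Submodule ℂ (n → ℂ)} :
    cut M U ≠ ⊥ ↔ ∃ u ∈ U, M *ᵥ u ≠ 0 := by
  rw [Ne, cut_eq_bot_iff]; push Not; rfl

theorem cut_span_ne_bot_iff {M : Matrix n n ℂ} {S : Set (n → ℂ)} :
    cut M (Submodule.span ℂ S) ≠ ⊥ ↔ ∃ u ∈ S, M *ᵥ u ≠ 0 := by
  rw [cut, Submodule.map_span, Ne, Submodule.span_eq_bot]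
  simp

theorem mem_cut {M : Matrix n n ℂ} {U : Submodule ℂ (n → ℂ)} {v : n → ℂ} :
    v ∈ cut M U ↔ ∃ u ∈ U, M *ᵥ u = v := Iff.rfl

end Stable

/-! ### The irreducible modules generated by lowest weight vectors -/

section Generated

variable {F : Type*} [Field F] [Fintype F] {D : ℕ} {x H : Pt F D}
  {X : Type*} [AddCommGroup X] [Module F X] [Finite X]
  {C : Type*} [AddCommGroup C] [Module F C] [Finite C]

/-- The indexing function `f` lets one statement serve the sums defining `nu`, `mu` and `tau`, which
freeze different coordinates of the cell. -/
theorem sum_cellE_eq_zero {i j k : ℤ} {w : Pt F D → ℂ}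
    (hw : ∀ y, w y ≠ 0 → y ∈ cell x H i j k) (s t : Finset ℕ) (f : ℕ → ℕ → ℤ × ℤ × ℤ)
    (h : ∀ m n, f m n ≠ (i, j, k)) :
    (∑ m ∈ s, ∑ n ∈ t, cellE x H (f m n).1 (f m n).2.1 (f m n).2.2) *ᵥ w = 0 := by
  rw [sum_mulVec]
  refine Finset.sum_eq_zero fun m _ => ?_
  rw [sum_mulVec]
  exact Finset.sum_eq_zero fun n _ => cellE_mulVec_of_ne hw (h m n)

theorem sum_cellE_eq_self {i j k : ℤ} {w : Pt F D → ℂ}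
    (hw : ∀ y, w y ≠ 0 → y ∈ cell x H i j k) (s t : Finset ℕ) (f : ℕ → ℕ → ℤ × ℤ × ℤ)
    {m₀ n₀ : ℕ} (hm : m₀ ∈ s) (hn : n₀ ∈ t)
    (h : ∀ m n, f m n = (i, j, k) ↔ m = m₀ ∧ n = n₀) :
    (∑ m ∈ s, ∑ n ∈ t, cellE x H (f m n).1 (f m n).2.1 (f m n).2.2) *ᵥ w = w := by
  rw [sum_mulVec, Finset.sum_eq_single m₀, sum_mulVec, Finset.sum_eq_single n₀]
  · rw [(h m₀ n₀).2 ⟨rfl, rfl⟩]; exact cellE_mulVec_of_supported hw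
  · intro n _ hne
    exact cellE_mulVec_of_ne hw (fun h' => hne ((h _ _).1 h').2)
  · exact fun h' => absurd hn h'
  · intro m _ hne
    rw [sum_mulVec]
    refine Finset.sum_eq_zero fun n _ => ?_
    exact cellE_mulVec_of_ne hw (fun h' => hne ((h _ _).1 h').1)
  · exact fun h' => absurd hm h'

theorem L1_mem : L1 x H ∈ Halg x H := Algebra.subset_adjoin (Or.inl (by simp))
theorem L2_mem : L2 x H ∈ Halg x H := Algebra.subset_adjoin (Or.inl (by simp))
theorem L3_mem : L3 x H ∈ Halg x H := Algebra.subset_adjoin (Or.inl (by simp))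
theorem R1_mem : R1 x H ∈ Halg x H := Algebra.subset_adjoin (Or.inl (by simp))
theorem R2_mem : R2 x H ∈ Halg x H := Algebra.subset_adjoin (Or.inl (by simp))
theorem R3_mem : R3 x H ∈ Halg x H := Algebra.subset_adjoin (Or.inl (by simp))
theorem cellE_mem (i j k : ℤ) : cellE x H i j k ∈ Halg x H :=
  Algebra.subset_adjoin (Or.inr ⟨i, j, k, rfl⟩)

namespace Splitting

variable (s : Splitting x H X C)

theorem Phi_eq_zero_of_ne {k : ℤ} (h0 : k ≠ 0) (h1 : k ≠ 1) (f : Model F X C) :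
    s.Phi k f = 0 := by
  ext y
  rw [Phi, LinearMap.comp_apply, emb_apply, if_neg]
  · rfl
  · have := kk_nonneg (H := H) y
    have := s.kk_le_one y
    omega

/-- At `k = -1` the left side is zero while the right side is at level zero, so this value has to be
excluded; `k = 2` plays the same role for `L3_Phi`. -/
theorem R3_Phi {k : ℤ} (hk : k ≠ -1) (f : Model F X C) :
    R3 x H *ᵥ s.Phi k f = s.Phi (k + 1) f := by
  by_cases h0 : k = 0
  · subst h0; exact s.R3_Phi_zero f
  by_cases h1 : k = 1
  · subst h1; rw [s.R3_Phi_one, s.Phi_eq_zero_of_ne (by norm_num) (by norm_num)]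
  · rw [s.Phi_eq_zero_of_ne h0 h1, mulVec_zero, s.Phi_eq_zero_of_ne (by omega) (by omega)]

theorem L3_Phi {k i j : ℤ} (hk : k ≠ 2) {f : Model F X C} (hf : f ∈ lev F X C i j) :
    L3 x H *ᵥ s.Phi k f = order F ^ (2 * (D : ℤ) - i - j) • s.Phi (k - 1) f := by
  by_cases h0 : k = 0
  · subst h0; rw [s.L3_Phi_zero, s.Phi_eq_zero_of_ne (by norm_num) (by norm_num), smul_zero]
  by_cases h1 : k = 1
  · subst h1; exact s.L3_Phi_one hf
  · rw [s.Phi_eq_zero_of_ne h0 h1, mulVec_zero, s.Phi_eq_zero_of_ne (by omega) (by omega),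
      smul_zero]

/-- The standard vectors of the module generated by a lowest weight vector. -/
def wv (ν μ i j k : ℤ) : Model F X C →ₗ[ℂ] (Pt F D → ℂ) := s.Phi k ∘ₗ std ν μ i j

theorem wv_apply (ν μ i j k : ℤ) (g : Model F X C) :
    s.wv ν μ i j k g = s.Phi k (std ν μ i j g) := rfl

variable {ν μ ρ : ℤ} {g : Model F X C}

theorem mem_cell_of_wv (hg : g ∈ Low F X C ν μ ρ) {i j k : ℤ} :
    ∀ y, s.wv ν μ i j k g y ≠ 0 → y ∈ cell x H i j k := fun _ hy =>
  s.Phi_apply_ne_zero (std_mem hg i j).1 hy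

theorem wv_eq_zero_iff (hg : g ∈ Low F X C ν μ ρ) (hne : g ≠ 0) (i j k : ℤ) :
    s.wv ν μ i j k g = 0 ↔ ¬ (ν ≤ i ∧ i ≤ finrank F X - ν - ρ ∧ μ ≤ j ∧
      j ≤ finrank F C - μ + ρ ∧ 0 ≤ k ∧ k ≤ 1) := by
  by_cases hk : k = 0 ∨ k = 1
  · have h1 : s.wv ν μ i j k g = 0 ↔ std ν μ i j g = 0 :=
      ⟨fun h => s.Phi_eq_zero (std_mem hg i j).1 hk h, fun h => by rw [wv_apply, h, map_zero]⟩
    rw [h1, std_eq_zero_iff hg hne]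
    omega
  · rw [wv_apply, s.Phi_eq_zero_of_ne (by tauto) (by tauto)]
    simp only [true_iff]; omega

/-- The subspace spanned by the standard vectors. -/
def wspan (ν μ : ℤ) (g : Model F X C) : Submodule ℂ (Pt F D → ℂ) :=
  Submodule.span ℂ (Set.range fun t : ℤ × ℤ × ℤ => s.wv ν μ t.1 t.2.1 t.2.2 g)

theorem wv_mem_wspan (i j k : ℤ) : s.wv ν μ i j k g ∈ s.wspan ν μ g :=
  Submodule.subset_span ⟨(i, j, k), rfl⟩

theorem L1_wv (hg : g ∈ Low F X C ν μ ρ) (i j k : ℤ) : L1 x H *ᵥ s.wv ν μ i j k g =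
    (order F ^ (ν + j) * gauss1 (order F) (finrank F X - ν - ρ - i + 1) *
      gauss1 (order F) (i - ν)) • s.wv ν μ (i - 1) j k g := by
  rw [wv_apply, s.L1_Phi, l1_std hg, map_smul]; rfl

theorem L2_wv (hg : g ∈ Low F X C ν μ ρ) (i j k : ℤ) : L2 x H *ᵥ s.wv ν μ i j k g =
    (order F ^ (finrank F X - ν + μ - ρ) * gauss1 (order F) (finrank F C - μ + ρ - j + 1) *
      gauss1 (order F) (j - μ)) • s.wv ν μ i (j - 1) k g := by
  rw [wv_apply, s.L2_Phi, l2_std hg, map_smul]; rfl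

theorem R1_wv {i : ℤ} (hi : ν ≤ i) (j k : ℤ) :
    R1 x H *ᵥ s.wv ν μ i j k g = order F ^ k • s.wv ν μ (i + 1) j k g := by
  rw [wv_apply, s.R1_Phi, r1_std hi]; rfl

theorem R2_wv {j : ℤ} (hj : μ ≤ j) (i k : ℤ) :
    R2 x H *ᵥ s.wv ν μ i j k g = order F ^ (ν - i + k) • s.wv ν μ i (j + 1) k g := by
  rw [wv_apply, s.R2_Phi, r2_std hj, map_smul, smul_smul, ← zpow_add₀ order_ne_zero,
    add_comm k]; rfl

theorem L3_wv (hg : g ∈ Low F X C ν μ ρ) {k : ℤ} (hk : k ≠ 2) (i j : ℤ) :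
    L3 x H *ᵥ s.wv ν μ i j k g = order F ^ (2 * (D : ℤ) - i - j) • s.wv ν μ i j (k - 1) g :=
  s.L3_Phi hk (std_mem hg i j).1

theorem R3_wv {k : ℤ} (hk : k ≠ -1) (i j : ℤ) :
    R3 x H *ᵥ s.wv ν μ i j k g = s.wv ν μ i j (k + 1) g := s.R3_Phi hk _

theorem wv_of_not {i j k : ℤ} (h : ¬ (ν ≤ i ∧ μ ≤ j)) : s.wv ν μ i j k g = 0 := by
  rw [wv_apply, std_apply_of_not h, map_zero]

theorem exists_generated (hg : g ∈ Low F X C ν μ ρ) :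
    ∃ 𝒲 : Submodule (Halg x H) (Pt F D → ℂ), 𝒲.restrictScalars ℂ = s.wspan ν μ g := by
  refine exists_submodule_adjoin _ ?_
  intro M hM u hu
  have hle : s.wspan ν μ g ≤ (s.wspan ν μ g).comap M.mulVecLin := by
    refine Submodule.span_le.2 ?_
    rintro _ ⟨⟨i, j, k⟩, rfl⟩
    change M *ᵥ s.wv ν μ i j k g ∈ s.wspan ν μ g
    rcases hM with hM | ⟨i', j', k', rfl⟩
    · simp only [Set.mem_insert_iff, Set.mem_singleton_iff] at hM
      -- The raising formulas fail just below the range, where zero would have to be sent to the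
      -- first vector of a string; there the vector is zero and nothing has to be shown.
      by_cases hij : ν ≤ i ∧ μ ≤ j
      swap
      · rw [s.wv_of_not hij, mulVec_zero]; exact zero_mem _
      by_cases hk : k = 0 ∨ k = 1
      swap
      · rw [wv_apply, s.Phi_eq_zero_of_ne (by tauto) (by tauto), mulVec_zero]; exact zero_mem _
      rcases hM with rfl | rfl | rfl | rfl | rfl | rfl
      · rw [s.L1_wv hg]; exact Submodule.smul_mem _ _ (s.wv_mem_wspan _ _ _)
      · rw [s.L2_wv hg]; exact Submodule.smul_mem _ _ (s.wv_mem_wspan _ _ _)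
      · rw [s.L3_wv hg (by omega)]; exact Submodule.smul_mem _ _ (s.wv_mem_wspan _ _ _)
      · rw [s.R1_wv hij.1]; exact Submodule.smul_mem _ _ (s.wv_mem_wspan _ _ _)
      · rw [s.R2_wv hij.2]; exact Submodule.smul_mem _ _ (s.wv_mem_wspan _ _ _)
      · rw [s.R3_wv (by omega)]; exact s.wv_mem_wspan _ _ _
    · by_cases h : (i', j', k') = (i, j, k)
      · obtain ⟨rfl, rfl, rfl⟩ : i' = i ∧ j' = j ∧ k' = k := by simpa using h
        rw [cellE_mulVec_of_supported (s.mem_cell_of_wv hg)]; exact s.wv_mem_wspan _ _ _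
      · rw [cellE_mulVec_of_ne (s.mem_cell_of_wv hg) h]; exact zero_mem _
  exact hle hu

/-- The module `𝒲` is generated by the lowest weight vector `g`. -/
structure Generates (ν μ ρ : ℤ) (g : Model F X C) (𝒲 : Submodule (Halg x H) (Pt F D → ℂ)) :
    Prop where
  finrank_X : (finrank F X : ℤ) = D - 1
  finrank_C : (finrank F C : ℤ) = D + 1
  mem : g ∈ Low F X C ν μ ρ
  ne_zero : g ≠ 0
  span : 𝒲.restrictScalars ℂ = s.wspan ν μ g

variable {s} {𝒲 : Submodule (Halg x H) (Pt F D → ℂ)}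

theorem Generates.bounds (h : s.Generates ν μ ρ g 𝒲) : 0 ≤ ν ∧ 0 ≤ ρ ∧ ρ ≤ μ ∧
    2 * ν ≤ (D : ℤ) - 1 - ρ ∧ 2 * μ ≤ (D : ℤ) + 1 + ρ := by
  have := Low_bounds h.mem h.ne_zero
  rw [h.finrank_X, h.finrank_C] at this
  exact this

theorem Generates.wv_eq_zero_iff (h : s.Generates ν μ ρ g 𝒲) (i j k : ℤ) :
    s.wv ν μ i j k g = 0 ↔ ¬ (ν ≤ i ∧ i ≤ (D : ℤ) - 1 - ν - ρ ∧ μ ≤ j ∧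
      j ≤ (D : ℤ) + 1 - μ + ρ ∧ 0 ≤ k ∧ k ≤ 1) := by
  rw [s.wv_eq_zero_iff h.mem h.ne_zero, h.finrank_X, h.finrank_C]

theorem Generates.cut_ne_bot_iff (h : s.Generates ν μ ρ g 𝒲)
    {M : Matrix (Pt F D) (Pt F D) ℂ} : cut M (𝒲.restrictScalars ℂ) ≠ ⊥ ↔
      ∃ i j k, M *ᵥ s.wv ν μ i j k g ≠ 0 := by
  rw [h.span, wspan, cut_span_ne_bot_iff]
  simp

theorem Generates.cut_nu (h : s.Generates ν μ ρ g 𝒲) (n : ℕ) :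
    cut (∑ j ∈ Finset.range (D + 2), ∑ k ∈ Finset.range 2, cellE x H n j k)
      (𝒲.restrictScalars ℂ) ≠ ⊥ ↔ ν ≤ n ∧ (n : ℤ) ≤ (D : ℤ) - 1 - ν - ρ := by
  have hb := h.bounds
  rw [h.cut_ne_bot_iff]
  constructor
  · rintro ⟨i, j, k, hne⟩
    have hi : i = n := by
      by_contra hi
      exact hne (sum_cellE_eq_zero (s.mem_cell_of_wv h.mem) _ _ (fun j k => (n, j, k))
        (fun _ _ h' => hi (by simp at h'; exact h'.1.symm)))
    have h0 : s.wv ν μ i j k g ≠ 0 := by intro h0; rw [h0, mulVec_zero] at hne; exact hne rfl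
    rw [Ne, h.wv_eq_zero_iff, not_not] at h0
    omega
  · intro hn
    refine ⟨n, μ, 0, ?_⟩
    have e : (∑ j ∈ Finset.range (D + 2), ∑ k ∈ Finset.range 2, cellE x H n j k) *ᵥ
        s.wv ν μ n μ 0 g = s.wv ν μ n μ 0 g :=
      sum_cellE_eq_self (s.mem_cell_of_wv h.mem) _ _ (fun j k => (n, j, k)) (m₀ := μ.toNat)
        (n₀ := 0) (by rw [Finset.mem_range]; omega) (by simp)
        (fun m n => by simp only [Prod.mk.injEq, true_and, and_true]; omega)
    rw [e, Ne, h.wv_eq_zero_iff]; omega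

theorem Generates.cut_mu (h : s.Generates ν μ ρ g 𝒲) (n : ℕ) :
    cut (∑ i ∈ Finset.range D, ∑ k ∈ Finset.range 2, cellE x H i n k)
      (𝒲.restrictScalars ℂ) ≠ ⊥ ↔ μ ≤ n ∧ (n : ℤ) ≤ (D : ℤ) + 1 - μ + ρ := by
  have hb := h.bounds
  rw [h.cut_ne_bot_iff]
  constructor
  · rintro ⟨i, j, k, hne⟩
    have hi : j = n := by
      by_contra hi
      exact hne (sum_cellE_eq_zero (s.mem_cell_of_wv h.mem) _ _ (fun j k => (j, n, k))
        (fun _ _ h' => hi (by simp at h'; exact h'.2.1.symm)))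
    have h0 : s.wv ν μ i j k g ≠ 0 := by intro h0; rw [h0, mulVec_zero] at hne; exact hne rfl
    rw [Ne, h.wv_eq_zero_iff, not_not] at h0
    omega
  · intro hn
    refine ⟨ν, n, 0, ?_⟩
    have e : (∑ i ∈ Finset.range D, ∑ k ∈ Finset.range 2, cellE x H i n k) *ᵥ
        s.wv ν μ ν n 0 g = s.wv ν μ ν n 0 g :=
      sum_cellE_eq_self (s.mem_cell_of_wv h.mem) _ _ (fun j k => (j, n, k)) (m₀ := ν.toNat)
        (n₀ := 0) (by rw [Finset.mem_range]; omega) (by simp)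
        (fun m n => by simp only [Prod.mk.injEq, true_and, and_true]; omega)
    rw [e, Ne, h.wv_eq_zero_iff]; omega

theorem Generates.nu_eq (h : s.Generates ν μ ρ g 𝒲) : (nu 𝒲 : ℤ) = ν := by
  have hb := h.bounds
  have hset : {i : ℕ | cut (∑ j ∈ Finset.range (D + 2), ∑ k ∈ Finset.range 2,
      cellE x H i j k) (𝒲.restrictScalars ℂ) ≠ ⊥} =
      {n : ℕ | ν ≤ n ∧ (n : ℤ) ≤ (D : ℤ) - 1 - ν - ρ} := Set.ext fun n => h.cut_nu n
  have : nu 𝒲 = ν.toNat := by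
    rw [nu, hset]
    apply le_antisymm
    · exact Nat.sInf_le (by simp only [Set.mem_ofPred_eq]; omega)
    · refine le_csInf ⟨ν.toNat, by simp only [Set.mem_ofPred_eq]; omega⟩ ?_
      intro n hn; simp only [Set.mem_ofPred_eq] at hn; omega
  omega

theorem Generates.nu'_eq (h : s.Generates ν μ ρ g 𝒲) : (nu' 𝒲 : ℤ) = (D : ℤ) - 1 - ν - ρ := by
  have hb := h.bounds
  have hset : {i : ℕ | cut (∑ j ∈ Finset.range (D + 2), ∑ k ∈ Finset.range 2,
      cellE x H i j k) (𝒲.restrictScalars ℂ) ≠ ⊥} =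
      {n : ℕ | ν ≤ n ∧ (n : ℤ) ≤ (D : ℤ) - 1 - ν - ρ} := Set.ext fun n => h.cut_nu n
  have : nu' 𝒲 = ((D : ℤ) - 1 - ν - ρ).toNat := by
    rw [nu', hset]
    apply le_antisymm
    · refine csSup_le ⟨ν.toNat, by simp only [Set.mem_ofPred_eq]; omega⟩ ?_
      intro n hn; simp only [Set.mem_ofPred_eq] at hn; omega
    · refine le_csSup ⟨D, ?_⟩ (by simp only [Set.mem_ofPred_eq]; omega)
      intro n hn; simp only [Set.mem_ofPred_eq] at hn; omega
  omega

theorem Generates.rho_eq (h : s.Generates ν μ ρ g 𝒲) : rho 𝒲 = ρ := by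
  rw [rho, h.nu_eq, h.nu'_eq]; ring

theorem Generates.mu_eq (h : s.Generates ν μ ρ g 𝒲) : (mu 𝒲 : ℤ) = μ := by
  have hb := h.bounds
  have hset : {j : ℕ | cut (∑ i ∈ Finset.range D, ∑ k ∈ Finset.range 2,
      cellE x H i j k) (𝒲.restrictScalars ℂ) ≠ ⊥} =
      {n : ℕ | μ ≤ n ∧ (n : ℤ) ≤ (D : ℤ) + 1 - μ + ρ} := Set.ext fun n => h.cut_mu n
  have : mu 𝒲 = μ.toNat := by
    rw [mu, hset]
    apply le_antisymm
    · exact Nat.sInf_le (by simp only [Set.mem_ofPred_eq]; omega)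
    · refine le_csInf ⟨μ.toNat, by simp only [Set.mem_ofPred_eq]; omega⟩ ?_
      intro n hn; simp only [Set.mem_ofPred_eq] at hn; omega
  omega

theorem Generates.tau_eq (h : s.Generates ν μ ρ g 𝒲) : tau 𝒲 = 0 := by
  have hb := h.bounds
  have h0 : (0 : ℕ) ∈ {k : ℕ | cut (∑ i ∈ Finset.range D, ∑ j ∈ Finset.range (D + 2),
      cellE x H i j k) (𝒲.restrictScalars ℂ) ≠ ⊥} := by
    simp only [Set.mem_ofPred_eq]
    rw [h.cut_ne_bot_iff]
    refine ⟨ν, μ, 0, ?_⟩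
    have e : (∑ i ∈ Finset.range D, ∑ j ∈ Finset.range (D + 2), cellE x H i j (0 : ℕ)) *ᵥ
        s.wv ν μ ν μ 0 g = s.wv ν μ ν μ 0 g :=
      sum_cellE_eq_self (s.mem_cell_of_wv h.mem) _ _ (fun i j => (i, j, (0 : ℕ)))
        (m₀ := ν.toNat) (n₀ := μ.toNat) (by rw [Finset.mem_range]; omega)
        (by rw [Finset.mem_range]; omega) (fun m n => by simp only [Prod.mk.injEq, true_and, and_true]; omega)
    rw [e, Ne, h.wv_eq_zero_iff]; omega
  have := Nat.sInf_le h0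
  unfold tau
  omega

theorem Generates.mem_stdIndex_iff (h : s.Generates ν μ ρ g 𝒲) {i j k : ℤ} :
    (i, j, k) ∈ stdIndex 𝒲 ↔ ν ≤ i ∧ i ≤ (D : ℤ) - 1 - ν - ρ ∧ μ ≤ j ∧
      j ≤ (D : ℤ) + 1 - μ + ρ ∧ 0 ≤ k ∧ k ≤ 1 := by
  simp only [stdIndex, Set.mem_ofPred_eq, h.nu_eq, h.mu_eq, h.rho_eq]

theorem linearIndependent_of_cells {ι : Type*} {w : ι → Pt F D → ℂ} {p : ι → ℤ × ℤ × ℤ}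
    (hp : Function.Injective p) (hw : ∀ t y, w t y ≠ 0 → y ∈ cell x H (p t).1 (p t).2.1 (p t).2.2)
    (h0 : ∀ t, w t ≠ 0) : LinearIndependent ℂ w := by
  rw [linearIndependent_iff']
  intro S c hc t ht
  obtain ⟨y, hy⟩ := Function.ne_iff.1 (h0 t)
  have h1 := congrFun hc y
  rw [Finset.sum_apply, Finset.sum_eq_single t] at h1
  · exact (mul_eq_zero.1 h1).resolve_right hy
  · intro t' _ hne
    have : w t' y = 0 := by
      by_contra h'
      obtain ⟨e1, e2, e3⟩ := cell_unique (hw t' y h') (hw t y hy)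
      exact hne (hp (Prod.ext e1 (Prod.ext e2 e3)))
    simp [this]
  · exact fun h' => absurd ht h'

theorem Generates.isStandardBasis (h : s.Generates ν μ ρ g 𝒲) :
    IsStandardBasis 𝒲 (fun i j k => s.wv ν μ i j k g) where
  zero i j k hn := by
    rw [h.mem_stdIndex_iff] at hn
    exact (h.wv_eq_zero_iff i j k).2 hn
  mem i j k hn := by
    refine mem_cut.2 ⟨_, ?_, cellE_mulVec_of_supported (s.mem_cell_of_wv h.mem)⟩
    rw [h.span]; exact s.wv_mem_wspan _ _ _
  linearIndependent := by
    refine linearIndependent_of_cells (p := fun t => t.1) Subtype.val_injective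
      (fun t => s.mem_cell_of_wv h.mem) ?_
    rintro ⟨⟨i, j, k⟩, ht⟩
    rw [h.mem_stdIndex_iff] at ht
    exact fun h0 => (h.wv_eq_zero_iff i j k).1 h0 ht
  span := by
    rw [h.span, wspan]
    apply le_antisymm
    · apply Submodule.span_mono
      rintro _ ⟨t, rfl⟩; exact ⟨t.1, rfl⟩
    · rw [Submodule.span_le]
      rintro _ ⟨⟨i, j, k⟩, rfl⟩
      by_cases ht : (i, j, k) ∈ stdIndex 𝒲
      · exact Submodule.subset_span ⟨⟨_, ht⟩, rfl⟩
      · rw [h.mem_stdIndex_iff] at ht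
        have h0 := (h.wv_eq_zero_iff i j k).2 ht
        simp only [h0]; exact zero_mem _
  lower1 i j k ht := by
    rw [h.nu_eq, h.rho_eq, s.L1_wv h.mem, h.finrank_X]
  raise1 i j k ht := by
    rw [h.mem_stdIndex_iff] at ht
    exact s.R1_wv ht.1 j k
  lower2 i j k ht := by
    rw [h.nu_eq, h.rho_eq, h.mu_eq, s.L2_wv h.mem, h.finrank_X, h.finrank_C]
  raise2 i j k ht := by
    rw [h.mem_stdIndex_iff] at ht
    rw [h.nu_eq]
    exact s.R2_wv ht.2.2.1 i k
  lower3 i j k ht := by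
    rw [h.mem_stdIndex_iff] at ht
    exact s.L3_wv h.mem (by omega) i j
  raise3 i j k ht := by
    rw [h.mem_stdIndex_iff] at ht
    exact s.R3_wv (by omega) i j

/-- Standard vectors with different indices lie in different cells, so each cell projection has rank
at most one on the module. -/
theorem cellE_mulVec_wspan (hg : g ∈ Low F X C ν μ ρ) {u : Pt F D → ℂ}
    (hu : u ∈ s.wspan ν μ g) (i j k : ℤ) :
    ∃ c : ℂ, cellE x H i j k *ᵥ u = c • s.wv ν μ i j k g := by
  have hle : s.wspan ν μ g ≤ (Submodule.span ℂ {s.wv ν μ i j k g}).comap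
      (cellE x H i j k).mulVecLin := by
    refine Submodule.span_le.2 ?_
    rintro _ ⟨⟨i', j', k'⟩, rfl⟩
    change cellE x H i j k *ᵥ s.wv ν μ i' j' k' g ∈ Submodule.span ℂ {s.wv ν μ i j k g}
    by_cases h : (i, j, k) = (i', j', k')
    · obtain ⟨rfl, rfl, rfl⟩ : i = i' ∧ j = j' ∧ k = k' := by simpa using h
      rw [cellE_mulVec_of_supported (s.mem_cell_of_wv hg)]
      exact Submodule.mem_span_singleton_self _
    · rw [cellE_mulVec_of_ne (s.mem_cell_of_wv hg) h]; exact zero_mem _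
  obtain ⟨c, hc⟩ := Submodule.mem_span_singleton.1 (hle hu)
  exact ⟨c, hc.symm⟩

theorem exists_mem_cell (s : Splitting x H X C) (y : Pt F D) : ∃ i j k : ℕ, y ∈ cell x H i j k ∧
    i ≤ finrank F X ∧ j ≤ finrank F C ∧ k < 2 := by
  have h0 := kk_nonneg (H := H) y
  have h1 := s.kk_le_one y
  refine ⟨_, _, (kk H y).toNat, s.mem_cell_iff.2 ⟨rfl, rfl, ?_⟩, finrank_le_whole _,
    finrank_le_whole _, by omega⟩
  omega

theorem wspan_le_of_Phi_mem (h𝒲 : s.Phi 0 g ∈ 𝒲) : s.wspan ν μ g ≤ 𝒲.restrictScalars ℂ := by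
  have hr1 : ∀ n f, s.Phi 0 f ∈ 𝒲 → s.Phi 0 ((r1 ^ n) f) ∈ 𝒲 := by
    intro n f hf
    induction n with
    | zero => simpa using hf
    | succ n ih =>
      have := mulVec_mem_submodule 𝒲 R1_mem ih
      rwa [s.R1_Phi, zpow_zero, one_smul, ← pow_succ_apply'] at this
  have hr2 : ∀ n f, s.Phi 0 f ∈ 𝒲 → s.Phi 0 ((r2 ^ n) f) ∈ 𝒲 := by
    intro n f hf
    induction n with
    | zero => simpa using hf
    | succ n ih =>
      have := mulVec_mem_submodule 𝒲 R2_mem ih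
      rwa [s.R2_Phi, zpow_zero, one_smul, ← pow_succ_apply'] at this
  refine Submodule.span_le.2 ?_
  rintro _ ⟨⟨i, j, k⟩, rfl⟩
  change s.wv ν μ i j k g ∈ 𝒲
  by_cases hij : ν ≤ i ∧ μ ≤ j
  swap
  · rw [s.wv_of_not hij]; exact zero_mem _
  have h0 : s.wv ν μ i j 0 g ∈ 𝒲 := by
    rw [wv_apply, std_apply hij.1 hij.2]; exact hr1 _ _ (hr2 _ _ h𝒲)
  by_cases hk0 : k = 0
  · rw [hk0]; exact h0
  by_cases hk1 : k = 1
  · rw [hk1]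
    have := mulVec_mem_submodule 𝒲 R3_mem h0
    rwa [s.R3_wv (by norm_num)] at this
  · rw [wv_apply, s.Phi_eq_zero_of_ne hk0 hk1]; exact zero_mem _

/-- Projecting a nonzero vector of a submodule to a cell yields a standard vector. Lowering by `L3`,
`L1`, `L2`, with coefficients that are nonzero inside the range, then leads down to `g`, which
generates everything. -/
theorem Generates.isSimpleModule (h : s.Generates ν μ ρ g 𝒲) : IsSimpleModule (Halg x H) 𝒲 := by
  have hb := h.bounds
  rw [isSimpleModule_iff_isAtom]
  have hmem0 : s.wv ν μ ν μ 0 g ∈ 𝒲 := by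
    have := s.wv_mem_wspan (ν := ν) (μ := μ) (g := g) ν μ 0
    rwa [← h.span] at this
  refine ⟨?_, ?_⟩
  · intro hbot
    rw [hbot, Submodule.mem_bot, h.wv_eq_zero_iff] at hmem0
    omega
  · intro 𝒰 hlt
    by_contra hne
    apply hlt.not_ge
    obtain ⟨u, hu, hu0⟩ := Submodule.exists_mem_ne_zero_of_ne_bot hne
    obtain ⟨y, hy⟩ := Function.ne_iff.1 hu0
    obtain ⟨i, j, k, hcell, -, -, -⟩ := s.exists_mem_cell y
    have huw : u ∈ s.wspan ν μ g := by rw [← h.span]; exact hlt.le hu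
    obtain ⟨c, hc⟩ := cellE_mulVec_wspan h.mem huw i j k
    have h1 : (cellE x H i j k *ᵥ u) y ≠ 0 := by
      rw [cellE_mulVec_apply, if_pos hcell]; exact hy
    have hc0 : c ≠ 0 := by rintro rfl; rw [hc, zero_smul] at h1; exact h1 rfl
    have hw0 : s.wv ν μ i j k g ≠ 0 := by intro h0; rw [hc, h0, smul_zero] at h1; exact h1 rfl
    have hmem : s.wv ν μ i j k g ∈ 𝒰 := by
      have := smul_mem_submodule 𝒰 c⁻¹ (mulVec_mem_submodule 𝒰 (cellE_mem i j k) hu)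
      rwa [hc, smul_smul, inv_mul_cancel₀ hc0, one_smul] at this
    rw [Ne, h.wv_eq_zero_iff, not_not] at hw0
    have hstep : ∀ {c : ℂ} {v : Pt F D → ℂ}, c ≠ 0 → c • v ∈ 𝒰 → v ∈ 𝒰 := by
      intro c v hc hv
      have := smul_mem_submodule 𝒰 c⁻¹ hv
      rwa [smul_smul, inv_mul_cancel₀ hc, one_smul] at this
    have hk0 : s.wv ν μ i j 0 g ∈ 𝒰 := by
      obtain hk | hk : (k : ℤ) = 0 ∨ (k : ℤ) = 1 := by omega
      · rwa [hk] at hmem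
      · rw [hk] at hmem
        have := mulVec_mem_submodule 𝒰 L3_mem hmem
        rw [s.L3_wv h.mem (by norm_num)] at this
        exact hstep (zpow_ne_zero _ order_ne_zero) this
    have hi : ∀ n : ℕ, ν + n ≤ (D : ℤ) - 1 - ν - ρ → s.wv ν μ (ν + n) j 0 g ∈ 𝒰 →
        s.wv ν μ ν j 0 g ∈ 𝒰 := by
      intro n
      induction n with
      | zero => intro _ h; simpa using h
      | succ n ih =>
        intro hn hmem
        apply ih (by push_cast at hn; omega)
        have := mulVec_mem_submodule 𝒰 L1_mem hmem
        rw [s.L1_wv h.mem, h.finrank_X] at this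
        push_cast at this hn
        rw [show ν + ((n : ℤ) + 1) - 1 = ν + n by ring] at this
        refine hstep (mul_ne_zero (mul_ne_zero (zpow_ne_zero _ order_ne_zero) ?_) ?_) this
        · rw [Ne, gauss1_eq_zero_iff]; omega
        · rw [Ne, gauss1_eq_zero_iff]; omega
    have hj : ∀ n : ℕ, μ + n ≤ (D : ℤ) + 1 - μ + ρ → s.wv ν μ ν (μ + n) 0 g ∈ 𝒰 →
        s.wv ν μ ν μ 0 g ∈ 𝒰 := by
      intro n
      induction n with
      | zero => intro _ h; simpa using h
      | succ n ih =>
        intro hn hmem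
        apply ih (by push_cast at hn; omega)
        have := mulVec_mem_submodule 𝒰 L2_mem hmem
        rw [s.L2_wv h.mem, h.finrank_C] at this
        push_cast at this hn
        rw [show μ + ((n : ℤ) + 1) - 1 = μ + n by ring] at this
        refine hstep (mul_ne_zero (mul_ne_zero (zpow_ne_zero _ order_ne_zero) ?_) ?_) this
        · rw [Ne, gauss1_eq_zero_iff]; omega
        · rw [Ne, gauss1_eq_zero_iff]; omega
    have hi' := hi (i - ν).toNat (by omega) (by rwa [show ν + ((i - ν).toNat : ℤ) = i by omega])
    have hj' := hj (j - μ).toNat (by omega) (by rwa [show μ + ((j - μ).toNat : ℤ) = j by omega])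
    have hfin : s.Phi 0 g ∈ 𝒰 := by rwa [wv_apply, std_self] at hj'
    have := wspan_le_of_Phi_mem (ν := ν) (μ := μ) hfin
    rw [← h.span] at this
    exact this

variable (s) in
/-- Every irreducible module with `τ = 0` is generated by a lowest weight vector. -/
theorem exists_generates (hX : (finrank F X : ℤ) = D - 1) (hC : (finrank F C : ℤ) = D + 1)
    (hs : IsSimpleModule (Halg x H) 𝒲) (hτ : tau 𝒲 = 0) :
    ∃ ν μ ρ g, s.Generates ν μ ρ g 𝒲 := by
  classical
  have hatom := isSimpleModule_iff_isAtom.1 hs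
  have hcell : ∃ i j : ℤ, ∃ f ∈ lev F X C i j, f ≠ 0 ∧ s.Phi 0 f ∈ 𝒲 := by
    have h0 : (0 : ℕ) ∈ {k : ℕ | cut (∑ i ∈ Finset.range D, ∑ j ∈ Finset.range (D + 2),
        cellE x H i j k) (𝒲.restrictScalars ℂ) ≠ ⊥} := by
      -- The infimum is zero also for the empty set; this is impossible, since a nonzero function is
      -- nonzero on some cell.
      rcases Nat.sInf_eq_zero.1 hτ with h0 | h0
      · exact h0
      · exfalso
        obtain ⟨w, hw, hw0⟩ := Submodule.exists_mem_ne_zero_of_ne_bot hatom.1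
        obtain ⟨y, hy⟩ := Function.ne_iff.1 hw0
        obtain ⟨i, j, k, hc, hi, hj, hk⟩ := s.exists_mem_cell y
        have : k ∈ (∅ : Set ℕ) := by
          rw [← h0]
          refine cut_ne_bot_iff.2 ⟨cellE x H i j k *ᵥ w, mulVec_mem_submodule 𝒲
            (cellE_mem i j k) hw, ?_⟩
          have e : (∑ i ∈ Finset.range D, ∑ j ∈ Finset.range (D + 2), cellE x H i j k) *ᵥ
              (cellE x H i j k *ᵥ w) = cellE x H i j k *ᵥ w := by
            refine sum_cellE_eq_self (i := i) (j := j) (k := k) ?_ _ _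
              (fun i j => (i, j, (k : ℤ))) (m₀ := i) (n₀ := j) (by rw [Finset.mem_range]; omega)
              (by rw [Finset.mem_range]; omega) (fun m n => by simp only [Prod.mk.injEq, true_and, and_true]; omega)
            intro y hy
            by_contra h'
            rw [cellE_mulVec_apply, if_neg h'] at hy
            exact hy rfl
          rw [e]
          intro h'
          have := congrFun h' y
          rw [cellE_mulVec_apply, if_pos hc] at this
          exact hy this
        exact this
    obtain ⟨w, hw, hne⟩ := cut_ne_bot_iff.1 h0
    have : ∃ i j : ℕ, cellE x H i j (0 : ℕ) *ᵥ w ≠ 0 := by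
      by_contra! hcon
      apply hne
      rw [sum_mulVec]
      refine Finset.sum_eq_zero fun i _ => ?_
      rw [sum_mulVec]
      exact Finset.sum_eq_zero fun j _ => hcon i j
    obtain ⟨i, j, hij⟩ := this
    obtain ⟨f, hf, hfw⟩ := s.exists_Phi_zero_eq (i := i) (j := j)
        (w := cellE x H i j (0 : ℕ) *ᵥ w) (by
      intro y hy
      by_contra h'
      rw [cellE_mulVec_apply, if_neg (by exact_mod_cast h')] at hy
      exact hy rfl)
    refine ⟨i, j, f, hf, ?_, ?_⟩
    · rintro rfl; rw [map_zero] at hfw; exact hij hfw.symm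
    · rw [hfw]; exact mulVec_mem_submodule 𝒲 (cellE_mem _ _ _) hw
  -- Minimality of `i + j` makes `l1` and `l2` vanish on the whole level `K` of the module, not just
  -- on one vector.
  have hex : ∃ n : ℕ, ∃ i j : ℤ, i + j = n ∧ ∃ f ∈ lev F X C i j, f ≠ 0 ∧ s.Phi 0 f ∈ 𝒲 := by
    obtain ⟨i, j, f, hf, hf0, hfw⟩ := hcell
    have : ¬ (i < 0 ∨ j < 0 ∨ finrank F X < i ∨ finrank F C < j) :=
      fun h => hf0 (eq_zero_of_mem_lev hf h)
    exact ⟨(i + j).toNat, i, j, by omega, f, hf, hf0, hfw⟩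
  obtain ⟨i, j, hij, f₀, hf₀, hf₀0, hf₀w⟩ := Nat.find_spec hex
  have hmin : ∀ i' j' : ℤ, i' + j' < Nat.find hex → ∀ f ∈ lev F X C i' j', s.Phi 0 f ∈ 𝒲 →
      f = 0 := by
    intro i' j' hlt f hf hfw
    by_contra hf0
    have : ¬ (i' < 0 ∨ j' < 0 ∨ finrank F X < i' ∨ finrank F C < j') :=
      fun h => hf0 (eq_zero_of_mem_lev hf h)
    exact Nat.find_min hex (m := (i' + j').toNat) (by omega)
      ⟨i', j', by omega, f, hf, hf0, hfw⟩
  let K : Submodule ℂ (Model F X C) := lev F X C i j ⊓ (𝒲.restrictScalars ℂ).comap (s.Phi 0)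
  have hl1 : ∀ f ∈ K, l1 f = 0 := by
    intro f hf
    refine hmin (i - 1) j (by omega) _ (l1_mem_lev hf.1) ?_
    rw [← s.L1_Phi]; exact mulVec_mem_submodule 𝒲 L1_mem hf.2
  have hl2 : ∀ f ∈ K, l2 f = 0 := by
    intro f hf
    refine hmin i (j - 1) (by omega) _ (l2_mem_lev hf.1) ?_
    rw [← s.L2_Phi]; exact mulVec_mem_submodule 𝒲 L2_mem hf.2
  have hK : ∀ f ∈ K, (l1 ∘ₗ r1) f ∈ K := by
    intro f hf
    refine ⟨?_, ?_⟩
    · have := l1_mem_lev (r1_mem_lev hf.1)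
      rwa [add_sub_cancel_right] at this
    · have h1 := mulVec_mem_submodule 𝒲 R1_mem hf.2
      rw [s.R1_Phi, zpow_zero, one_smul] at h1
      have h2 := mulVec_mem_submodule 𝒲 L1_mem h1
      rwa [s.L1_Phi] at h2
  have : Nontrivial K := ⟨⟨⟨f₀, hf₀, hf₀w⟩, 0, fun h => hf₀0 (congrArg Subtype.val h)⟩⟩
  -- The projections to a fixed rank are not among the generators of the algebra. On `K`, however,
  -- `l1 ∘ r1` multiplies the value at `φ` by an injective function of the rank of `φ`, so any
  -- eigenvector is supported on a single rank.
  obtain ⟨c, hc⟩ := Module.End.exists_eigenvalue ((l1 ∘ₗ r1).restrict hK)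
  obtain ⟨⟨f, hfK⟩, hfc⟩ := hc.exists_hasEigenvector
  have hf0 : f ≠ 0 := fun h => hfc.2 (Subtype.ext h)
  have heig : l1 (r1 f) = c • f := congrArg Subtype.val hfc.apply_eq_smul
  have hpt : ∀ φ A B, f φ A B ≠ 0 → c = order F ^ j *
      (gauss1 (order F) ((finrank F X : ℤ) - finrank F (LinearMap.range φ) - i) -
        gauss1 (order F) i) := by
    intro φ A B hne
    have h1 := l1_r1_sub f (supported_of_mem_lev hfK.1) φ A B
    rw [hl1 f hfK, map_zero, heig] at h1
    obtain ⟨-, h2, h3⟩ := hfK.1 φ A B hne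
    rw [h2, ← zpow_natCast, h3] at h1
    simp only [Pi.smul_apply, smul_eq_mul, Pi.zero_apply, sub_zero] at h1
    exact mul_right_cancel₀ hne h1
  obtain ⟨φ₀, A₀, B₀, hne₀⟩ : ∃ φ A B, f φ A B ≠ 0 := by
    by_contra! hcon
    exact hf0 (by ext φ A B; exact hcon φ A B)
  have hrk : f ∈ rk F X C (finrank F (LinearMap.range φ₀)) := by
    intro φ A B hne
    have h1 := (hpt φ A B hne).symm.trans (hpt φ₀ A₀ B₀ hne₀)
    rw [mul_right_inj' (zpow_ne_zero _ order_ne_zero), sub_left_inj, gauss1_inj] at h1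
    omega
  have hlow : f ∈ Low F X C i j (finrank F (LinearMap.range φ₀)) :=
    mem_Low.2 ⟨hfK.1, hrk, hl1 f hfK, hl2 f hfK⟩
  obtain ⟨𝒲', h𝒲'⟩ := s.exists_generated hlow
  have hgen : s.Generates i j (finrank F (LinearMap.range φ₀)) f 𝒲' := ⟨hX, hC, hlow, hf0, h𝒲'⟩
  have hle : 𝒲' ≤ 𝒲 := by
    have : 𝒲'.restrictScalars ℂ ≤ 𝒲.restrictScalars ℂ := by
      rw [h𝒲']; exact wspan_le_of_Phi_mem hfK.2
    exact this
  have hne : 𝒲' ≠ ⊥ := (isSimpleModule_iff_isAtom.1 hgen.isSimpleModule).1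
  obtain rfl : 𝒲' = 𝒲 := (hatom.le_iff.1 hle).resolve_left hne
  exact ⟨_, _, _, _, hgen⟩

/-- The cell `(ν, μ, 0)` meets the module in a line, so the first vectors are proportional. The
raising relations have nonzero coefficients and carry the same constant to all indices. -/
theorem Generates.exists_eq_smul (h : s.Generates ν μ ρ g 𝒲) {w : ℤ → ℤ → ℤ → Pt F D → ℂ}
    (hw : IsStandardBasis 𝒲 w) :
    ∃ c : ℂ, c ≠ 0 ∧ ∀ i j k, w i j k = c • s.wv ν μ i j k g := by
  have hb := h.bounds
  have h00 : (ν, μ, (0 : ℤ)) ∈ stdIndex 𝒲 := by rw [h.mem_stdIndex_iff]; omega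
  have hne : w ν μ 0 ≠ 0 := hw.linearIndependent.ne_zero (⟨_, h00⟩ : stdIndex 𝒲)
  obtain ⟨u, hu, huw⟩ := mem_cut.1 (hw.mem _ _ _ h00)
  rw [h.span] at hu
  obtain ⟨c, hc⟩ := cellE_mulVec_wspan h.mem hu ν μ 0
  have hw0 : w ν μ 0 = c • s.wv ν μ ν μ 0 g := huw.symm.trans hc
  refine ⟨c, by rintro rfl; rw [zero_smul] at hw0; exact hne hw0, ?_⟩
  have hi : ∀ n : ℕ, ν + n ≤ (D : ℤ) - 1 - ν - ρ →
      w (ν + n) μ 0 = c • s.wv ν μ (ν + n) μ 0 g := by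
    intro n
    induction n with
    | zero => intro _; simpa using hw0
    | succ n ih =>
      intro hn
      push_cast at hn
      have h1 := hw.raise1 (ν + n) μ 0 (by rw [h.mem_stdIndex_iff]; omega)
      rw [ih (by omega), mulVec_smul, s.R1_wv (by omega), zpow_zero, one_smul, one_smul] at h1
      push_cast
      rw [← add_assoc]; exact h1.symm
  have hj : ∀ i : ℤ, ν ≤ i → i ≤ (D : ℤ) - 1 - ν - ρ → ∀ n : ℕ, μ + n ≤ (D : ℤ) + 1 - μ + ρ →
      w i (μ + n) 0 = c • s.wv ν μ i (μ + n) 0 g := by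
    intro i h1 h2 n
    induction n with
    | zero =>
      intro _
      have := hi (i - ν).toNat (by omega)
      rw [show ν + ((i - ν).toNat : ℤ) = i by omega] at this
      simpa using this
    | succ n ih =>
      intro hn
      push_cast at hn
      have h3 := hw.raise2 i (μ + n) 0 (by rw [h.mem_stdIndex_iff]; omega)
      rw [ih (by omega), mulVec_smul, s.R2_wv (by omega), h.nu_eq, smul_comm] at h3
      push_cast
      rw [← add_assoc]
      exact (smul_right_injective _ (zpow_ne_zero _ order_ne_zero) h3).symm
  intro i j k
  by_cases ht : (i, j, k) ∈ stdIndex 𝒲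
  swap
  · rw [hw.zero _ _ _ ht, (h.wv_eq_zero_iff i j k).2, smul_zero]
    rwa [h.mem_stdIndex_iff] at ht
  rw [h.mem_stdIndex_iff] at ht
  have hk0 : w i j 0 = c • s.wv ν μ i j 0 g := by
    have := hj i ht.1 ht.2.1 (j - μ).toNat (by omega)
    rwa [show μ + ((j - μ).toNat : ℤ) = j by omega] at this
  obtain rfl | rfl : k = 0 ∨ k = 1 := by omega
  · exact hk0
  · have h3 := hw.raise3 i j 0 (by rw [h.mem_stdIndex_iff]; omega)
    rw [hk0, mulVec_smul, s.R3_wv (by norm_num)] at h3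
    exact h3.symm

end Splitting

end Generated

end

end TwistedGrassmann

namespace TwistedGrassmann

noncomputable section

set_option linter.unusedSectionVars false

open Module Matrix

/-! ### The adjacency matrix in terms of the raising and lowering matrices -/

section Adjacency

variable {F : Type*} [Field F] [Fintype F] {D : ℕ} {x H : Pt F D}
  {X : Type*} [AddCommGroup X] [Module F X] [Finite X]
  {C : Type*} [AddCommGroup C] [Module F C] [Finite C]

theorem kk_mono {y z : Pt F D} (h : y ≤ z) : kk H y ≤ kk H z := by
  have h1 := finrank_sup_inf (H ⊓ z) y
  have h2 : H ⊓ z ⊓ y = H ⊓ y := by rw [inf_assoc, inf_eq_right.2 h]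
  rw [h2] at h1
  have h3 := finrank_mono' (sup_le (inf_le_right : H ⊓ z ≤ z) h)
  unfold kk; omega

open Classical in
/-- The `0`-`1` matrix of the covering relation. -/
def coverMatrix : Matrix (Pt F D) (Pt F D) ℂ := Matrix.of fun y z => if Cov y z then 1 else 0

namespace Splitting

variable (s : Splitting x H X C)

include s in
open Classical in
-- A cover with the same codimension over `H` enlarges the trace by one dimension. As `lo` and `hi`
-- are monotone, exactly one of them grows.
theorem L1_add_L2_apply (y z : Pt F D) : (L1 x H + L2 x H) y z =
    if Cov y z ∧ kk H z = kk H y then 1 else 0 := by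
  rw [Matrix.add_apply, L1, L2, s.lower_apply, s.lower_apply]
  by_cases hle : y ≤ z
  swap
  · rw [if_neg (fun h => hle h.1), if_neg (fun h => hle h.1), if_neg (fun h => hle h.1.1), add_zero]
  have h1 : finrank F (lo (s.pull y)) ≤ finrank F (lo (s.pull z)) :=
    finrank_mono' (Submodule.comap_mono (s.pull_mono hle))
  have h2 : finrank F (hi (s.pull y)) ≤ finrank F (hi (s.pull z)) :=
    finrank_mono' (Submodule.map_mono (s.pull_mono hle))
  have h3 := s.finrank_eq y
  have h4 := s.finrank_eq z
  have h5 := finrank_eq_lo_add_hi (s.pull y)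
  have h6 := finrank_eq_lo_add_hi (s.pull z)
  have h7 : Cov y z ↔ finrank F z = finrank F y + 1 := and_iff_right hle
  simp only [h7, hle, true_and]
  split_ifs <;> first | omega | simp

include s in
open Classical in
theorem L3_apply (y z : Pt F D) : L3 x H y z =
    if Cov y z ∧ kk H z = kk H y + 1 then 1 else 0 := by
  rw [L3, s.lower_apply]
  by_cases hle : y ≤ z
  swap
  · rw [if_neg (fun h => hle h.1), if_neg (fun h => hle h.1.1)]
  have h1 : finrank F (lo (s.pull y)) ≤ finrank F (lo (s.pull z)) :=
    finrank_mono' (Submodule.comap_mono (s.pull_mono hle))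
  have h2 : finrank F (hi (s.pull y)) ≤ finrank F (hi (s.pull z)) :=
    finrank_mono' (Submodule.map_mono (s.pull_mono hle))
  have h3 := s.finrank_eq y
  have h4 := s.finrank_eq z
  have h5 := finrank_eq_lo_add_hi (s.pull y)
  have h6 := finrank_eq_lo_add_hi (s.pull z)
  have h7 : Cov y z ↔ finrank F z = finrank F y + 1 := and_iff_right hle
  simp only [h7, hle, true_and]
  split_ifs <;> first | omega | simp

include s in
theorem sum_lower : L1 x H + L2 x H + L3 x H = coverMatrix := by
  classical
  ext y z
  rw [Matrix.add_apply, s.L1_add_L2_apply, s.L3_apply, coverMatrix, Matrix.of_apply]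
  by_cases hc : Cov y z
  · have h1 := kk_mono (H := H) hc.1
    have h2 := finrank_mono' (s.pull_mono hc.1)
    have h3 := s.finrank_eq y
    have h4 := s.finrank_eq z
    have h5 := hc.2
    simp only [hc, true_and]
    split_ifs <;> first | omega | simp
  · simp [hc]

include s in
theorem transpose_lower (α β γ : ℤ) : (lower x H α β γ)ᵀ = raise x H α β γ := by
  classical
  ext y z
  rw [Matrix.transpose_apply, s.lower_apply, s.raise_apply]

include s in
theorem sum_raise : R1 x H + R2 x H + R3 x H = coverMatrixᵀ := by
  rw [← s.sum_lower, L1, L2, L3, R1, R2, R3, Matrix.transpose_add, Matrix.transpose_add,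
    s.transpose_lower, s.transpose_lower, s.transpose_lower]

end Splitting

open Classical in
/-- The `0`-`1` matrix of adjacency. -/
def nearMatrix : Matrix (Pt F D) (Pt F D) ℂ := Matrix.of fun y z =>
  if (finrank F y : ℤ) + finrank F z - 2 * finrank F ↥(y ⊓ z) = 2 then 1 else 0

open Classical in
-- Distinct subspaces of equal dimension have a common cover exactly when they are adjacent, and
-- then only one; the diagonal counts covers. The next lemma does the same with cocovers.
theorem coverMatrix_mul_apply {y z : Pt F D} (h : finrank F y = finrank F z) :
    (coverMatrix * coverMatrixᵀ : Matrix (Pt F D) (Pt F D) ℂ) y z = nearMatrix y z +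
      if y = z then gauss1 (order F) (2 * (D : ℤ) + 1 - finrank F y) else 0 := by
  have e : (coverMatrix * coverMatrixᵀ : Matrix (Pt F D) (Pt F D) ℂ) y z =
      ((Finset.univ.filter fun B => Cov y B ∧ Cov z B).card : ℂ) := by
    rw [Matrix.mul_apply, Finset.card_filter, Nat.cast_sum]
    refine Finset.sum_congr rfl fun B _ => ?_
    simp only [coverMatrix, Matrix.transpose_apply, Matrix.of_apply]
    by_cases h1 : Cov y B <;> by_cases h2 : Cov z B <;> simp [h1, h2]
  rw [e, nearMatrix, Matrix.of_apply]
  by_cases hyz : y = z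
  · subst hyz
    rw [if_pos rfl, if_neg (by rw [inf_idem]; omega), zero_add]
    have := card_covers (le_top : y ≤ ⊤)
    rw [finrank_top, Module.finrank_fin_fun] at this
    simp only [and_self]
    simp only [le_top, and_true] at this
    rw [this]; push_cast; rfl
  · rw [if_neg hyz, add_zero]
    simp only [cov_cov_iff hyz]
    split_ifs with h1
    · rw [Finset.card_eq_one.2 ⟨y ⊔ z, ?_⟩, Nat.cast_one]
      ext B
      simp only [Finset.mem_filter, Finset.mem_univ, true_and, Finset.mem_singleton]
      exact ⟨fun h => h.1, fun h' => ⟨h', h, by omega⟩⟩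
    · rw [Finset.card_eq_zero.2, Nat.cast_zero]
      rw [Finset.filter_eq_empty_iff]
      rintro B - ⟨-, -, h2⟩
      omega

open Classical in
theorem coverMatrix_transpose_mul_apply {y z : Pt F D} (h : finrank F y = finrank F z) :
    (coverMatrixᵀ * coverMatrix : Matrix (Pt F D) (Pt F D) ℂ) y z = nearMatrix y z +
      if y = z then gauss1 (order F) (finrank F y) else 0 := by
  have e : (coverMatrixᵀ * coverMatrix : Matrix (Pt F D) (Pt F D) ℂ) y z =
      ((Finset.univ.filter fun B => Cov B y ∧ Cov B z).card : ℂ) := by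
    rw [Matrix.mul_apply, Finset.card_filter, Nat.cast_sum]
    refine Finset.sum_congr rfl fun B _ => ?_
    simp only [coverMatrix, Matrix.transpose_apply, Matrix.of_apply]
    by_cases h1 : Cov B y <;> by_cases h2 : Cov B z <;> simp [h1, h2]
  rw [e, nearMatrix, Matrix.of_apply]
  by_cases hyz : y = z
  · subst hyz
    rw [if_pos rfl, if_neg (by rw [inf_idem]; omega), zero_add]
    have := card_cocovers (bot_le : ⊥ ≤ y)
    rw [finrank_bot] at this
    simp only [and_self]
    simp only [bot_le, and_true] at this
    rw [this]; simp
  · rw [if_neg hyz, add_zero]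
    simp only [cocov_cocov_iff hyz]
    split_ifs with h1
    · rw [Finset.card_eq_one.2 ⟨y ⊓ z, ?_⟩, Nat.cast_one]
      ext B
      simp only [Finset.mem_filter, Finset.mem_univ, true_and, Finset.mem_singleton]
      exact ⟨fun h => h.1, fun h' => ⟨h', h, by omega⟩⟩
    · rw [Finset.card_eq_zero.2, Nat.cast_zero]
      rw [Finset.filter_eq_empty_iff]
      rintro B - ⟨-, -, h2⟩
      omega

theorem nearMatrix_transpose : (nearMatrix : Matrix (Pt F D) (Pt F D) ℂ)ᵀ = nearMatrix := by
  ext y z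
  simp only [nearMatrix, Matrix.transpose_apply, Matrix.of_apply]
  rw [inf_comm, add_comm (finrank F z : ℤ)]

theorem kk_eq_one_of_mem_X1 (s : Splitting x H X C) {y : Pt F D} (hy : y ∈ X1 H) :
    kk H y = 1 := by
  have h1 := kk_nonneg (H := H) y
  have h2 := s.kk_le_one y
  have h3 : kk H y ≠ 0 := fun h => hy.2 (kk_eq_zero_iff.1 h)
  omega

theorem kk_eq_zero_of_mem_X2 {y : Pt F D} (hy : y ∈ X2 H) : kk H y = 0 := kk_eq_zero_iff.2 hy.2

/-- Here adjacency means `z ≤ y`. Taking the step out of `H` last makes the intermediate subspace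
unique, namely `H ⊓ y`, so no multiplicity arises. -/
theorem Splitting.R3_mul_apply (s : Splitting x H X C) (hD : 2 ≤ D) {y z : Pt F D}
    (hy : y ∈ X1 H) (hz : z ∈ X2 H) :
    (R3 x H * (R1 x H + R2 x H)) y z = nearMatrix y z := by
  classical
  have hky := kk_eq_one_of_mem_X1 s hy
  have hkz := kk_eq_zero_of_mem_X2 hz
  have hr3 : ∀ u, R3 x H y u = L3 x H u y := fun u => by
    rw [R3, ← s.transpose_lower, L3, Matrix.transpose_apply]
  have hr12 : ∀ u, (R1 x H + R2 x H) u z = (L1 x H + L2 x H) z u := fun u => by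
    rw [R1, R2, ← s.transpose_lower, ← s.transpose_lower, L1, L2]; rfl
  have hy1 := hy.1
  have hz1 := hz.1
  have hHy : finrank F ↥(H ⊓ y) = D := by unfold kk at hky; omega
  rw [Matrix.mul_apply, Finset.sum_eq_single (H ⊓ y)]
  · rw [hr3, hr12, s.L3_apply, s.L1_add_L2_apply, nearMatrix, Matrix.of_apply,
      if_pos ⟨⟨inf_le_right, by omega⟩, by rw [hky, kk_eq_zero_iff.2 inf_le_left]; norm_num⟩,
      one_mul]
    refine if_congr ?_ rfl rfl
    rw [hkz, kk_eq_zero_iff.2 inf_le_left, and_iff_left rfl]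
    constructor
    · intro h
      rw [inf_eq_right.2 (h.1.trans inf_le_right)]; omega
    · intro h
      have : y ⊓ z = z := eq_of_le_of_finrank_le' inf_le_right (by omega)
      exact ⟨le_inf hz.2 (inf_eq_right.1 this), by omega⟩
  · intro u _ hu
    rw [hr3, s.L3_apply, if_neg, zero_mul]
    rintro ⟨h1, h2⟩
    refine hu (eq_of_le_of_finrank_le' (le_inf (kk_eq_zero_iff.1 (by omega)) h1.1) ?_)
    have := h1.2; omega
  · exact fun h => absurd (Finset.mem_univ _) h

theorem Splitting.mul_L3_apply (s : Splitting x H X C) (hD : 2 ≤ D) {y z : Pt F D}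
    (hy : y ∈ X2 H) (hz : z ∈ X1 H) :
    ((L1 x H + L2 x H) * L3 x H) y z = nearMatrix y z := by
  have := s.R3_mul_apply hD hz hy
  rw [← nearMatrix_transpose, Matrix.transpose_apply, ← this, ← Matrix.transpose_apply
    (R3 x H * (R1 x H + R2 x H)), Matrix.transpose_mul, Matrix.transpose_add, R1, R2, R3,
    ← s.transpose_lower, ← s.transpose_lower, ← s.transpose_lower]
  rfl

/-- Restriction of functions on `P̃` to the vertices. -/
def res (H : Pt F D) : (Pt F D → ℂ) →ₗ[ℂ] (Vertex H → ℂ) :=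
  LinearMap.funLeft ℂ ℂ (fun v : Vertex H => v.1)

theorem res_apply (u : Pt F D → ℂ) (v : Vertex H) : res H u v = u v.1 := rfl

open Classical in
theorem sum_vertex (f : Pt F D → ℂ) (hf : ∀ z, f z ≠ 0 → z ∈ X1 H ∪ X2 H) :
    ∑ v : Vertex H, f v.1 = ∑ z, f z := by
  rw [← Finset.sum_subset (Finset.subset_univ (Finset.univ.filter (· ∈ X1 H ∪ X2 H)))]
  · exact (@Finset.sum_subtype _ _ _ _ (instFintypeVertex H) _ (fun z => by simp) f).symm
  · intro z _ hz
    by_contra h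
    exact hz (Finset.mem_filter.2 ⟨Finset.mem_univ _, hf z h⟩)

theorem adj_mulVec_res {u : Pt F D → ℂ} (hu : ∀ z, u z ≠ 0 → z ∈ X1 H ∪ X2 H) (y : Vertex H) :
    (adj H *ᵥ res H u) y = (nearMatrix *ᵥ u) y.1 := by
  classical
  rw [Matrix.mulVec, dotProduct, Matrix.mulVec, dotProduct,
    ← sum_vertex (H := H) (fun z => nearMatrix y.1 z * u z) (fun z hz => hu z (right_ne_zero_of_mul hz))]
  refine Finset.sum_congr rfl fun z _ => ?_
  rw [res_apply, adj, SimpleGraph.adjMatrix_apply, nearMatrix, Matrix.of_apply]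
  exact congrArg (· * u z.1) (if_congr Iff.rfl rfl rfl)

theorem mulVec_congr_of_support {n : Type*} [Fintype n] {M N : Matrix n n ℂ} {u : n → ℂ} {y : n}
    (h : ∀ z, u z ≠ 0 → M y z = N y z) : (M *ᵥ u) y = (N *ᵥ u) y := by
  rw [Matrix.mulVec, dotProduct, Matrix.mulVec, dotProduct]
  refine Finset.sum_congr rfl fun z _ => ?_
  by_cases hz : u z = 0
  · simp [hz]
  · rw [h z hz]

/-- The product formulas are valid only for particular pairs of dimensions, so the two halves of the
vector are treated separately: neighbours in `X1` through common cocovers, with the `[D + 1]`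
cocovers of the vertex itself removed, and neighbours in `X2` through `R3_mul_apply`. -/
theorem Splitting.adj_mulVec_of_mem_X1 (s : Splitting x H X C) (hD : 2 ≤ D) {u₀ u₁ : Pt F D → ℂ}
    (h₀ : ∀ z, u₀ z ≠ 0 → z ∈ X2 H) (h₁ : ∀ z, u₁ z ≠ 0 → z ∈ X1 H) {y : Vertex H}
    (hy : y.1 ∈ X1 H) :
    (adj H *ᵥ res H (u₁ + u₀)) y =
      ((R1 x H + R2 x H + R3 x H) *ᵥ ((L1 x H + L2 x H + L3 x H) *ᵥ u₁) -
        gauss1 (order F) (D + 1) • u₁ + R3 x H *ᵥ ((R1 x H + R2 x H) *ᵥ u₀)) y.1 := by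
  classical
  rw [adj_mulVec_res, Matrix.mulVec_add, Pi.add_apply, Pi.add_apply, Matrix.mulVec_mulVec,
    Matrix.mulVec_mulVec, s.sum_lower, s.sum_raise,
    mulVec_congr_of_support (u := u₀) (N := R3 x H * (R1 x H + R2 x H))
      (fun z hz => (s.R3_mul_apply hD hy (h₀ z hz)).symm),
    mulVec_congr_of_support (u := u₁) (N := coverMatrixᵀ * coverMatrix -
      gauss1 (order F) (D + 1) • (1 : Matrix (Pt F D) (Pt F D) ℂ)) ?_]
  · rw [Matrix.sub_mulVec, Matrix.smul_mulVec, Matrix.one_mulVec]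
  · intro z hz
    have h1 := hy.1
    rw [Matrix.sub_apply, coverMatrix_transpose_mul_apply (h1.trans (h₁ z hz).1.symm), h1,
      Matrix.smul_apply, Matrix.one_apply]
    split_ifs <;> push_cast <;> simp
  · intro z hz
    by_cases h : u₁ z = 0
    · exact Or.inr (h₀ z (by simpa [h] using hz))
    · exact Or.inl (h₁ z h)

theorem Splitting.adj_mulVec_of_mem_X2 (s : Splitting x H X C) (hD : 2 ≤ D) {u₀ u₁ : Pt F D → ℂ}
    (h₀ : ∀ z, u₀ z ≠ 0 → z ∈ X2 H) (h₁ : ∀ z, u₁ z ≠ 0 → z ∈ X1 H) {y : Vertex H}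
    (hy : y.1 ∈ X2 H) :
    (adj H *ᵥ res H (u₁ + u₀)) y =
      ((L1 x H + L2 x H) *ᵥ (L3 x H *ᵥ u₁) + ((L1 x H + L2 x H + L3 x H) *ᵥ
        ((R1 x H + R2 x H + R3 x H) *ᵥ u₀) - gauss1 (order F) (D + 2) • u₀)) y.1 := by
  classical
  rw [adj_mulVec_res, Matrix.mulVec_add, Pi.add_apply, Pi.add_apply, Matrix.mulVec_mulVec,
    Matrix.mulVec_mulVec, s.sum_lower, s.sum_raise,
    mulVec_congr_of_support (u := u₁) (N := (L1 x H + L2 x H) * L3 x H)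
      (fun z hz => (s.mul_L3_apply hD hy (h₁ z hz)).symm),
    mulVec_congr_of_support (u := u₀) (N := coverMatrix * coverMatrixᵀ -
      gauss1 (order F) (D + 2) • (1 : Matrix (Pt F D) (Pt F D) ℂ)) ?_]
  · rw [Matrix.sub_mulVec, Matrix.smul_mulVec, Matrix.one_mulVec]
  · intro z hz
    have h1 := hy.1
    rw [Matrix.sub_apply, coverMatrix_mul_apply (h1.trans (h₀ z hz).1.symm), h1,
      Matrix.smul_apply, Matrix.one_apply,
      show 2 * (D : ℤ) + 1 - ((D - 1 : ℕ) : ℤ) = D + 2 by omega]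
    split_ifs <;> simp
  · intro z hz
    by_cases h : u₁ z = 0
    · exact Or.inr (h₀ z (by simpa [h] using hz))
    · exact Or.inl (h₁ z h)

end Adjacency

end

end TwistedGrassmann

namespace TwistedGrassmann

noncomputable section

set_option linter.unusedSectionVars false

open Module Matrix

/-! ### The distance from the base vertex -/

section Distance

variable {F : Type*} [Field F] [Fintype F] {D : ℕ} {H : Pt F D}

/-- Twice the distance in the covering graph, made explicit. -/
def gap (y z : Pt F D) : ℤ := (finrank F y : ℤ) + finrank F z - 2 * finrank F ↥(y ⊓ z)

theorem gap_triangle (y z w : Pt F D) : gap y w ≤ gap y z + gap z w := by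
  have h1 := finrank_sup_inf (y ⊓ z) (z ⊓ w)
  have h2 := finrank_mono' (sup_le (inf_le_right : y ⊓ z ≤ z) (inf_le_left : z ⊓ w ≤ z))
  have h3 : finrank F ↥(y ⊓ z ⊓ (z ⊓ w)) ≤ finrank F ↥(y ⊓ w) :=
    finrank_mono' (inf_le_inf inf_le_left inf_le_right)
  unfold gap; omega

theorem gap_le_of_walk {y z : Vertex H} (p : (graph H).Walk y z) :
    gap y.1 z.1 ≤ 2 * p.length := by
  induction p with
  | nil => unfold gap; rw [inf_idem]; simp; omega
  | @cons u v w h p ih =>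
    have h1 := gap_triangle u.1 v.1 w.1
    have h2 : gap u.1 v.1 = 2 := h
    rw [SimpleGraph.Walk.length_cons]
    push_cast
    omega

theorem exists_cocover {A P : Pt F D} (h : P < A) : ∃ B, Cov B A ∧ P ≤ B := by
  classical
  have h1 := card_cocovers h.le
  by_contra! hne
  rw [Finset.card_eq_zero.2 (Finset.filter_eq_empty_iff.2 fun B _ hB => hne B hB.1 hB.2),
    Nat.cast_zero, eq_comm, gauss1_eq_zero_iff] at h1
  exact h.ne (eq_of_le_of_finrank_le' h.le (by omega))

/-- Replace `y` by `y₀ + ⟨a⟩`, where `y₀ ≥ P` has codimension one in `y` and `a` lies in `x` but not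
in `y`. The intersection with `x` gains `a` and loses nothing, as `x ⊓ y ≤ P`. -/
theorem exists_exchange {x y P : Pt F D} (hP : x ⊓ y ≤ P) (hPy : P < y) (hxy : ¬ x ≤ y) :
    ∃ z : Pt F D, finrank F z = finrank F y ∧ P ≤ z ∧ z ≤ y ⊔ x ∧ gap y z = 2 ∧
      gap x z ≤ gap x y - 2 := by
  obtain ⟨y₀, hy₀, hPy₀⟩ := exists_cocover hPy
  obtain ⟨a, hax, hay⟩ := SetLike.not_le_iff_exists.1 hxy
  have ha0 : a ∉ y₀ := fun h => hay (hy₀.1 h)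
  have hz := finrank_sup_span_singleton ha0
  have ha : a ∈ y₀ ⊔ Submodule.span F {a} :=
    Submodule.mem_sup_right (Submodule.mem_span_singleton_self a)
  have e1 : y ⊓ (y₀ ⊔ Submodule.span F {a}) = y₀ := by
    symm
    apply eq_of_le_of_finrank_le' (le_inf hy₀.1 le_sup_left)
    have h1 := finrank_mono' (inf_le_right : y ⊓ (y₀ ⊔ Submodule.span F {a}) ≤ _)
    by_contra! hlt
    have h2 := eq_of_le_of_finrank_le'
      (inf_le_right : y ⊓ (y₀ ⊔ Submodule.span F {a}) ≤ _) (by omega)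
    rw [← h2] at ha
    exact hay ha.1
  have h3 := hy₀.2
  have h4 : (x ⊓ y) ⊔ Submodule.span F {a} ≤ x ⊓ (y₀ ⊔ Submodule.span F {a}) :=
    sup_le (le_inf inf_le_left ((hP.trans hPy₀).trans le_sup_left))
      ((Submodule.span_singleton_le_iff_mem _ _).2 (Submodule.mem_inf.2 ⟨hax, ha⟩))
  have h5 := finrank_mono' h4
  rw [finrank_sup_span_singleton (fun h => hay (Submodule.mem_inf.1 h).2)] at h5
  refine ⟨y₀ ⊔ Submodule.span F {a}, by omega, hPy₀.trans le_sup_left, ?_, ?_, ?_⟩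
  · exact sup_le (hy₀.1.trans le_sup_left) (by simpa using Submodule.mem_sup_right hax)
  · unfold gap; rw [e1]; omega
  · unfold gap; omega

/-- One exchange suffices, the point being to remain in the vertex set. For `y` outside `H` a vector
of `y` not in `H` is protected by putting it into `P`; for `y ≤ H` the new subspace lies in `y ⊔ x ≤
H`. If `x ≤ y` and `y` is in `X1`, the two are already adjacent. -/
theorem exists_closer (hD : 2 ≤ D) {x y : Vertex H} (hx : x.1 ∈ X2 H) (hne : gap x.1 y.1 ≠ 0) :
    ∃ z : Vertex H, (graph H).Adj z y ∧ gap x.1 z.1 ≤ gap x.1 y.1 - 2 := by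
  have hx1 := hx.1
  rcases y.2 with hy | hy
  · have hy1 := hy.1
    by_cases hxy : x.1 ≤ y.1
    · refine ⟨x, ?_, ?_⟩
      · change (finrank F x.1 : ℤ) + finrank F y.1 - 2 * finrank F ↥(x.1 ⊓ y.1) = 2
        rw [inf_eq_left.2 hxy]; omega
      · unfold gap; rw [inf_eq_left.2 hxy, inf_idem]; omega
    · obtain ⟨t, hty, htH⟩ := SetLike.not_le_iff_exists.1 hy.2
      have h1 := finrank_mono' (inf_le_left : x.1 ⊓ y.1 ≤ x.1)
      have h2 : finrank F ↥(x.1 ⊓ y.1 ⊔ Submodule.span F {t}) = finrank F ↥(x.1 ⊓ y.1) + 1 :=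
        finrank_sup_span_singleton (fun h => htH (hx.2 h.1))
      obtain ⟨z, hz1, hz2, -, hz3, hz4⟩ := exists_exchange (x := x.1) (y := y.1)
        (P := x.1 ⊓ y.1 ⊔ Submodule.span F {t}) le_sup_left (lt_of_le_of_ne
          (sup_le inf_le_right (by simpa using hty)) (fun h => by rw [h] at h2; omega)) hxy
      refine ⟨⟨z, Or.inl ⟨by omega, fun h => htH (h (hz2 (Submodule.mem_sup_right
        (Submodule.mem_span_singleton_self t))))⟩⟩, ?_, hz4⟩
      exact SimpleGraph.Adj.symm (show (graph H).Adj y _ from hz3)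
  · have hy1 := hy.1
    have hxy : ¬ x.1 ≤ y.1 := fun h => hne (by
      unfold gap; rw [inf_eq_left.2 h]; omega)
    obtain ⟨z, hz1, hz2, hz5, hz3, hz4⟩ := exists_exchange (x := x.1) (y := y.1)
      (P := x.1 ⊓ y.1) le_rfl (lt_of_le_of_ne inf_le_right (fun h => by
        have := eq_of_le_of_finrank_le' (inf_eq_right.1 h) (by omega)
        exact hxy this.symm.le)) hxy
    refine ⟨⟨z, Or.inr ⟨by omega, hz5.trans (sup_le hy.2 hx.2)⟩⟩, ?_, hz4⟩
    exact SimpleGraph.Adj.symm (show (graph H).Adj y _ from hz3)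

theorem exists_walk_of_gap (hD : 2 ≤ D) {x : Vertex H} (hx : x.1 ∈ X2 H) (n : ℕ) :
    ∀ y : Vertex H, gap x.1 y.1 ≤ 2 * n → ∃ p : (graph H).Walk x y, p.length ≤ n := by
  induction n with
  | zero =>
    intro y hy
    have h1 := finrank_mono' (inf_le_left : x.1 ⊓ y.1 ≤ x.1)
    have h2 := finrank_mono' (inf_le_right : x.1 ⊓ y.1 ≤ y.1)
    unfold gap at hy
    have h3 := eq_of_le_of_finrank_le' (inf_le_left : x.1 ⊓ y.1 ≤ x.1) (by omega)
    have h4 := eq_of_le_of_finrank_le' (inf_le_right : x.1 ⊓ y.1 ≤ y.1) (by omega)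
    obtain rfl : x = y := Subtype.ext (h3.symm.trans h4)
    exact ⟨.nil, le_rfl⟩
  | succ n ih =>
    intro y hy
    by_cases h0 : gap x.1 y.1 = 0
    · obtain ⟨p, hp⟩ := ih y (by omega)
      exact ⟨p, by omega⟩
    · obtain ⟨z, hz, hgap⟩ := exists_closer hD hx h0
      obtain ⟨p, hp⟩ := ih z (by push_cast at hy; omega)
      exact ⟨p.concat hz, by rw [SimpleGraph.Walk.length_concat]; omega⟩

/-- An edge changes the gap by at most two, by the triangle inequality, and `exists_closer` provides
a walk on which every step lowers it by two. -/
theorem two_mul_dist (hD : 2 ≤ D) {x : Vertex H} (hx : x.1 ∈ X2 H) (y : Vertex H) :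
    2 * ((graph H).dist x y : ℤ) = gap x.1 y.1 := by
  have hx1 := hx.1
  have heven : ∃ n : ℕ, gap x.1 y.1 = 2 * n := by
    have h1 := finrank_mono' (inf_le_left : x.1 ⊓ y.1 ≤ x.1)
    have h2 := finrank_mono' (inf_le_right : x.1 ⊓ y.1 ≤ y.1)
    rcases y.2 with hy | hy
    · have hy1 := hy.1
      exact ⟨D - finrank F ↥(x.1 ⊓ y.1), by unfold gap; omega⟩
    · have hy1 := hy.1
      exact ⟨D - 1 - finrank F ↥(x.1 ⊓ y.1), by unfold gap; omega⟩
  obtain ⟨n, hn⟩ := heven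
  obtain ⟨p, hp⟩ := exists_walk_of_gap hD hx n y hn.le
  obtain ⟨p', hp'⟩ := SimpleGraph.Reachable.exists_walk_length_eq_dist ⟨p⟩
  have h1 := gap_le_of_walk p'
  have h2 := SimpleGraph.dist_le p
  omega

theorem dist_of_mem_cell (hD : 2 ≤ D) {x : Vertex H} (hx : x.1 ∈ X2 H) {y : Vertex H} {i j k : ℤ}
    (hy : y.1 ∈ cell x.1 H i j k) :
    2 * ((graph H).dist x y : ℤ) = (D : ℤ) - 1 + j + k - i := by
  rw [two_mul_dist hD hx]
  have hx1 := hx.1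
  obtain ⟨h1, h2, h3⟩ := hy
  unfold gap; omega

end Distance

/-! ### The vectors of the modules of type one -/

section TypeOneVectors

variable {F : Type*} [Field F] [Fintype F] {D : ℕ} {H : Pt F D}
  {X : Type*} [AddCommGroup X] [Module F X] [Finite X]
  {C : Type*} [AddCommGroup C] [Module F C] [Finite C]

theorem mem_X1_of_mem_cell {x y : Pt F D} {i j : ℤ} (h : y ∈ cell x H i j 1) (hij : i + j = D) :
    y ∈ X1 H := by
  obtain ⟨h1, h2, h3⟩ := h
  refine ⟨by omega, fun h => ?_⟩
  rw [inf_eq_right.2 h] at h2; omega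

theorem mem_X2_of_mem_cell (hD : 2 ≤ D) {x y : Pt F D} {i j : ℤ} (h : y ∈ cell x H i j 0)
    (hij : i + j = D - 1) : y ∈ X2 H := by
  obtain ⟨h1, h2, h3⟩ := h
  refine ⟨by omega, inf_eq_right.1 (eq_of_le_of_finrank_le' inf_le_right (by omega))⟩

/-- The coefficient `q^{ν+i}[D-ν-i]`. -/
def cc (q : ℂ) (D : ℕ) (ν i : ℤ) : ℂ := q ^ (ν + i) * gauss1 q (D - ν - i)

/-- The coefficient of `L₂` on the standard vectors. -/
def bb (q : ℂ) (D : ℕ) (ν μ ρ i : ℤ) : ℂ :=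
  q ^ ((D : ℤ) - 1 - ν + μ - ρ) * gauss1 q ((D : ℤ) + 2 - μ + ρ - i) * gauss1 q (i - μ)

/-- The coefficient of the next vector in the action of `A`. -/
def coefU (q : ℂ) (D : ℕ) (ν ρ i : ℤ) : ℂ :=
  q ^ (ν - D + 1 + i) * cc q D ν i * gauss1 q (i + 1 - ν - ρ)

/-- The diagonal coefficient in the action of `A`. -/
def coefA (q : ℂ) (D : ℕ) (ν μ ρ i : ℤ) : ℂ :=
  cc q D ν i - gauss1 q D + q * cc q D ν i * gauss1 q (i - ν - ρ) +
    q ^ (1 + ν - D + i) * bb q D ν μ ρ i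

variable {x : Pt F D} (s : Splitting x H X C)

/-- The vector `w_i` built from the standard vectors, as a function on `P̃`. -/
def Splitting.om (ν μ i : ℤ) : Model F X C →ₗ[ℂ] (Pt F D → ℂ) :=
  s.wv ν μ (D - i) i 1 + cc (order F) D ν i • s.wv ν μ (D - i - 1) i 0

/-- The vector `w_i` as a function on the vertices. -/
def Splitting.omv (ν μ i : ℤ) : Model F X C →ₗ[ℂ] (Vertex H → ℂ) := res H ∘ₗ s.om ν μ i

variable {s} {ν μ ρ : ℤ} {g : Model F X C}

theorem Splitting.om_apply (s : Splitting x H X C) (ν μ i : ℤ) (g : Model F X C) :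
    s.om ν μ i g = s.wv ν μ (D - i) i 1 g + cc (order F) D ν i • s.wv ν μ (D - i - 1) i 0 g := rfl

/-! ### The tridiagonal action of `A` on the vectors `w_i`. -/

section Action

theorem zpow_congr {q : ℂ} {m n : ℤ} (h : m = n) : q ^ m = q ^ n := by rw [h]

/-- The diagonal coefficient as it arises on `X2`, in agreement with the one found on `X1` in
`coefA_eq`. This agreement, and the recursion `cc_add` for the lower neighbour, explain the choice
of the coefficient `cc` in `w_i`. -/
theorem coef_identity {q : ℂ} (hq : q ≠ 0) (h1 : 1 - q ≠ 0) (D : ℕ) (ν μ ρ i : ℤ) :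
    cc q D ν i * gauss1 q (i - ν - ρ) + q ^ (ν - D + 1 + i) * bb q D ν μ ρ (i + 1) -
      gauss1 q (D + 1) + q ^ (D : ℤ) * gauss1 q (i - ν - ρ) = coefA q D ν μ ρ i := by
  unfold coefA cc bb gauss1
  simp only [show (D : ℤ) + 2 - μ + ρ - (i + 1) = D + 1 - μ + ρ - i by ring,
    show (D : ℤ) + 2 - μ + ρ - i = D + 1 + 1 - μ + ρ - i by ring,
    zpow_sub₀ hq, zpow_add₀ hq, zpow_one]
  have := zpow_ne_zero ν hq
  have := zpow_ne_zero μ hq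
  have := zpow_ne_zero ρ hq
  have := zpow_ne_zero i hq
  have := zpow_ne_zero (D : ℤ) hq
  field_simp
  ring

theorem coefA_eq {q : ℂ} (hq : q ≠ 0) (h1 : 1 - q ≠ 0) (D : ℕ) (ν μ ρ i : ℤ) :
    cc q D ν i * gauss1 q (i - ν - ρ) * q + bb q D ν μ ρ i * q ^ (ν - (D - i) + 1) +
      q ^ (D : ℤ) + cc q D ν i - gauss1 q (D + 1) = coefA q D ν μ ρ i := by
  unfold coefA gauss1
  rw [show ν - ((D : ℤ) - i) + 1 = 1 + ν - D + i by ring]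
  simp only [zpow_add₀ hq, zpow_one]
  field_simp
  ring

theorem coefU_eq {q : ℂ} (hq : q ≠ 0) (h1 : 1 - q ≠ 0) (D : ℕ) (ν ρ i : ℤ) :
    cc q D ν i * gauss1 q (i - ν - ρ) * q ^ (ν - (D - i - 1) + 1) +
      cc q D ν i * q ^ (ν - (D - i - 1)) = coefU q D ν ρ i := by
  unfold coefU gauss1
  rw [show ν - ((D : ℤ) - i - 1) = ν - D + 1 + i by ring,
    show i + 1 - ν - ρ = i - ν - ρ + 1 by ring]
  simp only [zpow_add₀ hq _ (1 : ℤ), zpow_one]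
  field_simp
  ring

theorem cc_add {q : ℂ} (hq : q ≠ 0) (h1 : 1 - q ≠ 0) (D : ℕ) (ν i : ℤ) :
    cc q D ν i + q ^ (D : ℤ) = q * cc q D ν (i - 1) := by
  unfold cc gauss1
  simp only [show (D : ℤ) - ν - (i - 1) = D - ν - i + 1 by ring, zpow_add₀ hq, zpow_sub₀ hq,
    zpow_one]
  have := zpow_ne_zero ν hq
  have := zpow_ne_zero i hq
  field_simp
  ring

variable (s) (hX : (finrank F X : ℤ) = D - 1) (hC : (finrank F C : ℤ) = D + 1)
  (hg : g ∈ Low F X C ν μ ρ)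
include hX hC hg

theorem Splitting.lower_wv_first (i k : ℤ) :
    L1 x H *ᵥ s.wv ν μ (D - i) i k g =
        (cc (order F) D ν i * gauss1 (order F) (i - ν - ρ)) • s.wv ν μ (D - i - 1) i k g ∧
      L2 x H *ᵥ s.wv ν μ (D - i) i k g =
        bb (order F) D ν μ ρ i • s.wv ν μ (D - i) (i - 1) k g := by
  constructor
  · rw [s.L1_wv hg, hX, cc, show (D : ℤ) - 1 - ν - ρ - (D - i) + 1 = i - ν - ρ by ring,
      show (D : ℤ) - i - ν = D - ν - i by ring]
    congr 1; ring
  · rw [s.L2_wv hg, hX, hC, bb, show (D : ℤ) + 1 - μ + ρ - i + 1 = D + 2 - μ + ρ - i by ring]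

/-- The last summand lives at `k = 0`. It comes from expanding the product of the full sums of
raising and lowering matrices, and it disappears on restriction to `X1`. -/
theorem Splitting.adj_first_part {i : ℤ} (h1 : μ ≤ i) (h2 : i ≤ D - ν) :
    (R1 x H + R2 x H + R3 x H) *ᵥ ((L1 x H + L2 x H + L3 x H) *ᵥ s.wv ν μ (D - i) i 1 g) -
        gauss1 (order F) (D + 1) • s.wv ν μ (D - i) i 1 g + R3 x H *ᵥ ((R1 x H + R2 x H) *ᵥ
          (cc (order F) D ν i • s.wv ν μ (D - i - 1) i 0 g)) =
      coefU (order F) D ν ρ i • s.wv ν μ (D - i - 1) (i + 1) 1 g +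
        coefA (order F) D ν μ ρ i • s.wv ν μ (D - i) i 1 g +
        (order F * bb (order F) D ν μ ρ i) • s.wv ν μ (D - i + 1) (i - 1) 1 g +
        order F ^ (D : ℤ) • (R1 x H + R2 x H) *ᵥ s.wv ν μ (D - i) i 0 g := by
  obtain ⟨l1, l2⟩ := s.lower_wv_first hX hC hg i 1
  have l3 : L3 x H *ᵥ s.wv ν μ (D - i) i 1 g = order F ^ (D : ℤ) • s.wv ν μ (D - i) i 0 g := by
    rw [s.L3_wv hg (by norm_num), show 2 * (D : ℤ) - (D - i) - i = D by ring, sub_self]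
  -- At the ends of the range a raising formula is not available for the vector just outside; there
  -- the coefficient in front of it is zero.
  have hc : D - i - 1 < ν → cc (order F) D ν i = 0 := fun h => by
    rw [cc, gauss1_eq_zero_iff.2 (by omega), mul_zero]
  have hb : i - 1 < μ → bb (order F) D ν μ ρ i = 0 := fun h => by
    rw [bb, gauss1_eq_zero_iff.2 (show i - μ = 0 by omega), mul_zero]
  have e1 : ∀ k, cc (order F) D ν i • R1 x H *ᵥ s.wv ν μ (D - i - 1) i k g =
      cc (order F) D ν i • order F ^ k • s.wv ν μ (D - i) i k g := fun k => by
    by_cases h : D - i - 1 < ν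
    · rw [hc h, zero_smul, zero_smul]
    · rw [s.R1_wv (by omega), sub_add_cancel]
  have e2 : ∀ k, R2 x H *ᵥ s.wv ν μ (D - i - 1) i k g =
      order F ^ (ν - (D - i - 1) + k) • s.wv ν μ (D - i - 1) (i + 1) k g := fun k => s.R2_wv h1 _ _
  have e3 : R1 x H *ᵥ s.wv ν μ (D - i) (i - 1) 1 g =
      order F • s.wv ν μ (D - i + 1) (i - 1) 1 g := by
    rw [s.R1_wv (by omega), zpow_one]
  have e4 : bb (order F) D ν μ ρ i • R2 x H *ᵥ s.wv ν μ (D - i) (i - 1) 1 g =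
      bb (order F) D ν μ ρ i • order F ^ (ν - (D - i) + 1) • s.wv ν μ (D - i) i 1 g := by
    by_cases h : i - 1 < μ
    · rw [hb h, zero_smul, zero_smul]
    · rw [s.R2_wv (by omega), sub_add_cancel]
  have e5 : ∀ i j, R3 x H *ᵥ s.wv ν μ i j 1 g = 0 := fun i j => by
    rw [s.R3_wv (by norm_num), s.wv_apply, s.Phi_eq_zero_of_ne (by norm_num) (by norm_num)]
  have e6 : ∀ i j, R3 x H *ᵥ s.wv ν μ i j 0 g = s.wv ν μ i j 1 g := fun i j => by
    rw [s.R3_wv (by norm_num), zero_add]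
  have e1' := congrArg (gauss1 (order F) (i - ν - ρ) • ·) (e1 1)
  have e1'' := congrArg (R3 x H *ᵥ ·) (e1 0)
  simp only [mulVec_smul, e6, zpow_zero, zpow_one, one_smul] at e1' e1''
  rw [← coefU_eq order_ne_zero one_sub_order_ne_zero, ← coefA_eq order_ne_zero one_sub_order_ne_zero]
  simp only [add_mulVec, l1, l2, l3, mulVec_add, mulVec_smul, e2, e3, e5, e6, add_zero,
    smul_add]
  linear_combination (norm := module) e1' + e4 + e1''

theorem Splitting.adj_second_part {i : ℤ} (h1 : μ ≤ i) (h2 : i ≤ D - ν) :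
    (L1 x H + L2 x H) *ᵥ (L3 x H *ᵥ s.wv ν μ (D - i) i 1 g) + ((L1 x H + L2 x H + L3 x H) *ᵥ
        ((R1 x H + R2 x H + R3 x H) *ᵥ (cc (order F) D ν i • s.wv ν μ (D - i - 1) i 0 g)) -
          gauss1 (order F) (D + 2) • cc (order F) D ν i • s.wv ν μ (D - i - 1) i 0 g) =
      coefU (order F) D ν ρ i • cc (order F) D ν (i + 1) • s.wv ν μ (D - i - 1 - 1) (i + 1) 0 g +
        coefA (order F) D ν μ ρ i • cc (order F) D ν i • s.wv ν μ (D - i - 1) i 0 g +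
        (order F * bb (order F) D ν μ ρ i) • cc (order F) D ν (i - 1) •
          s.wv ν μ (D - i) (i - 1) 0 g +
        cc (order F) D ν i • (L1 x H + L2 x H) *ᵥ s.wv ν μ (D - i - 1) i 1 g := by
  obtain ⟨l1, l2⟩ := s.lower_wv_first hX hC hg i 0
  obtain ⟨l1', l2'⟩ := s.lower_wv_first hX hC hg (i + 1) 0
  rw [← sub_sub] at l1' l2'
  rw [add_sub_cancel_right] at l2'
  have l3 : L3 x H *ᵥ s.wv ν μ (D - i) i 1 g = order F ^ (D : ℤ) • s.wv ν μ (D - i) i 0 g := by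
    rw [s.L3_wv hg (by norm_num), show 2 * (D : ℤ) - (D - i) - i = D by ring, sub_self]
  have l3' : L3 x H *ᵥ s.wv ν μ (D - i - 1) i 1 g =
      order F ^ ((D : ℤ) + 1) • s.wv ν μ (D - i - 1) i 0 g := by
    rw [s.L3_wv hg (by norm_num), show 2 * (D : ℤ) - (D - i - 1) - i = D + 1 by ring, sub_self]
  have hc : D - i - 1 < ν → cc (order F) D ν i = 0 := fun h => by
    rw [cc, gauss1_eq_zero_iff.2 (by omega), mul_zero]
  have e1 : cc (order F) D ν i • R1 x H *ᵥ s.wv ν μ (D - i - 1) i 0 g =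
      cc (order F) D ν i • s.wv ν μ (D - i) i 0 g := by
    by_cases h : D - i - 1 < ν
    · rw [hc h, zero_smul, zero_smul]
    · rw [s.R1_wv (by omega), sub_add_cancel, zpow_zero, one_smul]
  have e2 : R2 x H *ᵥ s.wv ν μ (D - i - 1) i 0 g =
      order F ^ (ν - (D - i - 1)) • s.wv ν μ (D - i - 1) (i + 1) 0 g := by
    rw [s.R2_wv h1, add_zero]
  have e6 : ∀ i j, R3 x H *ᵥ s.wv ν μ i j 0 g = s.wv ν μ i j 1 g := fun i j => by
    rw [s.R3_wv (by norm_num), zero_add]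
  have e7 : ∀ i j, L3 x H *ᵥ s.wv ν μ i j 0 g = 0 := fun i j => by
    rw [s.L3_wv hg (by norm_num), s.wv_apply, s.Phi_eq_zero_of_ne (by norm_num) (by norm_num),
      smul_zero]
  have hq := order_ne_zero (F := F)
  have k1 := coef_identity hq one_sub_order_ne_zero D ν μ ρ i
  have k2 := cc_add hq one_sub_order_ne_zero D ν i
  have k3 : order F ^ (ν - (D - i - 1)) = order F ^ (ν - D + 1 + i) := zpow_congr (by ring)
  have k4 : gauss1 (order F) (D + 2) = gauss1 (order F) (D + 1) + order F ^ ((D : ℤ) + 1) := by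
    unfold gauss1
    have := one_sub_order_ne_zero (F := F)
    rw [show (D : ℤ) + 2 = D + 1 + 1 by ring, zpow_add₀ hq (D + 1) 1, zpow_one]
    field_simp
    ring
  have e1' := fun M : Matrix (Pt F D) (Pt F D) ℂ => congrArg (M *ᵥ ·) e1
  simp only [mulVec_smul] at e1'
  have m1 := e1' (L1 x H)
  have m2 := e1' (L2 x H)
  have m3 := e1' (L3 x H)
  rw [k4]
  simp only [add_mulVec, mulVec_add, mulVec_smul, smul_add] at *
  rw [m1, m2, m3]
  simp only [e2, e6, e7, l1, l2, l1', l2', l3, l3', mulVec_smul, smul_zero, add_zero, k3]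
  rw [coefU]
  have k1' := congrArg (· • (cc (order F) D ν i • s.wv ν μ (D - i - 1) i 0 g)) k1
  have k2' := congrArg (fun t => (t * bb (order F) D ν μ ρ i) • s.wv ν μ (D - i) (i - 1) 0 g) k2
  beta_reduce at k1' k2'
  linear_combination (norm := module) k1' + k2'

end Action

variable (s) in
/-- The tridiagonal action of the adjacency matrix. -/
theorem Splitting.adj_omv (hD : 2 ≤ D) (hX : (finrank F X : ℤ) = D - 1)
    (hC : (finrank F C : ℤ) = D + 1) (hg : g ∈ Low F X C ν μ ρ) {i : ℤ} (h1 : μ ≤ i)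
    (h2 : i ≤ D - ν) :
    adj H *ᵥ s.omv ν μ i g = coefU (order F) D ν ρ i • s.omv ν μ (i + 1) g +
      coefA (order F) D ν μ ρ i • s.omv ν μ i g +
      (order F * bb (order F) D ν μ ρ i) • s.omv ν μ (i - 1) g := by
  have hs1 : ∀ {i j : ℤ} {z}, s.wv ν μ i j 1 g z ≠ 0 → i + j = D → z ∈ X1 H := fun hz hij =>
    mem_X1_of_mem_cell (s.mem_cell_of_wv hg _ hz) hij
  have hs2 : ∀ {i j : ℤ} {z}, s.wv ν μ i j 0 g z ≠ 0 → i + j = D - 1 → z ∈ X2 H := fun hz hij =>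
    mem_X2_of_mem_cell hD (s.mem_cell_of_wv hg _ hz) hij
  have hk : ∀ {i j k : ℤ} {z}, kk H z ≠ k → s.wv ν μ i j k g z = 0 := fun {i j k z} h => by
    by_contra h'
    exact h (s.mem_cell_iff.1 (s.mem_cell_of_wv hg _ h')).2.2
  ext y
  have hom : s.omv ν μ i g = res H (s.wv ν μ (D - i) i 1 g +
      cc (order F) D ν i • s.wv ν μ (D - i - 1) i 0 g) := rfl
  have hom1 : s.omv ν μ (i + 1) g = res H (s.wv ν μ (D - i - 1) (i + 1) 1 g +
      cc (order F) D ν (i + 1) • s.wv ν μ (D - i - 1 - 1) (i + 1) 0 g) := by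
    rw [sub_sub (D : ℤ) i 1]; rfl
  have hom2 : s.omv ν μ (i - 1) g = res H (s.wv ν μ (D - i + 1) (i - 1) 1 g +
      cc (order F) D ν (i - 1) • s.wv ν μ (D - i) (i - 1) 0 g) := by
    rw [show (D : ℤ) - i + 1 = D - (i - 1) by ring,
      show s.wv ν μ (D - i) (i - 1) 0 g = s.wv ν μ (D - (i - 1) - 1) (i - 1) 0 g by congr 2; ring]
    rfl
  have hu1 : ∀ z, s.wv ν μ (D - i) i 1 g z ≠ 0 → z ∈ X1 H := fun z hz => hs1 hz (by ring)
  have hu0 : ∀ z, (cc (order F) D ν i • s.wv ν μ (D - i - 1) i 0 g) z ≠ 0 → z ∈ X2 H :=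
    fun z hz => hs2 (right_ne_zero_of_mul hz) (by ring)
  rw [hom, hom1, hom2]
  rcases y.2 with hy | hy
  · have hky := kk_eq_one_of_mem_X1 s hy
    rw [s.adj_mulVec_of_mem_X1 hD hu0 hu1 hy, s.adj_first_part hX hC hg h1 h2]
    simp only [res_apply, Pi.add_apply, Pi.smul_apply, smul_eq_mul, add_mulVec,
      s.R1_wv (show ν ≤ D - i by omega), s.R2_wv h1, hk (show kk H y.1 ≠ 0 by omega)]
    ring
  · have hky := kk_eq_zero_of_mem_X2 hy
    rw [s.adj_mulVec_of_mem_X2 hD hu0 hu1 hy, s.adj_second_part hX hC hg h1 h2]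
    simp only [res_apply, Pi.add_apply, Pi.smul_apply, smul_eq_mul, add_mulVec,
      s.L1_wv hg, s.L2_wv hg, hk (show kk H y.1 ≠ 1 by omega)]
    ring

theorem dualE_mulVec_apply (x : Vertex H) (n : ℕ) (u : Vertex H → ℂ) (y : Vertex H) :
    (dualE x n *ᵥ u) y = if (graph H).dist x y = n then u y else 0 := by
  rw [dualE, Matrix.mulVec_diagonal]; split_ifs <;> simp

/-- Both cells `(D - i, i, 1)` and `(D - i - 1, i, 0)` lie at distance `i` from `x`. -/
theorem omv_apply_dist {x : Vertex H} (s : Splitting x.1 H X C) (hD : 2 ≤ D) (hx : x.1 ∈ X2 H)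
    (hg : g ∈ Low F X C ν μ ρ) {i : ℤ} {y : Vertex H} (hy : s.omv ν μ i g y ≠ 0) :
    ((graph H).dist x y : ℤ) = i := by
  by_cases h1 : s.wv ν μ (D - i) i 1 g y.1 = 0
  · have h2 : s.wv ν μ (D - i - 1) i 0 g y.1 ≠ 0 := fun h2 => hy (by
      change s.om ν μ i g y.1 = 0
      rw [s.om_apply, Pi.add_apply, Pi.smul_apply, h1, h2, smul_zero, add_zero])
    have := dist_of_mem_cell hD hx (s.mem_cell_of_wv hg _ h2)
    omega
  · have := dist_of_mem_cell hD hx (s.mem_cell_of_wv hg _ h1)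
    omega

theorem dualE_omv {x : Vertex H} (s : Splitting x.1 H X C) (hD : 2 ≤ D) (hx : x.1 ∈ X2 H)
    (hg : g ∈ Low F X C ν μ ρ) (n : ℕ) (i : ℤ) :
    dualE x n *ᵥ s.omv ν μ i g = if (n : ℤ) = i then s.omv ν μ i g else 0 := by
  ext y
  rw [dualE_mulVec_apply]
  by_cases hy : s.omv ν μ i g y = 0
  · rw [hy]; split_ifs <;> simp [hy]
  · have := omv_apply_dist s hD hx hg hy
    by_cases h : (n : ℤ) = i
    · rw [if_pos h, if_pos (by omega)]
    · rw [if_neg h, if_neg (by omega)]; rfl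

/-- The two components are supported on the disjoint sets `X1` and `X2`, so `w_i` vanishes only if
both do. The first one misses `i = ν + ρ`, the second one `i = D - ν`, and together they fill the
interval. -/
theorem Splitting.omv_eq_zero_iff (s : Splitting x H X C) (hD : 2 ≤ D)
    (hX : (finrank F X : ℤ) = D - 1) (hC : (finrank F C : ℤ) = D + 1)
    (hg : g ∈ Low F X C ν μ ρ) (hne : g ≠ 0) {i : ℤ} :
    s.omv ν μ i g = 0 ↔ ¬ (max (ν + ρ) μ ≤ i ∧ i ≤ min ((D : ℤ) - ν) (D - μ + ρ + 1)) := by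
  have hb := Low_bounds hg hne
  have h1 : s.omv ν μ i g = 0 ↔ s.wv ν μ (D - i) i 1 g = 0 ∧
      cc (order F) D ν i • s.wv ν μ (D - i - 1) i 0 g = 0 := by
    constructor
    · intro h
      have hz : ∀ z ∈ X1 H ∪ X2 H, s.om ν μ i g z = 0 := fun z hz => congrFun h (⟨z, hz⟩ : Vertex H)
      have key : ∀ z, s.wv ν μ (D - i) i 1 g z = 0 ∧
          (cc (order F) D ν i • s.wv ν μ (D - i - 1) i 0 g) z = 0 := by
        intro z
        by_cases h1 : s.wv ν μ (D - i) i 1 g z = 0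
        · refine ⟨h1, ?_⟩
          by_contra h2
          have hc := s.mem_cell_of_wv hg _ (right_ne_zero_of_mul h2)
          have := hz z (Or.inr (mem_X2_of_mem_cell hD hc (by ring)))
          rw [s.om_apply, Pi.add_apply, h1, zero_add] at this
          exact h2 this
        · have hc := s.mem_cell_of_wv hg _ h1
          have h3 := hz z (Or.inl (mem_X1_of_mem_cell hc (by ring)))
          have h2 : s.wv ν μ (D - i - 1) i 0 g z = 0 := by
            by_contra h2
            have := (cell_unique hc (s.mem_cell_of_wv hg _ h2)).2.2
            omega
          rw [s.om_apply, Pi.add_apply, Pi.smul_apply, h2, smul_zero, add_zero] at h3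
          exact absurd h3 h1
      exact ⟨funext fun z => (key z).1, funext fun z => (key z).2⟩
    · rintro ⟨h1, h2⟩
      rw [omv, LinearMap.comp_apply, om_apply, h1, h2, add_zero, map_zero]
  rw [h1, smul_eq_zero, s.wv_eq_zero_iff hg hne, s.wv_eq_zero_iff hg hne, cc, mul_eq_zero,
    gauss1_eq_zero_iff, or_iff_right (zpow_ne_zero _ order_ne_zero), hX, hC]
  omega

end TypeOneVectors

end

end TwistedGrassmann

namespace TwistedGrassmann

noncomputable section

set_option linter.unusedSectionVars false

open Module Matrix

/-! ### The spectral projections -/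

section Spectral

variable {F : Type*} [Field F] [Fintype F] {D : ℕ} {H : Pt F D}

theorem ofLp_eigE (i : ℕ) (u : Vertex H → ℂ) : WithLp.toLp 2 (eigE H i *ᵥ u) =
    (Module.End.eigenspace (Matrix.toEuclideanLin (adj H)) (theta (order F) D i)).starProjection
      (WithLp.toLp 2 u) := by
  rw [← Matrix.toEuclideanCLM_toLp, eigE, StarAlgEquiv.apply_symm_apply]

theorem adj_isHermitian : (adj H).IsHermitian := by
  classical
  have h : (adj H)ᴴ = adj H := by
    ext y z
    rw [Matrix.conjTranspose_apply, adj, SimpleGraph.adjMatrix_apply, SimpleGraph.adjMatrix_apply]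
    by_cases hyz : (graph H).Adj y z
    · rw [if_pos hyz.symm, if_pos hyz, star_one]
    · rw [if_neg (fun h => hyz h.symm), if_neg hyz, star_zero]
  exact h

theorem eigE_mulVec_of_eigenvector {i : ℕ} {u : Vertex H → ℂ}
    (hu : adj H *ᵥ u = theta (order F) D i • u) : eigE H i *ᵥ u = u := by
  apply WithLp.toLp_injective 2
  rw [ofLp_eigE, Submodule.starProjection_eq_self_iff, Module.End.mem_eigenspace_iff]
  exact congrArg (WithLp.toLp 2) hu

/-- As `A` is Hermitian, it preserves the orthogonal complement of an eigenspace and so commutes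
with the projection. -/
theorem eigE_mulVec_adj (i : ℕ) (u : Vertex H → ℂ) :
    eigE H i *ᵥ (adj H *ᵥ u) = theta (order F) D i • eigE H i *ᵥ u := by
  apply WithLp.toLp_injective 2
  rw [WithLp.toLp_smul, ofLp_eigE, ofLp_eigE]
  set K := Module.End.eigenspace (Matrix.toEuclideanLin (adj H)) (theta (order F) D i)
  have hA : WithLp.toLp 2 (adj H *ᵥ u) = Matrix.toEuclideanLin (adj H) (WithLp.toLp 2 u) := rfl
  have hsym : (Matrix.toEuclideanLin (adj H)).IsSymmetric :=
    Matrix.isSymmetric_toEuclideanLin_iff.2 adj_isHermitian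
  have h1 : K.starProjection (WithLp.toLp 2 u) ∈ K := Submodule.starProjection_apply_mem _ _
  have h2 := Submodule.sub_starProjection_mem_orthogonal (K := K) (WithLp.toLp 2 u)
  set p := K.starProjection (WithLp.toLp 2 u)
  have h3 : Matrix.toEuclideanLin (adj H) (WithLp.toLp 2 u - p) ∈ Kᗮ := by
    rw [Submodule.mem_orthogonal]
    intro k hk
    rw [← hsym, Module.End.mem_eigenspace_iff.1 hk, inner_smul_left,
      (Submodule.mem_orthogonal K _).1 h2 k hk, mul_zero]
  rw [map_sub, Module.End.mem_eigenspace_iff.1 h1] at h3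
  rw [hA]
  exact (Submodule.eq_starProjection_of_mem_orthogonal (K.smul_mem _ h1) h3)

/-- The difference of the eigenvalues is, up to nonzero factors, `(q^i - q^j)(1 - q^{2D+2-i-j})`,
and the second exponent is positive for `i, j ≤ D`. -/
theorem theta_inj {i j : ℤ} (hi : i ≤ D) (hj : j ≤ D)
    (h : theta (order F) D i = theta (order F) D j) : i = j := by
  have hq := order_ne_zero (F := F)
  have h1 := one_sub_order_ne_zero (F := F)
  have key : (order F ^ i - order F ^ j) * (1 - order F ^ (2 * (D : ℤ) + 2 - i - j)) = 0 := by
    unfold theta gauss1 at h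
    simp only [zpow_sub₀ hq, zpow_add₀ hq] at h ⊢
    have := zpow_ne_zero i hq
    have := zpow_ne_zero j hq
    field_simp at h ⊢
    linear_combination h
  rcases mul_eq_zero.1 key with h | h
  · exact order_zpow_inj.1 (sub_eq_zero.1 h)
  · have := order_zpow_eq_one_iff.1 (sub_eq_zero.1 h).symm
    omega

end Spectral

/-! ### Modules with a tridiagonal basis -/

section Hahn

/-- The polynomials in `q^{-j}` that triangularize the tridiagonal matrix. -/
def hahnPoly (q : ℂ) (n : ℕ) (j : ℤ) : ℂ := ∏ l ∈ Finset.range n, (1 - q ^ ((l : ℤ) - j))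

theorem hahnPoly_succ (q : ℂ) (n : ℕ) (j : ℤ) :
    hahnPoly q (n + 1) j = hahnPoly q n j * (1 - q ^ ((n : ℤ) - j)) := Finset.prod_range_succ _ _

theorem hahnPoly_succ' (q : ℂ) (n : ℕ) (j : ℤ) :
    hahnPoly q (n + 1) j = (1 - q ^ (-j)) * hahnPoly q n (j - 1) := by
  unfold hahnPoly
  rw [Finset.prod_range_succ', mul_comm]
  congr 1
  · simp
  · refine Finset.prod_congr rfl fun l _ => ?_
    rw [show ((l + 1 : ℕ) : ℤ) - j = l - (j - 1) by push_cast; ring]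

theorem hahnPoly_eq_zero_iff {F : Type*} [Field F] [Fintype F] {n : ℕ} {j : ℤ} :
    hahnPoly (order F) n j = 0 ↔ 0 ≤ j ∧ j < n := by
  unfold hahnPoly
  rw [Finset.prod_eq_zero_iff]
  constructor
  · rintro ⟨l, hl, h⟩
    have := order_zpow_eq_one_iff.1 (sub_eq_zero.1 h).symm
    rw [Finset.mem_range] at hl
    omega
  · intro h
    refine ⟨j.toNat, by rw [Finset.mem_range]; omega, ?_⟩
    rw [sub_eq_zero, eq_comm, order_zpow_eq_one_iff]; omega

/-- The parameter `h`. -/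
def hPar (q : ℂ) (D f : ℕ) : ℂ := q ^ (2 * (D : ℤ) + 2 - f) / (1 - q) ^ 2

/-- The parameter `s`. -/
def sPar (q : ℂ) (D f : ℕ) : ℂ := q ^ (2 * (f : ℤ) - 2 * D - 3)

/-- The increment is written in the form in which `hahnPoly_step` produces diagonal entries; this
identifies the eigenvalues of the tridiagonal matrix with consecutive `θ`'s. -/
theorem theta_sub {q : ℂ} (hq : q ≠ 0) (h1 : 1 - q ≠ 0) (D f n : ℕ) :
    theta q D ((f : ℤ) + n) - theta q D f =
      hPar q D f * sPar q D f * q * (q ^ (n : ℤ) - 1) + hPar q D f * (q ^ (-(n : ℤ)) - 1) := by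
  have h3 : q ^ (3 : ℤ) = q * q * q := by
    rw [show (3 : ℤ) = ((3 : ℕ) : ℤ) by rfl, zpow_natCast]; ring
  have h2 : q ^ (2 : ℤ) = q * q := by
    rw [show (2 : ℤ) = ((2 : ℕ) : ℤ) by rfl, zpow_natCast]; ring
  unfold theta gauss1 hPar sPar
  rw [two_mul (f : ℤ), two_mul (D : ℤ)]
  simp only [zpow_sub₀ hq, zpow_add₀ hq, _root_.zpow_neg, h3, h2]
  have := zpow_ne_zero (f : ℤ) hq
  have := zpow_ne_zero (n : ℤ) hq
  have := zpow_ne_zero (D : ℤ) hq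
  field_simp
  ring

/-- The subdiagonal coefficient of the triangularization. -/
def kap (q : ℂ) (d : ℕ) (h r : ℂ) (n : ℕ) : ℂ :=
  h * (q ^ (n : ℤ) - 1) * (r * q ^ ((n : ℤ) - 1 - d) + q ^ (-(n : ℤ)) - q ^ (-(d : ℤ) - 1) - r)

theorem hahnPoly_step {q : ℂ} (hq : q ≠ 0) (d : ℕ) {h r s : ℂ} (hs : s ≠ 0) (n i : ℕ) :
    entryB q d h r i * (hahnPoly q (n + 1) (i + 1) - hahnPoly q (n + 1) i) +
      entryC q d h r s i * (hahnPoly q (n + 1) (i - 1) - hahnPoly q (n + 1) i) =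
    (h * s * q * (q ^ ((n : ℤ) + 1) - 1) + h * (q ^ (-((n : ℤ) + 1)) - 1)) *
      hahnPoly q (n + 1) i + kap q d h r (n + 1) * hahnPoly q n i := by
  have e1 : hahnPoly q (n + 1) (i + 1) = (1 - q ^ (-(i : ℤ) - 1)) * hahnPoly q n i := by
    rw [hahnPoly_succ', add_sub_cancel_right, neg_add']
  have e2 : hahnPoly q (n + 1) i = hahnPoly q n i * (1 - q ^ ((n : ℤ) - i)) := hahnPoly_succ _ _ _
  have e3 : (1 - q ^ (-(i : ℤ))) * hahnPoly q (n + 1) (i - 1) =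
      hahnPoly q n i * (1 - q ^ ((n : ℤ) - i)) * (1 - q ^ ((n : ℤ) + 1 - i)) := by
    rw [← hahnPoly_succ', hahnPoly_succ, hahnPoly_succ]
    push_cast; rfl
  -- The factor `1 - q^i` of `entryC` supplies what the polynomial shifted to `i - 1` lacks, so no
  -- division is needed, even at `i = 0`.
  have e4 : entryC q d h r s i * hahnPoly q (n + 1) (i - 1) =
      - (h * s * q * q ^ (i : ℤ) * (1 - r * q ^ ((i : ℤ) - d - 1) / s)) *
        (hahnPoly q n i * (1 - q ^ ((n : ℤ) - i)) * (1 - q ^ ((n : ℤ) + 1 - i))) := by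
    rw [← e3, entryC, _root_.zpow_neg, zpow_natCast]
    have := pow_ne_zero i hq
    field_simp
    ring
  rw [mul_sub (entryC q d h r s i), e4, e1, e2, entryB, entryC, kap]
  have := zpow_ne_zero (i : ℤ) hq
  have := zpow_ne_zero (n : ℤ) hq
  have := zpow_ne_zero (d : ℤ) hq
  push_cast
  rw [← zpow_natCast q i, ← zpow_natCast q (i + 1)]
  push_cast
  simp only [show (n : ℤ) + 1 - 1 - d = n - d by ring, neg_add, zpow_sub₀ hq, zpow_add₀ hq,
    _root_.zpow_neg, zpow_one]
  field_simp
  ring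

/-- Since `b_d = 0` and `c_0 = 0`, the values of `p` at `-1` and `d + 1` may appear without harm.
Constant row sums turn the matrix into a difference operator plus `λ₀`. -/
theorem hahn_sum {q : ℂ} (d : ℕ) (h r s l0 : ℂ) (p : ℤ → ℂ) (i : Fin (d + 1)) :
    ∑ j, hahn q d h r s l0 i j * p (j : ℕ) = l0 * p (i : ℕ) +
      (entryB q d h r i * (p ((i : ℕ) + 1) - p (i : ℕ)) +
        entryC q d h r s i * (p ((i : ℕ) - 1) - p (i : ℕ))) := by
  have key : ∀ j : Fin (d + 1), hahn q d h r s l0 i j * p (j : ℕ) =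
      (if j = i then (l0 - entryB q d h r i - entryC q d h r s i) * p (i : ℕ) else 0) +
      (if (j : ℕ) = i + 1 then entryB q d h r i * p ((i : ℕ) + 1) else 0) +
      (if (i : ℕ) = j + 1 then entryC q d h r s i * p ((i : ℕ) - 1) else 0) := by
    intro j
    rw [hahn, Matrix.of_apply]
    by_cases h1 : j = i
    · subst h1; simp
    · rw [if_neg (Ne.symm h1), if_neg h1]
      by_cases h2 : (j : ℕ) = i + 1
      · rw [if_pos h2, if_pos h2, if_neg (by omega), h2]; push_cast; ring
      · rw [if_neg h2, if_neg h2]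
        by_cases h3 : (i : ℕ) = j + 1
        · rw [if_pos h3, if_pos h3, h3]
          have : ((j + 1 : ℕ) : ℤ) - 1 = (j : ℕ) := by push_cast; ring
          rw [this]; ring
        · rw [if_neg h3, if_neg h3]; ring
  rw [Finset.sum_congr rfl fun j _ => key j, Finset.sum_add_distrib, Finset.sum_add_distrib,
    Finset.sum_ite_eq' Finset.univ i, if_pos (Finset.mem_univ _)]
  have e1 : ∑ j : Fin (d + 1), (if (j : ℕ) = i + 1 then entryB q d h r i * p ((i : ℕ) + 1) else 0) =
      entryB q d h r i * p ((i : ℕ) + 1) := by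
    by_cases hi : (i : ℕ) = d
    · rw [entryB, hi, sub_self, zpow_zero, sub_self, mul_zero, zero_mul, zero_mul]
      simp
    · rw [Finset.sum_eq_single ⟨i + 1, by omega⟩]
      · simp
      · intro j _ hj
        rw [if_neg fun h' => hj (Fin.ext h')]
      · exact fun h' => absurd (Finset.mem_univ _) h'
  have e2 : ∑ j : Fin (d + 1), (if (i : ℕ) = j + 1 then entryC q d h r s i * p ((i : ℕ) - 1) else 0)
      = entryC q d h r s i * p ((i : ℕ) - 1) := by
    by_cases hi : (i : ℕ) = 0
    · rw [entryC, hi, pow_zero, sub_self, mul_zero, zero_mul, zero_mul]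
      simp
    · rw [Finset.sum_eq_single ⟨i - 1, by omega⟩]
      · rw [if_pos]; simp; omega
      · intro j _ hj
        rw [if_neg fun h' => hj (Fin.ext (by simp; omega))]
      · exact fun h' => absurd (Finset.mem_univ _) h'
  rw [e1, e2]
  ring

variable {F : Type*} [Field F] [Fintype F] {D : ℕ} {H : Pt F D} {x : Vertex H}

theorem entryB_ne_zero {f d : ℕ} {r : ℂ} (h : Admissible (order F) d (hPar (order F) D f) r (sPar (order F) D f)) {i : ℕ} (hi : i < d) :
    entryB (order F) d (hPar (order F) D f) r i ≠ 0 := by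
  obtain ⟨h1, h2, h3, h4, h5⟩ := h
  refine mul_ne_zero (mul_ne_zero h1 ?_) ?_
  · rw [Ne, sub_eq_zero, eq_comm, order_zpow_eq_one_iff]; omega
  · rw [Ne, sub_eq_zero, eq_comm]; exact (h4 (i + 1) (by rw [Finset.mem_Icc]; omega)).1

theorem entryC_ne_zero {f d : ℕ} {r : ℂ} (h : Admissible (order F) d (hPar (order F) D f) r (sPar (order F) D f)) {i : ℕ} (h0 : 0 < i) (hi : i ≤ d) :
    entryC (order F) d (hPar (order F) D f) r (sPar (order F) D f) i ≠ 0 := by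
  obtain ⟨h1, h2, h3, h4, h5⟩ := h
  refine mul_ne_zero (mul_ne_zero (mul_ne_zero (mul_ne_zero h1 h3) order_ne_zero) ?_) ?_
  · rw [Ne, sub_eq_zero, eq_comm, order_pow_eq_one_iff]; omega
  · have := (h4 (d + 1 - i) (by rw [Finset.mem_Icc]; omega)).2
    intro h'
    apply this
    have e1 : order F ^ ((i : ℤ) - d - 1) = (order F ^ (d + 1 - i))⁻¹ := by
      rw [← zpow_natCast, ← _root_.zpow_neg]; congr 1; omega
    rw [e1] at h'
    have h6 := pow_ne_zero (d + 1 - i) (order_ne_zero (F := F))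
    field_simp at h' ⊢
    linear_combination h'

/-- `W` has a basis on which `A` acts as a tridiagonal matrix of dual `q`-Hahn type. -/
structure IsHahnBasis (W : Submodule (Talg x) (Vertex H → ℂ)) (e f d : ℕ) (r : ℂ)
    (v : Fin (d + 1) → Vertex H → ℂ) : Prop where
  le_e : e + d ≤ D
  le_f : f + d ≤ D
  admissible : Admissible (order F) d (hPar (order F) D f) r (sPar (order F) D f)
  ne_zero : ∀ i, v i ≠ 0
  dual : ∀ i : Fin (d + 1), dualE x (e + i) *ᵥ v i = v i
  acts : ∀ j, adj H *ᵥ v j = ∑ i, hahn (order F) d (hPar (order F) D f) r (sPar (order F) D f)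
    (theta (order F) D f) i j • v i
  span : Submodule.span ℂ (Set.range v) = W.restrictScalars ℂ

namespace IsHahnBasis

variable {W : Submodule (Talg x) (Vertex H → ℂ)} {e f d : ℕ} {r : ℂ}
  {v : Fin (d + 1) → Vertex H → ℂ}

theorem dualE_mul (m n : ℕ) (u : Vertex H → ℂ) (hu : dualE x n *ᵥ u = u) :
    dualE x m *ᵥ u = if m = n then u else 0 := by
  split_ifs with h
  · rw [h, hu]
  · ext y
    rw [dualE_mulVec_apply]
    split_ifs with h1
    · have := congrFun hu y
      rw [dualE_mulVec_apply, if_neg (by omega)] at this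
      exact this.symm
    · rfl

theorem dualE_mulVec (h : IsHahnBasis W e f d r v) (m : ℕ) (i : Fin (d + 1)) :
    dualE x m *ᵥ v i = if m = e + i then v i else 0 := dualE_mul _ _ _ (h.dual i)

theorem mem (h : IsHahnBasis W e f d r v) (i : Fin (d + 1)) : v i ∈ W := by
  have : v i ∈ W.restrictScalars ℂ := h.span ▸ Submodule.subset_span ⟨i, rfl⟩
  exact this

theorem exists_coeff (h : IsHahnBasis W e f d r v) {u : Vertex H → ℂ} (hu : u ∈ W) :
    ∃ c : Fin (d + 1) → ℂ, u = ∑ i, c i • v i := by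
  have : u ∈ Submodule.span ℂ (Set.range v) := h.span.symm ▸ hu
  obtain ⟨c, hc⟩ := (Submodule.mem_span_range_iff_exists_fun ℂ).1 this
  exact ⟨c, hc.symm⟩

theorem dualE_sum (h : IsHahnBasis W e f d r v) (c : Fin (d + 1) → ℂ) (i : Fin (d + 1)) :
    dualE x (e + i) *ᵥ ∑ j, c j • v j = c i • v i := by
  rw [Matrix.mulVec_sum, Finset.sum_eq_single i]
  · rw [Matrix.mulVec_smul, h.dual]
  · intro j _ hj
    rw [Matrix.mulVec_smul, h.dualE_mulVec, if_neg, smul_zero]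
    intro h'; exact hj (Fin.ext (by omega))
  · exact fun h' => absurd (Finset.mem_univ _) h'

theorem linearIndependent (h : IsHahnBasis W e f d r v) : LinearIndependent ℂ v := by
  rw [Fintype.linearIndependent_iff]
  intro c hc i
  have := h.dualE_sum c i
  rw [hc, Matrix.mulVec_zero] at this
  exact (smul_eq_zero.1 this.symm).resolve_right (h.ne_zero i)

theorem cut_le (h : IsHahnBasis W e f d r v) (i : Fin (d + 1)) :
    cut (dualE x (e + i)) (W.restrictScalars ℂ) = Submodule.span ℂ {v i} := by
  apply le_antisymm
  · rintro _ ⟨u, hu, rfl⟩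
    obtain ⟨c, rfl⟩ := h.exists_coeff hu
    exact Submodule.mem_span_singleton.2 ⟨c i, (h.dualE_sum c i).symm⟩
  · rw [Submodule.span_singleton_le_iff_mem]
    exact mem_cut.2 ⟨v i, h.mem i, h.dual i⟩

theorem cut_eq_bot (h : IsHahnBasis W e f d r v) {m : ℕ} (hm : ¬ (e ≤ m ∧ m ≤ e + d)) :
    cut (dualE x m) (W.restrictScalars ℂ) = ⊥ := by
  rw [cut_eq_bot_iff]
  intro u hu
  obtain ⟨c, rfl⟩ := h.exists_coeff hu
  rw [Matrix.mulVec_sum]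
  refine Finset.sum_eq_zero fun j _ => ?_
  rw [Matrix.mulVec_smul, h.dualE_mulVec, if_neg (by omega), smul_zero]

theorem isThin (h : IsHahnBasis W e f d r v) : IsThin W := by
  intro m
  by_cases hm : e ≤ m ∧ m ≤ e + d
  · obtain ⟨i, rfl⟩ : ∃ i : Fin (d + 1), m = e + i := ⟨⟨m - e, by omega⟩, by simp; omega⟩
    rw [h.cut_le]
    exact (finrank_span_singleton (h.ne_zero i)).le
  · rw [h.cut_eq_bot hm, finrank_bot]; exact zero_le_one

theorem supp_eq (h : IsHahnBasis W e f d r v) : supp W = Set.Icc e (e + d) := by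
  ext m
  simp only [supp, Set.mem_ofPred_eq, Set.mem_Icc]
  constructor
  · rintro ⟨-, h1⟩
    by_contra hm
    exact h1 (h.cut_eq_bot hm)
  · intro hm
    have := h.le_e
    refine ⟨by omega, ?_⟩
    obtain ⟨i, rfl⟩ : ∃ i : Fin (d + 1), m = e + i := ⟨⟨m - e, by omega⟩, by simp; omega⟩
    rw [h.cut_le, Ne, Submodule.span_singleton_eq_bot]
    exact h.ne_zero i

theorem endpoint_eq (h : IsHahnBasis W e f d r v) : endpoint W = e := by
  rw [endpoint, h.supp_eq, csInf_Icc (by omega)]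

theorem diam_eq (h : IsHahnBasis W e f d r v) : diam W = d := by
  rw [diam, h.supp_eq, ← Finset.coe_Icc, Set.ncard_coe_finset, Nat.card_Icc]
  omega

/-- Projecting a nonzero vector to a distance class yields one of the `v i`; the nonzero
off-diagonal entries then reach all the others, upwards through `entryC` and downwards through
`entryB`. -/
theorem isSimpleModule (h : IsHahnBasis W e f d r v) : IsSimpleModule (Talg x) W := by
  rw [isSimpleModule_iff_isAtom]
  refine ⟨fun h0 => h.ne_zero 0 (by simpa [h0] using h.mem 0), fun N hN => ?_⟩
  by_contra hbot
  obtain ⟨u, hu, hu0⟩ := Submodule.exists_mem_ne_zero_of_ne_bot hbot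
  have hE : ∀ m, dualE x m ∈ Talg x := fun m => Algebra.subset_adjoin (Or.inr ⟨m, rfl⟩)
  have hA : adj H ∈ Talg x := Algebra.subset_adjoin (Or.inl rfl)
  obtain ⟨i, hi⟩ : ∃ i, v i ∈ N := by
    obtain ⟨c, rfl⟩ := h.exists_coeff (hN.le hu)
    obtain ⟨i, -, hi⟩ := Finset.exists_ne_zero_of_sum_ne_zero hu0
    refine ⟨i, ?_⟩
    have := mulVec_mem_submodule N (hE (e + i)) hu
    rw [h.dualE_sum] at this
    have h2 := smul_mem_submodule N (c i)⁻¹ this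
    rwa [smul_smul, inv_mul_cancel₀ (fun h0 => hi (by rw [h0, zero_smul])), one_smul] at h2
  have hstep : ∀ j k : Fin (d + 1), v j ∈ N → hahn (order F) d (hPar (order F) D f) r
      (sPar (order F) D f) (theta (order F) D f) k j ≠ 0 → v k ∈ N := by
    intro j k hj hkj
    have := mulVec_mem_submodule N (hE (e + k)) (mulVec_mem_submodule N hA hj)
    rw [h.acts, h.dualE_sum (fun i => hahn (order F) d (hPar (order F) D f) r
      (sPar (order F) D f) (theta (order F) D f) i j)] at this
    have h2 := smul_mem_submodule N (hahn (order F) d (hPar (order F) D f) r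
      (sPar (order F) D f) (theta (order F) D f) k j)⁻¹ this
    rwa [smul_smul, inv_mul_cancel₀ hkj, one_smul] at h2
  have hup : ∀ n : ℕ, ∀ hn : i + n < d + 1, v ⟨i + n, hn⟩ ∈ N := by
    intro n
    induction n with
    | zero => intro hn; simpa using hi
    | succ n ih =>
      intro hn
      refine hstep _ _ (ih (by omega)) ?_
      rw [hahn, Matrix.of_apply, if_neg (by simp), if_neg (by simp; omega), if_pos (by simp; omega)]
      exact entryC_ne_zero h.admissible (by simp) (by simp; omega)
  have hdown : ∀ n : ℕ, ∀ hn : n ≤ i, v ⟨i - n, by omega⟩ ∈ N := by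
    intro n
    induction n with
    | zero => intro hn; simpa using hi
    | succ n ih =>
      intro hn
      refine hstep _ _ (ih (by omega)) ?_
      rw [hahn, Matrix.of_apply, if_neg (by simp; omega), if_pos (by simp; omega)]
      exact entryB_ne_zero h.admissible (by simp; omega)
  refine hN.not_ge ?_
  intro w hw
  obtain ⟨c, rfl⟩ := h.exists_coeff hw
  refine N.sum_mem fun k _ => smul_mem_submodule N _ ?_
  rcases le_total (i : ℕ) k with hk | hk
  · have := hup (k - i) (by omega)
    convert this using 2
    ext; simp; omega
  · have := hdown (i - k) (by omega)
    convert this using 2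
    ext; simp; omega

theorem adj_sum_smul (h : IsHahnBasis W e f d r v) (p : ℤ → ℂ) :
    adj H *ᵥ ∑ j : Fin (d + 1), p (j : ℕ) • v j = ∑ i : Fin (d + 1),
      (theta (order F) D f * p (i : ℕ) +
      (entryB (order F) d (hPar (order F) D f) r i * (p ((i : ℕ) + 1) - p (i : ℕ)) +
        entryC (order F) d (hPar (order F) D f) r (sPar (order F) D f) i *
          (p ((i : ℕ) - 1) - p (i : ℕ)))) • v i := by
  rw [Matrix.mulVec_sum]
  simp only [Matrix.mulVec_smul, h.acts, Finset.smul_sum, smul_smul]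
  rw [Finset.sum_comm]
  refine Finset.sum_congr rfl fun i _ => ?_
  rw [← hahn_sum, Finset.sum_smul]
  exact Finset.sum_congr rfl fun j _ => by rw [mul_comm]

/-- Every row of the matrix sums to `θ_f`. The resulting eigenvector later shows that `f` belongs to
the dual support. -/
theorem adj_sum (h : IsHahnBasis W e f d r v) :
    adj H *ᵥ ∑ j : Fin (d + 1), v j = theta (order F) D f • ∑ j : Fin (d + 1), v j := by
  have := h.adj_sum_smul (fun _ => 1)
  simpa [Finset.smul_sum] using this

/-- The vectors triangularizing the adjacency matrix. -/
theorem adj_sum_hahnPoly (h : IsHahnBasis W e f d r v) (n : ℕ) :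
    adj H *ᵥ ∑ j : Fin (d + 1), hahnPoly (order F) (n + 1) (j : ℕ) • v j =
      theta (order F) D ((f : ℤ) + (n + 1 : ℕ)) •
        ∑ j : Fin (d + 1), hahnPoly (order F) (n + 1) (j : ℕ) • v j +
      kap (order F) d (hPar (order F) D f) r (n + 1) •
        ∑ j : Fin (d + 1), hahnPoly (order F) n (j : ℕ) • v j := by
  rw [h.adj_sum_smul, Finset.smul_sum, Finset.smul_sum, ← Finset.sum_add_distrib]
  refine Finset.sum_congr rfl fun i _ => ?_
  rw [smul_smul, smul_smul, ← add_smul, hahnPoly_step order_ne_zero d h.admissible.2.2.1]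
  have := theta_sub (order_ne_zero (F := F)) one_sub_order_ne_zero D f (n + 1)
  push_cast at this ⊢
  congr 1
  linear_combination (-hahnPoly (order F) (n + 1) (i : ℕ)) * this

/-- In the triangular form of `adj_sum_hahnPoly` the diagonal entries `θ_f, …, θ_{f+d}` all differ
from `θ_m`, so `E_m` kills each of those combinations. The `n`-th one involves only `v_n, …, v_d`,
with nonzero coefficient at `v_n`, and descending induction shows that `E_m` kills every `v_j`. -/
theorem eigE_eq_zero (h : IsHahnBasis W e f d r v) {m : ℕ} (hm : m < f) {u : Vertex H → ℂ}
    (hu : u ∈ W) : eigE H m *ᵥ u = 0 := by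
  have hf := h.le_f
  have key : ∀ n : ℕ, n ≤ d →
      eigE H m *ᵥ ∑ j : Fin (d + 1), hahnPoly (order F) n (j : ℕ) • v j = 0 := by
    intro n
    induction n with
    | zero =>
      intro _
      have h1 := eigE_mulVec_adj m (∑ j : Fin (d + 1), v j)
      rw [h.adj_sum, Matrix.mulVec_smul, ← sub_eq_zero, ← sub_smul, smul_eq_zero] at h1
      simp only [hahnPoly, Finset.range_zero, Finset.prod_empty, one_smul]
      refine h1.resolve_left fun h2 => ?_
      have := theta_inj (i := f) (j := m) (by omega) (by omega) (sub_eq_zero.1 h2)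
      omega
    | succ n ih =>
      intro hn
      have h1 := eigE_mulVec_adj m
        (∑ j : Fin (d + 1), hahnPoly (order F) (n + 1) (j : ℕ) • v j)
      rw [h.adj_sum_hahnPoly, Matrix.mulVec_add, Matrix.mulVec_smul, Matrix.mulVec_smul,
        ih (by omega), smul_zero, add_zero, ← sub_eq_zero, ← sub_smul, smul_eq_zero] at h1
      refine h1.resolve_left fun h2 => ?_
      have := theta_inj (i := (f : ℤ) + (n + 1 : ℕ)) (j := m) (by omega) (by omega)
        (sub_eq_zero.1 h2)
      omega
  have hv : ∀ n : ℕ, ∀ j : Fin (d + 1), d ≤ n + j → eigE H m *ᵥ v j = 0 := by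
    intro n
    induction n with
    | zero =>
      intro j hj
      have h1 := key j (by omega)
      rw [Finset.sum_eq_single j, Matrix.mulVec_smul, smul_eq_zero] at h1
      · refine h1.resolve_left fun h2 => ?_
        rw [hahnPoly_eq_zero_iff] at h2; omega
      · intro i _ hi
        rw [hahnPoly_eq_zero_iff.2, zero_smul]
        have : (i : ℕ) ≠ j := fun h' => hi (Fin.ext h')
        omega
      · exact fun h' => absurd (Finset.mem_univ _) h'
    | succ n ih =>
      intro j hj
      have h1 := key j (by omega)
      rw [Matrix.mulVec_sum, Finset.sum_eq_single j, Matrix.mulVec_smul, smul_eq_zero] at h1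
      · refine h1.resolve_left fun h2 => ?_
        rw [hahnPoly_eq_zero_iff] at h2; omega
      · intro i _ hi
        have : (i : ℕ) ≠ j := fun h' => hi (Fin.ext h')
        rcases lt_or_gt_of_ne this with h' | h'
        · rw [hahnPoly_eq_zero_iff.2 (by omega), zero_smul, Matrix.mulVec_zero]
        · rw [Matrix.mulVec_smul, ih i (by omega), smul_zero]
      · exact fun h' => absurd (Finset.mem_univ _) h'
  obtain ⟨c, rfl⟩ := h.exists_coeff hu
  rw [Matrix.mulVec_sum]
  exact Finset.sum_eq_zero fun j _ => by rw [Matrix.mulVec_smul, hv d j (by omega), smul_zero]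

theorem dualEndpoint_eq (h : IsHahnBasis W e f d r v) : dualEndpoint W = f := by
  have hf := h.le_f
  have hmem : f ∈ dualSupp W := by
    refine ⟨by omega, cut_ne_bot_iff.2 ⟨∑ j, v j, W.sum_mem fun j _ => h.mem j, ?_⟩⟩
    rw [eigE_mulVec_of_eigenvector h.adj_sum]
    intro h0
    have := h.dualE_sum (fun _ => 1) 0
    simp only [one_smul] at this
    rw [h0, Matrix.mulVec_zero] at this
    exact h.ne_zero 0 this.symm
  apply le_antisymm
  · exact Nat.sInf_le hmem
  · refine le_csInf ⟨f, hmem⟩ fun m hm => ?_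
    by_contra! hlt
    obtain ⟨u, hu, h1⟩ := cut_ne_bot_iff.1 hm.2
    exact h1 (h.eigE_eq_zero hlt hu)

theorem triple_eq (h : IsHahnBasis W e f d r v) : triple W = ((e : ℤ), (f : ℤ), (d : ℤ)) := by
  rw [triple, h.endpoint_eq, h.dualEndpoint_eq, h.diam_eq]

theorem actsAs (h : IsHahnBasis W e f d r v) : ActsAs W (hahn (order F) (diam W)
    (hPar (order F) D f) r (sPar (order F) D f) (theta (order F) D f)) := by
  obtain rfl := h.diam_eq
  obtain rfl := h.endpoint_eq
  exact ⟨v, h.linearIndependent, h.span, fun i => by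
    rw [h.cut_le]; exact Submodule.mem_span_singleton_self _, h.acts⟩

theorem of_linearEquiv (h : IsHahnBasis W e f d r v) {W' : Submodule (Talg x) (Vertex H → ℂ)}
    (φ : W ≃ₗ[Talg x] W') :
    IsHahnBasis W' e f d r (fun i => (φ ⟨v i, h.mem i⟩ : Vertex H → ℂ)) := by
  have hM : ∀ M (hM : M ∈ Talg x), ∀ u (hu : u ∈ W), M *ᵥ (φ ⟨u, hu⟩ : Vertex H → ℂ) =
      (φ ⟨M *ᵥ u, mulVec_mem_submodule W hM hu⟩ : Vertex H → ℂ) := fun M hM u hu =>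
    (congrArg Subtype.val (φ.map_smul (⟨M, hM⟩ : Talg x) ⟨u, hu⟩)).symm
  have hE : ∀ m, dualE x m ∈ Talg x := fun m => Algebra.subset_adjoin (Or.inr ⟨m, rfl⟩)
  have hA : adj H ∈ Talg x := Algebra.subset_adjoin (Or.inl rfl)
  have hs : ∀ c : Fin (d + 1) → ℂ, ∀ hu, (φ ⟨∑ i, c i • v i, hu⟩ : Vertex H → ℂ) =
      ∑ i, c i • (φ ⟨v i, h.mem i⟩ : Vertex H → ℂ) := by
    intro c hu
    have : (⟨∑ i, c i • v i, hu⟩ : W) = ∑ i, c i • ⟨v i, h.mem i⟩ := Subtype.ext (by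
      rw [AddSubmonoidClass.coe_finsetSum]; rfl)
    rw [this, map_sum, AddSubmonoidClass.coe_finsetSum]
    refine Finset.sum_congr rfl fun i _ => ?_
    have := (φ.toLinearMap.restrictScalars ℂ).map_smul (c i) ⟨v i, h.mem i⟩
    exact congrArg Subtype.val this
  refine ⟨h.le_e, h.le_f, h.admissible, fun i h0 => ?_, fun i => ?_, fun j => ?_, ?_⟩
  · have : φ ⟨v i, h.mem i⟩ = 0 := Subtype.ext h0
    rw [LinearEquiv.map_eq_zero_iff] at this
    exact h.ne_zero i (congrArg Subtype.val this)
  · rw [hM _ (hE _)]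
    exact congrArg (fun w => (φ w : Vertex H → ℂ)) (Subtype.ext (h.dual i))
  · rw [hM _ hA, ← hs _ (W.sum_mem fun i _ => smul_mem_submodule W _ (h.mem i))]
    exact congrArg (fun w => (φ w : Vertex H → ℂ)) (Subtype.ext (h.acts j))
  · apply le_antisymm
    · rw [Submodule.span_le]
      rintro _ ⟨i, rfl⟩
      exact (φ _).2
    · intro w hw
      obtain ⟨c, hc⟩ := h.exists_coeff (φ.symm ⟨w, hw⟩).2
      have h1 : w = (φ (φ.symm ⟨w, hw⟩) : Vertex H → ℂ) := by rw [LinearEquiv.apply_symm_apply]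
      have h2 : φ.symm ⟨w, hw⟩ = ⟨∑ i, c i • v i, hc ▸ (φ.symm ⟨w, hw⟩).2⟩ := Subtype.ext hc
      rw [h1, h2, hs]
      exact Submodule.sum_mem _ fun i _ => Submodule.smul_mem _ _ (Submodule.subset_span ⟨i, rfl⟩)

/-- The generators of `T` act on the basis by formulas in `e, f, d, r` alone, so matching the bases
commutes with them. The map is extended to the whole space, although only its restriction to `W`
matters. -/
theorem exists_intertwiner (h : IsHahnBasis W e f d r v)
    {W' : Submodule (Talg x) (Vertex H → ℂ)} {v' : Fin (d + 1) → Vertex H → ℂ}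
    (h' : IsHahnBasis W' e f d r v') : ∃ Ψ : (Vertex H → ℂ) →ₗ[ℂ] (Vertex H → ℂ),
      (∀ i, Ψ (v i) = v' i) ∧ (∀ u ∈ W, Ψ u ∈ W') ∧
      ∀ M ∈ Talg x, ∀ u ∈ W, Ψ (M *ᵥ u) = M *ᵥ Ψ u := by
  obtain ⟨Ψ, hΨ⟩ := LinearMap.exists_extend ((Basis.span h.linearIndependent).constr ℂ v')
  have hv : ∀ i, Ψ (v i) = v' i := by
    intro i
    have h1 := LinearMap.congr_fun hΨ (Basis.span h.linearIndependent i)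
    rw [Basis.constr_basis, LinearMap.comp_apply, Submodule.subtype_apply, Basis.span_apply] at h1
    exact h1
  refine ⟨Ψ, hv, fun u hu => ?_, fun M hM => ?_⟩
  · obtain ⟨c, rfl⟩ := h.exists_coeff hu
    rw [map_sum]
    refine W'.sum_mem fun i _ => ?_
    rw [map_smul, hv]
    exact smul_mem_submodule W' _ (h'.mem i)
  induction hM using Algebra.adjoin_induction with
  | mem M hM =>
    intro u hu
    obtain ⟨c, rfl⟩ := h.exists_coeff hu
    rw [Matrix.mulVec_sum, map_sum, map_sum, Matrix.mulVec_sum]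
    refine Finset.sum_congr rfl fun j _ => ?_
    rw [Matrix.mulVec_smul, map_smul, map_smul, Matrix.mulVec_smul, hv]
    congr 1
    rcases hM with hM | ⟨m, rfl⟩
    · obtain rfl : M = adj H := hM
      rw [h.acts, h'.acts, map_sum]
      exact Finset.sum_congr rfl fun i _ => by rw [map_smul, hv]
    · rw [h.dualE_mulVec, h'.dualE_mulVec]
      split_ifs
      · exact hv j
      · exact map_zero Ψ
  | algebraMap c =>
    intro u _
    rw [Algebra.algebraMap_eq_smul_one, smul_mulVec, one_mulVec, smul_mulVec, one_mulVec, map_smul]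
  | add M N _ _ ihM ihN =>
    intro u hu
    rw [add_mulVec, map_add, ihM u hu, ihN u hu, add_mulVec]
  | mul M N _ hN ihM ihN =>
    intro u hu
    rw [← mulVec_mulVec, ihM _ (mulVec_mem_submodule W hN hu), ihN u hu, mulVec_mulVec]

theorem nonempty_linearEquiv (h : IsHahnBasis W e f d r v)
    {W' : Submodule (Talg x) (Vertex H → ℂ)} {v' : Fin (d + 1) → Vertex H → ℂ}
    (h' : IsHahnBasis W' e f d r v') : Nonempty (W ≃ₗ[Talg x] W') := by
  obtain ⟨Ψ, h1, h2, h3⟩ := h.exists_intertwiner h'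
  obtain ⟨Ψ', h1', h2', h3'⟩ := h'.exists_intertwiner h
  refine ⟨LinearEquiv.ofLinearMap
    { toFun := fun u => ⟨Ψ u.1, h2 u.1 u.2⟩
      map_add' := fun u w => Subtype.ext (map_add Ψ u.1 w.1)
      map_smul' := fun M u => Subtype.ext (h3 M.1 M.2 u.1 u.2) }
    { toFun := fun u => ⟨Ψ' u.1, h2' u.1 u.2⟩
      map_add' := fun u w => Subtype.ext (map_add Ψ' u.1 w.1)
      map_smul' := fun M u => Subtype.ext (h3' M.1 M.2 u.1 u.2) } ?_ ?_⟩
  · ext1 ⟨u, hu⟩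
    refine Subtype.ext ?_
    change Ψ (Ψ' u) = u
    obtain ⟨c, rfl⟩ := h'.exists_coeff hu
    rw [map_sum, map_sum]
    exact Finset.sum_congr rfl fun i _ => by rw [map_smul, map_smul, h1', h1]
  · ext1 ⟨u, hu⟩
    refine Subtype.ext ?_
    change Ψ' (Ψ u) = u
    obtain ⟨c, rfl⟩ := h.exists_coeff hu
    rw [map_sum, map_sum]
    exact Finset.sum_congr rfl fun i _ => by rw [map_smul, map_smul, h1, h1']

end IsHahnBasis

end Hahn

end

end TwistedGrassmann

namespace TwistedGrassmann

noncomputable section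

set_option linter.unusedSectionVars false

open Module Matrix

/-! ### Comparison of the tridiagonal coefficients with the parameters of the matrix `hahn`. -/

section Parameters

theorem hahn_sum_smul {E : Type*} [AddCommGroup E] [Module ℂ E] {q : ℂ} (d : ℕ) (h r s l0 : ℂ)
    (w : ℕ → E) (j : Fin (d + 1)) :
    ∑ i : Fin (d + 1), hahn q d h r s l0 i j • w i =
      (l0 - entryB q d h r j - entryC q d h r s j) • w j +
      (if 0 < (j : ℕ) then entryB q d h r (j - 1) • w (j - 1) else 0) +
      (if (j : ℕ) < d then entryC q d h r s (j + 1) • w (j + 1) else 0) := by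
  have key : ∀ i : Fin (d + 1), hahn q d h r s l0 i j • w i =
      (if i = j then (l0 - entryB q d h r j - entryC q d h r s j) • w j else 0) +
      (if (j : ℕ) = i + 1 then entryB q d h r i • w i else 0) +
      (if (i : ℕ) = j + 1 then entryC q d h r s i • w i else 0) := by
    intro i
    rw [hahn, Matrix.of_apply]
    by_cases h1 : i = j
    · subst h1; simp
    · rw [if_neg h1, if_neg h1]
      by_cases h2 : (j : ℕ) = i + 1
      · rw [if_pos h2, if_pos h2, if_neg (by omega)]; simp
      · rw [if_neg h2, if_neg h2]
        by_cases h3 : (i : ℕ) = j + 1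
        · rw [if_pos h3, if_pos h3]; simp
        · rw [if_neg h3, if_neg h3]; simp
  rw [Finset.sum_congr rfl fun j _ => key j, Finset.sum_add_distrib, Finset.sum_add_distrib,
    Finset.sum_ite_eq' Finset.univ j, if_pos (Finset.mem_univ _)]
  congr 1
  · congr 1
    by_cases hj : 0 < (j : ℕ)
    · rw [if_pos hj, Finset.sum_eq_single ⟨j - 1, by omega⟩]
      · rw [if_pos]; simp; omega
      · intro i _ hi
        rw [if_neg fun h' => hi (Fin.ext (by simp; omega))]
      · exact fun h' => absurd (Finset.mem_univ _) h'
    · rw [if_neg hj]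
      exact Finset.sum_eq_zero fun i _ => if_neg (by omega)
  · by_cases hj : (j : ℕ) < d
    · rw [if_pos hj, Finset.sum_eq_single ⟨j + 1, by omega⟩]
      · simp
      · intro i _ hi
        rw [if_neg fun h' => hi (Fin.ext h')]
      · exact fun h' => absurd (Finset.mem_univ _) h'
    · rw [if_neg hj]
      exact Finset.sum_eq_zero fun i _ => if_neg (by omega)

variable {q : ℂ} (hq : q ≠ 0) (h1 : 1 - q ≠ 0) {D e f d : ℕ} {ν μ ρ : ℤ} (j : ℕ)
include hq h1

theorem zpow_three_two : q ^ (3 : ℤ) = q * q * q ∧ q ^ (2 : ℤ) = q * q := by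
  rw [show (3 : ℤ) = ((3 : ℕ) : ℤ) by rfl, show (2 : ℤ) = ((2 : ℕ) : ℤ) by rfl, zpow_natCast,
    zpow_natCast]
  constructor <;> ring

/-- The `w_i` still have to be rescaled, so only quantities invariant under rescaling are compared:
the diagonal entries here, and in `coefU_mul_of_ge` the products of opposite off-diagonal entries.
Everything becomes a rational identity in `q^ν, q^μ, q^ρ, q^D, q^j`. -/
theorem coefA_eq_of_ge (he : (e : ℤ) = ν + ρ) (hf : (f : ℤ) = ν + μ) (hd : (d : ℤ) = D - 2 * ν - ρ) :
    coefA q D ν μ ρ (e + j) = theta q D f - entryB q d (hPar q D f) (q ^ ((f : ℤ) - D - 2)) j -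
      entryC q d (hPar q D f) (q ^ ((f : ℤ) - D - 2)) (sPar q D f) j := by
  obtain ⟨h3, h2⟩ := zpow_three_two hq h1
  unfold coefA entryB entryC hPar sPar theta cc bb gauss1
  rw [← zpow_natCast q j, ← zpow_natCast q (j + 1)]
  push_cast
  simp only [he, hf, hd]
  simp only [two_mul, zpow_sub₀ hq, zpow_add₀ hq, zpow_one, h3, h2]
  have := zpow_ne_zero ν hq
  have := zpow_ne_zero μ hq
  have := zpow_ne_zero ρ hq
  have := zpow_ne_zero (D : ℤ) hq
  have := zpow_ne_zero (j : ℤ) hq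
  field_simp
  ring

theorem coefU_mul_of_ge (he : (e : ℤ) = ν + ρ) (hf : (f : ℤ) = ν + μ)
    (hd : (d : ℤ) = D - 2 * ν - ρ) :
    coefU q D ν ρ (e + j) * (q * bb q D ν μ ρ (e + j + 1)) =
      entryC q d (hPar q D f) (q ^ ((f : ℤ) - D - 2)) (sPar q D f) (j + 1) *
        entryB q d (hPar q D f) (q ^ ((f : ℤ) - D - 2)) j := by
  obtain ⟨h3, h2⟩ := zpow_three_two hq h1
  unfold coefU entryB entryC hPar sPar cc bb gauss1
  rw [← zpow_natCast q (j + 1)]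
  push_cast
  simp only [he, hf, hd]
  simp only [two_mul, zpow_sub₀ hq, zpow_add₀ hq, zpow_one, h3, h2]
  have := zpow_ne_zero ν hq
  have := zpow_ne_zero μ hq
  have := zpow_ne_zero ρ hq
  have := zpow_ne_zero (D : ℤ) hq
  have := zpow_ne_zero (j : ℤ) hq
  field_simp
  ring

theorem coefA_eq_of_lt (he : (e : ℤ) = μ) (hf : (f : ℤ) = ν + μ)
    (hd : (d : ℤ) = D + 1 - 2 * μ + ρ) :
    coefA q D ν μ ρ (e + j) = theta q D f - entryB q d (hPar q D f) (q ^ ((f : ℤ) - D - 1)) j -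
      entryC q d (hPar q D f) (q ^ ((f : ℤ) - D - 1)) (sPar q D f) j := by
  obtain ⟨h3, h2⟩ := zpow_three_two hq h1
  unfold coefA entryB entryC hPar sPar theta cc bb gauss1
  rw [← zpow_natCast q j, ← zpow_natCast q (j + 1)]
  push_cast
  simp only [he, hf, hd]
  simp only [two_mul, zpow_sub₀ hq, zpow_add₀ hq, zpow_one, h3, h2]
  have := zpow_ne_zero ν hq
  have := zpow_ne_zero μ hq
  have := zpow_ne_zero ρ hq
  have := zpow_ne_zero (D : ℤ) hq
  have := zpow_ne_zero (j : ℤ) hq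
  field_simp
  ring

theorem coefU_mul_of_lt (he : (e : ℤ) = μ) (hf : (f : ℤ) = ν + μ)
    (hd : (d : ℤ) = D + 1 - 2 * μ + ρ) :
    coefU q D ν ρ (e + j) * (q * bb q D ν μ ρ (e + j + 1)) =
      entryC q d (hPar q D f) (q ^ ((f : ℤ) - D - 1)) (sPar q D f) (j + 1) *
        entryB q d (hPar q D f) (q ^ ((f : ℤ) - D - 1)) j := by
  obtain ⟨h3, h2⟩ := zpow_three_two hq h1
  unfold coefU entryB entryC hPar sPar cc bb gauss1
  rw [← zpow_natCast q (j + 1)]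
  push_cast
  simp only [he, hf, hd]
  simp only [two_mul, zpow_sub₀ hq, zpow_add₀ hq, zpow_one, h3, h2]
  have := zpow_ne_zero ν hq
  have := zpow_ne_zero μ hq
  have := zpow_ne_zero ρ hq
  have := zpow_ne_zero (D : ℤ) hq
  have := zpow_ne_zero (j : ℤ) hq
  field_simp
  ring

end Parameters

/-! ### The `T`-modules spanned by the vectors `w_i`. -/

section TypeOneModules

variable {F : Type*} [Field F] [Fintype F] {D : ℕ} {H : Pt F D}

/-- Each quantity that must differ from one is a power of `q`, and `f + d ≤ D` makes its exponent
negative. -/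
theorem admissible_of_le {f d : ℕ} (hfd : f + d ≤ D) {m : ℤ} (hm : m = 1 ∨ m = 2) :
    Admissible (order F) d (hPar (order F) D f) (order F ^ ((f : ℤ) - D - m))
      (sPar (order F) D f) := by
  have hq := order_ne_zero (F := F)
  have h1 := one_sub_order_ne_zero (F := F)
  refine ⟨div_ne_zero (zpow_ne_zero _ hq) (pow_ne_zero _ h1), zpow_ne_zero _ hq,
    zpow_ne_zero _ hq, fun i hi => ⟨?_, ?_⟩, fun i hi => ?_⟩ <;> rw [Finset.mem_Icc] at hi
  · rw [← zpow_natCast, ← zpow_add₀ hq, Ne, order_zpow_eq_one_iff]; omega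
  · rw [sPar, ← zpow_natCast, ← zpow_add₀ hq, ← zpow_sub₀ hq, Ne, order_zpow_eq_one_iff]; omega
  · rw [sPar, ← zpow_natCast, ← zpow_add₀ hq, Ne, order_zpow_eq_one_iff]; omega

variable {x : Vertex H}

/-- A tridiagonal action with the right diagonal and the right products of off-diagonal entries
is rescaled to the standard form. -/
theorem exists_isHahnBasis {W : Submodule (Talg x) (Vertex H → ℂ)} {e f d : ℕ} {r : ℂ}
    (he : e + d ≤ D) (hf : f + d ≤ D)
    (hadm : Admissible (order F) d (hPar (order F) D f) r (sPar (order F) D f))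
    {u : ℤ → Vertex H → ℂ} (hu : ∀ j : ℕ, j ≤ d → u j ≠ 0) (hu0 : u (-1) = 0) (hud : u (d + 1) = 0)
    (hdual : ∀ j : ℕ, j ≤ d → dualE x (e + j) *ᵥ u j = u j) {U A B : ℕ → ℂ}
    (hact : ∀ j : ℕ, j ≤ d → adj H *ᵥ u j = U j • u (j + 1) + A j • u j + B j • u (j - 1))
    (hA : ∀ j : ℕ, j ≤ d → A j = theta (order F) D f - entryB (order F) d (hPar (order F) D f) r j -
      entryC (order F) d (hPar (order F) D f) r (sPar (order F) D f) j)
    (hUB : ∀ j : ℕ, j < d → U j * B (j + 1) =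
      entryC (order F) d (hPar (order F) D f) r (sPar (order F) D f) (j + 1) *
        entryB (order F) d (hPar (order F) D f) r j)
    (hspan : Submodule.span ℂ (Set.range fun j : Fin (d + 1) => u (j : ℕ)) = W.restrictScalars ℂ) :
    ∃ v, IsHahnBasis W e f d r v := by
  set b := entryB (order F) d (hPar (order F) D f) r
  set c := entryC (order F) d (hPar (order F) D f) r (sPar (order F) D f)
  have hb : ∀ i, i < d → b i ≠ 0 := fun i hi => entryB_ne_zero hadm hi
  have hc : ∀ i, 0 < i → i ≤ d → c i ≠ 0 := fun i h0 hi => entryC_ne_zero hadm h0 hi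
  -- With these factors the coefficient of the next vector becomes `c`; the one of the previous
  -- vector is then `b`, because the products agree by `hUB`.
  set κ : ℕ → ℂ := fun j => ∏ l ∈ Finset.range j, (U l / c (l + 1))
  have hκs : ∀ j, κ (j + 1) = κ j * (U j / c (j + 1)) := fun j => Finset.prod_range_succ _ _
  have hκ : ∀ j, j ≤ d → κ j ≠ 0 := by
    intro j hj
    refine Finset.prod_ne_zero_iff.2 fun l hl => ?_
    rw [Finset.mem_range] at hl
    have h1 := hUB l (by omega)
    have h2 := hc (l + 1) (by omega) (by omega)
    exact div_ne_zero (left_ne_zero_of_mul (h1 ▸ mul_ne_zero h2 (hb l (by omega)))) h2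
  refine ⟨fun j => κ j • u (j : ℕ), he, hf, hadm, fun j => smul_ne_zero (hκ j (by omega))
    (hu j (by omega)), fun j => ?_, fun j => ?_, ?_⟩
  · rw [Matrix.mulVec_smul, hdual j (by omega)]
  · rw [hahn_sum_smul d _ _ _ _ (fun i : ℕ => κ i • u (i : ℤ)) j, Matrix.mulVec_smul,
      hact j (by omega), hA j (by omega)]
    change _ = (theta (order F) D f - b j - c j) • _ + (if _ then b (j - 1) • _ else _) +
      (if _ then c (j + 1) • _ else _)
    have e1 : (if 0 < (j : ℕ) then b (j - 1) • κ (j - 1) • u ((j - 1 : ℕ) : ℤ) else 0) =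
        (κ j * B j) • u ((j : ℕ) - 1) := by
      split_ifs with h0
      · obtain ⟨m, hm⟩ : ∃ m, (j : ℕ) = m + 1 := ⟨j - 1, by omega⟩
        have h2 := hUB m (by omega)
        have h3 := hc (m + 1) (by omega) (by omega)
        rw [hm, Nat.add_sub_cancel, hκs, smul_smul, show ((m + 1 : ℕ) : ℤ) - 1 = m by push_cast; ring]
        congr 1
        field_simp
        linear_combination -κ m * h2
      · rw [show (j : ℕ) = 0 by omega, Nat.cast_zero, zero_sub, hu0, smul_zero]
    have e2 : (if (j : ℕ) < d then c (j + 1) • κ (j + 1) • u ((j + 1 : ℕ) : ℤ) else 0) =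
        (κ j * U j) • u ((j : ℕ) + 1) := by
      split_ifs with h0
      · have h3 := hc (j + 1) (by omega) (by omega)
        rw [hκs, smul_smul]
        push_cast
        congr 1
        field_simp
      · rw [show (j : ℕ) = d by omega, hud, smul_zero]
    rw [e1, e2]
    module
  · rw [← hspan]
    apply le_antisymm
    · rw [Submodule.span_le]
      rintro _ ⟨j, rfl⟩
      exact Submodule.smul_mem _ _ (Submodule.subset_span ⟨j, rfl⟩)
    · rw [Submodule.span_le]
      rintro _ ⟨j, rfl⟩
      have : u (j : ℕ) = (κ j)⁻¹ • κ j • u (j : ℕ) := by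
        rw [smul_smul, inv_mul_cancel₀ (hκ j (by omega)), one_smul]
      change u (j : ℕ) ∈ Submodule.span ℂ _
      rw [this]
      exact Submodule.smul_mem _ _ (Submodule.subset_span ⟨j, rfl⟩)

variable {X : Type*} [AddCommGroup X] [Module F X] [Finite X]
  {C : Type*} [AddCommGroup C] [Module F C] [Finite C] (s : Splitting x.1 H X C)
  {ν μ ρ : ℤ} {g : Model F X C}

/-- The span of the vectors `w_i`. -/
def Splitting.ospan (ν μ : ℤ) (g : Model F X C) : Submodule ℂ (Vertex H → ℂ) :=
  Submodule.span ℂ (Set.range fun i => s.omv ν μ i g)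

variable (hD : 2 ≤ D) (hx : x.1 ∈ X2 H) (hX : (finrank F X : ℤ) = D - 1)
  (hC : (finrank F C : ℤ) = D + 1) (hg : g ∈ Low F X C ν μ ρ)
include hD hx hX hC hg

theorem Splitting.exists_ospan : ∃ W : Submodule (Talg x) (Vertex H → ℂ),
    W.restrictScalars ℂ = s.ospan ν μ g := by
  refine exists_submodule_adjoin _ fun M hM u hu => ?_
  have hle : s.ospan ν μ g ≤ (s.ospan ν μ g).comap M.mulVecLin := by
    refine Submodule.span_le.2 ?_
    rintro _ ⟨i, rfl⟩
    change M *ᵥ s.omv ν μ i g ∈ s.ospan ν μ g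
    have hmem : ∀ i, s.omv ν μ i g ∈ s.ospan ν μ g := fun i => Submodule.subset_span ⟨i, rfl⟩
    by_cases h0 : s.omv ν μ i g = 0
    · rw [h0, Matrix.mulVec_zero]; exact zero_mem _
    rcases hM with hM | ⟨m, rfl⟩
    · obtain rfl : M = adj H := hM
      have hne : g ≠ 0 := fun h => h0 (by rw [h, map_zero])
      have := not_not.1 (mt (s.omv_eq_zero_iff hD hX hC hg hne).2 h0)
      rw [s.adj_omv hD hX hC hg (by omega) (by omega)]
      exact add_mem (add_mem (Submodule.smul_mem _ _ (hmem _)) (Submodule.smul_mem _ _ (hmem _)))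
        (Submodule.smul_mem _ _ (hmem _))
    · rw [dualE_omv s hD hx hg]
      split_ifs
      · exact hmem i
      · exact zero_mem _
  exact hle hu

/-- The common part of the two cases, which differ in the term that realizes the maximum of `ν + ρ`
and `μ` and in the exponent `m` entering `r`. -/
theorem Splitting.exists_isHahnBasis_aux (hne : g ≠ 0) {e f d : ℕ} {m : ℤ} (hm : m = 1 ∨ m = 2)
    (hfd : f + d ≤ D) (hed : e + d ≤ D)
    (hmin : (e : ℤ) = max (ν + ρ) μ) (hmax : (e : ℤ) + d = min ((D : ℤ) - ν) (D - μ + ρ + 1))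
    (hA : ∀ j : ℕ, coefA (order F) D ν μ ρ (e + j) = theta (order F) D f -
      entryB (order F) d (hPar (order F) D f) (order F ^ ((f : ℤ) - D - m)) j -
      entryC (order F) d (hPar (order F) D f) (order F ^ ((f : ℤ) - D - m)) (sPar (order F) D f) j)
    (hUB : ∀ j : ℕ, coefU (order F) D ν ρ (e + j) * (order F * bb (order F) D ν μ ρ (e + j + 1)) =
      entryC (order F) d (hPar (order F) D f) (order F ^ ((f : ℤ) - D - m)) (sPar (order F) D f)
        (j + 1) * entryB (order F) d (hPar (order F) D f) (order F ^ ((f : ℤ) - D - m)) j)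
    {W : Submodule (Talg x) (Vertex H → ℂ)} (hW : W.restrictScalars ℂ = s.ospan ν μ g) :
    ∃ v, IsHahnBasis W e f d (order F ^ ((f : ℤ) - D - m)) v := by
  have hz := fun i => s.omv_eq_zero_iff hD hX hC hg hne (i := i)
  refine exists_isHahnBasis hed hfd (admissible_of_le hfd hm) (u := fun j => s.omv ν μ (e + j) g)
    (U := fun j => coefU (order F) D ν ρ (e + j)) (A := fun j => coefA (order F) D ν μ ρ (e + j))
    (B := fun j => order F * bb (order F) D ν μ ρ (e + j))
    (fun j hj h0 => (hz _).1 h0 (by omega)) ((hz _).2 (by omega)) ((hz _).2 (by omega))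
    (fun j hj => ?_) (fun j hj => ?_) (fun j _ => hA j) (fun j _ => ?_) ?_
  · rw [dualE_omv s hD hx hg, if_pos (by push_cast; rfl)]
  · simp only [← add_assoc, ← add_sub_assoc]
    exact s.adj_omv hD hX hC hg (by omega) (by omega)
  · have := hUB j
    rw [add_assoc (e : ℤ)] at this
    simpa using this
  · rw [hW]
    apply le_antisymm
    · rw [Submodule.span_le]
      rintro _ ⟨j, rfl⟩
      exact Submodule.subset_span ⟨_, rfl⟩
    · refine Submodule.span_le.2 ?_
      rintro _ ⟨i, rfl⟩
      by_cases h0 : s.omv ν μ i g = 0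
      · simp only [h0]; exact zero_mem _
      · have := not_not.1 (mt (hz i).2 h0)
        refine Submodule.subset_span ⟨⟨(i - e).toNat, by omega⟩, ?_⟩
        change s.omv ν μ (e + ((i - e).toNat : ℤ)) g = s.omv ν μ i g
        rw [show (e : ℤ) + ((i - e).toNat : ℤ) = i by omega]

/-- The modules with `ν + ρ ≥ μ`. -/
theorem Splitting.exists_isHahnBasis_of_ge (hne : g ≠ 0) (hle : μ ≤ ν + ρ) {e f d : ℕ}
    (he : (e : ℤ) = ν + ρ) (hf : (f : ℤ) = ν + μ) (hd : (d : ℤ) = D - 2 * ν - ρ)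
    {W : Submodule (Talg x) (Vertex H → ℂ)} (hW : W.restrictScalars ℂ = s.ospan ν μ g) :
    ∃ v, IsHahnBasis W e f d (order F ^ ((f : ℤ) - D - 2)) v := by
  have hb := Low_bounds hg hne
  refine s.exists_isHahnBasis_aux hD hx hX hC hg hne (Or.inr rfl) (by omega) (by omega) (by omega)
    (by omega) (fun j => coefA_eq_of_ge order_ne_zero one_sub_order_ne_zero j he hf hd)
    (fun j => coefU_mul_of_ge order_ne_zero one_sub_order_ne_zero j he hf hd) hW

/-- The modules with `ν + ρ < μ`. -/
theorem Splitting.exists_isHahnBasis_of_lt (hne : g ≠ 0) (hlt : ν + ρ < μ) {e f d : ℕ}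
    (he : (e : ℤ) = μ) (hf : (f : ℤ) = ν + μ) (hd : (d : ℤ) = D + 1 - 2 * μ + ρ)
    {W : Submodule (Talg x) (Vertex H → ℂ)} (hW : W.restrictScalars ℂ = s.ospan ν μ g) :
    ∃ v, IsHahnBasis W e f d (order F ^ ((f : ℤ) - D - 1)) v := by
  have hb := Low_bounds hg hne
  refine s.exists_isHahnBasis_aux hD hx hX hC hg hne (Or.inl rfl) (by omega) (by omega) (by omega)
    (by omega) (fun j => coefA_eq_of_lt order_ne_zero one_sub_order_ne_zero j he hf hd)
    (fun j => coefU_mul_of_lt order_ne_zero one_sub_order_ne_zero j he hf hd) hW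

end TypeOneModules

end

end TwistedGrassmann

namespace TwistedGrassmann

noncomputable section

set_option linter.unusedSectionVars false

open Module Matrix

/-! ### Dimensions of the spaces of lowest weight vectors -/

section Ladder

variable {F : Type*} [Field F] [Fintype F] {E : Type*} [AddCommGroup E] [Module ℂ E]
  {l r : E →ₗ[ℂ] E} {K : ℤ → Submodule ℂ E} {t : ℤ} {z : ℂ} (hz : z ≠ 0)
  (hl : ∀ i, ∀ f ∈ K i, l f ∈ K (i - 1)) (h0 : ∀ i < 0, K i = ⊥)
  (hlr : ∀ i, ∀ f ∈ K i, l (r f) = r (l f) +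
    (z * (gauss1 (order F) (t - i) - gauss1 (order F) i)) • f)
include hz hl h0 hlr

/-- From `l (r f) = 0` it follows inductively that `r ∘ l` multiplies `l^n f` by a scalar, which is
nonzero below the middle. So `l^{n+1} f = 0` implies `l^n f = 0`; and some power of `l` kills `f`,
as `K` vanishes in negative degrees. -/
theorem ladder_injective {i : ℤ} (hi : 2 * i < t) {f : E} (hf : f ∈ K i) (hfr : l (r f) = 0) :
    f = 0 := by
  have hmem : ∀ n : ℕ, (l ^ n) f ∈ K (i - n) := by
    intro n
    induction n with
    | zero => simpa using hf
    | succ n ih =>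
      rw [pow_succ_apply']
      have := hl _ _ ih
      rwa [show i - ((n + 1 : ℕ) : ℤ) = i - n - 1 by push_cast; ring]
  have hrec : ∀ n : ℕ, l (r ((l ^ n) f)) = -(z * (order F ^ (i - n + 1) *
      gauss1 (order F) n * gauss1 (order F) (t - 2 * i + n - 1))) • (l ^ n) f → r (l ((l ^ n) f)) =
        -(z * (order F ^ (i - n) *
      gauss1 (order F) (n + 1) * gauss1 (order F) (t - 2 * i + n))) • (l ^ n) f := by
    intro n hn
    have h1 := hlr _ _ (hmem n)
    rw [hn] at h1
    have h2 : order F ^ (i - n + 1) * gauss1 (order F) n * gauss1 (order F) (t - 2 * i + n - 1) +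
        (gauss1 (order F) (t - (i - n)) - gauss1 (order F) (i - n)) = order F ^ (i - n) *
        gauss1 (order F) (n + 1) * gauss1 (order F) (t - 2 * i + n) := by
      have hq := order_ne_zero (F := F)
      have h1 := one_sub_order_ne_zero (F := F)
      unfold gauss1
      simp only [two_mul, zpow_sub₀ hq, zpow_add₀ hq, zpow_one]
      have := zpow_ne_zero i hq
      have := zpow_ne_zero (n : ℤ) hq
      field_simp
      ring
    rw [← h2]
    linear_combination (norm := module) -h1
  have hlow : ∀ n : ℕ, l (r ((l ^ n) f)) = -(z * (order F ^ (i - n + 1) *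
      gauss1 (order F) n * gauss1 (order F) (t - 2 * i + n - 1))) • (l ^ n) f := by
    intro n
    induction n with
    | zero => simp [hfr, gauss1_zero]
    | succ n ih =>
      rw [pow_succ_apply', hrec n ih, map_smul]
      push_cast
      rw [show i - ((n : ℤ) + 1) + 1 = i - n by ring,
        show t - 2 * i + ((n : ℤ) + 1) - 1 = t - 2 * i + n by ring]
  have hstep := fun n => hrec n (hlow n)
  have hdesc : ∀ n : ℕ, (l ^ n) f = 0 → f = 0 := by
    intro n
    induction n with
    | zero => exact fun h => by simpa using h
    | succ n ih =>
      intro h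
      apply ih
      have h1 := hstep n
      rw [← pow_succ_apply', h, map_zero] at h1
      refine (smul_eq_zero.1 h1.symm).resolve_left ?_
      refine neg_ne_zero.2 (mul_ne_zero hz (mul_ne_zero (mul_ne_zero (zpow_ne_zero _ order_ne_zero)
        ?_) ?_)) <;> rw [Ne, gauss1_eq_zero_iff] <;> omega
  apply hdesc (i.toNat + 1)
  have := hmem (i.toNat + 1)
  rwa [h0 _ (by push_cast; omega), Submodule.mem_bot] at this

/-- Injectivity of `l ∘ r` on `K (i - 1)` gives bijectivity in finite dimension, hence `l` maps `K
i` onto `K (i - 1)`, and rank-nullity applies. -/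
theorem finrank_ladder [FiniteDimensional ℂ E] (hr : ∀ i, ∀ f ∈ K i, r f ∈ K (i + 1)) {i : ℤ}
    (hi : 2 * (i - 1) < t) :
    finrank ℂ (K i) = finrank ℂ ↥(K i ⊓ LinearMap.ker l) + finrank ℂ (K (i - 1)) := by
  have hr' : ∀ f ∈ K (i - 1), r f ∈ K i := fun f hf => by
    have := hr _ _ hf
    rwa [sub_add_cancel] at this
  have hinj : Function.Injective ((l ∘ₗ r).restrict (p := K (i - 1)) (q := K (i - 1))
      fun f hf => hl _ _ (hr' f hf)) := by
    rw [← LinearMap.ker_eq_bot, LinearMap.ker_eq_bot']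
    rintro ⟨f, hf⟩ h
    exact Subtype.ext (ladder_injective hz hl h0 hlr hi hf (congrArg Subtype.val h))
  have hsurj := LinearMap.injective_iff_surjective.1 hinj
  have hrange : LinearMap.range (l.domRestrict (K i)) = K (i - 1) := by
    apply le_antisymm
    · rintro _ ⟨⟨f, hf⟩, rfl⟩
      exact hl _ _ hf
    · intro f hf
      obtain ⟨⟨f', hf'⟩, h⟩ := hsurj ⟨f, hf⟩
      exact ⟨⟨r f', hr' _ hf'⟩, congrArg Subtype.val h⟩
  have hker : finrank ℂ (LinearMap.ker (l.domRestrict (K i))) =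
      finrank ℂ ↥(K i ⊓ LinearMap.ker l) := by
    rw [LinearMap.ker_domRestrict, ← Submodule.finrank_map_subtype_eq]
    exact congrArg (fun S : Submodule ℂ E => finrank ℂ S) (Submodule.map_comap_subtype _ _)
  have := LinearMap.finrank_range_add_finrank_ker (l.domRestrict (K i))
  rw [hrange, hker] at this
  omega

end Ladder

/-! ### Counting linear maps, and the dimension of the space of lowest weight vectors. -/

section Counting

variable {F : Type*} [Field F] [Fintype F] {X : Type*} [AddCommGroup X] [Module F X] [Finite X]
  {C : Type*} [AddCommGroup C] [Module F C] [Finite C]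

/-- Such maps are the injections of `X/K` into `C`, that is, after the choice of a basis of the
quotient, the linearly independent `ρ`-tuples in `C`. -/
theorem card_ker_eq {K : Submodule F X} {ρ : ℕ} (hK : finrank F K + ρ = finrank F X)
    (hρ : ρ ≤ finrank F C) :
    Nat.card {φ : X →ₗ[F] C // LinearMap.ker φ = K} =
      ∏ i : Fin ρ, (Fintype.card F ^ finrank F C - Fintype.card F ^ (i : ℕ)) := by
  have := finite_dimensional_of_finite (F := F) (E := X)
  have hquot : finrank F (X ⧸ K) = ρ := by
    have := Submodule.finrank_quotient_add_finrank K
    omega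
  let b : Basis (Fin ρ) F (X ⧸ K) := finBasisOfFinrankEq F _ hquot
  rw [← card_linearIndependent hρ]
  symm
  have hker : ∀ s : Fin ρ → C, LinearIndependent F s → LinearMap.ker (b.constr F s) = ⊥ := by
    intro s hs
    rw [LinearMap.ker_eq_bot']
    intro y hy
    rw [Basis.constr_apply_fintype] at hy
    have := Fintype.linearIndependent_iff.1 hs _ hy
    exact b.equivFun.map_eq_zero_iff.1 (funext this)
  refine Nat.card_eq_of_bijective (fun s => ⟨b.constr F s.1 ∘ₗ K.mkQ, by
    rw [LinearMap.ker_comp, hker _ s.2, ← LinearMap.ker, Submodule.ker_mkQ]⟩) ⟨?_, ?_⟩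
  · intro s s' h
    have h1 := (LinearMap.cancel_right K.mkQ_surjective).1 (congrArg Subtype.val h)
    exact Subtype.ext ((b.constr F).injective h1)
  · rintro ⟨φ, rfl⟩
    refine ⟨⟨fun i => (LinearMap.ker φ).liftQ φ le_rfl (b i), ?_⟩, Subtype.ext ?_⟩
    · exact b.linearIndependent.map' _ (Submodule.ker_liftQ_eq_bot' _ _ rfl)
    · change b.constr F (fun i => (LinearMap.ker φ).liftQ φ le_rfl (b i)) ∘ₗ _ = φ
      rw [Basis.constr_self, Submodule.liftQ_mkQ]

open Classical in
theorem card_rank_eq {ρ : ℕ} (hX : ρ ≤ finrank F X) (hC : ρ ≤ finrank F C) :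
    ((Finset.univ.filter fun φ : X →ₗ[F] C => finrank F (LinearMap.range φ) = ρ).card : ℂ) =
      gbin (order F) (finrank F X) (finrank F X - ρ) *
        ∏ i ∈ Finset.range ρ, (order F ^ finrank F C - order F ^ i) := by
  have := finite_dimensional_of_finite (F := F) (E := X)
  have h1 := Finset.card_eq_sum_card_fiberwise (f := fun φ : X →ₗ[F] C => LinearMap.ker φ)
    (s := Finset.univ.filter fun φ : X →ₗ[F] C => finrank F (LinearMap.range φ) = ρ)
    (t := Finset.univ.filter fun K : Submodule F X => ⊥ ≤ K ∧ K ≤ ⊤ ∧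
      finrank F K = finrank F X - ρ) (by
      intro φ hφ
      simp only [Finset.coe_filter, Finset.mem_univ, true_and, Set.mem_ofPred_eq] at hφ ⊢
      have := LinearMap.finrank_range_add_finrank_ker φ
      exact ⟨bot_le, le_top, by omega⟩)
  have h2 : ∀ K ∈ Finset.univ.filter (fun K : Submodule F X => ⊥ ≤ K ∧ K ≤ ⊤ ∧
      finrank F K = finrank F X - ρ),
      (Finset.filter (fun φ : X →ₗ[F] C => LinearMap.ker φ = K)
        (Finset.univ.filter fun φ : X →ₗ[F] C => finrank F (LinearMap.range φ) = ρ)).card =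
      ∏ i : Fin ρ, (Fintype.card F ^ finrank F C - Fintype.card F ^ (i : ℕ)) := by
    intro K hK
    simp only [Finset.mem_filter, Finset.mem_univ, true_and] at hK
    rw [← card_ker_eq (K := K) (C := C) (by omega) hC, Nat.card_eq_fintype_card,
      Fintype.card_subtype, Finset.filter_filter]
    congr 1
    ext φ
    simp only [Finset.mem_filter, Finset.mem_univ, true_and, and_iff_right_iff_imp]
    rintro rfl
    have := LinearMap.finrank_range_add_finrank_ker φ
    omega
  rw [h1, Finset.sum_congr rfl h2, Finset.sum_const, smul_eq_mul, Nat.cast_mul]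
  have h3 := card_interval (bot_le : (⊥ : Submodule F X) ≤ ⊤) (finrank F X - ρ)
  rw [finrank_bot, finrank_top, Nat.cast_zero, sub_zero, sub_zero, Nat.cast_sub hX] at h3
  rw [h3, Nat.cast_prod, Finset.prod_range]
  congr 1
  refine Finset.prod_congr rfl fun i _ => ?_
  rw [Nat.cast_sub (Nat.pow_le_pow_right Fintype.card_pos (by omega))]
  push_cast; rfl

open Classical in
/-- The number of linear maps of rank `ρ`. -/
def numRank (F X C : Type*) [Field F] [Fintype F] [AddCommGroup X] [Module F X] [Finite X]
    [AddCommGroup C] [Module F C] [Finite C] (ρ : ℤ) : ℂ :=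
  ((Finset.univ.filter fun φ : X →ₗ[F] C => (finrank F (LinearMap.range φ) : ℤ) = ρ).card : ℂ)

/-- The space consists of all functions on the finite set of triples satisfying `P`. For a fixed `φ`
of rank `ρ`, `A` and `B` range independently over the intervals `[⊥, ker φ]` and `[range φ, ⊤]`. -/
theorem finrank_lev_rk (i j : ℕ) (ρ : ℤ) :
    (finrank ℂ ↥(lev F X C i j ⊓ rk F X C ρ) : ℂ) = numRank F X C ρ *
      (gbin (order F) (finrank F X - ρ) i * gbin (order F) (finrank F C - ρ) (j - ρ)) := by
  classical
  let P : (X →ₗ[F] C) × Submodule F X × Submodule F C → Prop := fun t =>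
    (finrank F (LinearMap.range t.1) : ℤ) = ρ ∧ (⊥ ≤ t.2.1 ∧ t.2.1 ≤ LinearMap.ker t.1 ∧
      finrank F t.2.1 = i) ∧ (LinearMap.range t.1 ≤ t.2.2 ∧ t.2.2 ≤ ⊤ ∧ finrank F t.2.2 = j)
  have hP : ∀ f ∈ lev F X C i j ⊓ rk F X C ρ, ∀ φ A B, f φ A B ≠ 0 → P (φ, A, B) := by
    intro f hf φ A B hne
    obtain ⟨⟨h1, h2⟩, h3, h4⟩ := hf.1 φ A B hne
    exact ⟨hf.2 φ A B hne, ⟨bot_le, h1, by exact_mod_cast h3⟩, h2, le_top, by exact_mod_cast h4⟩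
  let ψ : ↥(lev F X C i j ⊓ rk F X C ρ) ≃ₗ[ℂ] ({t // P t} → ℂ) :=
    { toFun := fun f t => f.1 t.1.1 t.1.2.1 t.1.2.2
      map_add' := fun _ _ => rfl
      map_smul' := fun _ _ => rfl
      invFun := fun g => ⟨fun φ A B => if h : P (φ, A, B) then g ⟨_, h⟩ else 0, by
        refine ⟨fun φ A B hne => ?_, fun φ A B hne => ?_⟩
        · by_cases h : P (φ, A, B)
          · exact ⟨⟨h.2.1.2.1, h.2.2.1⟩, by exact_mod_cast h.2.1.2.2, by exact_mod_cast h.2.2.2.2⟩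
          · exact absurd (dif_neg h) hne
        · by_cases h : P (φ, A, B)
          · exact h.1
          · exact absurd (dif_neg h) hne⟩
      left_inv := fun f => Subtype.ext (by
        ext φ A B
        change (if h : P (φ, A, B) then f.1 φ A B else 0) = f.1 φ A B
        split_ifs with h
        · rfl
        · by_contra hne; exact h (hP f.1 f.2 φ A B (Ne.symm hne)))
      right_inv := fun g => funext fun t => dif_pos t.2 }
  rw [ψ.finrank_eq, Module.finrank_fintype_fun_eq_card, Fintype.card_subtype, Finset.card_filter,
    Nat.cast_sum, Fintype.sum_prod_type]
  have key : ∀ φ : X →ₗ[F] C, ∑ t : Submodule F X × Submodule F C,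
      (((if P (φ, t) then 1 else 0 : ℕ)) : ℂ) =
      if (finrank F (LinearMap.range φ) : ℤ) = ρ then
        gbin (order F) (finrank F X - ρ) i * gbin (order F) (finrank F C - ρ) (j - ρ) else 0 := by
    intro φ
    split_ifs with hφ
    · have := finite_dimensional_of_finite (F := F) (E := X)
      have h1 := card_interval (bot_le : ⊥ ≤ LinearMap.ker φ) i
      have h2 := card_interval (le_top : LinearMap.range φ ≤ ⊤) j
      have h3 := LinearMap.finrank_range_add_finrank_ker φ
      rw [finrank_bot, show (finrank F (LinearMap.ker φ) : ℤ) - (0 : ℕ) = finrank F X - ρ by omega,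
        Nat.cast_zero, sub_zero] at h1
      rw [finrank_top, hφ] at h2
      rw [← h1, ← h2, Finset.card_filter, Finset.card_filter, Nat.cast_sum, Nat.cast_sum,
        Finset.sum_mul_sum, Fintype.sum_prod_type]
      refine Finset.sum_congr rfl fun A _ => Finset.sum_congr rfl fun B _ => ?_
      simp only [P, hφ, true_and]
      by_cases hA : ⊥ ≤ A ∧ A ≤ LinearMap.ker φ ∧ finrank F A = i
      · by_cases hB : LinearMap.range φ ≤ B ∧ B ≤ ⊤ ∧ finrank F B = j
        · rw [if_pos ⟨hA, hB⟩, if_pos hA, if_pos hB]; simp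
        · rw [if_neg (fun h => hB h.2), if_neg hB]; simp
      · rw [if_neg (fun h => hA h.1), if_neg hA]; simp
    · refine Finset.sum_eq_zero fun t _ => ?_
      rw [if_neg (fun h => hφ h.1), Nat.cast_zero]
  rw [Finset.sum_congr rfl fun φ _ => key φ, numRank, ← Finset.sum_filter, Finset.sum_const,
    nsmul_eq_mul]

theorem finrank_lev_rk' (i j ρ : ℤ) (hj : 0 ≤ j) :
    (finrank ℂ ↥(lev F X C i j ⊓ rk F X C ρ) : ℂ) = numRank F X C ρ *
      (gbin (order F) (finrank F X - ρ) i * gbin (order F) (finrank F C - ρ) (j - ρ)) := by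
  obtain ⟨j, rfl⟩ := Int.eq_ofNat_of_zero_le hj
  by_cases hi : 0 ≤ i
  · obtain ⟨i, rfl⟩ := Int.eq_ofNat_of_zero_le hi
    exact finrank_lev_rk i j ρ
  · have h1 : lev F X C i j ⊓ rk F X C ρ = ⊥ := (Submodule.eq_bot_iff _).2 fun f hf =>
      eq_zero_of_mem_lev hf.1 (by omega)
    rw [h1, finrank_bot, gbin, if_neg (by omega)]
    simp

theorem finrank_lev_rk_ker {i j ρ : ℤ} (hj : 0 ≤ j)
    (hi : 2 * i ≤ (finrank F X : ℤ) - ρ) :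
    (finrank ℂ ↥(lev F X C i j ⊓ rk F X C ρ ⊓ LinearMap.ker l1) : ℂ) = numRank F X C ρ *
      ((gbin (order F) (finrank F X - ρ) i - gbin (order F) (finrank F X - ρ) (i - 1)) *
        gbin (order F) (finrank F C - ρ) (j - ρ)) := by
  have h := finrank_ladder (F := F) (l := l1) (r := r1) (K := fun i => lev F X C i j ⊓ rk F X C ρ)
    (t := finrank F X - ρ) (z := order F ^ j) (zpow_ne_zero _ order_ne_zero)
    (fun i f hf => ⟨l1_mem_lev hf.1, l1_mem_rk hf.2⟩)
    (fun i hi => (Submodule.eq_bot_iff _).2 fun f hf => eq_zero_of_mem_lev hf.1 (by omega))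
    (fun i f hf => l1_r1_of_mem hf.1 hf.2)
    (fun i f hf => ⟨r1_mem_lev hf.1, r1_mem_rk hf.2⟩) (i := i) (by omega)
  have h' := congrArg (Nat.cast (R := ℂ)) h
  rw [Nat.cast_add, finrank_lev_rk' _ _ _ hj, finrank_lev_rk' _ _ _ hj] at h'
  linear_combination -h'

/-- A second ladder, now for `l2` and `r2` inside the kernel of `l1`, which they preserve thanks to
the mixed commutation relations. -/
theorem finrank_Low {ν μ ρ : ℤ} (hρ : 0 ≤ ρ) (hμ : ρ ≤ μ)
    (h1 : 2 * ν ≤ (finrank F X : ℤ) - ρ) (h2 : 2 * μ ≤ (finrank F C : ℤ) + ρ) :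
    (finrank ℂ (Low F X C ν μ ρ) : ℂ) = numRank F X C ρ *
      ((gbin (order F) (finrank F X - ρ) ν - gbin (order F) (finrank F X - ρ) (ν - 1)) *
        (gbin (order F) (finrank F C - ρ) (μ - ρ) -
          gbin (order F) (finrank F C - ρ) (μ - ρ - 1))) := by
  obtain ⟨m, rfl⟩ : ∃ m, μ = ρ + m := ⟨μ - ρ, by ring⟩
  -- The second ladder starts at `j = ρ`, since `range φ ≤ B` on the support; its index is therefore
  -- shifted to `m = μ - ρ`.
  have hbot : ∀ j < ρ, lev F X C ν j ⊓ rk F X C ρ = ⊥ := fun j hj =>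
    (Submodule.eq_bot_iff _).2 fun f hf => by
      ext φ A B
      by_contra hne
      obtain ⟨⟨-, h3⟩, -, h4⟩ := hf.1 φ A B hne
      have h5 := hf.2 φ A B hne
      have := finrank_mono' h3
      omega
  have h := finrank_ladder (F := F) (l := l2) (r := r2)
    (K := fun j => lev F X C ν (ρ + j) ⊓ rk F X C ρ ⊓ LinearMap.ker l1)
    (t := finrank F C - ρ) (z := order F ^ ((finrank F X : ℤ) - ν)) (zpow_ne_zero _ order_ne_zero)
    (fun j f hf => ⟨⟨by rw [← add_sub_assoc]; exact l2_mem_lev hf.1.1, l2_mem_rk hf.1.2⟩, by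
      have := l2_l1 f
      rw [LinearMap.mem_ker.1 hf.2, map_zero, eq_comm, smul_eq_zero] at this
      exact LinearMap.mem_ker.2 (this.resolve_left order_ne_zero)⟩)
    (fun j hj => by rw [hbot _ (by omega), bot_inf_eq])
    (fun j f hf => by
      have := l2_r2_of_mem hf.1.1 hf.1.2
      rwa [← sub_sub, add_sub_cancel_left] at this)
    (fun j f hf => ⟨⟨by rw [← add_assoc]; exact r2_mem_lev hf.1.1, r2_mem_rk hf.1.2⟩, LinearMap.mem_ker.2 (by
      rw [l1_r2, LinearMap.mem_ker.1 hf.2, map_zero])⟩)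
    (i := m) (by omega)
  have h' := congrArg (Nat.cast (R := ℂ)) h
  rw [Nat.cast_add, finrank_lev_rk_ker (by omega) h1] at h'
  have h3 : (finrank ℂ ↥(lev F X C ν (ρ + (m - 1)) ⊓ rk F X C ρ ⊓ LinearMap.ker l1) : ℂ) =
      numRank F X C ρ *
      ((gbin (order F) (finrank F X - ρ) ν - gbin (order F) (finrank F X - ρ) (ν - 1)) *
        gbin (order F) (finrank F C - ρ) (m - 1)) := by
    by_cases hm : 0 ≤ m - 1
    · rw [finrank_lev_rk_ker (by omega) h1, add_sub_cancel_left]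
    · rw [hbot _ (by omega), bot_inf_eq, finrank_bot, gbin, gbin, gbin,
        if_neg (c := _ ∧ m - 1 ≤ _) (by omega)]
      simp
  rw [h3] at h'
  rw [Low, add_sub_cancel_left] at *
  linear_combination -h'

theorem gbin_sub {n k : ℤ} (h0 : 0 ≤ k) (hk : 2 * k ≤ n) :
    gbin (order F) n k - gbin (order F) n (k - 1) =
      order F ^ k * qq (order F) n * (1 - order F ^ (n - 2 * k + 1)) /
        (qq (order F) k * qq (order F) (n - k + 1)) := by
  have hq := order_ne_zero (F := F)
  have e1 := qq_succ (order F) (n := n - k) (by omega)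
  have n1 := qq_ne_zero (F := F) k
  have n2 := qq_ne_zero (F := F) (n - k + 1)
  have n3 := qq_ne_zero (F := F) (n - k)
  rw [gbin, if_pos (by omega)]
  -- The case `k = 0` is separate: `gbin` vanishes at `-1`, and `qq_succ` needs nonnegative
  -- arguments.
  by_cases hk0 : k = 0
  · rw [gbin, if_neg (by omega), sub_zero]
    subst hk0
    simp only [sub_zero, mul_zero, zpow_zero, qq_zero] at *
    rw [e1] at n2 ⊢
    have := right_ne_zero_of_mul n2
    field_simp
  · have e2 := qq_succ (order F) (n := k - 1) (by omega)
    rw [sub_add_cancel] at e2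
    rw [gbin, if_pos (by omega), show n - (k - 1) = n - k + 1 by ring]
    have n4 := qq_ne_zero (F := F) (k - 1)
    rw [e2] at n1 ⊢
    rw [e1] at n2 ⊢
    have n5 := right_ne_zero_of_mul n1
    have n6 := right_ne_zero_of_mul n2
    field_simp
    rw [show n - 2 * k + 1 = (n - k + 1) - k by ring, zpow_sub₀ hq]
    have := zpow_ne_zero k hq
    field_simp
    ring

/-- Each factor is `-q^i (1 - q^{b-i})`; this is the origin of the sign and of the binomial exponent
in the multiplicities. -/
theorem prod_order_sub {b ρ : ℕ} (h : ρ ≤ b) :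
    ∏ i ∈ Finset.range ρ, (order F ^ b - order F ^ i) =
      (-1) ^ ρ * order F ^ (ρ.choose 2) * qq (order F) b / qq (order F) ((b : ℤ) - ρ) := by
  induction ρ with
  | zero => simp [div_self (qq_ne_zero (F := F) b)]
  | succ ρ ih =>
    have e1 := qq_succ (order F) (n := (b : ℤ) - (ρ + 1)) (by omega)
    rw [show (b : ℤ) - (ρ + 1) + 1 = b - ρ by ring] at e1
    have n1 := qq_ne_zero (F := F) ((b : ℤ) - ρ)
    have n2 := qq_ne_zero (F := F) ((b : ℤ) - (ρ + 1))
    rw [Finset.prod_range_succ, ih (by omega), Nat.choose_succ_succ' ρ 1, Nat.choose_one_right,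
      pow_succ, pow_add]
    push_cast
    have e2 : order F ^ b = order F ^ ρ * order F ^ ((b : ℤ) - ρ) := by
      rw [← zpow_natCast, ← zpow_natCast, ← zpow_add₀ order_ne_zero]; congr 1; ring
    rw [e1] at n1 ⊢
    have n3 := right_ne_zero_of_mul n1
    rw [e2]
    field_simp
    ring

/-- The dimension of the space of lowest weight vectors, in closed form. -/
theorem finrank_Low_eq {ν μ ρ : ℤ} (hν : 0 ≤ ν) (hρ : 0 ≤ ρ) (hμ : ρ ≤ μ)
    (h1 : 2 * ν ≤ (finrank F X : ℤ) - ρ) (h2 : 2 * μ ≤ (finrank F C : ℤ) + ρ) :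
    (finrank ℂ (Low F X C ν μ ρ) : ℂ) /
        (qq (order F) (finrank F X) * qq (order F) (finrank F C)) =
      ((-1) ^ ρ * (1 - order F ^ ((finrank F X : ℤ) - ρ - 2 * ν + 1)) *
        (1 - order F ^ ((finrank F C : ℤ) + ρ - 2 * μ + 1)) *
        order F ^ (ν + μ - ρ + choose2 ρ)) /
      (qq (order F) ρ * qq (order F) ν * qq (order F) (finrank F X - ρ - ν + 1) *
        qq (order F) (μ - ρ) * qq (order F) (finrank F C - μ + 1)) := by
  have hq := order_ne_zero (F := F)
  rw [finrank_Low hρ hμ h1 h2, gbin_sub hν h1, gbin_sub (by omega) (by omega)]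
  obtain ⟨ρ, rfl⟩ := Int.eq_ofNat_of_zero_le hρ
  have e1 : numRank F X C ρ = gbin (order F) (finrank F X) (finrank F X - ρ) *
        ∏ i ∈ Finset.range ρ, (order F ^ finrank F C - order F ^ i) := by
    rw [← card_rank_eq (by omega) (by omega), numRank]
    simp only [Nat.cast_inj]
  have e2 : order F ^ (ν + μ - ρ + ((ρ.choose 2 : ℕ) : ℤ)) =
      order F ^ ν * order F ^ (μ - ρ) * order F ^ ρ.choose 2 := by
    rw [add_sub_assoc, zpow_add₀ hq, zpow_add₀ hq, zpow_natCast]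
  rw [e1, prod_order_sub (by omega), gbin, if_pos (by omega), sub_sub_cancel,
    show (finrank F C : ℤ) - ρ - 2 * (μ - ρ) + 1 = finrank F C + ρ - 2 * μ + 1 by ring,
    show (finrank F C : ℤ) - ρ - (μ - ρ) + 1 = finrank F C - μ + 1 by ring, choose2,
    Int.toNat_natCast, zpow_natCast, e2]
  have n1 := qq_ne_zero (F := F) (finrank F X)
  have n2 := qq_ne_zero (F := F) (finrank F C)
  have n3 := qq_ne_zero (F := F) ((finrank F X : ℤ) - ρ)
  have n4 := qq_ne_zero (F := F) ((finrank F C : ℤ) - ρ)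
  have n5 := qq_ne_zero (F := F) ρ
  have n6 := qq_ne_zero (F := F) ν
  have n7 := qq_ne_zero (F := F) (finrank F X - ρ - ν + 1)
  have n8 := qq_ne_zero (F := F) (μ - ρ)
  have n9 := qq_ne_zero (F := F) (finrank F C - μ + 1)
  field_simp

end Counting

end

end TwistedGrassmann

namespace TwistedGrassmann

noncomputable section

set_option linter.unusedSectionVars false

open Module Matrix

/-! ### Sums of simple submodules -/

section SimpleSums

variable {R M M' : Type*} [Ring R] [AddCommGroup M] [Module R M] [AddCommGroup M'] [Module R M']

theorem nonempty_equiv_map (f : M →ₗ[R] M') {N : Submodule R M} (hN : IsSimpleModule R N)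
    (h : N.map f ≠ ⊥) : Nonempty (N ≃ₗ[R] N.map f) := by
  have hs : Function.Surjective (f.submoduleMap N) := f.submoduleMap_surjective N
  refine ⟨LinearEquiv.ofBijective (f.submoduleMap N)
    ⟨(LinearMap.injective_or_eq_zero _).resolve_right fun h0 => h ?_, hs⟩⟩
  rw [Submodule.eq_bot_iff]
  intro w hw
  obtain ⟨u, hu⟩ := hs ⟨w, hw⟩
  rw [h0] at hu
  exact (congrArg Subtype.val hu).symm

/-- A simple submodule of a sum of simple submodules lies in the sum of those isomorphic to
it. -/
theorem le_sSup_isomorphic {𝒮 : Set (Submodule R M)} (h𝒮 : ∀ N ∈ 𝒮, IsSimpleModule R N)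
    {N : Submodule R M} (hN : IsSimpleModule R N) (hle : N ≤ sSup 𝒮) :
    N ≤ sSup {N' ∈ 𝒮 | Nonempty (N' ≃ₗ[R] N)} := by
  -- If `N` is not contained in `A`, it survives modulo `A` and is isomorphic to the nonzero image
  -- of some `N'` in `𝒮`. Then `N'` itself is isomorphic to `N`, so `N' ≤ A` and its image is zero.
  set A := sSup {N' ∈ 𝒮 | Nonempty (N' ≃ₗ[R] N)} with hA
  by_contra hNA
  have hmap : N.map A.mkQ ≠ ⊥ := by
    intro h0
    refine hNA fun u hu => ?_
    rw [← Submodule.ker_mkQ A, LinearMap.mem_ker, ← Submodule.mem_bot R, ← h0]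
    exact Submodule.mem_map_of_mem hu
  obtain ⟨φ⟩ := nonempty_equiv_map _ hN hmap
  set 𝒬 : Set (Submodule R (M ⧸ A)) := {Q | Q ≠ ⊥ ∧ ∃ N' ∈ 𝒮, N'.map A.mkQ = Q} with h𝒬
  have hsimple : ∀ Q : 𝒬, IsSimpleModule R Q := by
    rintro ⟨_, hQ, N', hN', rfl⟩
    have := h𝒮 N' hN'
    obtain ⟨ψ⟩ := nonempty_equiv_map _ (h𝒮 N' hN') hQ
    exact IsSimpleModule.congr ψ.symm
  have hQle : N.map A.mkQ ≤ sSup 𝒬 := by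
    rw [Submodule.map_le_iff_le_comap]
    refine hle.trans (sSup_le fun N' hN' => ?_)
    rw [← Submodule.map_le_iff_le_comap]
    by_cases h0 : N'.map A.mkQ = ⊥
    · rw [h0]; exact bot_le
    · exact le_sSup ⟨h0, N', hN', rfl⟩
  have : IsSimpleModule R (N.map A.mkQ) := IsSimpleModule.congr φ.symm
  obtain ⟨_, ⟨hQ, N', hN', rfl⟩, ⟨ψ⟩⟩ := (N.map A.mkQ).linearEquiv_of_le_sSup _ hQle
  obtain ⟨χ⟩ := nonempty_equiv_map _ (h𝒮 N' hN') hQ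
  apply hQ
  rw [← le_bot_iff, Submodule.map_le_iff_le_comap]
  refine le_trans ?_ (Submodule.ker_mkQ A).ge
  exact le_sSup ⟨hN', ⟨χ.trans (ψ.symm.trans φ.symm)⟩⟩

/-- The isotypic component is formed from all submodules isomorphic to `N`; by `le_sSup_isomorphic`
those belonging to `𝒮` already span it. -/
theorem map_isotypicComponent {𝒮 : Set (Submodule R M)} (h𝒮 : ∀ N ∈ 𝒮, IsSimpleModule R N)
    {N : Submodule R M} (hN : IsSimpleModule R N) :
    (isotypicComponent R ↥(sSup 𝒮) N).map (sSup 𝒮).subtype =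
      sSup {N' ∈ 𝒮 | Nonempty (N' ≃ₗ[R] N)} := by
  apply le_antisymm
  · rw [Submodule.map_le_iff_le_comap, isotypicComponent]
    refine sSup_le ?_
    rintro m ⟨φ⟩
    rw [← Submodule.map_le_iff_le_comap]
    have e := Submodule.equivMapOfInjective (sSup 𝒮).subtype (Submodule.subtype_injective _) m
    have : IsSimpleModule R (m.map (sSup 𝒮).subtype) := IsSimpleModule.congr (e.symm.trans φ)
    refine (le_sSup_isomorphic h𝒮 ‹_› (Submodule.map_subtype_le _ _)).trans (sSup_le_sSup ?_)
    rintro N' ⟨hN', ⟨ψ⟩⟩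
    exact ⟨hN', ⟨ψ.trans (e.symm.trans φ)⟩⟩
  · refine sSup_le ?_
    rintro N' ⟨hN', ⟨ψ⟩⟩
    have hle : N' ≤ sSup 𝒮 := le_sSup hN'
    have h1 : (N'.comap (sSup 𝒮).subtype).map (sSup 𝒮).subtype = N' := by
      rw [Submodule.map_comap_subtype, inf_eq_right.2 hle]
    rw [← h1]
    refine Submodule.map_mono (le_sSup ?_)
    exact ⟨(Submodule.comapSubtypeEquivOfLe hle).trans ψ⟩

theorem exists_isotypicComponent_equiv (K : Type*) [Field K] [Algebra K R] [Module K M]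
    [IsScalarTower K R M] [Module.Finite K M] {𝒮 : Set (Submodule R M)}
    (h𝒮 : ∀ N ∈ 𝒮, IsSimpleModule R N) {N : Submodule R M} (hN : IsSimpleModule R N) :
    ∃ n : ℕ, Nonempty (isotypicComponent R ↥(sSup 𝒮) N ≃ₗ[R] (Fin n → N)) ∧
      n * finrank K (N.restrictScalars K) =
        finrank K ((sSup {N' ∈ 𝒮 | Nonempty (N' ≃ₗ[R] N)}).restrictScalars K) := by
  have : Module.Finite K ↥(sSup 𝒮) :=
    inferInstanceAs (Module.Finite K ((sSup 𝒮).restrictScalars K))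
  have : Module.Finite K (isotypicComponent R ↥(sSup 𝒮) N) :=
    inferInstanceAs (Module.Finite K ((isotypicComponent R ↥(sSup 𝒮) N).restrictScalars K))
  have : Module.Finite K N := inferInstanceAs (Module.Finite K (N.restrictScalars K))
  have : Module.Finite R (isotypicComponent R ↥(sSup 𝒮) N) :=
    Module.Finite.of_restrictScalars_finite K _ _
  obtain ⟨n, ⟨φ⟩⟩ := (IsIsotypicOfType.isotypicComponent R ↥(sSup 𝒮) N).linearEquiv_fun
  refine ⟨n, ⟨φ⟩, ?_⟩
  have e := (Submodule.equivMapOfInjective (sSup 𝒮).subtype (Submodule.subtype_injective _)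
    (isotypicComponent R ↥(sSup 𝒮) N)).restrictScalars K
  rw [← map_isotypicComponent h𝒮 hN]
  have h1 := e.finrank_eq
  rw [(φ.restrictScalars K).finrank_eq, finrank_pi_fintype] at h1
  simp only [Finset.sum_const, Finset.card_univ, Fintype.card_fin, smul_eq_mul] at h1
  exact h1

end SimpleSums

/-! ### The modules obtained from the lowest weight vectors -/

section Family

variable {F : Type*} [Field F] [Fintype F] {D : ℕ} {H : Pt F D} {x : Vertex H}
  {X : Type*} [AddCommGroup X] [Module F X] [Finite X]
  {C : Type*} [AddCommGroup C] [Module F C] [Finite C] (s : Splitting x.1 H X C)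

section TypeOne

variable {s} {ν μ ρ : ℤ} {g : Model F X C}

/-- All standard bases are proportional, which makes `W₁` independent of the choice. As `w_i`
vanishes outside the prescribed interval, the span may be taken over all integers. -/
theorem Splitting.Generates.isTypeOne_iff (hD : 2 ≤ D)
    {𝒲 : Submodule (Halg x.1 H) (Pt F D → ℂ)} (h : s.Generates ν μ ρ g 𝒲)
    {U : Submodule ℂ (Vertex H → ℂ)} : IsTypeOne 𝒲 U ↔ U = s.ospan ν μ g := by
  have key : ∀ c : ℂ, c ≠ 0 → ∀ w : ℤ → ℤ → ℤ → Pt F D → ℂ,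
      (∀ i j k, w i j k = c • s.wv ν μ i j k g) → Submodule.span ℂ (wVec 𝒲 w ''
        Set.Icc (max (nu 𝒲 + rho 𝒲) (mu 𝒲)) (min ((D : ℤ) - nu 𝒲) (D - mu 𝒲 + rho 𝒲 + 1))) =
      s.ospan ν μ g := by
    intro c hc w hw
    have hv : ∀ i, wVec 𝒲 w i = c • s.omv ν μ i g := by
      intro i
      ext y
      change (w (D - i) i 1 + (order F ^ (nu 𝒲 + i) * gauss1 (order F) (D - nu 𝒲 - i)) •
        w (D - i - 1) i 0) y.1 = c • s.om ν μ i g y.1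
      rw [hw, hw, s.om_apply, cc, h.nu_eq]
      simp only [Pi.add_apply, Pi.smul_apply, smul_eq_mul]
      ring
    rw [h.nu_eq, h.mu_eq, h.rho_eq]
    apply le_antisymm
    · rw [Submodule.span_le]
      rintro _ ⟨i, -, rfl⟩
      rw [hv]
      exact Submodule.smul_mem _ _ (Submodule.subset_span ⟨i, rfl⟩)
    · refine Submodule.span_le.2 ?_
      rintro _ ⟨i, rfl⟩
      by_cases h0 : s.omv ν μ i g = 0
      · simp only [h0]; exact zero_mem _
      · have hi := not_not.1
          (mt (s.omv_eq_zero_iff hD h.finrank_X h.finrank_C h.mem h.ne_zero).2 h0)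
        have : s.omv ν μ i g = c⁻¹ • wVec 𝒲 w i := by
          rw [hv, smul_smul, inv_mul_cancel₀ hc, one_smul]
        simp only [this]
        exact Submodule.smul_mem _ _ (Submodule.subset_span ⟨i, hi, rfl⟩)
  constructor
  · rintro ⟨w, hw, rfl⟩
    obtain ⟨c, hc, hcw⟩ := h.exists_eq_smul hw
    exact key c hc w hcw
  · rintro rfl
    exact ⟨_, h.isStandardBasis, (key 1 one_ne_zero _ fun i j k => (one_smul _ _).symm).symm⟩

/-- Quantification over irreducible `Halg`-modules is replaced by quantification over lowest weight
vectors; `Q` stands for the inequality that separates the two families. -/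
theorem Splitting.exists_isTypeOne_iff (hD : 2 ≤ D) (hX : (finrank F X : ℤ) = D - 1)
    (hC : (finrank F C : ℤ) = D + 1) (Q : ℤ → ℤ → ℤ → Prop) {U : Submodule ℂ (Vertex H → ℂ)} :
    (∃ 𝒲 : Submodule (Halg x.1 H) (Pt F D → ℂ), IsSimpleModule (Halg x.1 H) 𝒲 ∧ tau 𝒲 = 0 ∧
      Q (nu 𝒲) (mu 𝒲) (rho 𝒲) ∧ IsTypeOne 𝒲 U) ↔
    ∃ ν μ ρ g, g ∈ Low F X C ν μ ρ ∧ g ≠ 0 ∧ Q ν μ ρ ∧ U = s.ospan ν μ g := by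
  constructor
  · rintro ⟨𝒲, hs, hτ, hQ, hU⟩
    obtain ⟨ν, μ, ρ, g, h⟩ := Splitting.exists_generates (s := s) hX hC hs hτ
    rw [h.nu_eq, h.mu_eq, h.rho_eq] at hQ
    exact ⟨ν, μ, ρ, g, h.mem, h.ne_zero, hQ, (h.isTypeOne_iff hD).1 hU⟩
  · rintro ⟨ν, μ, ρ, g, hg, hne, hQ, hU⟩
    obtain ⟨𝒲, h𝒲⟩ := s.exists_generated hg
    have h : s.Generates ν μ ρ g 𝒲 := ⟨hX, hC, hg, hne, h𝒲⟩
    refine ⟨𝒲, h.isSimpleModule, h.tau_eq, ?_, (h.isTypeOne_iff hD).2 hU⟩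
    rwa [h.nu_eq, h.mu_eq, h.rho_eq]

end TypeOne

/-- The data of a family of modules: `P e f d ν μ ρ` relates the triple `(ε, ε^*, d)` to the
parameters of the lowest weight vector. -/
structure Splitting.IsFamily (P : ℕ → ℕ → ℕ → ℤ → ℤ → ℤ → Prop) (r : ℤ → ℂ) : Prop where
  unique : ∀ {e f d ν μ ρ ν' μ' ρ'}, P e f d ν μ ρ → P e f d ν' μ' ρ' → ν = ν' ∧ μ = μ' ∧ ρ = ρ'
  bounds : ∀ {e f d ν μ ρ}, P e f d ν μ ρ →
    0 ≤ ν ∧ 0 ≤ ρ ∧ ρ ≤ μ ∧ 2 * ν ≤ (finrank F X : ℤ) - ρ ∧ 2 * μ ≤ (finrank F C : ℤ) + ρ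
  range : ∀ {e f d ν μ ρ}, P e f d ν μ ρ → (e : ℤ) = max (ν + ρ) μ ∧
    (e : ℤ) + d = min ((D : ℤ) - ν) (D - μ + ρ + 1)
  hahn : ∀ {e f d ν μ ρ}, P e f d ν μ ρ → ∀ g ∈ Low F X C ν μ ρ, g ≠ 0 →
    ∀ W : Submodule (Talg x) (Vertex H → ℂ), W.restrictScalars ℂ = s.ospan ν μ g →
      ∃ v, IsHahnBasis W e f d (r f) v

/-- The modules of a family. -/
def Splitting.family (P : ℕ → ℕ → ℕ → ℤ → ℤ → ℤ → Prop) :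
    Set (Submodule (Talg x) (Vertex H → ℂ)) :=
  {W | ∃ e f d ν μ ρ g, P e f d ν μ ρ ∧ g ∈ Low F X C ν μ ρ ∧ g ≠ 0 ∧
    W.restrictScalars ℂ = s.ospan ν μ g}

variable {s} {P : ℕ → ℕ → ℕ → ℤ → ℤ → ℤ → Prop} {r : ℤ → ℂ}

namespace Splitting.IsFamily

theorem isSimpleModule_of_mem (h : s.IsFamily P r) :
    ∀ W ∈ s.family P, IsSimpleModule (Talg x) W := by
  rintro W ⟨e, f, d, ν, μ, ρ, g, hP, hg, hne, hW⟩
  obtain ⟨v, hv⟩ := h.hahn hP g hg hne W hW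
  exact hv.isSimpleModule

/-- A simple submodule of the sum need not belong to the family, but it is isomorphic to a member,
and the basis is transported along the isomorphism. -/
theorem exists_isHahnBasis (h : s.IsFamily P r) {W : Submodule (Talg x) (Vertex H → ℂ)}
    (hle : W ≤ sSup (s.family P)) (hW : IsSimpleModule (Talg x) W) :
    ∃ e f d ν μ ρ v, P e f d ν μ ρ ∧ IsHahnBasis W e f d (r f) v := by
  have : ∀ N : s.family P, IsSimpleModule (Talg x) N := fun N => h.isSimpleModule_of_mem N.1 N.2
  obtain ⟨N, ⟨e, f, d, ν, μ, ρ, g, hP, hg, hne, hN⟩, ⟨φ⟩⟩ := W.linearEquiv_of_le_sSup _ hle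
  obtain ⟨v, hv⟩ := h.hahn hP g hg hne N hN
  exact ⟨e, f, d, ν, μ, ρ, _, hP, hv.of_linearEquiv φ.symm⟩

variable (hD : 2 ≤ D) (hx : x.1 ∈ X2 H) (hX : (finrank F X : ℤ) = D - 1)
  (hC : (finrank F C : ℤ) = D + 1)
include hD hx hX hC

/-- Isomorphic modules have the same triple, and inside a family the triple determines `(ν, μ, ρ)`;
so the copies of `W` are exactly the modules attached to one space `Low`. -/
theorem setOf_linearEquiv (h : s.IsFamily P r) {W : Submodule (Talg x) (Vertex H → ℂ)}
    {e f d : ℕ} {ν μ ρ : ℤ} {v : Fin (d + 1) → Vertex H → ℂ} (hP : P e f d ν μ ρ)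
    (hv : IsHahnBasis W e f d (r f) v) :
    Submodule.restrictScalars ℂ '' {N ∈ s.family P | Nonempty (N ≃ₗ[Talg x] W)} =
      {U | ∃ g ∈ Low F X C ν μ ρ, g ≠ 0 ∧ U = s.ospan ν μ g} := by
  ext U
  constructor
  · rintro ⟨N, ⟨⟨e', f', d', ν', μ', ρ', g, hP', hg, hne, hN⟩, ⟨φ⟩⟩, rfl⟩
    obtain ⟨v', hv'⟩ := h.hahn hP' g hg hne N hN
    have ht := (hv.of_linearEquiv φ.symm).triple_eq.symm.trans hv'.triple_eq
    simp only [Prod.mk.injEq, Nat.cast_inj] at ht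
    obtain ⟨rfl, rfl, rfl⟩ := ht
    obtain ⟨rfl, rfl, rfl⟩ := h.unique hP hP'
    exact ⟨g, hg, hne, hN⟩
  · rintro ⟨g, hg, hne, rfl⟩
    obtain ⟨N, hN⟩ := s.exists_ospan hD hx hX hC hg
    obtain ⟨v', hv'⟩ := h.hahn hP g hg hne N hN
    exact ⟨N, ⟨⟨e, f, d, ν, μ, ρ, g, hP, hg, hne, hN⟩, hv'.nonempty_linearEquiv hv⟩, hN⟩

end Splitting.IsFamily

variable (s) in
/-- The sum of the vectors `w_{e+j}` attached to lowest weight vectors `g_j`. -/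
def Splitting.omSum (ν μ ρ : ℤ) (e d : ℕ) :
    (Fin (d + 1) → Low F X C ν μ ρ) →ₗ[ℂ] (Vertex H → ℂ) :=
  ∑ j : Fin (d + 1), s.omv ν μ ((e : ℤ) + (j : ℕ)) ∘ₗ (Low F X C ν μ ρ).subtype ∘ₗ LinearMap.proj j

theorem Splitting.omSum_apply {ν μ ρ : ℤ} {e d : ℕ} (G : Fin (d + 1) → Low F X C ν μ ρ) :
    s.omSum ν μ ρ e d G = ∑ j : Fin (d + 1), s.omv ν μ ((e : ℤ) + (j : ℕ)) (G j).1 := by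
  rw [omSum, LinearMap.sum_apply]; rfl

/-- The projections to the distance classes separate the summands, and each `g ↦ w_{e+j}` is
injective on `Low` for indices inside the interval. -/
theorem Splitting.omSum_injective (hD : 2 ≤ D) (hx : x.1 ∈ X2 H)
    (hX : (finrank F X : ℤ) = D - 1) (hC : (finrank F C : ℤ) = D + 1) {ν μ ρ : ℤ} {e d : ℕ}
    (h1 : (e : ℤ) = max (ν + ρ) μ) (h2 : (e : ℤ) + d = min ((D : ℤ) - ν) (D - μ + ρ + 1)) :
    Function.Injective (s.omSum ν μ ρ e d) := by
  rw [injective_iff_map_eq_zero]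
  intro G hG
  ext1 j
  have h : dualE x (e + j) *ᵥ s.omSum ν μ ρ e d G = s.omv ν μ ((e : ℤ) + (j : ℕ)) (G j).1 := by
    rw [omSum_apply, Matrix.mulVec_sum, Finset.sum_eq_single j]
    · rw [dualE_omv s hD hx (G j).2, if_pos (by push_cast; rfl)]
    · intro i _ hij
      rw [dualE_omv s hD hx (G i).2, if_neg]
      intro h
      exact hij (Fin.ext (by push_cast at h; omega))
    · simp
  rw [hG, Matrix.mulVec_zero] at h
  by_contra hne
  have hne' : (G j).1 ≠ 0 := fun h0 => hne (Subtype.ext h0)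
  exact (s.omv_eq_zero_iff hD hX hC (G j).2 hne').1 h.symm (by have := j.2; omega)

theorem Splitting.range_omSum (hD : 2 ≤ D)
    (hX : (finrank F X : ℤ) = D - 1) (hC : (finrank F C : ℤ) = D + 1) {ν μ ρ : ℤ} {e d : ℕ}
    (h1 : (e : ℤ) = max (ν + ρ) μ) (h2 : (e : ℤ) + d = min ((D : ℤ) - ν) (D - μ + ρ + 1)) :
    LinearMap.range (s.omSum ν μ ρ e d) =
      sSup {U | ∃ g ∈ Low F X C ν μ ρ, g ≠ 0 ∧ U = s.ospan ν μ g} := by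
  apply le_antisymm
  · rintro _ ⟨G, rfl⟩
    rw [omSum_apply]
    refine Submodule.sum_mem _ fun j _ => ?_
    by_cases h0 : (G j).1 = 0
    · rw [h0, map_zero]; exact zero_mem _
    · have hle : s.ospan ν μ (G j).1 ≤
          sSup {U | ∃ g ∈ Low F X C ν μ ρ, g ≠ 0 ∧ U = s.ospan ν μ g} :=
        le_sSup ⟨_, (G j).2, h0, rfl⟩
      exact hle (Submodule.subset_span ⟨_, rfl⟩)
  · refine sSup_le ?_
    rintro _ ⟨g, hg, hne, rfl⟩
    refine Submodule.span_le.2 ?_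
    rintro _ ⟨i, rfl⟩
    by_cases h0 : s.omv ν μ i g = 0
    · simp only [h0]; exact zero_mem _
    · have hi := not_not.1 (mt (s.omv_eq_zero_iff hD hX hC hg hne).2 h0)
      have hj : (i - e).toNat < d + 1 := by omega
      refine ⟨Pi.single ⟨_, hj⟩ ⟨g, hg⟩, ?_⟩
      rw [omSum_apply, Finset.sum_eq_single ⟨_, hj⟩]
      · simp only [Pi.single_eq_same]
        rw [show (e : ℤ) + ((i - e).toNat : ℕ) = i by omega]
      · intro b _ hb
        rw [Pi.single_eq_of_ne hb, Submodule.coe_zero, map_zero]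
      · simp

theorem IsHahnBasis.finrank_eq {W : Submodule (Talg x) (Vertex H → ℂ)} {e f d : ℕ} {r : ℂ}
    {v : Fin (d + 1) → Vertex H → ℂ} (h : IsHahnBasis W e f d r v) :
    finrank ℂ (W.restrictScalars ℂ) = d + 1 := by
  rw [← h.span, finrank_span_eq_card h.linearIndependent, Fintype.card_fin]

namespace Splitting.IsFamily

/-- The isotypic component has dimension `(d + 1) dim Low` through `omSum`, and `W` has dimension `d
+ 1`. -/
theorem hasMultiplicity (h : s.IsFamily P r) (hD : 2 ≤ D) (hx : x.1 ∈ X2 H)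
    (hX : (finrank F X : ℤ) = D - 1) (hC : (finrank F C : ℤ) = D + 1)
    {W : Submodule (Talg x) (Vertex H → ℂ)}
    {e f d : ℕ} {ν μ ρ : ℤ} {v : Fin (d + 1) → Vertex H → ℂ} (hP : P e f d ν μ ρ)
    (hv : IsHahnBasis W e f d (r f) v) :
    HasMultiplicity (sSup (s.family P)) W (finrank ℂ (Low F X C ν μ ρ)) := by
  have hW := hv.isSimpleModule
  obtain ⟨hr1, hr2⟩ := h.range hP
  obtain ⟨n, hφ, hn⟩ := exists_isotypicComponent_equiv ℂ h.isSimpleModule_of_mem hW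
  rw [hv.finrank_eq, Submodule.restrictScalars_sSup, h.setOf_linearEquiv hD hx hX hC hP hv,
    ← s.range_omSum hD hX hC hr1 hr2,
    LinearMap.finrank_range_of_inj (s.omSum_injective hD hx hX hC hr1 hr2),
    finrank_pi_fintype] at hn
  simp only [Finset.sum_const, Finset.card_univ, Fintype.card_fin, smul_eq_mul] at hn
  have : n = finrank ℂ (Low F X C ν μ ρ) :=
    Nat.eq_of_mul_eq_mul_left (Nat.succ_pos d) ((mul_comm _ _).trans hn)
  rw [← this]
  exact hφ

theorem described (h : s.IsFamily P r) (hD : 2 ≤ D) (hx : x.1 ∈ X2 H)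
    (hX : (finrank F X : ℤ) = D - 1) (hC : (finrank F C : ℤ) = D + 1)
    {Ω' : Set (ℤ × ℤ × ℤ)} {m' : ℤ → ℤ → ℤ → ℂ}
    (hΩ : ∀ t : ℤ × ℤ × ℤ, t ∈ Ω' ↔
      ∃ (e f d : ℕ) (ν μ ρ : ℤ), t = ((e : ℤ), (f : ℤ), (d : ℤ)) ∧ P e f d ν μ ρ)
    (hm : ∀ {e f d ν μ ρ}, P e f d ν μ ρ → m' e f d =
      ((-1) ^ ρ * (1 - order F ^ ((finrank F X : ℤ) - ρ - 2 * ν + 1)) *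
        (1 - order F ^ ((finrank F C : ℤ) + ρ - 2 * μ + 1)) *
        order F ^ (ν + μ - ρ + choose2 ρ)) /
      (qq (order F) ρ * qq (order F) ν * qq (order F) (finrank F X - ρ - ν + 1) *
        qq (order F) (μ - ρ) * qq (order F) (finrank F C - μ + 1))) :
    Described (sSup (s.family P)) Ω' r m' where
  range := by
    ext t
    rw [hΩ]
    constructor
    · rintro ⟨W, hle, hW, rfl⟩
      obtain ⟨e, f, d, ν, μ, ρ, v, hP, hv⟩ := h.exists_isHahnBasis hle hW
      exact ⟨e, f, d, ν, μ, ρ, hv.triple_eq, hP⟩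
    · rintro ⟨e, f, d, ν, μ, ρ, rfl, hP⟩
      obtain ⟨h1, h2, h3, h4, h5⟩ := h.bounds hP
      -- The bounds make both exponents in the dimension formula positive, so every admissible `(ν,
      -- μ, ρ)` really occurs.
      have hdim : finrank ℂ (Low F X C ν μ ρ) ≠ 0 := by
        intro h0
        have := finrank_Low_eq (F := F) (X := X) (C := C) h1 h2 h3 h4 h5
        rw [h0, Nat.cast_zero, zero_div, eq_comm, div_eq_zero_iff] at this
        have hz : ∀ {n : ℤ}, n ≠ 0 → (1 : ℂ) - order F ^ n ≠ 0 := fun hn h0 =>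
          hn (order_zpow_eq_one_iff.1 (sub_eq_zero.1 h0).symm)
        rcases this with h0 | h0
        · exact (mul_ne_zero (mul_ne_zero (mul_ne_zero (zpow_ne_zero _ (by norm_num))
            (hz (by omega))) (hz (by omega))) (zpow_ne_zero _ order_ne_zero)) h0
        · simp only [mul_eq_zero, qq_ne_zero, or_self] at h0
      obtain ⟨g, hg, hne⟩ := (Low F X C ν μ ρ).ne_bot_iff.1
        fun h0 => hdim (by rw [h0, finrank_bot])
      obtain ⟨W, hW⟩ := s.exists_ospan hD hx hX hC hg
      obtain ⟨v, hv⟩ := h.hahn hP g hg hne W hW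
      exact ⟨W, le_sSup ⟨e, f, d, ν, μ, ρ, g, hP, hg, hne, hW⟩, hv.isSimpleModule, hv.triple_eq⟩
  thin W hle hW := by
    obtain ⟨e, f, d, ν, μ, ρ, v, hP, hv⟩ := h.exists_isHahnBasis hle hW
    exact hv.isThin
  admissible W hle hW := by
    obtain ⟨e, f, d, ν, μ, ρ, v, hP, hv⟩ := h.exists_isHahnBasis hle hW
    rw [hv.diam_eq, hv.dualEndpoint_eq]
    exact hv.admissible
  acts W hle hW := by
    obtain ⟨e, f, d, ν, μ, ρ, v, hP, hv⟩ := h.exists_isHahnBasis hle hW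
    rw [hv.dualEndpoint_eq]
    exact hv.actsAs
  iso W W' hle hle' hW hW' := by
    obtain ⟨e, f, d, ν, μ, ρ, v, hP, hv⟩ := h.exists_isHahnBasis hle hW
    obtain ⟨e', f', d', ν', μ', ρ', v', hP', hv'⟩ := h.exists_isHahnBasis hle' hW'
    constructor
    · rintro ⟨φ⟩
      rw [hv.triple_eq, (hv.of_linearEquiv φ).triple_eq]
    · intro ht
      rw [hv.triple_eq, hv'.triple_eq] at ht
      simp only [Prod.mk.injEq, Nat.cast_inj] at ht
      obtain ⟨rfl, rfl, rfl⟩ := ht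
      exact hv.nonempty_linearEquiv hv'
  multiplicity W hle hW := by
    obtain ⟨e, f, d, ν, μ, ρ, v, hP, hv⟩ := h.exists_isHahnBasis hle hW
    obtain ⟨h1, h2, h3, h4, h5⟩ := h.bounds hP
    refine ⟨_, h.hasMultiplicity hD hx hX hC hP hv, ?_⟩
    rw [hv.diam_eq, hv.dualEndpoint_eq, hv.endpoint_eq, hm hP, ← hX, ← hC]
    exact finrank_Low_eq h1 h2 h3 h4 h5

end Splitting.IsFamily

end Family

end

end TwistedGrassmann

namespace TwistedGrassmann

noncomputable section

set_option linter.unusedSectionVars false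

open Module Matrix

/-! ### The two families and their disjointness -/

section Families

variable {F : Type*} [Field F] [Fintype F] {D : ℕ} {H : Pt F D} {x : Vertex H}
  {X : Type*} [AddCommGroup X] [Module F X] [Finite X]
  {C : Type*} [AddCommGroup C] [Module F C] [Finite C] {s : Splitting x.1 H X C}

/-- The first vector is unique up to a scalar, so the diagonal entry `θ_f - b_0` depends on `W`
only; and `b_0` is affine in `r` with nonzero slope as soon as `d > 0`. -/
theorem IsHahnBasis.param_eq {W : Submodule (Talg x) (Vertex H → ℂ)} {e f d : ℕ} {r r' : ℂ}
    {v v' : Fin (d + 1) → Vertex H → ℂ} (h : IsHahnBasis W e f d r v)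
    (h' : IsHahnBasis W e f d r' v') (hd : 0 < d) : r = r' := by
  have hact : ∀ {r : ℂ} {v : Fin (d + 1) → Vertex H → ℂ}, IsHahnBasis W e f d r v →
      dualE x (e + (0 : Fin (d + 1)) : ℕ) *ᵥ (adj H *ᵥ v 0) =
        (theta (order F) D f - entryB (order F) d (hPar (order F) D f) r 0) • v 0 := by
    intro r v h
    rw [h.acts, h.dualE_sum]
    simp [hahn, entryC]
  have hmem : v' 0 ∈ Submodule.span ℂ {v 0} := by
    rw [← h.cut_le]
    exact mem_cut.2 ⟨v' 0, h'.mem 0, h'.dual 0⟩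
  obtain ⟨c, hc⟩ := Submodule.mem_span_singleton.1 hmem
  have h1 := hact h'
  rw [← hc, Matrix.mulVec_smul, Matrix.mulVec_smul, hact h, smul_comm, hc] at h1
  have h2 := smul_left_injective ℂ (h'.ne_zero 0) h1
  have hq := order_ne_zero (F := F)
  have hpow : (1 : ℂ) - order F ^ (((0 : ℕ) : ℤ) - d) ≠ 0 := fun h0 => by
    have := order_zpow_eq_one_iff.1 (sub_eq_zero.1 h0).symm
    omega
  have h3 : hPar (order F) D f * (1 - order F ^ (((0 : ℕ) : ℤ) - d)) * (order F * (r - r')) = 0 := by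
    simp only [entryB] at h2
    linear_combination h2
  have h4 := (mul_eq_zero.1 h3).resolve_left (mul_ne_zero h.admissible.1 hpow)
  exact sub_eq_zero.1 ((mul_eq_zero.1 h4).resolve_left hq)

/-- A nonzero intersection contains a simple module, which would carry a basis of each kind with the
same triple but with different `r`. -/
theorem Splitting.IsFamily.disjoint {P P' : ℕ → ℕ → ℕ → ℤ → ℤ → ℤ → Prop} {r r' : ℤ → ℂ}
    (h : s.IsFamily P r) (h' : s.IsFamily P' r')
    (hd : ∀ {e f d ν μ ρ}, P e f d ν μ ρ → 0 < d) (hr : ∀ f, r f ≠ r' f) :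
    Disjoint (sSup (s.family P)) (sSup (s.family P')) := by
  rw [disjoint_iff]
  by_contra hne
  have : IsArtinian (Talg x) (Vertex H → ℂ) := isArtinian_of_tower ℂ inferInstance
  obtain ⟨W, hW, hle⟩ := (IsAtomic.eq_bot_or_exists_atom_le _).resolve_left hne
  rw [← isSimpleModule_iff_isAtom] at hW
  obtain ⟨e, f, d, ν, μ, ρ, v, hP, hv⟩ := h.exists_isHahnBasis (hle.trans inf_le_left) hW
  obtain ⟨e', f', d', ν', μ', ρ', v', hP', hv'⟩ := h'.exists_isHahnBasis (hle.trans inf_le_right) hW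
  have ht := hv.triple_eq.symm.trans hv'.triple_eq
  simp only [Prod.mk.injEq, Nat.cast_inj] at ht
  obtain ⟨rfl, rfl, rfl⟩ := ht
  exact hr f (hv.param_eq hv' (hd hP))

variable (s) in
theorem Splitting.restrictScalars_family (hD : 2 ≤ D) (hx : x.1 ∈ X2 H)
    (hX : (finrank F X : ℤ) = D - 1) (hC : (finrank F C : ℤ) = D + 1)
    {P : ℕ → ℕ → ℕ → ℤ → ℤ → ℤ → Prop} {Q : ℤ → ℤ → ℤ → Prop}
    (hPQ : ∀ {ν μ ρ}, 0 ≤ ν → 0 ≤ ρ → ρ ≤ μ → 2 * ν ≤ (D : ℤ) - 1 - ρ → 2 * μ ≤ (D : ℤ) + 1 + ρ →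
      ((∃ e f d, P e f d ν μ ρ) ↔ Q ν μ ρ)) :
    (sSup (s.family P)).restrictScalars ℂ =
      sSup {U | ∃ 𝒲 : Submodule (Halg x.1 H) (Pt F D → ℂ), IsSimpleModule (Halg x.1 H) 𝒲 ∧
        tau 𝒲 = 0 ∧ Q (nu 𝒲) (mu 𝒲) (rho 𝒲) ∧ IsTypeOne 𝒲 U} := by
  rw [Submodule.restrictScalars_sSup]
  congr 1
  ext U
  rw [Set.mem_ofPred_eq, Splitting.exists_isTypeOne_iff (s := s) hD hX hC Q]
  constructor
  · rintro ⟨W, ⟨e, f, d, ν, μ, ρ, g, hP, hg, hne, hW⟩, rfl⟩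
    have hb := Low_bounds hg hne
    exact ⟨ν, μ, ρ, g, hg, hne, (hPQ (by omega) (by omega) (by omega) (by omega) (by omega)).1
      ⟨e, f, d, hP⟩, hW⟩
  · rintro ⟨ν, μ, ρ, g, hg, hne, hQ, rfl⟩
    have hb := Low_bounds hg hne
    obtain ⟨e, f, d, hP⟩ :=
      (hPQ (by omega) (by omega) (by omega) (by omega) (by omega)).2 hQ
    obtain ⟨W, hW⟩ := s.exists_ospan hD hx hX hC hg
    exact ⟨W, ⟨e, f, d, ν, μ, ρ, g, hP, hg, hne, hW⟩, hW⟩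

/-- The relation between `(ε, ε^*, d)` and `(ν, μ, ρ)` when `ν + ρ ≥ μ`. -/
def relGe (D e f d : ℕ) (ν μ ρ : ℤ) : Prop :=
  (μ ≤ ν + ρ ∧ (e : ℤ) = ν + ρ ∧ (f : ℤ) = ν + μ ∧ (d : ℤ) = D - 2 * ν - ρ) ∧
    0 ≤ ν ∧ 0 ≤ ρ ∧ ρ ≤ μ ∧ 2 * ν ≤ (D : ℤ) - 1 - ρ ∧ 2 * μ ≤ (D : ℤ) + 1 + ρ

/-- The relation between `(ε, ε^*, d)` and `(ν, μ, ρ)` when `ν + ρ < μ`. -/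
def relLt (D e f d : ℕ) (ν μ ρ : ℤ) : Prop :=
  (ν + ρ < μ ∧ (e : ℤ) = μ ∧ (f : ℤ) = ν + μ ∧ (d : ℤ) = D + 1 - 2 * μ + ρ) ∧
    0 ≤ ν ∧ 0 ≤ ρ ∧ ρ ≤ μ ∧ 2 * ν ≤ (D : ℤ) - 1 - ρ ∧ 2 * μ ≤ (D : ℤ) + 1 + ρ

section

variable (hD : 2 ≤ D) (hx : x.1 ∈ X2 H) (hX : (finrank F X : ℤ) = D - 1)
  (hC : (finrank F C : ℤ) = D + 1)
include hD hx hX hC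

variable (s)

theorem Splitting.isFamily_relGe :
    s.IsFamily (relGe D) (fun f => order F ^ (f - (D : ℤ) - 2)) where
  unique h h' := by unfold relGe at h h'; omega
  bounds h := by unfold relGe at h; omega
  range h := by unfold relGe at h; omega
  hahn h g hg hne W hW := s.exists_isHahnBasis_of_ge hD hx hX hC hg hne h.1.1 h.1.2.1 h.1.2.2.1
    h.1.2.2.2 hW

theorem Splitting.isFamily_relLt :
    s.IsFamily (relLt D) (fun f => order F ^ (f - (D : ℤ) - 1)) where
  unique h h' := by unfold relLt at h h'; omega
  bounds h := by unfold relLt at h; omega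
  range h := by unfold relLt at h; omega
  hahn h g hg hne W hW := s.exists_isHahnBasis_of_lt hD hx hX hC hg hne h.1.1 h.1.2.1 h.1.2.2.1
    h.1.2.2.2 hW

theorem Splitting.described_relGe : Described (sSup (s.family (relGe D))) (Omega10 D)
    (fun f => order F ^ (f - (D : ℤ) - 2)) (mult10 (order F) D) := by
  refine (s.isFamily_relGe hD hx hX hC).described hD hx hX hC ?_ ?_
  · rintro ⟨e, f, d⟩
    simp only [Omega10, Omega, Set.mem_ofPred_eq, relGe, Prod.mk.injEq]
    constructor
    · intro h
      -- The linear system `e = ν + ρ`, `f = ν + μ`, `d = D - 2ν - ρ`, solved for `(ν, μ, ρ)`.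
      exact ⟨e.toNat, f.toNat, d.toNat, D - e - d, f - (D - e - d), 2 * e + d - D,
        by omega, by omega⟩
    · rintro ⟨e', f', d', ν, μ, ρ, h1, h2⟩
      omega
  · rintro e f d ν μ ρ ⟨⟨hle, he, hf, hd⟩, h1, -⟩
    have hs : ((-1 : ℂ)) ^ ((D : ℤ) - d) = (-1) ^ ρ := by
      rw [show (D : ℤ) - d = 2 * ν + ρ by omega, zpow_add₀ (by norm_num), _root_.zpow_mul]
      norm_num
    rw [mult10, hs, hX, hC,
      show 2 * (D : ℤ) - 2 * f - d + 2 = (D : ℤ) + 1 + ρ - 2 * μ + 1 by omega,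
      show 2 * (e : ℤ) - D + d = ρ by omega, show (D : ℤ) - e = D - 1 - ρ - ν + 1 by omega,
      show 2 * (D : ℤ) - e - f - d + 2 = D + 1 - μ + 1 by omega,
      show (D : ℤ) - 2 * e + f - d + choose2 ρ = ν + μ - ρ + choose2 ρ by omega,
      show (D : ℤ) - 1 - ρ - ν + 1 - d = ν by omega, show (f : ℤ) - e = μ - ρ by omega,
      show (d : ℤ) = D - 1 - ρ - 2 * ν + 1 by omega]
    congr 1 <;> ring

theorem Splitting.described_relLt : Described (sSup (s.family (relLt D))) (Omega11 D)
    (fun f => order F ^ (f - (D : ℤ) - 1)) (mult11 (order F) D) := by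
  refine (s.isFamily_relLt hD hx hX hC).described hD hx hX hC ?_ ?_
  · rintro ⟨e, f, d⟩
    simp only [Omega11, Omega, Set.mem_ofPred_eq, relLt, Prod.mk.injEq]
    constructor
    · intro h
      -- The solution of `e = μ`, `f = ν + μ`, `d = D + 1 - 2μ + ρ`.
      exact ⟨e.toNat, f.toNat, d.toNat, f - e, e, 2 * e + d - D - 1, by omega, by omega⟩
    · rintro ⟨e', f', d', ν, μ, ρ, h1, h2⟩
      omega
  · rintro e f d ν μ ρ ⟨⟨hle, he, hf, hd⟩, h1, -⟩
    have hs : ((-1 : ℂ)) ^ ((D : ℤ) - d + 1) = (-1) ^ ρ := by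
      rw [show (D : ℤ) - d + 1 = 2 * (μ - ρ) + ρ by omega, zpow_add₀ (by norm_num),
        _root_.zpow_mul]
      norm_num
    rw [mult11, hs, hX, hC,
      show 2 * (D : ℤ) - 2 * f - d + 1 = D - 1 - ρ - 2 * ν + 1 by omega,
      show 2 * (e : ℤ) - D + d - 1 = ρ by omega, show (D : ℤ) - e + 2 = D + 1 - μ + 1 by omega,
      show 2 * (D : ℤ) - e - f - d + 1 = D - 1 - ρ - ν + 1 by omega,
      show (D : ℤ) - 2 * e + f - d + 1 + choose2 ρ = ν + μ - ρ + choose2 ρ by omega,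
      show (D : ℤ) - e - d + 1 = μ - ρ by omega, show (f : ℤ) - e = ν by omega,
      show (d : ℤ) + 1 = D + 1 + ρ - 2 * μ + 1 by omega]
    congr 1; ring

end

end Families

end

end TwistedGrassmann

/-! ### The theorem, assembled from the two families. -/

theorem mainTheorem1 {F : Type*} [Field F] [Fintype F] (D : ℕ) (hD : 2 ≤ D)
    (H : TwistedGrassmann.Pt F D) (hH : Module.finrank F H = 2 * D)
    (x : TwistedGrassmann.Vertex H) (hx : x.1 ∈ TwistedGrassmann.X2 H) :
    -- each irreducible module with `τ = 0` yields a well-defined thin irreducible `W₁`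
    (∀ 𝒲 : Submodule (TwistedGrassmann.Halg x.1 H) (TwistedGrassmann.Pt F D → ℂ),
      IsSimpleModule (TwistedGrassmann.Halg x.1 H) 𝒲 → TwistedGrassmann.tau 𝒲 = 0 →
      (∃! U, TwistedGrassmann.IsTypeOne 𝒲 U) ∧
      ∀ U, TwistedGrassmann.IsTypeOne 𝒲 U →
        ∃ W : Submodule (TwistedGrassmann.Talg x) (TwistedGrassmann.Vertex H → ℂ),
          W.restrictScalars ℂ = U ∧ IsSimpleModule (TwistedGrassmann.Talg x) W ∧
          TwistedGrassmann.IsThin W) ∧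
    -- the decomposition of `V₁` and the description of the two summands
    ∃ V10 V11 : Submodule (TwistedGrassmann.Talg x) (TwistedGrassmann.Vertex H → ℂ),
      V10.restrictScalars ℂ = TwistedGrassmann.V1ge H x.1 ∧
      V11.restrictScalars ℂ = TwistedGrassmann.V1lt H x.1 ∧
      (V10 ⊔ V11).restrictScalars ℂ = TwistedGrassmann.V1 H x.1 ∧ Disjoint V10 V11 ∧
      TwistedGrassmann.Described V10 (TwistedGrassmann.Omega10 D)
        (fun f => TwistedGrassmann.order F ^ (f - D - 2))
        (TwistedGrassmann.mult10 (TwistedGrassmann.order F) D) ∧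
      TwistedGrassmann.Described V11 (TwistedGrassmann.Omega11 D)
        (fun f => TwistedGrassmann.order F ^ (f - D - 1))
        (TwistedGrassmann.mult11 (TwistedGrassmann.order F) D) := by
  open TwistedGrassmann in
  obtain ⟨c, hc, ⟨s⟩⟩ := exists_splitting hx.2 hH
  have hX : (Module.finrank F x.1 : ℤ) = D - 1 := by have := hx.1; omega
  have hC : (Module.finrank F c : ℤ) = D + 1 := by omega
  have h10 := s.restrictScalars_family hD hx hX hC (P := relGe D)
    (Q := fun ν μ ρ => μ ≤ ν + ρ) (fun {ν μ ρ} h1 h2 h3 h4 h5 =>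
      ⟨fun ⟨_, _, _, h⟩ => h.1.1, fun h => ⟨(ν + ρ).toNat, (ν + μ).toNat, (D - 2 * ν - ρ).toNat,
        by unfold relGe; omega⟩⟩)
  have h11 := s.restrictScalars_family hD hx hX hC (P := relLt D)
    (Q := fun ν μ ρ => ν + ρ < μ) (fun {ν μ ρ} h1 h2 h3 h4 h5 =>
      ⟨fun ⟨_, _, _, h⟩ => h.1.1, fun h => ⟨μ.toNat, (ν + μ).toNat, (D + 1 - 2 * μ + ρ).toNat,
        by unfold relLt; omega⟩⟩)
  refine ⟨fun 𝒲 h𝒲 hτ => ?_, sSup (s.family (relGe D)), sSup (s.family (relLt D)), h10, h11, ?_,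
    ?_, s.described_relGe hD hx hX hC, s.described_relLt hD hx hX hC⟩
  · obtain ⟨ν, μ, ρ, g, h⟩ := Splitting.exists_generates (s := s) hX hC h𝒲 hτ
    refine ⟨⟨_, (h.isTypeOne_iff hD).2 rfl, fun U hU => (h.isTypeOne_iff hD).1 hU⟩,
      fun U hU => ?_⟩
    obtain ⟨W, hW⟩ := s.exists_ospan hD hx hX hC h.mem
    rw [(h.isTypeOne_iff hD).1 hU]
    have hb := h.bounds
    rcases le_or_gt μ (ν + ρ) with hle | hlt
    · obtain ⟨v, hv⟩ := s.exists_isHahnBasis_of_ge hD hx hX hC h.mem h.ne_zero hle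
        (e := (ν + ρ).toNat) (f := (ν + μ).toNat) (d := (D - 2 * ν - ρ).toNat)
        (by omega) (by omega) (by omega) hW
      exact ⟨W, hW, hv.isSimpleModule, hv.isThin⟩
    · obtain ⟨v, hv⟩ := s.exists_isHahnBasis_of_lt hD hx hX hC h.mem h.ne_zero hlt
        (e := μ.toNat) (f := (ν + μ).toNat) (d := (D + 1 - 2 * μ + ρ).toNat)
        (by omega) (by omega) (by omega) hW
      exact ⟨W, hW, hv.isSimpleModule, hv.isThin⟩
  · rw [Submodule.restrictScalars_sup, h10, h11, ← sSup_union, V1]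
    congr 1
    ext U
    constructor
    · rintro (⟨𝒲, h1, h2, -, h3⟩ | ⟨𝒲, h1, h2, -, h3⟩) <;> exact ⟨𝒲, h1, h2, h3⟩
    · rintro ⟨𝒲, h1, h2, h3⟩
      rcases le_or_gt (mu 𝒲 : ℤ) (nu 𝒲 + rho 𝒲) with hle | hlt
      · exact Or.inl ⟨𝒲, h1, h2, hle, h3⟩
      · exact Or.inr ⟨𝒲, h1, h2, hlt, h3⟩
  · refine (s.isFamily_relGe hD hx hX hC).disjoint (s.isFamily_relLt hD hx hX hC)
      -- In the first family `d = D - 2ν - ρ` is positive because `2ν ≤ D - 1 - ρ`; in the second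
      -- one `d` may be zero.
      (fun h => by unfold relGe at h; omega) (fun f h => ?_)
    have := order_zpow_inj.1 h
    omega
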